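/- Let $K$ be a field. Let $C=(c_{ij})\in M_n(\mathbb Z)$ be a symmetrizable generalized Cartan matrix with symmetrizer $D=\mathrm{diag}(c_1,\dots,c_n)$ ($c_i\ge 1$, $DC$ symmetric), let $\Omega$ be an acyclic orientation of $C$, and let $\Pi=\Pi(C,D)$ be the generalized preprojective algebra of Geiss, Leclerc and Schröer: the quotient of the path algebra over $K$ of the quiver with vertices $1,\dots,n$, loops $\varepsilon_i$, and $g_{ij}=\gcd(|c_{ij}|,|c_{ji}|)$ arrows $\alpha_{ij}^{(g)}:j\to i$ for $c_{ij}<0$, by the relations $\varepsilon_i^{c_i}=0$; $\varepsilon_i^{f_{ji}}\alpha_{ij}^{(g)}=\alpha_{ij}^{(g)}\varepsilon_j^{f_{ij}}$ with $f_{ij}=|c_{ij}|/g_{ij}$; and $\sum_{j,g}\sum_{f=0}^{f_{ji}-1}\mathrm{sgn}(i,j)\,\varepsilon_i^f\alpha_{ij}^{(g)}\alpha_{ji}^{(g)}\varepsilon_i^{f_{ji}-1-f}=0$ for each $i$, where $\mathrm{sgn}(i,j)=1$ if $(i,j)\in\Omega$ and $-1$ if $(j,i)\in\Omega$. Let $\varpi_1,\dots,\varpi_n$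 be the fundamental weights (the standard basis of the weight lattice $\mathbb Z^n$), let $\alpha_j=\sum_k c_{kj}\varpi_k$ be the simple roots, and let $W$ be the Weyl group, generated by $s_i(x)=x-x_i\alpha_i$. A module is locally free if each $e_iM$ is a free module of finite rank over $H_i=K[\varepsilon_i]/(\varepsilon_i^{c_i})$, and its rank vector consists of these ranks; the generalized simple module $E_i$ is the locally free module with $e_iE_i\cong H_i$ and $e_jE_i=0$ for $j\ne i$; a module is $\mathbb E$-filtered if it has a finite filtration whose successive quotients are generalized simple modules. Let $\widetilde\Pi$ be the generalized preprojective algebra of the framed matrix $\widetilde C=\begin{pmatrix}C&-I_n\\-I_n&2I_n\end{pmatrix}$, $\widetilde D=\mathrm{diag}(D,D)$, with vertices $1,\dots,n,1',\dots,n'$ and the orientation consisting of $\Omega$ and the pairs $(i',i)$. An $\mathbb E$-filtered $\widetilde\Pi$-module is stable if, for each unframed vertex $i\in\{1,\dots,n\}$, it has no nonzero submodule all of whose composition factors are isomorphic to the simple module at $i$. A locally free $\widetilde\Pi$-module has rank vector $(\nu,\mu)$, for $\nu$ in the root lattice and $\mu$ an antidominant weight, if its ranks $\nu_j$ at the unframed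 vertices satisfy $\sum_j\nu_j\alpha_j=\nu$ and its rank at $i'$ is $-\mu_i$ for each $i$. For a weight $\gamma=w\mu$ with $w\in W$ and $\mu$ antidominant, $N(\gamma)$ denotes the $\Pi$-module $\widetilde N(\gamma)/\widetilde N(\mu)$, where $\widetilde N(\gamma)$ is a stable $\widetilde\Pi$-module of rank vector $(\gamma-\mu,\mu)$ and $\widetilde N(\mu)\subseteq\widetilde N(\gamma)$ is a submodule that is stable of rank vector $(0,\mu)$; this quotient vanishes at the vertices $i'$ and so is a $\Pi$-module. Theorem. Suppose that $C$ is of finite type, that is, the quadratic form $\sum_i c_ix_i^2+\sum_{i<j}c_ic_{ij}x_ix_j$ is positive definite. Then for each $i\in\{1,\dots,n\}$ the module $N(\varpi_i)$ exists, and every module $N(\varpi_i)$ as above is a projective cover of the simple $\Pi$-module $S_i$ at the vertex $i$: it is projective and has a surjection onto $S_i$ with superfluous kernel. In particular, $N(\varpi_i)$ is unique up to isomorphism and isomorphic to the projective cover of $S_i$. -/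

import Mathlib

open scoped Polynomial

universe u v

noncomputable section

namespace GenPreproj

/-! ### Symmetrizable generalized Cartan matrices, orientations, Weyl group -/

/-- A symmetrizable generalized Cartan matrix `C`, indexed by `ι`, together with a symmetrizer
`D = diag(c i)`. -/
structure SymmGCM (ι : Type) where
  C : Matrix ι ι ℤ
  c : ι → ℕ
  diag : ∀ i, C i i = 2
  nonpos : ∀ i j, i ≠ j → C i j ≤ 0
  ne_zero_iff : ∀ i j, C i j ≠ 0 ↔ C j i ≠ 0
  c_pos : ∀ i, 1 ≤ c i
  symm : ∀ i j, (c i : ℤ) * C i j = (c j : ℤ) * C j i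

namespace SymmGCM

variable {ι : Type} (X : SymmGCM ι)

/-- Finite type: the quadratic form `q = ∑ᵢ cᵢ xᵢ² + ∑_{i<j} cᵢ cᵢⱼ xᵢ xⱼ` is positive definite.
The double sum below equals `2 q(x)`, because `cᵢᵢ = 2` and `cᵢ cᵢⱼ = cⱼ cⱼᵢ`. -/
def IsFiniteType [Fintype ι] : Prop :=
  ∀ x : ι → ℤ, x ≠ 0 → 0 < ∑ i, ∑ j, (X.c i : ℤ) * X.C i j * x i * x j

/-- The number of arrows `j → i` in the double quiver: `gcd(|cᵢⱼ|, |cⱼᵢ|)` when `cᵢⱼ < 0`, and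
none otherwise. -/
def g (i j : ι) : ℕ := if X.C i j < 0 then Int.gcd (X.C i j) (X.C j i) else 0

/-- `fᵢⱼ = |cᵢⱼ| / gᵢⱼ` (used only when `cᵢⱼ < 0`). -/
def f (i j : ι) : ℕ := (X.C i j).natAbs / X.g i j

theorem neg_iff (i j : ι) : X.C i j < 0 ↔ X.C j i < 0 := by
  by_cases h : i = j
  · subst h; rfl
  · have h1 := X.nonpos i j h
    have h2 := X.nonpos j i (Ne.symm h)
    have h3 := X.ne_zero_iff i j
    omega

theorem g_comm (i j : ι) : X.g i j = X.g j i := by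
  unfold g
  simp only [X.neg_iff i j, Int.gcd_comm (X.C i j)]

/-- The simple root `αⱼ = ∑ₖ cₖⱼ ϖₖ`, in the basis of fundamental weights. -/
def simpleRoot (j : ι) : ι → ℤ := fun k => X.C k j

/-- The simple reflection `sᵢ(x) = x - ⟨x, αᵢ^∨⟩ αᵢ` on the weight lattice `ℤ^ι`, whose standard
basis vectors are the fundamental weights. -/
def reflection (i : ι) : (ι → ℤ) ≃ₗ[ℤ] (ι → ℤ) :=
  LinearEquiv.ofInvolutive
    { toFun := fun x => x - x i • X.simpleRoot i
      map_add' := fun x y => by simp only [Pi.add_apply, add_smul]; abel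
      map_smul' := fun a x => by
        simp only [Pi.smul_apply, smul_sub, smul_assoc, RingHom.id_apply] }
    (fun x => by
      funext k
      simp [simpleRoot, X.diag]
      ring)

/-- The Weyl group, acting on the weight lattice. -/
def weylGroup : Subgroup ((ι → ℤ) ≃ₗ[ℤ] (ι → ℤ)) :=
  Subgroup.closure (Set.range X.reflection)

/-- The framed matrix `(C, -I; -I, 2I)` with symmetrizer `(D, 0; 0, D)`; the vertex `i'` is
`Sum.inr i`. -/
def framed [DecidableEq ι] : SymmGCM (ι ⊕ ι) where
  C := Matrix.fromBlocks X.C (-1) (-1) (Matrix.diagonal fun _ => 2)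
  c := Sum.elim X.c X.c
  diag := by rintro (i | i) <;> simp [X.diag]
  nonpos := by
    rintro (i | i) (j | j) h
    · exact X.nonpos i j (fun e => h (by rw [e]))
    · by_cases e : i = j <;> simp [e]
    · by_cases e : i = j <;> simp [e]
    · have e : i ≠ j := fun e => h (by rw [e])
      simp [e]
  ne_zero_iff := by
    rintro (i | i) (j | j)
    · exact X.ne_zero_iff i j
    all_goals simp [Matrix.one_apply, Matrix.diagonal_apply, eq_comm]
  c_pos := by rintro (i | i) <;> simp [X.c_pos]
  symm := by
    rintro (i | i) (j | j)
    · exact X.symm i j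
    all_goals
      by_cases e : i = j
      · subst e; simp
      · simp [e, Ne.symm e]

end SymmGCM

/-- An orientation `Ω` of `C`: `rel i j` means `(i, j) ∈ Ω`; it contains `(i, j)` or `(j, i)`
exactly when `cᵢⱼ < 0`, and it has no oriented cycle. -/
structure Orientation {ι : Type} (X : SymmGCM ι) where
  rel : ι → ι → Prop
  rel_or_iff : ∀ i j, (rel i j ∨ rel j i) ↔ X.C i j < 0
  acyclic : ∀ i, ¬ Relation.TransGen rel i i

namespace Orientation

variable {ι : Type} {X : SymmGCM ι}

/-- `sgn(i, j)`, which is `1` on `Ω` and `-1` on `Ω*`. -/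
def sgn (Ω : Orientation X) (i j : ι) : ℤ := open Classical in if Ω.rel i j then 1 else -1

/-- The orientation of the framed matrix that restricts to `Ω` and contains all `(i', i)`. -/
def framedRel (Ω : Orientation X) : ι ⊕ ι → ι ⊕ ι → Prop
  | .inl i, .inl j => Ω.rel i j
  | .inr i, .inl j => i = j
  | _, .inr _ => False

theorem framedRel_transGen (Ω : Orientation X) {a b : ι ⊕ ι}
    (h : Relation.TransGen Ω.framedRel a b) :
    ∃ j, b = .inl j ∧ ∀ i, a = .inl i → Relation.TransGen Ω.rel i j := by
  induction h with
  | @single b h =>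
    rcases b with j | j
    · exact ⟨j, rfl, fun i hi => by subst hi; exact .single h⟩
    · rcases a with i | i <;> exact h.elim
  | @tail b d _ h ih =>
    obtain ⟨k, rfl, hk⟩ := ih
    rcases d with j | j
    · exact ⟨j, rfl, fun i hi => (hk i hi).tail h⟩
    · exact h.elim

def framed [DecidableEq ι] (Ω : Orientation X) : Orientation X.framed where
  rel := Ω.framedRel
  rel_or_iff := by
    rintro (i | i) (j | j)
    · exact Ω.rel_or_iff i j
    · by_cases e : i = j
      · subst e; simp [framedRel, SymmGCM.framed]
      · simp [framedRel, SymmGCM.framed, e, Ne.symm e]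
    · by_cases e : i = j
      · subst e; simp [framedRel, SymmGCM.framed]
      · simp [framedRel, SymmGCM.framed, e]
    · by_cases e : i = j <;> simp [framedRel, SymmGCM.framed, e]
  acyclic := by
    intro a h
    obtain ⟨j, rfl, hj⟩ := Ω.framedRel_transGen h
    exact Ω.acyclic j (hj j rfl)

end Orientation

/-! ### Generalized preprojective algebras -/

/-- Generators of the path algebra of the double quiver: trivial paths `e i`, loops `ε i` and
arrows `α i j g : j → i`. -/
inductive Gen {ι : Type} (X : SymmGCM ι) : Type
  | e (i : ι) : Gen X
  | ε (i : ι) : Gen X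
  | α (i j : ι) (g : Fin (X.g i j)) : Gen X

section Preprojective

variable (K : Type*) [Field K] {ι : Type} [Fintype ι] [DecidableEq ι] {X : SymmGCM ι}

/-- The left-hand side of the mesh relation at `i`, for an assignment `v` of elements of an algebra
to the generators. -/
def mesh {A : Type*} [Ring A] (Ω : Orientation X) (v : Gen X → A) (i : ι) : A :=
  ∑ j, ∑ g : Fin (X.g i j), ∑ f ∈ Finset.range (X.f j i),
    Ω.sgn i j • (v (.ε i) ^ f * v (.α i j g) * v (.α j i (Fin.cast (X.g_comm i j) g))
      * v (.ε i) ^ (X.f j i - 1 - f))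

/-- The defining relations. The first four present the path algebra of the double quiver (paths are
composed like functions); `nilp`, `comm`, `mesh` are the relations (P1), (P2), (P3). -/
inductive Rel (Ω : Orientation X) : FreeAlgebra K (Gen X) → FreeAlgebra K (Gen X) → Prop
  | idem (i j : ι) : Rel Ω (FreeAlgebra.ι K (.e i) * FreeAlgebra.ι K (.e j))
      (if i = j then FreeAlgebra.ι K (.e i) else 0)
  | unit : Rel Ω (∑ i, FreeAlgebra.ι K (.e i)) 1
  | loop (i : ι) : Rel Ω
      (FreeAlgebra.ι K (.e i) * FreeAlgebra.ι K (.ε i) * FreeAlgebra.ι K (.e i))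
      (FreeAlgebra.ι K (.ε i))
  | arrow (i j : ι) (g : Fin (X.g i j)) : Rel Ω
      (FreeAlgebra.ι K (.e i) * FreeAlgebra.ι K (.α i j g) * FreeAlgebra.ι K (.e j))
      (FreeAlgebra.ι K (.α i j g))
  | nilp (i : ι) : Rel Ω (FreeAlgebra.ι K (.ε i) ^ X.c i) 0
  | comm (i j : ι) (g : Fin (X.g i j)) : Rel Ω
      (FreeAlgebra.ι K (.ε i) ^ X.f j i * FreeAlgebra.ι K (.α i j g))
      (FreeAlgebra.ι K (.α i j g) * FreeAlgebra.ι K (.ε j) ^ X.f i j)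
  | mesh (i : ι) : Rel Ω (GenPreproj.mesh Ω (FreeAlgebra.ι K) i) 0

/-- The generalized preprojective algebra `Π = Π(C, D)`. -/
def Preproj (Ω : Orientation X) : Type _ := RingQuot (Rel K Ω)

instance (Ω : Orientation X) : Ring (Preproj K Ω) :=
  inferInstanceAs (Ring (RingQuot (Rel K Ω)))

instance (Ω : Orientation X) : Algebra K (Preproj K Ω) :=
  inferInstanceAs (Algebra K (RingQuot (Rel K Ω)))

/-- The quotient map onto `Π`. -/
def mk (Ω : Orientation X) : FreeAlgebra K (Gen X) →ₐ[K] Preproj K Ω :=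
  RingQuot.mkAlgHom K (Rel K Ω)

theorem mk_rel (Ω : Orientation X) {x y : FreeAlgebra K (Gen X)} (h : Rel K Ω x y) :
    mk K Ω x = mk K Ω y :=
  RingQuot.mkAlgHom_rel K h

/-- The image of a generator in `Π`. -/
def gen (Ω : Orientation X) (x : Gen X) : Preproj K Ω := mk K Ω (FreeAlgebra.ι K x)

/-- An assignment `v` of elements of a `K`-algebra to the generators satisfies the relations. -/
structure Satisfies {A : Type*} [Ring A] (Ω : Orientation X) (v : Gen X → A) : Prop where
  idem : ∀ i j, v (.e i) * v (.e j) = if i = j then v (.e i) else 0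
  unit : ∑ i, v (.e i) = 1
  loop : ∀ i, v (.e i) * v (.ε i) * v (.e i) = v (.ε i)
  arrow : ∀ i j g, v (.e i) * v (.α i j g) * v (.e j) = v (.α i j g)
  nilp : ∀ i, v (.ε i) ^ X.c i = 0
  comm : ∀ i j g, v (.ε i) ^ X.f j i * v (.α i j g) = v (.α i j g) * v (.ε j) ^ X.f i j
  mesh : ∀ i, mesh Ω v i = 0

theorem map_mesh {A B : Type*} [Ring A] [Ring B] (Ω : Orientation X) (φ : A →+* B)
    (v : Gen X → A) (i : ι) : φ (mesh Ω v i) = mesh Ω (fun x => φ (v x)) i := by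
  simp [mesh, map_sum]

theorem gen_satisfies (Ω : Orientation X) : Satisfies Ω (gen K Ω) where
  idem i j := by
    have h := mk_rel K Ω (Rel.idem (K := K) (Ω := Ω) i j)
    rw [map_mul] at h
    split_ifs at h ⊢ with e
    · exact h
    · rwa [map_zero] at h
  unit := by
    have h := mk_rel K Ω (Rel.unit (K := K) (Ω := Ω))
    rwa [map_sum, map_one] at h
  loop i := by
    have h := mk_rel K Ω (Rel.loop (K := K) (Ω := Ω) i)
    rwa [map_mul, map_mul] at h
  arrow i j g := by
    have h := mk_rel K Ω (Rel.arrow (K := K) (Ω := Ω) i j g)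
    rwa [map_mul, map_mul] at h
  nilp i := by
    have h := mk_rel K Ω (Rel.nilp (K := K) (Ω := Ω) i)
    rwa [map_pow, map_zero] at h
  comm i j g := by
    have h := mk_rel K Ω (Rel.comm (K := K) (Ω := Ω) i j g)
    rwa [map_mul, map_mul, map_pow, map_pow] at h
  mesh i := by
    have h := mk_rel K Ω (Rel.mesh (K := K) (Ω := Ω) i)
    rw [map_zero] at h
    exact (map_mesh Ω (mk K Ω).toRingHom (FreeAlgebra.ι K) i).symm.trans h

/-- The algebra homomorphism out of `Π` given by elements that satisfy the relations. -/
def lift {A : Type*} [Ring A] [Algebra K A] (Ω : Orientation X) (v : Gen X → A)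
    (hv : Satisfies Ω v) : Preproj K Ω →ₐ[K] A :=
  RingQuot.liftAlgHom K ⟨FreeAlgebra.lift K v, by
    intro x y h
    induction h with
    | idem i j =>
      rw [map_mul]
      simp only [FreeAlgebra.lift_ι_apply, hv.idem]
      split_ifs <;> simp
    | unit => simpa using hv.unit
    | loop i => simpa using hv.loop i
    | arrow i j g => simpa using hv.arrow i j g
    | nilp i => simpa using hv.nilp i
    | comm i j g => simpa using hv.comm i j g
    | mesh i =>
      have := map_mesh Ω (FreeAlgebra.lift K v).toRingHom (FreeAlgebra.ι K) i
      simp only [map_zero]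
      refine this.trans ?_
      simpa using hv.mesh i⟩

@[simp]
theorem lift_gen {A : Type*} [Ring A] [Algebra K A] (Ω : Orientation X) (v : Gen X → A)
    (hv : Satisfies Ω v) (x : Gen X) : lift K Ω v hv (gen K Ω x) = v x :=
  (RingQuot.liftAlgHom_mkAlgHom_apply _ _ _ _).trans (FreeAlgebra.lift_ι_apply v x)

/-! ### Simple modules -/

/-- The scalars by which the generators act on the simple module at `i`. -/
def simpleVal (i : ι) : Gen X → K
  | .e j => if j = i then 1 else 0
  | _ => 0

theorem simpleVal_satisfies (Ω : Orientation X) (i : ι) :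
    Satisfies Ω (simpleVal (X := X) K i) where
  idem j k := by
    by_cases h : j = i <;> by_cases h' : k = i <;> by_cases h'' : j = k <;> simp_all [simpleVal]
  unit := by simp [simpleVal]
  loop j := by simp [simpleVal]
  arrow j k g := by simp [simpleVal]
  nilp j := by simp [simpleVal, Nat.one_le_iff_ne_zero.mp (X.c_pos j)]
  comm j k g := by simp [simpleVal]
  mesh j := by simp [mesh, simpleVal]

/-- The simple module `S_i`: one-dimensional, supported at the vertex `i`, on which all `ε j` and
all `α j k g` act as zero. -/
def Simple (_Ω : Orientation X) (_i : ι) : Type _ := K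

instance (Ω : Orientation X) (i : ι) : AddCommGroup (Simple K Ω i) :=
  inferInstanceAs (AddCommGroup K)

instance (Ω : Orientation X) (i : ι) : Module (Preproj K Ω) (Simple K Ω i) :=
  Module.compHom K (lift K Ω (simpleVal K i) (simpleVal_satisfies K Ω i)).toRingHom

/-! ### Locally free modules and rank vectors -/

/-- `H_i = K[ε]/(ε ^ c i)`. -/
abbrev H (X : SymmGCM ι) (i : ι) : Type _ := K[X] ⧸ Ideal.span {(Polynomial.X : K[X]) ^ X.c i}

/-- The algebra homomorphism `H_i → Π` that sends `ε` to `ε i`. -/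
def loopHom (Ω : Orientation X) (i : ι) : H K X i →ₐ[K] Preproj K Ω :=
  Ideal.Quotient.liftₐ _ (Polynomial.aeval (gen K Ω (.ε i))) (by
    intro a ha
    obtain ⟨b, rfl⟩ := Ideal.mem_span_singleton'.mp ha
    simp [(gen_satisfies K Ω).nilp i])

/-- A `Π`-module `M`, regarded as an `H_i`-module through `ε i`. -/
def LoopRestrict (_Ω : Orientation X) (_i : ι) (M : Type*) : Type _ := M

instance (Ω : Orientation X) (i : ι) (M : Type*) [AddCommGroup M] :
    AddCommGroup (LoopRestrict Ω i M) :=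
  inferInstanceAs (AddCommGroup M)

instance (Ω : Orientation X) (i : ι) (M : Type*) [AddCommGroup M] [Module (Preproj K Ω) M] :
    Module (H K X i) (LoopRestrict Ω i M) :=
  Module.compHom M (loopHom K Ω i).toRingHom

theorem e_mul_loopHom (Ω : Orientation X) (i : ι) (h : H K X i) :
    gen K Ω (.e i) * loopHom K Ω i h = loopHom K Ω i h * gen K Ω (.e i) := by
  have hg := gen_satisfies K Ω
  have h1 : gen K Ω (.e i) * gen K Ω (.ε i) = gen K Ω (.ε i) := by
    conv_lhs => rw [← hg.loop i]
    rw [mul_assoc, ← mul_assoc, hg.idem, if_pos rfl, ← mul_assoc, hg.loop]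
  have h2 : gen K Ω (.ε i) * gen K Ω (.e i) = gen K Ω (.ε i) := by
    conv_lhs => rw [← hg.loop i]
    rw [mul_assoc, hg.idem, if_pos rfl, hg.loop]
  obtain ⟨p, rfl⟩ := Ideal.Quotient.mk_surjective h
  change gen K Ω (.e i) * Polynomial.aeval (gen K Ω (.ε i)) p =
    Polynomial.aeval (gen K Ω (.ε i)) p * gen K Ω (.e i)
  induction p using Polynomial.induction_on' with
  | add p q hp hq => rw [map_add, mul_add, add_mul, hp, hq]
  | monomial n a =>
    have hc : Commute (gen K Ω (.e i)) (gen K Ω (.ε i)) := h1.trans h2.symm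
    rw [Polynomial.aeval_monomial]
    exact (show Commute _ _ from (Algebra.commutes a (gen K Ω (.e i))).symm).mul_right
      (hc.pow_right n)

/-- The `H_i`-module `e_i M`. -/
def vertexModule (Ω : Orientation X) (i : ι) (M : Type*) [AddCommGroup M]
    [Module (Preproj K Ω) M] : Submodule (H K X i) (LoopRestrict Ω i M) where
  carrier := Set.range fun x : M => gen K Ω (.e i) • x
  add_mem' := by
    rintro _ _ ⟨x, rfl⟩ ⟨y, rfl⟩
    exact ⟨x + y, smul_add (gen K Ω (.e i)) (x : M) y⟩
  zero_mem' := ⟨0, smul_zero (A := M) (gen K Ω (.e i))⟩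
  smul_mem' := by
    rintro h _ ⟨x, rfl⟩
    refine ⟨loopHom K Ω i h • x, ?_⟩
    change gen K Ω (.e i) • loopHom K Ω i h • x = loopHom K Ω i h • gen K Ω (.e i) • x
    rw [smul_smul, smul_smul, e_mul_loopHom]

/-- `M` is locally free with rank vector `r`: each `e_i M` is a free `H_i`-module of finite rank
`r i`. -/
def HasRankVec (Ω : Orientation X) (M : Type*) [AddCommGroup M] [Module (Preproj K Ω) M]
    (r : ι → ℕ) : Prop :=
  ∀ i, Module.Free (H K X i) (vertexModule K Ω i M) ∧
    Module.Finite (H K X i) (vertexModule K Ω i M) ∧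
    Module.finrank (H K X i) (vertexModule K Ω i M) = r i

/-- `M` is a generalized simple module `E_i`: `e_i M ≅ H_i`, and `e_j M = 0` for `j ≠ i`. -/
def IsGenSimple (Ω : Orientation X) (i : ι) (M : Type*) [AddCommGroup M]
    [Module (Preproj K Ω) M] : Prop :=
  Nonempty (vertexModule K Ω i M ≃ₗ[H K X i] H K X i) ∧
    ∀ j, j ≠ i → Subsingleton (vertexModule K Ω j M)

/-- `M` is `𝔼`-filtered: it has a finite filtration whose successive quotients are generalized
simple modules. -/
def IsEFiltered (Ω : Orientation X) (M : Type*) [AddCommGroup M] [Module (Preproj K Ω) M] : Prop :=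
  ∃ (m : ℕ) (F : ℕ → Submodule (Preproj K Ω) M), F 0 = ⊥ ∧ F m = ⊤ ∧
    ∀ k < m, F k ≤ F (k + 1) ∧ ∃ i, IsGenSimple K Ω i (F (k + 1) ⧸ (F k).submoduleOf (F (k + 1)))

/-- Every composition factor (simple subquotient) of the submodule `L` is isomorphic to `S_i`. -/
def AllFactorsSimple (Ω : Orientation X) (i : ι) {M : Type*} [AddCommGroup M]
    [Module (Preproj K Ω) M] (L : Submodule (Preproj K Ω) M) : Prop :=
  ∀ A B : Submodule (Preproj K Ω) M, A ≤ B → B ≤ L →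
    IsSimpleModule (Preproj K Ω) (B ⧸ A.submoduleOf B) →
      Nonempty ((B ⧸ A.submoduleOf B) ≃ₗ[Preproj K Ω] Simple K Ω i)

/-- `sub_i M`, the largest submodule of `M` all of whose composition factors are isomorphic
to `S_i`. -/
def subAt (Ω : Orientation X) (i : ι) (M : Type*) [AddCommGroup M] [Module (Preproj K Ω) M] :
    Submodule (Preproj K Ω) M :=
  sSup {L | AllFactorsSimple K Ω i L}

/-! ### Framed preprojective algebra and the modules `N(γ)` -/

/-- The images in `Π` of the generators of the framed preprojective algebra. -/
def framedVal (Ω : Orientation X) : Gen X.framed → Preproj K Ω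
  | .e (.inl i) => gen K Ω (.e i)
  | .ε (.inl i) => gen K Ω (.ε i)
  | .α (.inl i) (.inl j) g => gen K Ω (.α i j g)
  | _ => 0

theorem framedVal_satisfies (Ω : Orientation X) :
    Satisfies Ω.framed (framedVal K Ω) where
  idem := by
    have hg := gen_satisfies K Ω
    rintro (i | i) (j | j)
    · simpa [framedVal] using hg.idem i j
    all_goals simp [framedVal]
  unit := by
    simpa [Fintype.sum_sum_type, framedVal] using (gen_satisfies K Ω).unit
  loop := by
    rintro (i | i)
    · exact (gen_satisfies K Ω).loop i
    · simp [framedVal]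
  arrow := by
    rintro (i | i) (j | j) g
    · exact (gen_satisfies K Ω).arrow i j g
    all_goals simp [framedVal]
  nilp := by
    rintro (i | i)
    · exact (gen_satisfies K Ω).nilp i
    · exact zero_pow (Nat.one_le_iff_ne_zero.mp (X.c_pos i))
  comm := by
    rintro (i | i) (j | j) g
    · exact (gen_satisfies K Ω).comm i j g
    all_goals simp [framedVal]
  mesh := by
    rintro (i | i)
    · rw [mesh, Fintype.sum_sum_type]
      have h := (gen_satisfies K Ω).mesh i
      rw [mesh] at h
      refine (congrArg₂ (· + ·) h ?_).trans (add_zero 0)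
      simp [framedVal]
    · rw [mesh, Fintype.sum_sum_type]
      simp [framedVal]

/-- The canonical surjection from the framed preprojective algebra onto `Π`, which kills the
idempotents `e_{i'}`; it identifies `Π`-modules with the modules over the framed algebra that vanish
at the vertices `i'`. -/
def framedProj (Ω : Orientation X) : Preproj K Ω.framed →ₐ[K] Preproj K Ω :=
  lift K Ω.framed (framedVal K Ω) (framedVal_satisfies K Ω)

/-- `M` is a stable module over the framed algebra with rank vector `(γ - μ, μ)`: it is
`𝔼`-filtered, `sub_i M = 0` for all unframed vertices `i`, its ranks `νⱼ` at the unframed vertices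
satisfy `∑ⱼ νⱼ αⱼ = γ - μ`, and its rank at `i'` is `-μ_i`. -/
def IsStableOfWeight (Ω : Orientation X) (γ μ : ι → ℤ) (M : Type*) [AddCommGroup M]
    [Module (Preproj K Ω.framed) M] : Prop :=
  IsEFiltered K Ω.framed M ∧
  (∀ i : ι, subAt K Ω.framed (.inl i) M = ⊥) ∧
  ∃ r : ι ⊕ ι → ℕ, HasRankVec K Ω.framed M r ∧
    (∑ j, (r (.inl j) : ℤ) • X.simpleRoot j = γ - μ) ∧ ∀ i, (r (.inr i) : ℤ) = -μ i

/-- `N` is the module `N(γ)`: for an antidominant weight `μ` and a Weyl group element `w` with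
`γ = w μ`, there are a stable module `Ñ(γ)` with rank vector `(γ - μ, μ)` and a submodule
`Ñ(μ)` of it, stable with rank vector `(0, μ)`, such that the quotient `Ñ(γ)/Ñ(μ)`
is (the inflation to the framed algebra of) the `Π`-module `N`. -/
def IsN (Ω : Orientation X) (γ : ι → ℤ) (N : Type v) [AddCommGroup N]
    [Module (Preproj K Ω) N] : Prop :=
  ∃ μ : ι → ℤ, (∀ i, μ i ≤ 0) ∧ (∃ w ∈ X.weylGroup, w μ = γ) ∧
    ∃ (M : Type v) (_ : AddCommGroup M) (_ : Module (Preproj K Ω.framed) M)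
      (L : Submodule (Preproj K Ω.framed) M),
      IsStableOfWeight K Ω γ μ M ∧ IsStableOfWeight K Ω μ μ L ∧
      ∃ φ : (M ⧸ L) ≃+ N, ∀ a x, φ (a • x) = framedProj K Ω a • φ x

end Preprojective

/-! ### Projective covers -/

/-- `p : P → S` is a projective cover: `P` is projective, `p` is surjective, and the kernel of `p`
is a superfluous submodule. -/
def IsProjectiveCover {R P S : Type*} [Ring R] [AddCommGroup P] [Module R P] [AddCommGroup S]
    [Module R S] (p : P →ₗ[R] S) : Prop :=
  Module.Projective R P ∧ Function.Surjective p ∧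
    ∀ A : Submodule R P, A ⊔ LinearMap.ker p = ⊤ → A = ⊤

end GenPreproj

end

/-! The stable modules are built by reflection functors, and at the dominant end they turn out to be
extensions of the modules `Π e_i` by their framed part.

Start from the generalized simple modules at the framing vertices, whose weights are `-ϖ_k`.
Reflecting a representation at an unframed vertex `j` replaces `M_j` by the kernel of `⊕ₖ ⱼHₖ ⊗ Mₖ →
M_j`. If that map is onto, the result is again locally free, stable and `𝔼`-filtered (`Good.refl`),
and its weight is moved by `s_j`.

That the map is onto when required is seen by counting dimensions. For representations `M` and `N`
with `M` locally free, the Euler form is at most `dim Hom(M, N) + dim Hom(N, M)` (`euler_le`). A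
homomorphism into a stable representation is determined at the framing vertices, so both Hom spaces
are small. Together these give a linear inequality on the dimension vectors of stable
representations (`Good.sum_le`), and Weyl invariance (`Good.pr_wt`) makes it an equality for ranks
in the orbit. Applied to the subrepresentation generated away from `j`, and to the reflection at
`j`, it shows that for the whole family obtained from one Weyl group element `s` the map into `M_j`
is onto as soon as one member has negative weight at `j`, and that the sequence `M_j → ⊕ₖ ⱼHₖ ⊗ Mₖ →
M_j` is exact in the middle as soon as one member has positive weight at `j`.

Reflecting the whole family while some weight is negative stops, because positivity of the quadratic
form bounds the ranks (`exists_bound`). At the end the weights sum to `ρ`, so they are a permutation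
of the fundamental weights, and every member is exact at every unframed vertex
(`exists_dominant_family`). Conversely any stable module of weight `ϖ_i` has the ranks of a member
of this family (`exists_rank_eq`) and is isomorphic to it (`Good.exists_iso`).

For the member of weight `ϖ_i`, exactness says that away from its framed part it is generated by one
vector `v0` at `i`, and that all relations come from the mesh relations (`Presentation`). Hence
there are maps to `Π` sending `v0` to `e_i`, at first modulo long paths only, improved arrow by
arrow (`Presentation.exists_homMod`). Since `Π` is graded by the number of arrows, the annihilator
of the image of `v0` in `N` also annihilates `e_i`. So `N` is a direct summand of `Π`, and
Nakayama's lemma for filtered modules makes the kernel of `N → S_i` superfluous. -/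

set_option linter.unusedSectionVars false

noncomputable section

namespace GenPreproj

/-! ### Free modules over truncated polynomial rings, elementwise -/

section Nilpotent

variable {K : Type*} [Field K] {M : Type*} [AddCommGroup M] [Module K M]

/-- `p` is an idempotent and `ε` an endomorphism of its range with `ε ^ c = 0`. -/
structure NilpOn (p ε : Module.End K M) (c : ℕ) : Prop where
  idem : p * p = p
  left : p * ε = ε
  right : ε * p = ε
  nil : ε ^ c = 0
  pos : 1 ≤ c

/-- The range of `p` is free over `K[ε]/(ε ^ c)`, expressed by exactness. -/
def FreeOn (p ε : Module.End K M) (c : ℕ) : Prop :=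
  ∀ x, p x = x → ε x = 0 → ∃ y, p y = y ∧ (ε ^ (c - 1)) y = x

namespace NilpOn

variable {p ε : Module.End K M} {c : ℕ}

theorem p_pow (h : NilpOn p ε c) (a : ℕ) : p * ε ^ a = ε ^ a * p := by
  have hc : Commute p ε := h.left.trans h.right.symm
  exact hc.pow_right a

theorem apply_pow (h : NilpOn p ε c) {x : M} (hx : p x = x) (a : ℕ) :
    p ((ε ^ a) x) = (ε ^ a) x := by
  have := congrArg (fun f : Module.End K M => f x) (h.p_pow a)
  simpa [hx] using this

theorem apply_self (h : NilpOn p ε c) (x : M) : p (p x) = p x :=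
  congrArg (fun f : Module.End K M => f x) h.idem

theorem mem_range (h : NilpOn p ε c) {x : M} : x ∈ LinearMap.range p ↔ p x = x :=
  ⟨fun ⟨y, hy⟩ => hy ▸ h.apply_self y, fun hx => ⟨x, hx⟩⟩

theorem p_eps (h : NilpOn p ε c) (x : M) : p (ε x) = ε x :=
  congrArg (fun f : Module.End K M => f x) h.left

theorem eps_p (h : NilpOn p ε c) (x : M) : ε (p x) = ε x :=
  congrArg (fun f : Module.End K M => f x) h.right

theorem pow_eq_zero (h : NilpOn p ε c) {a : ℕ} (ha : c ≤ a) : ε ^ a = 0 :=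
  pow_eq_zero_of_le ha h.nil

/-- Exactness at the socle propagates to every power, `ker ε ^ a = im ε ^ (c - a)`: subtracting from
`x` a suitable value of `ε ^ (c - 1 - a)` makes it vanish already under `ε ^ a`, and induction
applies. -/
theorem eps_injOn_of_pow (h : NilpOn p ε c) (hF : FreeOn p ε c) :
    ∀ a ≤ c, ∀ x, p x = x → (ε ^ a) x = 0 → ∃ y, p y = y ∧ (ε ^ (c - a)) y = x := by
  intro a
  induction a with
  | zero => intro _ x _ hx; exact ⟨0, by simp, by simpa using hx.symm⟩
  | succ a ih =>
    intro ha x hp hx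
    obtain ⟨y, hy, hyx⟩ := hF ((ε ^ a) x) (h.apply_pow hp a)
      (by rw [← Module.End.mul_apply, ← pow_succ']; exact hx)
    have e1 : (ε ^ a) (x - (ε ^ (c - 1 - a)) y) = 0 := by
      rw [map_sub, ← Module.End.mul_apply, ← pow_add, show a + (c - 1 - a) = c - 1 by omega, hyx,
        sub_self]
    obtain ⟨z, hz, hzx⟩ := ih (by omega) (x - (ε ^ (c - 1 - a)) y)
      (by rw [map_sub, hp, h.apply_pow hy]) e1
    refine ⟨y + ε z, by rw [map_add, hy, h.p_eps], ?_⟩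
    have e2 : (ε ^ (c - (a + 1))) (ε z) = (ε ^ (c - a)) z := by
      rw [← Module.End.mul_apply, ← pow_succ]
      congr 2; omega
    rw [map_add, e2, hzx, show c - (a + 1) = c - 1 - a by omega]
    abel

/-- The generators `u t` are preimages, under `ε ^ (c - 1)`, of a basis of the socle `ker ε`;
freeness says that such preimages exist. -/
theorem exists_chainBasis [FiniteDimensional K M] (h : NilpOn p ε c) (hF : FreeOn p ε c) :
    ∃ (r : ℕ) (u : Fin r → M), (∀ t, p (u t) = u t) ∧
      ∃ b : Module.Basis (Fin r × Fin c) K (LinearMap.range p),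
        ∀ q, (b q : M) = (ε ^ (q.2 : ℕ)) (u q.1) := by
  classical
  set W : Submodule K M := LinearMap.range p ⊓ LinearMap.ker ε
  set w := Module.finBasis K W
  set r := Module.finrank K W
  have hw (t : Fin r) : p (w t : M) = w t ∧ ε (w t : M) = 0 :=
    ⟨h.mem_range.1 (w t).2.1, (w t).2.2⟩
  choose u hu hu' using fun t => hF (w t) (hw t).1 (hw t).2
  have hpos := h.pos
  have hmem (q : Fin r × Fin c) : (ε ^ (q.2 : ℕ)) (u q.1) ∈ LinearMap.range p :=
    h.mem_range.2 (h.apply_pow (hu q.1) _)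
  have hwlin : LinearIndependent K fun t => (w t : M) :=
    w.linearIndependent.map' W.subtype (Submodule.ker_subtype W)
  have hli : LinearIndependent K fun q : Fin r × Fin c =>
      (⟨(ε ^ (q.2 : ℕ)) (u q.1), hmem q⟩ : LinearMap.range p) := by
    rw [Fintype.linearIndependent_iff]
    intro k hk
    have hk' : ∑ q : Fin r × Fin c, k q • (ε ^ (q.2 : ℕ)) (u q.1) = 0 := by
      have := congrArg (LinearMap.range p).subtype hk
      simpa using this
    have key : ∀ a : ℕ, ∀ (ha : a < c) (t : Fin r), k (t, ⟨a, ha⟩) = 0 := by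
      intro a
      induction a using Nat.strong_induction_on with
      | _ a ih =>
        intro ha
        -- Coefficients below `a` vanish by induction and terms above `a` are killed by this power,
        -- so what is left is a relation between the socle vectors `w t`.
        have h1 := congrArg (ε ^ (c - 1 - a)) hk'
        rw [map_zero, map_sum, Fintype.sum_prod_type] at h1
        have h2 : ∀ t : Fin r, ∑ b : Fin c,
            (ε ^ (c - 1 - a)) (k (t, b) • (ε ^ (b : ℕ)) (u t)) = k (t, ⟨a, ha⟩) • (w t : M) := by
          intro t
          rw [Finset.sum_eq_single ⟨a, ha⟩]
          · rw [map_smul, ← Module.End.mul_apply, ← pow_add]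
            simp only
            rw [show c - 1 - a + a = c - 1 by omega, hu']
          · intro b _ hb
            rcases lt_or_gt_of_ne (fun e => hb (Fin.ext e) : (b : ℕ) ≠ a) with hlt | hgt
            · rw [show b = ⟨b, b.2⟩ from rfl, ih b hlt b.2 t]; simp
            · rw [map_smul, ← Module.End.mul_apply, ← pow_add, h.pow_eq_zero (by omega)]
              simp
          · simp
        simp only [h2] at h1
        exact Fintype.linearIndependent_iff.1 hwlin _ h1
    rintro ⟨t, b⟩
    exact key b b.2 t
  have hsp : ⊤ ≤ Submodule.span K (Set.range fun q : Fin r × Fin c =>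
      (⟨(ε ^ (q.2 : ℕ)) (u q.1), hmem q⟩ : LinearMap.range p)) := by
    set S := Submodule.span K (Set.range fun q : Fin r × Fin c => (ε ^ (q.2 : ℕ)) (u q.1))
    have hS : ∀ a ≤ c, ∀ x, p x = x → (ε ^ a) x = 0 → x ∈ S := by
      intro a
      induction a with
      | zero => intro _ x _ hx; simp at hx; simp [hx]
      | succ a ih =>
        intro ha x hp hx
        have hxW : (ε ^ a) x ∈ W := ⟨h.mem_range.2 (h.apply_pow hp a), by
          change ε ((ε ^ a) x) = 0
          rw [← Module.End.mul_apply, ← pow_succ']; exact hx⟩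
        set k := w.repr ⟨_, hxW⟩
        have hk : ∑ t, k t • (w t : M) = (ε ^ a) x := by
          have := congrArg W.subtype (w.sum_repr ⟨_, hxW⟩)
          rw [map_sum] at this
          exact this
        set y := ∑ t, k t • (ε ^ (c - 1 - a)) (u t)
        have hyS : y ∈ S := Submodule.sum_mem _ fun t _ => Submodule.smul_mem _ _
          (Submodule.subset_span ⟨(t, ⟨c - 1 - a, by omega⟩), rfl⟩)
        have hy : p y = y := by
          simp only [y, map_sum, map_smul, h.apply_pow (hu _)]
        have e : (ε ^ a) (x - y) = 0 := by
          rw [map_sub, ← hk, sub_eq_zero, map_sum]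
          refine Finset.sum_congr rfl fun t _ => ?_
          rw [map_smul, ← Module.End.mul_apply, ← pow_add, show a + (c - 1 - a) = c - 1 by omega,
            hu']
        have := ih (by omega) (x - y) (by rw [map_sub, hp, hy]) e
        simpa using S.add_mem this hyS
    intro x _
    have hx : (x : M) ∈ S := hS c le_rfl x (h.mem_range.1 x.2) (by rw [h.nil]; rfl)
    have himg : S = (Submodule.span K (Set.range fun q : Fin r × Fin c =>
      (⟨(ε ^ (q.2 : ℕ)) (u q.1), hmem q⟩ : LinearMap.range p))).map
        (LinearMap.range p).subtype := by
      rw [Submodule.map_span, ← Set.range_comp]; rfl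
    rw [himg] at hx
    obtain ⟨z, hz, hzx⟩ := hx
    rwa [← Subtype.ext hzx]
  exact ⟨r, u, hu, Module.Basis.mk hli hsp, fun q => by simp⟩

/-- Relative projectivity of a free module over the Frobenius algebra `K[ε]/(ε ^ c)`. The map `s`
sends `ε ^ (c - 1) u_t` to `u_t` and the other chain vectors to zero; applied to `ε ^ d u_t`, only
the term `a = d` of the sum survives. -/
theorem exists_averaging [FiniteDimensional K M] (h : NilpOn p ε c) (hF : FreeOn p ε c) :
    ∃ s : Module.End K M, ∑ a ∈ Finset.range c, ε ^ a * p * s * p * ε ^ (c - 1 - a) = p := by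
  obtain ⟨r, u, hu, b, hb⟩ := h.exists_chainBasis hF
  have hpos := h.pos
  set s0 : LinearMap.range p →ₗ[K] M :=
    b.constr K fun q => if (q.2 : ℕ) + 1 = c then u q.1 else 0
  set s : Module.End K M := s0 ∘ₗ p.rangeRestrict
  have hs (t : Fin r) (a : ℕ) : s ((ε ^ a) (u t)) = if a + 1 = c then u t else 0 := by
    by_cases ha : a < c
    · have h1 : p.rangeRestrict ((ε ^ a) (u t)) = b (t, ⟨a, ha⟩) := by
        apply Subtype.ext
        rw [hb]
        exact h.apply_pow (hu t) a
      simp only [s, LinearMap.comp_apply, h1, s0, Module.Basis.constr_basis]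
    · rw [h.pow_eq_zero (not_lt.1 ha), if_neg (by omega)]
      simp
  refine ⟨s, ?_⟩
  have key : ∀ x : LinearMap.range p,
      (∑ a ∈ Finset.range c, ε ^ a * p * s * p * ε ^ (c - 1 - a)) (x : M) = (x : M) := by
    intro x
    have : (∑ a ∈ Finset.range c, ε ^ a * p * s * p * ε ^ (c - 1 - a)) ∘ₗ
        (LinearMap.range p).subtype = (LinearMap.range p).subtype := by
      refine b.ext fun ⟨t, d⟩ => ?_
      simp only [LinearMap.comp_apply, Submodule.subtype_apply, hb, LinearMap.sum_apply,
        Module.End.mul_apply]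
      rw [Finset.sum_eq_single (d : ℕ)]
      · rw [← Module.End.mul_apply (ε ^ (c - 1 - (d : ℕ))), ← pow_add, h.apply_pow (hu t), hs,
          if_pos (by omega), hu]
      · intro a _ ha
        rw [← Module.End.mul_apply (ε ^ (c - 1 - a)), ← pow_add, h.apply_pow (hu t), hs]
        rw [if_neg (by have := d.2; simp at *; omega)]
        simp
      · intro hd; simp at hd
    exact congrArg (fun f => f x) this
  ext x
  have h2 := key (p.rangeRestrict x)
  have h3 : (∑ a ∈ Finset.range c, ε ^ a * p * s * p * ε ^ (c - 1 - a)) * p =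
      ∑ a ∈ Finset.range c, ε ^ a * p * s * p * ε ^ (c - 1 - a) := by
    rw [Finset.sum_mul]
    refine Finset.sum_congr rfl fun a _ => ?_
    rw [mul_assoc _ _ p, ← h.p_pow (c - 1 - a), ← mul_assoc, mul_assoc _ p p, h.idem]
  rw [← h3]
  exact h2

/-- The homomorphisms of `K[σ]`-modules between the ranges of two idempotents. -/
def homOn {N : Type*} [AddCommGroup N] [Module K N] (p σ : Module.End K M)
    (p' σ' : Module.End K N) : Submodule K (M →ₗ[K] N) where
  carrier := {f | p' ∘ₗ f ∘ₗ p = f ∧ σ' ∘ₗ f = f ∘ₗ σ}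
  add_mem' := by
    rintro f g ⟨hf, hf'⟩ ⟨hg, hg'⟩
    refine ⟨?_, ?_⟩
    · rw [LinearMap.add_comp, LinearMap.comp_add, hf, hg]
    · rw [LinearMap.add_comp, LinearMap.comp_add, hf', hg']
  zero_mem' := by simp
  smul_mem' := by
    rintro k f ⟨hf, hf'⟩
    refine ⟨?_, ?_⟩
    · rw [LinearMap.smul_comp, LinearMap.comp_smul, hf]
    · rw [LinearMap.smul_comp, LinearMap.comp_smul, hf']

/-- A homomorphism out of a free module is a free choice of images for the `r` generators. The
target need not be free, which matters when representations are compared with reflections and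
subrepresentations. -/
theorem finrank_homOn [FiniteDimensional K M] {N : Type*} [AddCommGroup N] [Module K N]
    [FiniteDimensional K N]
    (h : NilpOn p ε c) (hF : FreeOn p ε c) {p' ε' : Module.End K N} (h' : NilpOn p' ε' c)
    {r : ℕ} (hr : Module.finrank K (LinearMap.range p) = r * c) :
    Module.finrank K (homOn p ε p' ε') = r * Module.finrank K (LinearMap.range p') := by
  obtain ⟨r', u, hu, b, hb⟩ := h.exists_chainBasis hF
  have hpos := h.pos
  have hr' : r' = r := by
    have := Module.finrank_eq_card_basis b
    rw [hr] at this
    simp at this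
    rcases this with this | this <;> omega
  subst hr'
  have hcomm {f : M →ₗ[K] N} (hf : ε' ∘ₗ f = f ∘ₗ ε) (a : ℕ) (x : M) :
      f ((ε ^ a) x) = (ε' ^ a) (f x) := by
    induction a with
    | zero => simp
    | succ a ih =>
      rw [pow_succ', pow_succ', Module.End.mul_apply, Module.End.mul_apply, ← ih]
      exact (congrArg (fun g => g ((ε ^ a) x)) hf).symm
  let F : homOn p ε p' ε' →ₗ[K] (Fin r' → LinearMap.range p') :=
    { toFun := fun f t => p'.rangeRestrict (f.1 (u t))
      map_add' := fun f g => by ext t; simp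
      map_smul' := fun k f => by ext t; simp }
  have hval (f : homOn p ε p' ε') (t : Fin r') : (F f t : N) = f.1 (u t) := by
    have := congrArg (fun g => g (u t)) f.2.1
    simp only [LinearMap.comp_apply, hu] at this
    exact this
  have hinj : Function.Injective F := by
    rw [← LinearMap.ker_eq_bot, LinearMap.ker_eq_bot']
    intro f hf
    have h0 (t : Fin r') : f.1 (u t) = 0 := by rw [← hval, hf]; rfl
    apply Subtype.ext
    have h1 : f.1 ∘ₗ (LinearMap.range p).subtype = 0 := by
      refine b.ext fun q => ?_
      simp only [LinearMap.comp_apply, Submodule.subtype_apply, hb, hcomm f.2.2, h0]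
      simp
    have h2 := f.2.1
    ext x
    have h3 := congrArg (fun g => g (p.rangeRestrict x)) h1
    have h4 := congrArg (fun g => g x) h2
    simp only [LinearMap.comp_apply] at h4
    have h5 : f.1 (p x) = 0 := h3
    rw [← h4, h5]
    simp
  have hsurj : Function.Surjective F := by
    intro y
    set f0 : LinearMap.range p →ₗ[K] N := b.constr K fun q => (ε' ^ (q.2 : ℕ)) (y q.1 : N)
    have hy (t) : p' (y t : N) = y t := h'.mem_range.1 (y t).2
    have hf0 (t : Fin r') (a : ℕ) : f0 (p.rangeRestrict ((ε ^ a) (u t))) =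
        (ε' ^ a) (y t : N) := by
      by_cases ha : a < c
      · have h1 : p.rangeRestrict ((ε ^ a) (u t)) = b (t, ⟨a, ha⟩) := by
          apply Subtype.ext
          rw [hb]
          exact h.apply_pow (hu t) a
        rw [h1]
        simp only [f0, Module.Basis.constr_basis]
      · rw [h.pow_eq_zero (not_lt.1 ha), h'.pow_eq_zero (not_lt.1 ha)]
        simp
    have e1 : p' ∘ₗ f0 = f0 := by
      refine b.ext fun q => ?_
      simp only [LinearMap.comp_apply, f0, Module.Basis.constr_basis]
      exact h'.apply_pow (hy _) _
    have hpp : p.rangeRestrict ∘ₗ p = p.rangeRestrict := by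
      ext x; exact h.apply_self x
    have e2 : ε' ∘ₗ f0 = f0 ∘ₗ p.rangeRestrict ∘ₗ ε ∘ₗ (LinearMap.range p).subtype := by
      refine b.ext fun ⟨t, d⟩ => ?_
      simp only [LinearMap.comp_apply, Submodule.subtype_apply, hb]
      rw [← Module.End.mul_apply ε, ← pow_succ', hf0, pow_succ', Module.End.mul_apply]
      simp only [f0, Module.Basis.constr_basis]
    refine ⟨⟨f0 ∘ₗ p.rangeRestrict, ?_, ?_⟩, ?_⟩
    · rw [LinearMap.comp_assoc, hpp, ← LinearMap.comp_assoc, e1]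
    · rw [← LinearMap.comp_assoc, e2]
      ext x
      change f0 (p.rangeRestrict (ε (p x))) = f0 (p.rangeRestrict (ε x))
      rw [h.eps_p]
    · ext t
      rw [hval]
      have := hf0 t 0
      simpa using this
  have := (LinearEquiv.ofBijective F ⟨hinj, hsurj⟩).finrank_eq
  rw [this, Module.finrank_pi_fintype]
  simp

end NilpOn

end Nilpotent

/-! ### Numerical lemmas on `g` and `f` -/

namespace SymmGCM

variable {ι : Type} (X : SymmGCM ι)

theorem neg_of_fin {i j : ι} (g : Fin (X.g i j)) : X.C i j < 0 := by
  by_contra h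
  have := g.2
  simp [SymmGCM.g, h] at this

theorem ne_of_fin {i j : ι} (g : Fin (X.g i j)) : i ≠ j := by
  rintro rfl
  have := X.neg_of_fin g
  rw [X.diag] at this
  omega

theorem g_self (i : ι) : X.g i i = 0 := by simp [SymmGCM.g, X.diag]

theorem g_pos {i j : ι} (h : X.C i j < 0) : 0 < X.g i j := by
  rw [SymmGCM.g, if_pos h]
  exact Int.gcd_pos_of_ne_zero_left _ h.ne

theorem g_mul_f (i j : ι) (h : i ≠ j) : X.g i j * X.f i j = (X.C i j).natAbs := by
  by_cases hn : X.C i j < 0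
  · rw [SymmGCM.f]
    apply Nat.mul_div_cancel'
    rw [SymmGCM.g, if_pos hn]
    exact Nat.gcd_dvd_left _ _
  · have : X.C i j = 0 := le_antisymm (X.nonpos i j h) (not_lt.1 hn)
    simp [SymmGCM.g, this]

theorem c_mul_f (i j : ι) (h : X.C i j < 0) : X.c i * X.f i j = X.c j * X.f j i := by
  have hg := X.g_pos h
  have hij : i ≠ j := by rintro rfl; rw [X.diag] at h; omega
  have h1 := X.g_mul_f i j hij
  have h2 := X.g_mul_f j i hij.symm
  have h3 := congrArg Int.natAbs (X.symm i j)
  rw [Int.natAbs_mul, Int.natAbs_mul, ← h1, ← h2, X.g_comm j i] at h3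
  simp only [Int.natAbs_natCast] at h3
  apply Nat.eq_of_mul_eq_mul_left hg
  linarith

theorem f_pos {i j : ι} (h : X.C i j < 0) : 0 < X.f i j := by
  have hij : i ≠ j := by rintro rfl; rw [X.diag] at h; omega
  have h1 := X.g_mul_f i j hij
  rcases Nat.eq_zero_or_pos (X.f i j) with h0 | h0
  · rw [h0] at h1; simp at h1; omega
  · exact h0

theorem f_coprime {i j : ι} (h : X.C i j < 0) : Nat.Coprime (X.f i j) (X.f j i) := by
  have hg := X.g_pos h
  rw [SymmGCM.f, SymmGCM.f, X.g_comm j i]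
  rw [SymmGCM.g, if_pos h] at hg ⊢
  exact Nat.coprime_div_gcd_div_gcd hg

/-- Since `f i j` and `f j i` are coprime and `c i * f i j = c j * f j i`, the number `f j i`
divides `c i`. Consequently `ε_i ^ f j i` and `ε_j ^ f i j`, which an arrow intertwines, both have
`q`-th power zero. -/
theorem exists_quot {i j : ι} (h : X.C i j < 0) :
    ∃ q, 1 ≤ q ∧ X.c i = X.f j i * q ∧ X.c j = X.f i j * q := by
  have h1 := X.c_mul_f i j h
  have h2 := X.f_coprime h
  have h3 : X.f j i ∣ X.c i := by
    apply h2.symm.dvd_of_dvd_mul_right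
    rw [h1]; exact dvd_mul_left _ _
  obtain ⟨q, hq⟩ := h3
  have hp := X.f_pos ((X.neg_iff i j).1 h)
  refine ⟨q, ?_, hq, ?_⟩
  · have := X.c_pos i
    rw [hq] at this
    exact Nat.pos_of_mul_pos_left this
  · rw [hq] at h1
    apply Nat.eq_of_mul_eq_mul_right hp
    linarith

end SymmGCM

theorem Orientation.sgn_mul_self {ι : Type} {X : SymmGCM ι} (Ω : Orientation X) (i j : ι) :
    Ω.sgn i j * Ω.sgn i j = 1 := by
  unfold Orientation.sgn; split_ifs <;> rfl

theorem Orientation.sgn_symm {ι : Type} {X : SymmGCM ι} (Ω : Orientation X) {i j : ι}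
    (h : X.C i j < 0) : Ω.sgn j i = - Ω.sgn i j := by
  unfold Orientation.sgn
  have h1 := (Ω.rel_or_iff i j).2 h
  have h2 : ¬ (Ω.rel i j ∧ Ω.rel j i) := fun ⟨a, b⟩ => Ω.acyclic i (.tail (.single a) b)
  split_ifs <;> tauto

/-- The reindexing behind `inMap_shift`: all copies move up by one place, and the copy that leaves
at the top is traded for the new entry `z` at the bottom. -/
theorem sum_shift {A N : Type*} [AddCommGroup N] {F : ℕ} (hF : 0 < F) (G : ℕ → A → N) (z : A)
    (y : Fin F → A) :
    ∑ f : Fin F, G f (if _ : (f : ℕ) = 0 then z else y ⟨f - 1, by omega⟩) +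
      G F (y ⟨F - 1, by omega⟩) = G 0 z + ∑ f : Fin F, G (f + 1) (y f) := by
  obtain ⟨n, rfl⟩ : ∃ n, F = n + 1 := ⟨F - 1, by omega⟩
  rw [Fin.sum_univ_succ, Fin.sum_univ_castSucc]
  simp only [Fin.val_zero, Fin.val_succ, Nat.add_eq_zero_iff, one_ne_zero, and_false,
    dif_neg, not_false_eq_true, add_tsub_cancel_right, Fin.val_castSucc, add_assoc, Fin.val_last]
  rfl

/-! ### The `H_j`-module of all neighbours of a vertex, with its maps to and from that vertex. -/

section Rep

variable {K : Type*} [Field K] {ι : Type} [Fintype ι] [DecidableEq ι] {Y : SymmGCM ι}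
  {Ω : Orientation Y} {M : Type*} [AddCommGroup M] [Module K M]

namespace Satisfies

variable {v : Gen Y → Module.End K M} (hv : Satisfies Ω v)

include hv

theorem nilpOn (j : ι) : NilpOn (v (.e j)) (v (.ε j)) (Y.c j) where
  idem := by rw [hv.idem, if_pos rfl]
  left := by
    conv_lhs => rw [← hv.loop j]
    rw [mul_assoc, ← mul_assoc, hv.idem, if_pos rfl, ← mul_assoc, hv.loop]
  right := by
    conv_lhs => rw [← hv.loop j]
    rw [mul_assoc, hv.idem, if_pos rfl, hv.loop]
  nil := hv.nilp j
  pos := Y.c_pos j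

theorem e_e (i : ι) (x : M) : v (.e i) (v (.e i) x) = v (.e i) x := (hv.nilpOn i).apply_self x

theorem e_e_ne {i j : ι} (h : i ≠ j) (x : M) : v (.e i) (v (.e j) x) = 0 := by
  have := congrArg (fun f : Module.End K M => f x) (hv.idem i j)
  simpa [h] using this

theorem e_of_e {i j : ι} {x : M} (hx : v (.e j) x = x) : v (.e i) x = if i = j then x else 0 := by
  split_ifs with h
  · rw [h, hx]
  · rw [← hx, hv.e_e_ne h]

theorem e_eps (i : ι) (x : M) : v (.e i) (v (.ε i) x) = v (.ε i) x := (hv.nilpOn i).p_eps x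

theorem eps_e (i : ι) (x : M) : v (.ε i) (v (.e i) x) = v (.ε i) x := (hv.nilpOn i).eps_p x

theorem e_α (i j : ι) (g) (x : M) : v (.e i) (v (.α i j g) x) = v (.α i j g) x := by
  rw [← hv.arrow i j g]
  exact hv.e_e i _

theorem α_e (i j : ι) (g) (x : M) : v (.α i j g) (v (.e j) x) = v (.α i j g) x := by
  rw [← hv.arrow i j g]
  simp [hv.e_e j]

theorem α_of_e {i j k : ι} {g} (h : k ≠ j) {x : M} (hx : v (.e k) x = x) :
    v (.α i j g) x = 0 := by
  rw [← hv.α_e, ← hx, hv.e_e_ne h.symm, map_zero]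

theorem eps_of_e {j k : ι} (h : k ≠ j) {x : M} (hx : v (.e k) x = x) :
    v (.ε j) x = 0 := by
  rw [← hv.eps_e, ← hx, hv.e_e_ne h.symm, map_zero]

theorem sum_e (x : M) : ∑ i, v (.e i) x = x := by
  have := congrArg (fun f : Module.End K M => f x) hv.unit
  simpa using this

theorem comm_apply (i j : ι) (g) (x : M) :
    (v (.ε i) ^ Y.f j i) (v (.α i j g) x) = v (.α i j g) ((v (.ε j) ^ Y.f i j) x) :=
  congrArg (fun f : Module.End K M => f x) (hv.comm i j g)

end Satisfies

/-- The index set of the arrows into `j`, each repeated `f k j` times: the space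
`⊕ₖ ⱼHₖ ⊗ Mₖ` consists of the families indexed by it. -/
abbrev Ar (Y : SymmGCM ι) (j : ι) : Type := Σ k, Fin (Y.g j k) × Fin (Y.f k j)

/-- The families `y` with `y (k, g, f) ∈ M_k`. -/
def tl (v : Gen Y → Module.End K M) (j : ι) : Submodule K (Ar Y j → M) where
  carrier := {y | ∀ q, v (.e q.1) (y q) = y q}
  add_mem' hx hy q := by simp [hx q, hy q]
  zero_mem' q := by simp
  smul_mem' k x hx q := by simp [hx q]

/-- The sum of all maps into the vertex `j`. -/
def inMap (v : Gen Y → Module.End K M) (j : ι) : (Ar Y j → M) →ₗ[K] M :=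
  ∑ q : Ar Y j, (v (.ε j) ^ (q.2.2 : ℕ) * v (.α j q.1 q.2.1)) ∘ₗ LinearMap.proj q

/-- The collection of all signed maps out of the vertex `j`. -/
def outMap (Ω : Orientation Y) (v : Gen Y → Module.End K M) (j : ι) : M →ₗ[K] (Ar Y j → M) :=
  LinearMap.pi fun q => Ω.sgn j q.1 • (v (.α q.1 j (Fin.cast (Y.g_comm j q.1) q.2.1)) *
    v (.ε j) ^ (Y.f q.1 j - 1 - q.2.2))

theorem Ar.last_lt {j : ι} (k : ι) (g : Fin (Y.g j k)) : Y.f k j - 1 < Y.f k j := by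
  have := Y.f_pos ((Y.neg_iff _ _).1 (Y.neg_of_fin g))
  omega

/-- The last of the copies of an arrow. -/
abbrev Ar.last {j : ι} (k : ι) (g : Fin (Y.g j k)) : Ar Y j :=
  ⟨k, g, ⟨Y.f k j - 1, Ar.last_lt k g⟩⟩

/-- The action of `ε_j` on `⊕ₖ ⱼHₖ ⊗ Mₖ`. -/
def shift (v : Gen Y → Module.End K M) (j : ι) : Module.End K (Ar Y j → M) :=
  LinearMap.pi fun q => if _ : (q.2.2 : ℕ) = 0 then
    (v (.ε q.1) ^ Y.f j q.1) ∘ₗ LinearMap.proj (Ar.last q.1 q.2.1) else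
    LinearMap.proj ⟨q.1, q.2.1, ⟨q.2.2 - 1, by omega⟩⟩

theorem inMap_apply (v : Gen Y → Module.End K M) (j : ι) (y : Ar Y j → M) :
    inMap v j y = ∑ k, ∑ g, ∑ f : Fin (Y.f k j),
      (v (.ε j) ^ (f : ℕ)) (v (.α j k g) (y ⟨k, g, f⟩)) := by
  simp [inMap, Fintype.sum_sigma, Fintype.sum_prod_type]

theorem outMap_apply (v : Gen Y → Module.End K M) (j : ι) (x : M) (q : Ar Y j) :
    outMap Ω v j x q = Ω.sgn j q.1 • (v (.α q.1 j (Fin.cast (Y.g_comm j q.1) q.2.1))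
      ((v (.ε j) ^ (Y.f q.1 j - 1 - q.2.2)) x)) := rfl

theorem shift_apply (v : Gen Y → Module.End K M) (j : ι) (y : Ar Y j → M) (k g f) :
    shift v j y ⟨k, g, f⟩ = if _ : (f : ℕ) = 0 then
      (v (.ε k) ^ Y.f j k) (y (Ar.last k g)) else y ⟨k, g, ⟨f - 1, by omega⟩⟩ := by
  simp only [shift, LinearMap.pi_apply]
  split_ifs <;> rfl

theorem shift_pow_apply (v : Gen Y → Module.End K M) (j : ι) (m : ℕ) (y : Ar Y j → M) (k g)
    (hm : m ≤ Y.f k j) (f : Fin (Y.f k j)) :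
    (shift v j ^ m) y ⟨k, g, f⟩ = if h : m ≤ f then y ⟨k, g, ⟨f - m, by omega⟩⟩ else
      (v (.ε k) ^ Y.f j k) (y ⟨k, g, ⟨f + Y.f k j - m, by omega⟩⟩) := by
  induction m generalizing f with
  | zero => simp
  | succ m ih =>
    rw [pow_succ', Module.End.mul_apply, shift_apply]
    by_cases h0 : (f : ℕ) = 0
    · rw [dif_pos h0, dif_neg (by omega), ih (by omega), dif_pos (by simp; omega)]
      congr 3
      simp only [Prod.mk.injEq, Fin.mk.injEq, true_and]
      omega
    · rw [dif_neg h0, ih (by omega)]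
      by_cases hm' : m + 1 ≤ f
      · rw [dif_pos hm', dif_pos (by simp; omega)]
        congr 3
        simp only [Fin.mk.injEq]
        omega
      · rw [dif_neg hm', dif_neg (by simp; omega)]
        congr 5
        simp only
        omega

/-- After `f k j` shifts each copy is back in its place and has gone once through the wrap-around:
this is the relation `ε_j ^ f k j = ε_k ^ f j k` in the bimodule `ⱼHₖ`. -/
theorem shift_pow_f (v : Gen Y → Module.End K M) (j : ι) (y : Ar Y j → M) (q : Ar Y j) :
    (shift v j ^ Y.f q.1 j) y q = (v (.ε q.1) ^ Y.f j q.1) (y q) := by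
  obtain ⟨k, g, f⟩ := q
  rw [shift_pow_apply _ _ _ _ _ _ le_rfl, dif_neg (by simp)]
  simp

theorem shift_pow_f_mul (v : Gen Y → Module.End K M) (j : ι) (m : ℕ) (y : Ar Y j → M)
    (q : Ar Y j) :
    (shift v j ^ (Y.f q.1 j * m)) y q = (v (.ε q.1) ^ (Y.f j q.1 * m)) (y q) := by
  induction m with
  | zero => simp
  | succ m ih =>
    rw [mul_add, mul_one, add_comm, pow_add, Module.End.mul_apply, shift_pow_f, ih,
      ← Module.End.mul_apply, ← pow_add]
    congr 2; ring

variable {v : Gen Y → Module.End K M}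

theorem shift_pow_c (hv : Satisfies Ω v) (j : ι) : shift v j ^ Y.c j = 0 := by
  refine LinearMap.ext fun y => funext fun q => ?_
  obtain ⟨m, _, h1, h2⟩ := Y.exists_quot (Y.neg_of_fin q.2.1)
  rw [h1, shift_pow_f_mul, ← h2, hv.nilp]
  rfl

theorem shift_mem_tl (hv : Satisfies Ω v) {j : ι} {y : Ar Y j → M} (hy : y ∈ tl v j) :
    shift v j y ∈ tl v j := by
  rintro ⟨k, g, f⟩
  rw [shift_apply]
  split_ifs with h
  · exact (hv.nilpOn k).apply_pow (hy (Ar.last k g)) _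
  · exact hy ⟨k, g, ⟨f - 1, by omega⟩⟩

theorem outMap_mem_tl (hv : Satisfies Ω v) (j : ι) (x : M) : outMap Ω v j x ∈ tl v j := by
  intro q
  rw [outMap_apply, map_zsmul, hv.e_α]

theorem e_inMap (hv : Satisfies Ω v) (j : ι) (y : Ar Y j → M) :
    v (.e j) (inMap v j y) = inMap v j y := by
  rw [inMap_apply]
  simp only [map_sum]
  refine Finset.sum_congr rfl fun k _ => Finset.sum_congr rfl fun g _ =>
    Finset.sum_congr rfl fun f _ => (hv.nilpOn j).apply_pow (hv.e_α _ _ _ _) _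

theorem outMap_e (hv : Satisfies Ω v) (j : ι) (x : M) :
    outMap Ω v j (v (.e j) x) = outMap Ω v j x := by
  funext q
  rw [outMap_apply, outMap_apply]
  congr 1
  have := congrArg (fun f : Module.End K M => f x)
    ((hv.nilpOn j).p_pow (Y.f q.1 j - 1 - q.2.2))
  rw [← hv.α_e _ _ _ ((v (.ε j) ^ (Y.f q.1 j - 1 - q.2.2)) x)]
  simp only [Module.End.mul_apply] at this
  rw [this, ← this, hv.α_e, ← hv.α_e, this]

theorem inMap_shift (hv : Satisfies Ω v) (j : ι) (y : Ar Y j → M) :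
    inMap v j (shift v j y) = v (.ε j) (inMap v j y) := by
  rw [inMap_apply, inMap_apply]
  simp only [map_sum, shift_apply]
  refine Finset.sum_congr rfl fun k _ => Finset.sum_congr rfl fun g _ => ?_
  have := sum_shift (Y.f_pos ((Y.neg_iff _ _).1 (Y.neg_of_fin g)))
    (fun f x => (v (.ε j) ^ f) (v (.α j k g) x)) ((v (.ε k) ^ Y.f j k) (y (Ar.last k g)))
    (fun f => y ⟨k, g, f⟩)
  simp only [pow_zero, Module.End.one_apply, hv.comm_apply] at this
  rw [add_comm] at this
  have := add_left_cancel this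
  simp only [pow_succ', Module.End.mul_apply] at this
  exact this

theorem outMap_eps (hv : Satisfies Ω v) (j : ι) (x : M) :
    outMap Ω v j (v (.ε j) x) = shift v j (outMap Ω v j x) := by
  funext ⟨k, g, f⟩
  rw [shift_apply]
  split_ifs with h
  · rw [outMap_apply, outMap_apply, map_zsmul, hv.comm_apply, ← Module.End.mul_apply (_ ^ _),
      ← Module.End.mul_apply (_ ^ _), ← pow_succ, ← pow_add]
    congr 4
    have := Ar.last_lt k g
    simp only
    omega
  · rw [outMap_apply, outMap_apply, ← Module.End.mul_apply (_ ^ _), ← pow_succ]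
    congr 4
    simp only
    omega

/-- The signs and powers of `ε_j` in `inMap` and `outMap` are distributed so that the composite is
term by term the mesh relation at `j`. -/
theorem inMap_outMap (hv : Satisfies Ω v) (j : ι) (x : M) :
    inMap v j (outMap Ω v j x) = 0 := by
  have h := congrArg (fun f : Module.End K M => f x) (hv.mesh j)
  simp only [mesh, LinearMap.sum_apply, Finset.sum_range] at h
  rw [inMap_apply]
  refine Eq.trans ?_ h
  refine Finset.sum_congr rfl fun k _ => Finset.sum_congr rfl fun g _ =>
    Finset.sum_congr rfl fun f _ => ?_
  rw [outMap_apply, map_zsmul, map_zsmul]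
  rfl

/-- No power of `ε_j` precedes the arrow in the last copy, so the arrow `j → k` itself can be
recovered from `outMap`. This dictates the action of the outgoing arrows on the reflected
representation. -/
theorem outMap_last (v : Gen Y → Module.End K M) (j k : ι) (g) (x : M) :
    Ω.sgn j k • outMap Ω v j x (Ar.last k g) = v (.α k j (Fin.cast (Y.g_comm j k) g)) x := by
  rw [outMap_apply]
  simp [smul_smul, Ω.sgn_mul_self]

/-- The family with the single entry `x` at the first copy of an arrow. -/
theorem inMap_single (v : Gen Y → Module.End K M) (j : ι) (q : Ar Y j) (x : M) :
    inMap v j (Pi.single q x) = (v (.ε j) ^ (q.2.2 : ℕ)) (v (.α j q.1 q.2.1) x) := by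
  classical
  simp only [inMap, LinearMap.sum_apply, LinearMap.comp_apply, LinearMap.proj_apply]
  rw [Finset.sum_eq_single q]
  · simp
  · intro b _ hb
    simp [Pi.single_eq_of_ne hb]
  · simp

theorem single_mem_tl {j : ι} {q : Ar Y j} {x : M} (hx : v (.e q.1) x = x) :
    Pi.single q x ∈ tl v j := by
  intro b
  by_cases h : b = q
  · subst h; simpa using hx
  · simp [Pi.single_eq_of_ne h]

/-- A family killed by the shift is concentrated in the last copies, where it is killed by `ε_k ^ f
j k`; freeness of `M_k` writes these entries as `ε_k ^ (c k - f j k) z`. The family with `z` in the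
first copies is the required preimage. -/
theorem shift_free (hv : Satisfies Ω v) (hF : ∀ k, FreeOn (v (.e k)) (v (.ε k)) (Y.c k)) (j : ι)
    {y : Ar Y j → M} (hy : y ∈ tl v j) (h0 : shift v j y = 0) :
    ∃ z ∈ tl v j, (shift v j ^ (Y.c j - 1)) z = y := by
  have key : ∀ q : Ar Y j, ∃ z, v (.e q.1) z = z ∧
      (v (.ε q.1) ^ (Y.c q.1 - Y.f j q.1)) z = y (Ar.last q.1 q.2.1) := by
    rintro ⟨k, g, f⟩
    obtain ⟨m, hm, h1, h2⟩ := Y.exists_quot (Y.neg_of_fin g)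
    have := congrFun h0 ⟨k, g, ⟨0, Nat.zero_lt_of_lt f.2⟩⟩
    rw [shift_apply, dif_pos rfl] at this
    exact (hv.nilpOn k).eps_injOn_of_pow (hF k) (Y.f j k)
      (by rw [h2]; exact Nat.le_mul_of_pos_right _ hm) _ (hy (Ar.last k g)) this
  have hlow : ∀ k g (f : Fin (Y.f k j)), f ≠ (Ar.last (Y := Y) (j := j) k g).2.2 → y ⟨k, g, f⟩ = 0 := by
    intro k g f hf
    have hlt : (f : ℕ) + 1 < Y.f k j := by
      have := f.2
      by_contra h
      exact hf (Fin.ext (by change (f : ℕ) = Y.f k j - 1; omega))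
    have := congrFun h0 ⟨k, g, ⟨f + 1, hlt⟩⟩
    rw [shift_apply, dif_neg (by simp)] at this
    simpa using this
  choose z hz hz' using key
  refine ⟨fun q => if (q.2.2 : ℕ) = 0 then z ⟨q.1, q.2.1, q.2.2⟩ else 0, ?_, ?_⟩
  · rintro ⟨k, g, f⟩
    simp only
    split_ifs
    · exact hz ⟨k, g, f⟩
    · simp
  · funext ⟨k, g, f⟩
    obtain ⟨m, hm, h1, h2⟩ := Y.exists_quot (Y.neg_of_fin g)
    have hlt : (f : ℕ) < Y.f k j := f.2
    -- The `m - 1` full turns multiply `z` by `ε_k ^ (c k - f j k)`, and the remaining `f k j - 1`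
    -- shifts carry the first copy to the last one.
    have e1 : Y.c j - 1 = (Y.f k j - 1) + Y.f k j * (m - 1) := by
      obtain ⟨m, rfl⟩ : ∃ m', m = m' + 1 := ⟨m - 1, by omega⟩
      rw [h1, mul_add]
      simp
      omega
    rw [e1, pow_add, Module.End.mul_apply, shift_pow_apply _ _ _ _ _ _ (by omega)]
    have e2 : Y.f j k * (m - 1) = Y.c k - Y.f j k := by
      rw [h2, Nat.mul_sub, mul_one]
    by_cases hf : f = (Ar.last (Y := Y) (j := j) k g).2.2
    · subst hf
      rw [dif_pos (by simp)]
      have e3 := shift_pow_f_mul v j (m - 1)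
        (fun q => if (q.2.2 : ℕ) = 0 then z ⟨q.1, q.2.1, q.2.2⟩ else 0)
        ⟨k, g, ⟨(Ar.last (Y := Y) (j := j) k g).2.2 - (Y.f k j - 1), by simp; omega⟩⟩
      rw [e3, e2]
      simp only [tsub_self, if_true]
      exact hz' ⟨k, g, _⟩
    · rw [hlow _ _ _ hf, dif_neg (by
        intro h; exact hf (Fin.ext (by change (f : ℕ) = Y.f k j - 1; omega)))]
      have e3 := shift_pow_f_mul v j (m - 1)
        (fun q => if (q.2.2 : ℕ) = 0 then z ⟨q.1, q.2.1, q.2.2⟩ else 0)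
        ⟨k, g, ⟨(f : ℕ) + Y.f k j - (Y.f k j - 1), by
          have : (f : ℕ) ≠ Y.f k j - 1 := fun h => hf (Fin.ext h)
          omega⟩⟩
      rw [e3]
      simp only
      rw [if_neg (by omega)]
      simp

end Rep

/-! ### Reflection of a representation at a vertex -/

section Reflection

variable {K : Type*} [Field K] {ι : Type} [Fintype ι] [DecidableEq ι] {Y : SymmGCM ι}
  {Ω : Orientation Y} {M : Type*} [AddCommGroup M] [Module K M]

/-- The kernel of `⊕ₖ ⱼHₖ ⊗ Mₖ → M_j`, the space at the vertex `j` of the reflected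
representation. -/
def reflR (v : Gen Y → Module.End K M) (j : ι) : Submodule K (Ar Y j → M) :=
  tl v j ⊓ LinearMap.ker (inMap v j)

/-- The part of `M` away from the vertex `j`. -/
def reflZ (v : Gen Y → Module.End K M) (j : ι) : Submodule K M := LinearMap.ker (v (.e j))

/-- The space of the representation reflected at `j`. -/
abbrev Refl (v : Gen Y → Module.End K M) (j : ι) : Type _ := reflR v j × reflZ v j

variable {v : Gen Y → Module.End K M}

theorem shift_mem_reflR (hv : Satisfies Ω v) {j : ι} {y : Ar Y j → M} (hy : y ∈ reflR v j) :
    shift v j y ∈ reflR v j :=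
  ⟨shift_mem_tl hv hy.1, by
    have h : inMap v j y = 0 := hy.2
    change inMap v j (shift v j y) = 0
    rw [inMap_shift hv, h, map_zero]⟩

theorem outMap_mem_reflR (hv : Satisfies Ω v) (j : ι) (x : M) : outMap Ω v j x ∈ reflR v j :=
  ⟨outMap_mem_tl hv j x, inMap_outMap hv j x⟩

def reflShift (hv : Satisfies Ω v) (j : ι) : Module.End K (reflR v j) :=
  (shift v j).restrict fun _ hy => shift_mem_reflR hv hy

def reflOut (hv : Satisfies Ω v) (j : ι) : M →ₗ[K] reflR v j :=
  (outMap Ω v j).codRestrict _ fun x => outMap_mem_reflR hv j x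

def reflPr (hv : Satisfies Ω v) (j : ι) : M →ₗ[K] reflZ v j :=
  (1 - v (.e j)).codRestrict _ fun x => by
    change v (.e j) (x - v (.e j) x) = 0
    rw [map_sub, hv.e_e, sub_self]

theorem coe_reflPr (hv : Satisfies Ω v) (j : ι) (x : M) :
    (reflPr hv j x : M) = x - v (.e j) x := rfl

theorem coe_reflPr_of_e (hv : Satisfies Ω v) {j k : ι} (h : k ≠ j) {x : M}
    (hx : v (.e k) x = x) : (reflPr hv j x : M) = x := by
  rw [coe_reflPr, hv.e_of_e hx, if_neg h.symm, sub_zero]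

/-- The reflected representation. -/
def reflVal (hv : Satisfies Ω v) (j : ι) : Gen Y → Module.End K (Refl v j)
  | .e k => if k = j then LinearMap.inl K _ _ ∘ₗ LinearMap.fst K _ _ else
      LinearMap.inr K _ _ ∘ₗ reflPr hv j ∘ₗ v (.e k) ∘ₗ (reflZ v j).subtype ∘ₗ LinearMap.snd K _ _
  | .ε k => if k = j then LinearMap.inl K _ _ ∘ₗ reflShift hv j ∘ₗ LinearMap.fst K _ _ else
      LinearMap.inr K _ _ ∘ₗ reflPr hv j ∘ₗ v (.ε k) ∘ₗ (reflZ v j).subtype ∘ₗ LinearMap.snd K _ _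
  -- Arrows out of `j` read off the last copy, with the sign from `outMap_last`; arrows into `j` are
  -- the old arrow followed by `outMap`, which lands in the kernel of `inMap` by the mesh relation.
  | .α a b g => if h : b = j then
      LinearMap.inr K _ _ ∘ₗ reflPr hv j ∘ₗ (Ω.sgn j a • LinearMap.proj
        (Ar.last a (Fin.cast (h ▸ Y.g_comm a b) g))) ∘ₗ (reflR v j).subtype ∘ₗ LinearMap.fst K _ _
      else if a = j then
      LinearMap.inl K _ _ ∘ₗ reflOut hv j ∘ₗ v (.α a b g) ∘ₗ (reflZ v j).subtype ∘ₗ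
        LinearMap.snd K _ _ else
      LinearMap.inr K _ _ ∘ₗ reflPr hv j ∘ₗ v (.α a b g) ∘ₗ (reflZ v j).subtype ∘ₗ
        LinearMap.snd K _ _

theorem Refl.ext' {j : ι} {w w' : Refl v j} (h1 : (w.1 : Ar Y j → M) = w'.1)
    (h2 : (w.2 : M) = w'.2) : w = w' :=
  Prod.ext (Subtype.ext h1) (Subtype.ext h2)

theorem Refl.e_snd {j : ι} (w : Refl v j) : v (.e j) (w.2 : M) = 0 := w.2.2

theorem Refl.fst_mem {j : ι} (w : Refl v j) (q : Ar Y j) :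
    v (.e q.1) ((w.1 : Ar Y j → M) q) = (w.1 : Ar Y j → M) q := w.1.2.1 q

section Apply

variable (hv : Satisfies Ω v) (j : ι) (w : Refl v j)

theorem reflVal_e_self : reflVal hv j (.e j) w = (w.1, 0) := by
  simp [reflVal]

theorem reflVal_e_ne {k : ι} (h : k ≠ j) : (reflVal hv j (.e k) w).1 = 0 ∧
    ((reflVal hv j (.e k) w).2 : M) = v (.e k) w.2 := by
  simp only [reflVal, if_neg h]
  exact ⟨rfl, coe_reflPr_of_e hv h (hv.e_e _ _)⟩

theorem reflVal_eps_self : reflVal hv j (.ε j) w = (reflShift hv j w.1, 0) := by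
  simp [reflVal]

theorem reflVal_eps_ne {k : ι} (h : k ≠ j) : (reflVal hv j (.ε k) w).1 = 0 ∧
    ((reflVal hv j (.ε k) w).2 : M) = v (.ε k) w.2 := by
  simp only [reflVal, if_neg h]
  exact ⟨rfl, coe_reflPr_of_e hv h (hv.e_eps _ _)⟩

theorem reflVal_α_out (a : ι) (g : Fin (Y.g a j)) : (reflVal hv j (.α a j g) w).1 = 0 ∧
    ((reflVal hv j (.α a j g) w).2 : M) =
      Ω.sgn j a • (w.1 : Ar Y j → M) (Ar.last a (Fin.cast (Y.g_comm a j) g)) := by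
  simp only [reflVal, dif_pos]
  refine ⟨rfl, coe_reflPr_of_e hv (Y.ne_of_fin g) ?_⟩
  change v (.e a) (Ω.sgn j a • (w.1 : Ar Y j → M) _) = Ω.sgn j a • (w.1 : Ar Y j → M) _
  rw [map_zsmul]
  congr 1
  exact w.fst_mem (Ar.last a (Fin.cast (Y.g_comm a j) g))

theorem reflVal_α_in (b : ι) (g : Fin (Y.g j b)) :
    ((reflVal hv j (.α j b g) w).1 : Ar Y j → M) = outMap Ω v j (v (.α j b g) w.2) ∧
      (reflVal hv j (.α j b g) w).2 = 0 := by
  simp only [reflVal, dif_neg (Y.ne_of_fin g).symm, if_pos]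
  exact ⟨rfl, rfl⟩

theorem reflVal_α_ne {a b : ι} (ha : a ≠ j) (hb : b ≠ j) (g : Fin (Y.g a b)) :
    (reflVal hv j (.α a b g) w).1 = 0 ∧
      ((reflVal hv j (.α a b g) w).2 : M) = v (.α a b g) w.2 := by
  simp only [reflVal, dif_neg hb, if_neg ha]
  exact ⟨rfl, coe_reflPr_of_e hv ha (hv.e_α _ _ _ _)⟩

theorem reflVal_eps_self_pow (n : ℕ) :
    (((reflVal hv j (.ε j) ^ n) w).1 : Ar Y j → M) = (shift v j ^ n) w.1 := by
  induction n with
  | zero => rfl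
  | succ n ih =>
    rw [pow_succ', pow_succ', Module.End.mul_apply, Module.End.mul_apply, ← ih, reflVal_eps_self]
    rfl

theorem reflVal_eps_self_pow_snd (n : ℕ) (h : w.2 = 0) :
    (((reflVal hv j (.ε j) ^ n) w).2) = 0 := by
  cases n with
  | zero => exact h
  | succ n => rw [pow_succ', Module.End.mul_apply, reflVal_eps_self]

theorem reflVal_eps_ne_pow {k : ι} (h : k ≠ j) (n : ℕ) :
    (((reflVal hv j (.ε k) ^ n) w).2 : M) = (v (.ε k) ^ n) w.2 := by
  induction n with
  | zero => rfl
  | succ n ih =>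
    rw [pow_succ', pow_succ', Module.End.mul_apply, Module.End.mul_apply, ← ih,
      (reflVal_eps_ne hv j _ h).2]

theorem reflVal_eps_ne_pow_fst {k : ι} (hk : k ≠ j) (n : ℕ) (h : w.1 = 0) :
    (((reflVal hv j (.ε k) ^ n) w).1) = 0 := by
  cases n with
  | zero => exact h
  | succ n => rw [pow_succ', Module.End.mul_apply, (reflVal_eps_ne hv j _ hk).1]

end Apply

theorem mesh_apply (Ω : Orientation Y) (v : Gen Y → Module.End K M) (i : ι) (x : M) :
    mesh Ω v i x = ∑ j, ∑ g : Fin (Y.g i j), ∑ f : Fin (Y.f j i),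
      Ω.sgn i j • (v (.ε i) ^ (f : ℕ)) (v (.α i j g) (v (.α j i (Fin.cast (Y.g_comm i j) g))
        ((v (.ε i) ^ (Y.f j i - 1 - f)) x))) := by
  simp only [mesh, LinearMap.sum_apply, Finset.sum_range]
  rfl

/-- The two signs cancel and the mesh sum at `j` becomes `outMap ∘ inMap`, which vanishes because
the new space at `j` is the kernel of `inMap`. -/
theorem reflVal_mesh_self (hv : Satisfies Ω v) (j : ι) : mesh Ω (reflVal hv j) j = 0 := by
  refine LinearMap.ext fun w => ?_
  have hterm (k : ι) (g : Fin (Y.g j k)) (f : Fin (Y.f k j)) :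
      ((((reflVal hv j (.ε j) ^ (f : ℕ)) (reflVal hv j (.α j k g)
        (reflVal hv j (.α k j (Fin.cast (Y.g_comm j k) g))
          ((reflVal hv j (.ε j) ^ (Y.f k j - 1 - f)) w)))).1 : Ar Y j → M)) =
      Ω.sgn j k • outMap Ω v j ((v (.ε j) ^ (f : ℕ)) (v (.α j k g)
        ((w.1 : Ar Y j → M) ⟨k, g, f⟩))) := by
    have hlt := f.2
    rw [reflVal_eps_self_pow, (reflVal_α_in hv j _ k g).1, (reflVal_α_out hv j _ k _).2,
      reflVal_eps_self_pow]
    have e1 : ∀ x, (shift v j ^ (f : ℕ)) (outMap Ω v j x) =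
        outMap Ω v j ((v (.ε j) ^ (f : ℕ)) x) := by
      intro x
      generalize (f : ℕ) = n
      induction n with
      | zero => rfl
      | succ n ih => rw [pow_succ', pow_succ', Module.End.mul_apply, Module.End.mul_apply, ih,
          outMap_eps hv]
    rw [map_zsmul, map_zsmul, map_zsmul, e1]
    congr 6
    -- After `f k j - 1 - f` shifts the last copy contains the old copy `f`, so the term indexed by
    -- `f` of the mesh sees exactly that entry.
    have e2 := shift_pow_apply v j (Y.f k j - 1 - f) (w.1 : Ar Y j → M) k g (by omega)
      ⟨Y.f k j - 1, Ar.last_lt k g⟩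
    rw [dif_pos (by simp only; omega)] at e2
    refine Eq.trans ?_ (e2.trans ?_)
    · rfl
    · exact congrArg (fun f' => (w.1 : Ar Y j → M) ⟨k, g, f'⟩) (Fin.ext (by simp only; omega))
  have hterm2 (k : ι) (g : Fin (Y.g j k)) (f : Fin (Y.f k j)) :
      ((((reflVal hv j (.ε j) ^ (f : ℕ)) (reflVal hv j (.α j k g)
        (reflVal hv j (.α k j (Fin.cast (Y.g_comm j k) g))
          ((reflVal hv j (.ε j) ^ (Y.f k j - 1 - f)) w)))).2)) = 0 :=
    reflVal_eps_self_pow_snd _ _ _ _ (reflVal_α_in hv j _ k g).2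
  rw [mesh_apply]
  refine Refl.ext' ?_ ?_
  · simp only [Prod.fst_sum, Prod.smul_fst, Submodule.coe_sum, Submodule.coe_smul_of_tower, hterm,
      smul_smul, Ω.sgn_mul_self, one_smul, ← map_sum]
    rw [← inMap_apply, show inMap v j (w.1 : Ar Y j → M) = 0 from w.1.2.2]
    simp
  · simp only [Prod.snd_sum, Prod.smul_snd, hterm2, smul_zero, Finset.sum_const_zero]
    rfl

/-- By `outMap_last`, a path `a → j → a` acts through the new space at `j` exactly as it did through
the old one, so the mesh relation at `a` is unchanged term by term. -/
theorem reflVal_mesh_ne (hv : Satisfies Ω v) {j a : ι} (ha : a ≠ j) :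
    mesh Ω (reflVal hv j) a = 0 := by
  refine LinearMap.ext fun w => ?_
  have hterm (k : ι) (g : Fin (Y.g a k)) (f : Fin (Y.f k a)) :
      ((reflVal hv j (.ε a) ^ (f : ℕ)) (reflVal hv j (.α a k g)
        (reflVal hv j (.α k a (Fin.cast (Y.g_comm a k) g))
          ((reflVal hv j (.ε a) ^ (Y.f k a - 1 - f)) w)))).1 = 0 ∧
      (((reflVal hv j (.ε a) ^ (f : ℕ)) (reflVal hv j (.α a k g)
        (reflVal hv j (.α k a (Fin.cast (Y.g_comm a k) g))
          ((reflVal hv j (.ε a) ^ (Y.f k a - 1 - f)) w)))).2 : M) =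
      (v (.ε a) ^ (f : ℕ)) (v (.α a k g)
        (v (.α k a (Fin.cast (Y.g_comm a k) g)) ((v (.ε a) ^ (Y.f k a - 1 - f)) w.2))) := by
    by_cases hk : k = j
    · subst hk
      refine ⟨reflVal_eps_ne_pow_fst _ _ _ ha _ (reflVal_α_out hv k _ a g).1, ?_⟩
      rw [reflVal_eps_ne_pow _ _ _ ha, (reflVal_α_out hv k _ a g).2, (reflVal_α_in hv k _ a _).1,
        reflVal_eps_ne_pow _ _ _ ha, outMap_last]
      rfl
    · refine ⟨reflVal_eps_ne_pow_fst _ _ _ ha _ (reflVal_α_ne hv j _ ha hk g).1, ?_⟩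
      rw [reflVal_eps_ne_pow _ _ _ ha, (reflVal_α_ne hv j _ ha hk g).2,
        (reflVal_α_ne hv j _ hk ha _).2, reflVal_eps_ne_pow _ _ _ ha]
  rw [mesh_apply]
  refine Refl.ext' ?_ ?_
  · simp only [Prod.fst_sum, Prod.smul_fst, hterm, smul_zero, Finset.sum_const_zero]
    rfl
  · simp only [Prod.snd_sum, Prod.smul_snd, Submodule.coe_sum, Submodule.coe_smul_of_tower, hterm]
    rw [← mesh_apply, hv.mesh]
    rfl

theorem reflVal_satisfies (hv : Satisfies Ω v) (j : ι) : Satisfies Ω (reflVal hv j) where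
  idem a b := by
    refine LinearMap.ext fun w => ?_
    rw [Module.End.mul_apply]
    by_cases hb : b = j
    · subst hb
      rw [reflVal_e_self]
      split_ifs with h
      · subst h; rw [reflVal_e_self, reflVal_e_self]
      · refine Refl.ext' ?_ ?_
        · rw [(reflVal_e_ne hv b _ h).1]; rfl
        · rw [(reflVal_e_ne hv b _ h).2]; simp
    · by_cases ha : a = j
      · subst ha
        rw [reflVal_e_self, (reflVal_e_ne hv a _ hb).1, if_neg (Ne.symm hb)]
        rfl
      · refine Refl.ext' ?_ ?_
        · rw [(reflVal_e_ne hv j _ ha).1]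
          split_ifs with h
          · rw [(reflVal_e_ne hv j _ ha).1]
          · rfl
        · rw [(reflVal_e_ne hv j _ ha).2, (reflVal_e_ne hv j _ hb).2]
          split_ifs with h
          · subst h; rw [(reflVal_e_ne hv j _ ha).2, hv.e_e]
          · rw [hv.e_e_ne h]; rfl
  unit := by
    refine LinearMap.ext fun w => ?_
    rw [LinearMap.sum_apply, Fintype.sum_eq_add_sum_compl j, reflVal_e_self]
    refine Refl.ext' ?_ ?_
    · simp only [Prod.fst_add, Prod.fst_sum, Module.End.one_apply]
      rw [Finset.sum_eq_zero, add_zero]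
      intro k hk
      exact (reflVal_e_ne hv j w (by simpa using hk)).1
    · simp only [Prod.snd_add, Prod.snd_sum, Module.End.one_apply, zero_add, Submodule.coe_sum]
      have h := hv.sum_e (w.2 : M)
      rw [Fintype.sum_eq_add_sum_compl j, w.e_snd, zero_add] at h
      refine Eq.trans ?_ h
      refine Finset.sum_congr rfl fun k hk => ?_
      exact (reflVal_e_ne hv j w (by simpa using hk)).2
  loop k := by
    refine LinearMap.ext fun w => ?_
    rw [Module.End.mul_apply, Module.End.mul_apply]
    by_cases hk : k = j
    · subst hk
      rw [reflVal_e_self, reflVal_eps_self, reflVal_eps_self, reflVal_e_self]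
    · refine Refl.ext' ?_ ?_
      · rw [(reflVal_e_ne hv j _ hk).1, (reflVal_eps_ne hv j _ hk).1]
      · rw [(reflVal_e_ne hv j _ hk).2, (reflVal_eps_ne hv j _ hk).2, (reflVal_e_ne hv j _ hk).2,
          (reflVal_eps_ne hv j _ hk).2, hv.e_eps, hv.eps_e]
  arrow a b g := by
    refine LinearMap.ext fun w => ?_
    rw [Module.End.mul_apply, Module.End.mul_apply]
    have hab := Y.ne_of_fin g
    by_cases hb : b = j
    · subst hb
      refine Refl.ext' ?_ ?_
      · rw [(reflVal_e_ne hv b _ hab).1, (reflVal_α_out hv b _ a g).1]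
      · rw [(reflVal_e_ne hv b _ hab).2, (reflVal_α_out hv b _ a g).2,
          (reflVal_α_out hv b _ a g).2, reflVal_e_self, map_zsmul]
        congr 1
        exact w.fst_mem (Ar.last a (Fin.cast (Y.g_comm a b) g))
    · by_cases ha : a = j
      · subst ha
        rw [reflVal_e_self]
        refine Refl.ext' ?_ ?_
        · simp only
          rw [(reflVal_α_in hv a _ b g).1, (reflVal_α_in hv a _ b g).1,
            (reflVal_e_ne hv a _ hb).2, hv.α_e]
        · rw [(reflVal_α_in hv a _ b g).2]
      · refine Refl.ext' ?_ ?_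
        · rw [(reflVal_e_ne hv j _ ha).1, (reflVal_α_ne hv j _ ha hb g).1]
        · rw [(reflVal_e_ne hv j _ ha).2, (reflVal_α_ne hv j _ ha hb g).2,
            (reflVal_e_ne hv j _ hb).2, (reflVal_α_ne hv j _ ha hb g).2, hv.α_e, hv.e_α]
  nilp k := by
    refine LinearMap.ext fun w => ?_
    have hc := Y.c_pos k
    obtain ⟨n, hn⟩ : ∃ n, Y.c k = n + 1 := ⟨Y.c k - 1, by omega⟩
    by_cases hk : k = j
    · subst hk
      refine Refl.ext' ?_ ?_
      · rw [reflVal_eps_self_pow, shift_pow_c hv]; rfl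
      · rw [hn, pow_succ', Module.End.mul_apply, reflVal_eps_self]; rfl
    · refine Refl.ext' ?_ ?_
      · rw [hn, pow_succ', Module.End.mul_apply, (reflVal_eps_ne hv j _ hk).1]; rfl
      · rw [reflVal_eps_ne_pow hv j _ hk, hv.nilp]; rfl
  comm a b g := by
    refine LinearMap.ext fun w => ?_
    rw [Module.End.mul_apply, Module.End.mul_apply]
    have hab := Y.ne_of_fin g
    by_cases hb : b = j
    · subst hb
      refine Refl.ext' ?_ ?_
      · rw [(reflVal_α_out hv b _ a g).1, reflVal_eps_ne_pow_fst hv b _ hab _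
          (reflVal_α_out hv b _ a g).1]
      · rw [reflVal_eps_ne_pow hv b _ hab, (reflVal_α_out hv b _ a g).2,
          (reflVal_α_out hv b _ a g).2, reflVal_eps_self_pow, map_zsmul]
        congr 1
        exact (shift_pow_f v b _ (Ar.last a (Fin.cast (Y.g_comm a b) g))).symm
    · by_cases ha : a = j
      · subst ha
        refine Refl.ext' ?_ ?_
        · rw [reflVal_eps_self_pow, (reflVal_α_in hv a _ b g).1, (reflVal_α_in hv a _ b g).1,
            reflVal_eps_ne_pow hv a _ hb, ← hv.comm_apply]
          generalize Y.f b a = n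
          induction n with
          | zero => rfl
          | succ n ih => rw [pow_succ', pow_succ', Module.End.mul_apply, Module.End.mul_apply, ih,
              outMap_eps hv]
        · rw [(reflVal_α_in hv a _ b g).2, reflVal_eps_self_pow_snd _ _ _ _
            (reflVal_α_in hv a _ b g).2]
      · refine Refl.ext' ?_ ?_
        · rw [(reflVal_α_ne hv j _ ha hb g).1, reflVal_eps_ne_pow_fst hv j _ ha _
            (reflVal_α_ne hv j _ ha hb g).1]
        · rw [reflVal_eps_ne_pow hv j _ ha, (reflVal_α_ne hv j _ ha hb g).2,
            (reflVal_α_ne hv j _ ha hb g).2, reflVal_eps_ne_pow hv j _ hb, hv.comm_apply]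
  mesh a := by
    by_cases ha : a = j
    · subst ha; exact reflVal_mesh_self hv a
    · exact reflVal_mesh_ne hv ha

/-- The canonical homomorphism from a representation to its reflection. -/
def toRefl (hv : Satisfies Ω v) (j : ι) : M →ₗ[K] Refl v j := (reflOut hv j).prod (reflPr hv j)

theorem toRefl_fst (hv : Satisfies Ω v) (j : ι) (x : M) :
    ((toRefl hv j x).1 : Ar Y j → M) = outMap Ω v j x := rfl

theorem toRefl_snd (hv : Satisfies Ω v) (j : ι) (x : M) :
    ((toRefl hv j x).2 : M) = x - v (.e j) x := rfl

theorem outMap_of_e (hv : Satisfies Ω v) {j k : ι} (h : k ≠ j) {x : M} (hx : v (.e k) x = x) :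
    outMap Ω v j x = 0 := by
  rw [← outMap_e hv, hv.e_of_e hx, if_neg h.symm, map_zero]

theorem toRefl_comm (hv : Satisfies Ω v) (j : ι) (a : Gen Y) (x : M) :
    toRefl hv j (v a x) = reflVal hv j a (toRefl hv j x) := by
  rcases a with k | k | ⟨a, b, g⟩
  · by_cases hk : k = j
    · subst hk
      rw [reflVal_e_self]
      refine Refl.ext' ?_ ?_
      · rw [toRefl_fst, outMap_e hv]; rfl
      · rw [toRefl_snd, hv.e_e, sub_self]; rfl
    · refine Refl.ext' ?_ ?_
      · rw [toRefl_fst, (reflVal_e_ne hv j _ hk).1, outMap_of_e hv hk (hv.e_e _ _)]; rfl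
      · rw [toRefl_snd, (reflVal_e_ne hv j _ hk).2, toRefl_snd, map_sub, hv.e_e_ne hk,
          hv.e_e_ne (Ne.symm hk)]
  · by_cases hk : k = j
    · subst hk
      rw [reflVal_eps_self]
      refine Refl.ext' ?_ ?_
      · rw [toRefl_fst, outMap_eps hv]; rfl
      · rw [toRefl_snd, hv.e_eps, sub_self]; rfl
    · refine Refl.ext' ?_ ?_
      · rw [toRefl_fst, (reflVal_eps_ne hv j _ hk).1, outMap_of_e hv hk (hv.e_eps _ _)]; rfl
      · rw [toRefl_snd, (reflVal_eps_ne hv j _ hk).2, toRefl_snd, map_sub,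
          hv.eps_of_e (Ne.symm hk) (hv.e_e _ _), hv.e_of_e (hv.e_eps _ _), if_neg (Ne.symm hk)]
  · have hab := Y.ne_of_fin g
    by_cases hb : b = j
    · subst hb
      refine Refl.ext' ?_ ?_
      · rw [toRefl_fst, (reflVal_α_out hv b _ a g).1, outMap_of_e hv hab (hv.e_α _ _ _ _)]; rfl
      · rw [toRefl_snd, (reflVal_α_out hv b _ a g).2, toRefl_fst, outMap_last,
          hv.e_of_e (hv.e_α _ _ _ _), if_neg hab.symm, sub_zero]
        rfl
    · by_cases ha : a = j
      · subst ha
        refine Refl.ext' ?_ ?_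
        · rw [toRefl_fst, (reflVal_α_in hv a _ b g).1, toRefl_snd, map_sub,
            hv.α_of_e hab (hv.e_e _ _), sub_zero]
        · rw [toRefl_snd, (reflVal_α_in hv a _ b g).2, hv.e_α, sub_self]; rfl
      · refine Refl.ext' ?_ ?_
        · rw [toRefl_fst, (reflVal_α_ne hv j _ ha hb g).1, outMap_of_e hv ha (hv.e_α _ _ _ _)]
          rfl
        · rw [toRefl_snd, (reflVal_α_ne hv j _ ha hb g).2, toRefl_snd, map_sub,
            hv.α_of_e (Ne.symm hb) (hv.e_e _ _), hv.e_of_e (hv.e_α _ _ _ _), if_neg (Ne.symm ha)]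

end Reflection

/-! ### Homomorphisms into and out of a locally free representation -/

section Averaging

variable {K : Type*} [Field K] {A B A' B' : Type*} [AddCommGroup A] [Module K A] [AddCommGroup B]
  [Module K B] [AddCommGroup A'] [Module K A'] [AddCommGroup B'] [Module K B']

/-- The averaging operator `f ↦ ∑ σ' ^ a f σ ^ (c - 1 - a)`. -/
def avg (σ' : Module.End K B) (σ : Module.End K A) (c : ℕ) : (A →ₗ[K] B) →ₗ[K] (A →ₗ[K] B) where
  toFun f := ∑ a ∈ Finset.range c, (σ' ^ a) ∘ₗ f ∘ₗ (σ ^ (c - 1 - a))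
  map_add' f g := by
    simp only [LinearMap.add_comp, LinearMap.comp_add, Finset.sum_add_distrib]
  map_smul' k f := by
    simp only [LinearMap.smul_comp, LinearMap.comp_smul, Finset.smul_sum, RingHom.id_apply]

variable {σ' : Module.End K B} {σ : Module.End K A}

theorem avg_apply (c : ℕ) (f : A →ₗ[K] B) (x : A) :
    avg σ' σ c f x = ∑ a ∈ Finset.range c, (σ' ^ a) (f ((σ ^ (c - 1 - a)) x)) := by
  simp [avg]

/-- A telescoping sum. If both `c`-th powers vanish, averaging kills the commutators `σ' f - f σ`,
and together with `comp_avg` and `avg_comp` this shows that averages commute with `σ` and `σ'`. -/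
theorem avg_left_right (c : ℕ) (f : A →ₗ[K] B) :
    avg σ' σ c (σ' ∘ₗ f) + f ∘ₗ σ ^ c = avg σ' σ c (f ∘ₗ σ) + (σ' ^ c) ∘ₗ f := by
  ext x
  simp only [LinearMap.add_apply, avg_apply, LinearMap.comp_apply]
  have h1 : ∀ a ∈ Finset.range c, (σ' ^ a) (σ' (f ((σ ^ (c - 1 - a)) x))) =
      (σ' ^ (a + 1)) (f ((σ ^ (c - (a + 1))) x)) := by
    intro a ha
    rw [pow_succ, Module.End.mul_apply, show c - (a + 1) = c - 1 - a by omega]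
  have h2 : ∀ a ∈ Finset.range c, (σ' ^ a) (f (σ ((σ ^ (c - 1 - a)) x))) =
      (σ' ^ a) (f ((σ ^ (c - a)) x)) := by
    intro a ha
    rw [← Module.End.mul_apply σ, ← pow_succ', show c - 1 - a + 1 = c - a by
      have := Finset.mem_range.1 ha; omega]
  rw [Finset.sum_congr rfl h1, Finset.sum_congr rfl h2]
  have h3 := Finset.sum_range_succ (fun a => (σ' ^ a) (f ((σ ^ (c - a)) x))) c
  have h4 := Finset.sum_range_succ' (fun a => (σ' ^ a) (f ((σ ^ (c - a)) x))) c
  simp only [tsub_self, pow_zero, Module.End.one_apply, tsub_zero] at h3 h4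
  rw [← h3, h4]

theorem comp_avg {c : ℕ} (f : A →ₗ[K] B) :
    σ' ∘ₗ avg σ' σ c f = avg σ' σ c (σ' ∘ₗ f) := by
  ext x
  simp only [avg_apply, LinearMap.comp_apply, map_sum]
  refine Finset.sum_congr rfl fun a _ => ?_
  rw [← Module.End.mul_apply, ← Module.End.mul_apply, ← pow_succ, ← pow_succ']

theorem avg_comp {c : ℕ} (f : A →ₗ[K] B) :
    avg σ' σ c f ∘ₗ σ = avg σ' σ c (f ∘ₗ σ) := by
  ext x
  simp only [avg_apply, LinearMap.comp_apply]
  refine Finset.sum_congr rfl fun a _ => ?_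
  rw [← Module.End.mul_apply (σ ^ _), ← Module.End.mul_apply σ, ← pow_succ, ← pow_succ']

theorem pow_comp_of_comm {τ : Module.End K A'} {τ' : Module.End K A} {α : A' →ₗ[K] A}
    (h : τ' ∘ₗ α = α ∘ₗ τ) (n : ℕ) (x : A') : (τ' ^ n) (α x) = α ((τ ^ n) x) := by
  induction n with
  | zero => rfl
  | succ n ih =>
    rw [pow_succ', pow_succ', Module.End.mul_apply, Module.End.mul_apply, ih]
    exact congrArg (fun f => f ((τ ^ n) x)) h

theorem avg_comp_of_comm {τ : Module.End K A'} {α : A' →ₗ[K] A} (h : σ ∘ₗ α = α ∘ₗ τ) (c : ℕ)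
    (f : A →ₗ[K] B) : avg σ' σ c f ∘ₗ α = avg σ' τ c (f ∘ₗ α) := by
  ext x
  simp only [avg_apply, LinearMap.comp_apply, pow_comp_of_comm h]

theorem comp_avg_of_comm {τ : Module.End K B'} {α : B →ₗ[K] B'} (h : τ ∘ₗ α = α ∘ₗ σ') (c : ℕ)
    (f : A →ₗ[K] B) : α ∘ₗ avg σ' σ c f = avg τ σ c (α ∘ₗ f) := by
  ext x
  simp only [avg_apply, LinearMap.comp_apply, map_sum, pow_comp_of_comm h]

theorem sum_range_mul_eq {N : Type*} [AddCommMonoid N] (F q : ℕ) (G : ℕ → N) :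
    ∑ m ∈ Finset.range (F * q), G m = ∑ a ∈ Finset.range q, ∑ f ∈ Finset.range F, G (f + F * a) := by
  induction q with
  | zero => simp
  | succ q ih =>
    rw [mul_add, mul_one, Finset.sum_range_succ, ← ih]
    rw [Finset.sum_range_add]
    simp only [add_comm]

/-- Division with remainder in the exponents. With `c i = f j i * q`, the average over `H_i` splits
into the average over `q` that makes an arrow deformation equivariant and the average over `f j i`
that occurs in the mesh relation. -/
theorem avg_avg (F q : ℕ) (f : A →ₗ[K] B) :
    avg σ' σ F (avg (σ' ^ F) (σ ^ F) q f) = avg σ' σ (F * q) f := by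
  ext x
  rw [avg_apply, avg_apply, sum_range_mul_eq, Finset.sum_comm]
  refine Finset.sum_congr rfl fun b hb => ?_
  rw [avg_apply, map_sum]
  refine Finset.sum_congr rfl fun a ha => ?_
  have ha := Finset.mem_range.1 ha
  have hb := Finset.mem_range.1 hb
  rw [← pow_mul, ← pow_mul, ← Module.End.mul_apply, ← Module.End.mul_apply, ← pow_add, ← pow_add]
  congr 4
  obtain ⟨q', rfl⟩ : ∃ q', q = a + 1 + q' := ⟨q - (a + 1), by omega⟩
  rw [show a + 1 + q' - 1 - a = q' by omega, mul_add, mul_add, mul_one]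
  omega

end Averaging

/-! ### Trace duality between `Hom(A, B)` and `Hom(B, A)`. -/

section TraceForm

variable {K : Type*} [Field K] {A B : Type*} [AddCommGroup A] [Module K A] [FiniteDimensional K A]
  [AddCommGroup B] [Module K B] [FiniteDimensional K B]

/-- The trace pairing between `Hom(B, A)` and `Hom(A, B)`. -/
def tracePairing (K A B : Type*) [Field K] [AddCommGroup A] [Module K A] [AddCommGroup B]
    [Module K B] : (B →ₗ[K] A) →ₗ[K] Module.Dual K (A →ₗ[K] B) :=
  LinearMap.mk₂ K (fun G f => LinearMap.trace K A (G ∘ₗ f))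
    (fun _ _ _ => by rw [LinearMap.add_comp, map_add])
    (fun _ _ _ => by rw [LinearMap.smul_comp, map_smul])
    (fun _ _ _ => by rw [LinearMap.comp_add, map_add])
    (fun _ _ _ => by rw [LinearMap.comp_smul, map_smul])

theorem tracePairing_apply (G : B →ₗ[K] A) (f : A →ₗ[K] B) :
    tracePairing K A B G f = LinearMap.trace K A (G ∘ₗ f) := rfl

/-- Rank-one maps `x ↦ φ x • b` already detect `G`, because the trace pairing with them is `φ (G
b)`. -/
theorem tracePairing_injective : Function.Injective (tracePairing K A B) := by
  rw [← LinearMap.ker_eq_bot, LinearMap.ker_eq_bot']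
  intro G hG
  ext b
  rw [LinearMap.zero_apply]
  by_contra hne
  have : ∃ φ : Module.Dual K A, φ (G b) ≠ 0 := by
    by_contra h
    push Not at h
    exact hne ((Module.forall_dual_apply_eq_zero_iff K _).1 h)
  obtain ⟨φ, hφ⟩ := this
  have h := congrArg (fun ψ => ψ (φ.smulRight b)) hG
  simp only [tracePairing_apply, LinearMap.zero_apply] at h
  rw [show G ∘ₗ φ.smulRight b = φ.smulRight (G b) by ext x; simp] at h
  rw [LinearMap.trace_smulRight] at h
  exact hφ h

/-- The maps `B → A` orthogonal to `S` under the trace pairing. -/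
def traceOrtho (S : Submodule K (A →ₗ[K] B)) : Submodule K (B →ₗ[K] A) :=
  S.dualAnnihilator.comap (tracePairing K A B)

theorem mem_traceOrtho {S : Submodule K (A →ₗ[K] B)} {G : B →ₗ[K] A} :
    G ∈ traceOrtho S ↔ ∀ f ∈ S, LinearMap.trace K A (G ∘ₗ f) = 0 := by
  rw [traceOrtho, Submodule.mem_comap, Submodule.mem_dualAnnihilator]
  rfl

theorem finrank_traceOrtho (S : Submodule K (A →ₗ[K] B)) :
    Module.finrank K S + Module.finrank K (traceOrtho S) = Module.finrank K (A →ₗ[K] B) := by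
  have hd : Module.finrank K (B →ₗ[K] A) = Module.finrank K (Module.Dual K (A →ₗ[K] B)) := by
    rw [Subspace.dual_finrank_eq, Module.finrank_linearMap, Module.finrank_linearMap, mul_comm]
  let e : (B →ₗ[K] A) ≃ₗ[K] Module.Dual K (A →ₗ[K] B) :=
    LinearEquiv.ofInjectiveOfFinrankEq (tracePairing K A B) tracePairing_injective hd
  have h1 : traceOrtho S = S.dualAnnihilator.comap (e : (B →ₗ[K] A) →ₗ[K] _) := rfl
  rw [h1, (e.submoduleMap _ ).finrank_eq, Submodule.map_comap_eq_of_surjective e.surjective]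
  exact Subspace.finrank_add_finrank_dualAnnihilator_eq S

/-- `G` commutes with an endomorphism if it is orthogonal to the commutators with it. -/
theorem comp_eq_comp_of_ortho {G : B →ₗ[K] A} {σ : Module.End K A} {σ' : Module.End K B}
    (h : ∀ f : A →ₗ[K] B, LinearMap.trace K A (G ∘ₗ (f ∘ₗ σ - σ' ∘ₗ f)) = 0) :
    σ ∘ₗ G = G ∘ₗ σ' := by
  apply tracePairing_injective
  ext f
  have := h f
  rw [LinearMap.comp_sub, map_sub, sub_eq_zero] at this
  rw [tracePairing_apply, tracePairing_apply, LinearMap.comp_assoc, LinearMap.comp_assoc, ← this,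
    ← LinearMap.comp_assoc]
  exact LinearMap.trace_mul_comm K σ (G ∘ₗ f)

end TraceForm

/-! ### The complex computing homomorphisms, and the Euler form inequality. -/

section Complex

variable {K : Type*} [Field K] {ι : Type} [Fintype ι] [DecidableEq ι] {Y : SymmGCM ι}
  {Ω : Orientation Y} {A : Type*} [AddCommGroup A] [Module K A] {B : Type*} [AddCommGroup B]
  [Module K B]

/-- The homomorphisms between two representations. -/
def homRep (v : Gen Y → Module.End K A) (w : Gen Y → Module.End K B) :
    Submodule K (A →ₗ[K] B) where
  carrier := {f | ∀ x, w x ∘ₗ f = f ∘ₗ v x}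
  add_mem' hf hg x := by rw [LinearMap.add_comp, LinearMap.comp_add, hf, hg]
  zero_mem' x := by simp
  smul_mem' k f hf x := by rw [LinearMap.smul_comp, LinearMap.comp_smul, hf]

/-- The maps that commute with all `e j` and `ε j`. -/
def homLoop (v : Gen Y → Module.End K A) (w : Gen Y → Module.End K B) :
    Submodule K (A →ₗ[K] B) where
  carrier := {f | ∀ j, w (.e j) ∘ₗ f = f ∘ₗ v (.e j) ∧ w (.ε j) ∘ₗ f = f ∘ₗ v (.ε j)}
  add_mem' hf hg x := by
    simp only [LinearMap.add_comp, LinearMap.comp_add, (hf x).1, (hg x).1, (hf x).2, (hg x).2,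
      and_self]
  zero_mem' x := by simp
  smul_mem' k f hf x := by
    simp only [LinearMap.smul_comp, LinearMap.comp_smul, (hf x).1, (hf x).2, and_self]

/-- The arrows of the double quiver other than loops; `⟨(i, j), g⟩` is the arrow `α i j g`. -/
abbrev Arr (Y : SymmGCM ι) : Type := Σ p : ι × ι, Fin (Y.g p.1 p.2)

namespace Arr

/-- The generator of an arrow. -/
abbrev gen (r : Arr Y) : Gen Y := .α r.1.1 r.1.2 r.2

/-- The opposite arrow. -/
def star (r : Arr Y) : Arr Y := ⟨(r.1.2, r.1.1), Fin.cast (Y.g_comm _ _) r.2⟩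

@[simp]
theorem star_star (r : Arr Y) : r.star.star = r := rfl

theorem star_eq_iff {r s : Arr Y} : r.star = s ↔ r = s.star :=
  ⟨fun h => by rw [← h, star_star], fun h => by rw [h, star_star]⟩

/-- The factor `q` with `c i = f j i * q` and `c j = f i j * q` for the arrow `j → i`. -/
def q (r : Arr Y) : ℕ := (Y.exists_quot (Y.neg_of_fin r.2)).choose

theorem one_le_q (r : Arr Y) : 1 ≤ r.q := (Y.exists_quot (Y.neg_of_fin r.2)).choose_spec.1

theorem c_fst (r : Arr Y) : Y.c r.1.1 = Y.f r.1.2 r.1.1 * r.q :=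
  (Y.exists_quot (Y.neg_of_fin r.2)).choose_spec.2.1

theorem c_snd (r : Arr Y) : Y.c r.1.2 = Y.f r.1.1 r.1.2 * r.q :=
  (Y.exists_quot (Y.neg_of_fin r.2)).choose_spec.2.2

theorem f_fst_pos (r : Arr Y) : 1 ≤ Y.f r.1.1 r.1.2 := Y.f_pos (Y.neg_of_fin r.2)

theorem f_snd_pos (r : Arr Y) : 1 ≤ Y.f r.1.2 r.1.1 :=
  Y.f_pos ((Y.neg_iff _ _).1 (Y.neg_of_fin r.2))

end Arr

theorem NilpOn.pow {p ε : Module.End K A} {c m q : ℕ} (h : NilpOn p ε c) (hm : 1 ≤ m)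
    (hq : 1 ≤ q) (hc : c = m * q) : NilpOn p (ε ^ m) q where
  idem := h.idem
  left := by
    obtain ⟨m, rfl⟩ : ∃ k, m = k + 1 := ⟨m - 1, by omega⟩
    rw [pow_succ', ← mul_assoc, h.left]
  right := by
    obtain ⟨m, rfl⟩ : ∃ k, m = k + 1 := ⟨m - 1, by omega⟩
    rw [pow_succ, mul_assoc, h.right]
  nil := by rw [← pow_mul, ← hc, h.nil]
  pos := hq

/-- Arrows are only linear over the subalgebras generated by `ε ^ m`, and `K[ε]/(ε ^ c)` is free
over such a subalgebra when `m` divides `c`. -/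
theorem FreeOn.pow {p ε : Module.End K A} {c m q : ℕ} (hF : FreeOn p ε c) (h : NilpOn p ε c)
    (hq : 1 ≤ q) (hc : c = m * q) : FreeOn p (ε ^ m) q := by
  intro x hx h0
  obtain ⟨y, hy, hyx⟩ := h.eps_injOn_of_pow hF m
    (by rw [hc]; exact Nat.le_mul_of_pos_right m hq) x hx h0
  refine ⟨y, hy, ?_⟩
  rw [← pow_mul, Nat.mul_sub, ← hc, mul_one, hyx]

variable {v : Gen Y → Module.End K A} {w : Gen Y → Module.End K B}

/-- The deformations of the arrows compatible with the relations `comm`. -/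
def homArr (v : Gen Y → Module.End K A) (w : Gen Y → Module.End K B) :
    Submodule K (Arr Y → A →ₗ[K] B) :=
  Submodule.pi Set.univ fun r => NilpOn.homOn (v (.e r.1.2)) (v (.ε r.1.2) ^ Y.f r.1.1 r.1.2)
    (w (.e r.1.1)) (w (.ε r.1.1) ^ Y.f r.1.2 r.1.1)

theorem finrank_pi_submodule {κ : Type*} [Fintype κ] {E : Type*} [AddCommGroup E] [Module K E]
    [FiniteDimensional K E] (S : κ → Submodule K E) :
    Module.finrank K (Submodule.pi Set.univ S) = ∑ k, Module.finrank K (S k) := by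
  rw [← Module.finrank_pi_fintype]
  exact LinearEquiv.finrank_eq
    { toFun := fun f k => ⟨f.1 k, f.2 k trivial⟩
      map_add' := fun _ _ => rfl
      map_smul' := fun _ _ => rfl
      invFun := fun f => ⟨fun k => f k, fun k _ => (f k).2⟩
      left_inv := fun _ => rfl
      right_inv := fun _ => rfl }

theorem homLoop_apply_e {f : A →ₗ[K] B} (hf : f ∈ homLoop v w) (j : ι) (x : A) :
    w (.e j) (f x) = f (v (.e j) x) := congrArg (fun g => g x) (hf j).1

theorem homLoop_apply_eps {f : A →ₗ[K] B} (hf : f ∈ homLoop v w) (j : ι) (x : A) :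
    w (.ε j) (f x) = f (v (.ε j) x) := congrArg (fun g => g x) (hf j).2

theorem NilpOn.homOn_apply {p σ : Module.End K A} {p' σ' : Module.End K B} {f : A →ₗ[K] B}
    (hf : f ∈ NilpOn.homOn p σ p' σ') (x : A) : p' (f (p x)) = f x ∧ σ' (f x) = f (σ x) :=
  ⟨congrArg (fun g => g x) hf.1, congrArg (fun g => g x) hf.2⟩

theorem finrank_homLoop [FiniteDimensional K A] [FiniteDimensional K B] (hv : Satisfies Ω v)
    (hw : Satisfies Ω w)
    (hF : ∀ k, FreeOn (v (.e k)) (v (.ε k)) (Y.c k)) {ν : ι → ℕ}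
    (hν : ∀ k, Module.finrank K (LinearMap.range (v (.e k))) = ν k * Y.c k) :
    Module.finrank K (homLoop v w) =
      ∑ k, ν k * Module.finrank K (LinearMap.range (w (.e k))) := by
  have h1 : Module.finrank K (homLoop v w) = Module.finrank K (Submodule.pi Set.univ fun k =>
      NilpOn.homOn (v (.e k)) (v (.ε k)) (w (.e k)) (w (.ε k))) := by
    refine LinearEquiv.finrank_eq
      { toFun := fun f => ⟨fun k => w (.e k) ∘ₗ f.1 ∘ₗ v (.e k), fun k _ => ⟨?_, ?_⟩⟩
        map_add' := fun f g => ?_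
        map_smul' := fun a f => ?_
        invFun := fun f => ⟨∑ k, f.1 k, fun j => ⟨?_, ?_⟩⟩
        left_inv := fun f => ?_
        right_inv := fun f => ?_ }
    · ext x
      simp [hv.e_e, hw.e_e]
    · ext x
      have h1 := homLoop_apply_eps f.2 k (v (.e k) x)
      simp only [LinearMap.comp_apply, hw.eps_e, h1, hv.eps_e, hv.e_eps]
      rw [homLoop_apply_e f.2, hv.e_eps]
    · apply Subtype.ext
      funext k
      ext x
      simp
    · apply Subtype.ext
      funext k
      ext x
      simp
    · ext x
      simp only [LinearMap.comp_apply, LinearMap.sum_apply, map_sum]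
      refine Finset.sum_congr rfl fun k _ => ?_
      rw [← (NilpOn.homOn_apply (f.2 k trivial) x).1,
        ← (NilpOn.homOn_apply (f.2 k trivial) (v (.e j) x)).1]
      by_cases h : j = k
      · subst h; rw [hw.e_e, hv.e_e]
      · rw [hw.e_e_ne h, hv.e_e_ne (Ne.symm h), map_zero, map_zero]
    · ext x
      simp only [LinearMap.comp_apply, LinearMap.sum_apply, map_sum]
      refine Finset.sum_congr rfl fun k _ => ?_
      by_cases h : j = k
      · subst h; exact (NilpOn.homOn_apply (f.2 j trivial) x).2
      · rw [← (NilpOn.homOn_apply (f.2 k trivial) x).1,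
          ← (NilpOn.homOn_apply (f.2 k trivial) (v (.ε j) x)).1, ← hw.eps_e, hw.e_e_ne h,
          ← hv.e_eps, hv.e_e_ne (Ne.symm h), map_zero, map_zero, map_zero]
    · apply Subtype.ext
      ext x
      simp only [LinearMap.comp_apply, LinearMap.sum_apply, homLoop_apply_e f.2, hv.e_e]
      rw [← map_sum, hv.sum_e]
    · apply Subtype.ext
      funext k
      ext x
      simp only [LinearMap.comp_apply, LinearMap.sum_apply, map_sum]
      rw [Finset.sum_eq_single k]
      · exact (NilpOn.homOn_apply (f.2 k trivial) x).1
      · intro b _ hb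
        rw [← (NilpOn.homOn_apply (f.2 b trivial) (v (.e k) x)).1, hw.e_e_ne hb.symm]
      · simp
  rw [h1, finrank_pi_submodule]
  exact Finset.sum_congr rfl fun k _ => (hv.nilpOn k).finrank_homOn (hF k) (hw.nilpOn k) (hν k)

/-- For an arrow `k → j` the space at `k` is free of rank `f j k * ν k` over the subalgebra
generated by `ε_k ^ f j k`, so its equivariant maps can be counted by `finrank_homOn`. -/
theorem finrank_homArr [FiniteDimensional K A] [FiniteDimensional K B] (hv : Satisfies Ω v)
    (hw : Satisfies Ω w)
    (hF : ∀ k, FreeOn (v (.e k)) (v (.ε k)) (Y.c k)) {ν : ι → ℕ}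
    (hν : ∀ k, Module.finrank K (LinearMap.range (v (.e k))) = ν k * Y.c k) :
    Module.finrank K (homArr v w) =
      ∑ j, ∑ k, Y.g j k * (Y.f j k * ν k) * Module.finrank K (LinearMap.range (w (.e j))) := by
  rw [homArr, finrank_pi_submodule, Fintype.sum_sigma, Fintype.sum_prod_type]
  refine Finset.sum_congr rfl fun j _ => Finset.sum_congr rfl fun k _ => ?_
  have : ∀ g : Fin (Y.g j k), Module.finrank K (NilpOn.homOn (v (.e k)) (v (.ε k) ^ Y.f j k)
      (w (.e j)) (w (.ε j) ^ Y.f k j)) =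
      (Y.f j k * ν k) * Module.finrank K (LinearMap.range (w (.e j))) := by
    intro g
    let r : Arr Y := ⟨(j, k), g⟩
    refine ((hv.nilpOn k).pow r.f_fst_pos r.one_le_q r.c_snd).finrank_homOn
      ((hF k).pow (hv.nilpOn k) r.one_le_q r.c_snd)
      ((hw.nilpOn j).pow r.f_snd_pos r.one_le_q r.c_fst) ?_
    rw [hν, r.c_snd]
    change ν k * (Y.f j k * r.q) = _
    ring
  rw [Finset.sum_congr rfl fun g _ => this g]
  simp [mul_assoc]

/-- The commutators with the arrows. -/
def arrComm (v : Gen Y → Module.End K A) (w : Gen Y → Module.End K B) :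
    (A →ₗ[K] B) →ₗ[K] (Arr Y → A →ₗ[K] B) where
  toFun f r := w r.gen ∘ₗ f - f ∘ₗ v r.gen
  map_add' f g := by
    funext r
    simp only [LinearMap.comp_add, LinearMap.add_comp, Pi.add_apply]
    abel
  map_smul' a f := by
    funext r
    simp only [LinearMap.comp_smul, LinearMap.smul_comp, Pi.smul_apply, smul_sub,
      RingHom.id_apply]

/-- The linearized mesh relations. -/
def meshLin (Ω : Orientation Y) (v : Gen Y → Module.End K A) (w : Gen Y → Module.End K B) :
    (Arr Y → A →ₗ[K] B) →ₗ[K] (A →ₗ[K] B) where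
  toFun b := ∑ r : Arr Y, Ω.sgn r.1.1 r.1.2 • avg (w (.ε r.1.1)) (v (.ε r.1.1)) (Y.f r.1.2 r.1.1)
    (b r ∘ₗ v r.star.gen + w r.gen ∘ₗ b r.star)
  map_add' b b' := by
    rw [← Finset.sum_add_distrib]
    refine Finset.sum_congr rfl fun r _ => ?_
    rw [← smul_add, ← map_add]
    congr 2
    simp only [Pi.add_apply, LinearMap.add_comp, LinearMap.comp_add]
    abel
  map_smul' a b := by
    rw [RingHom.id_apply, Finset.smul_sum]
    refine Finset.sum_congr rfl fun r _ => ?_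
    rw [smul_comm a]
    congr 1
    refine Eq.trans ?_ (map_smul _ a _)
    congr 1
    simp only [Pi.smul_apply, LinearMap.smul_comp, LinearMap.comp_smul, smul_add]

theorem sum_mesh (Ω : Orientation Y) (v : Gen Y → Module.End K A) :
    ∑ j, mesh Ω v j = ∑ r : Arr Y, Ω.sgn r.1.1 r.1.2 •
      avg (v (.ε r.1.1)) (v (.ε r.1.1)) (Y.f r.1.2 r.1.1) (v r.gen ∘ₗ v r.star.gen) := by
  rw [Fintype.sum_sigma, Fintype.sum_prod_type]
  refine Finset.sum_congr rfl fun j _ => ?_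
  rw [mesh]
  refine Finset.sum_congr rfl fun k _ => Finset.sum_congr rfl fun g _ => ?_
  rw [← Finset.smul_sum]
  congr 1

/-- Linearizing the mesh along an infinitesimal change of basis `f` gives the commutator of `f` with
the meshes of `v` and `w`, which are zero. Compatibility of `f` with the loops moves it through the
averages. -/
theorem meshLin_arrComm (hv : Satisfies Ω v) (hw : Satisfies Ω w) {f : A →ₗ[K] B}
    (hf : f ∈ homLoop v w) : meshLin Ω v w (arrComm v w f) = 0 := by
  have h1 : ∀ r : Arr Y, arrComm v w f r ∘ₗ v r.star.gen + w r.gen ∘ₗ arrComm v w f r.star =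
      (w r.gen ∘ₗ w r.star.gen) ∘ₗ f - f ∘ₗ (v r.gen ∘ₗ v r.star.gen) := by
    intro r
    simp only [arrComm, LinearMap.coe_mk, AddHom.coe_mk, LinearMap.sub_comp, LinearMap.comp_sub,
      LinearMap.comp_assoc]
    abel
  have h2 : meshLin Ω v w (arrComm v w f) =
      (∑ j, mesh Ω w j) ∘ₗ f - f ∘ₗ (∑ j, mesh Ω v j) := by
    rw [sum_mesh, sum_mesh]
    simp only [meshLin, LinearMap.coe_mk, AddHom.coe_mk, h1]
    ext x
    simp only [LinearMap.sub_apply, LinearMap.comp_apply, LinearMap.sum_apply,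
      LinearMap.smul_apply, map_sum, map_zsmul]
    rw [← Finset.sum_sub_distrib]
    refine Finset.sum_congr rfl fun r _ => ?_
    rw [map_sub, ← avg_comp_of_comm (hf r.1.1).2, ← comp_avg_of_comm (α := f) (hf r.1.1).2, ← smul_sub]
    rfl
  rw [h2]
  simp [hv.mesh, hw.mesh]

theorem arrComm_mem (hv : Satisfies Ω v) (hw : Satisfies Ω w) {f : A →ₗ[K] B}
    (hf : f ∈ homLoop v w) : arrComm v w f ∈ homArr v w := by
  intro r _
  refine ⟨?_, ?_⟩
  · ext x
    simp only [arrComm, LinearMap.coe_mk, AddHom.coe_mk, LinearMap.comp_apply,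
      LinearMap.sub_apply, map_sub]
    rw [hw.e_α, hv.α_e, ← homLoop_apply_e hf, hw.α_e, homLoop_apply_e hf, hv.e_α]
  · ext x
    simp only [arrComm, LinearMap.coe_mk, AddHom.coe_mk, LinearMap.comp_apply,
      LinearMap.sub_apply, map_sub]
    rw [hw.comm_apply, pow_comp_of_comm (hf _).2, pow_comp_of_comm (hf _).2, hv.comm_apply]

/-- The averaging operator onto the maps that commute with all `e j` and `ε j`. -/
def avgLoop (v : Gen Y → Module.End K A) (w : Gen Y → Module.End K B) :
    (A →ₗ[K] B) →ₗ[K] (A →ₗ[K] B) where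
  toFun f := ∑ j, avg (w (.ε j)) (v (.ε j)) (Y.c j) (w (.e j) ∘ₗ f ∘ₗ v (.e j))
  map_add' f g := by
    simp only [LinearMap.add_comp, LinearMap.comp_add, map_add, Finset.sum_add_distrib]
  map_smul' a f := by
    simp only [LinearMap.smul_comp, LinearMap.comp_smul, map_smul, Finset.smul_sum,
      RingHom.id_apply]

theorem avgLoop_apply (f : A →ₗ[K] B) : avgLoop v w f =
    ∑ j, avg (w (.ε j)) (v (.ε j)) (Y.c j) (w (.e j) ∘ₗ f ∘ₗ v (.e j)) := rfl

/-- By `exists_averaging` the identity of each `M_k` is an average of some `s k`; composing with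
`f`, which commutes with the loops, exhibits `f` itself as an average. -/
theorem homLoop_le_range [FiniteDimensional K A] (hv : Satisfies Ω v)
    (hF : ∀ k, FreeOn (v (.e k)) (v (.ε k)) (Y.c k)) :
    homLoop v w ≤ LinearMap.range (avgLoop v w) := by
  intro f hf
  choose s hs using fun k => (hv.nilpOn k).exists_averaging (hF k)
  refine ⟨f ∘ₗ ∑ k, v (.e k) * s k * v (.e k), ?_⟩
  rw [avgLoop_apply]
  have h1 : ∀ j, w (.e j) ∘ₗ (f ∘ₗ ∑ k, v (.e k) * s k * v (.e k)) ∘ₗ v (.e j) =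
      f ∘ₗ (v (.e j) * s j * v (.e j)) := by
    intro j
    ext x
    simp only [LinearMap.comp_apply, LinearMap.sum_apply, Module.End.mul_apply, map_sum,
      homLoop_apply_e hf]
    rw [Finset.sum_eq_single j]
    · rw [hv.e_e, hv.e_e]
    · intro k _ hk
      rw [hv.e_e_ne hk.symm, map_zero]
    · simp
  have h2 : ∀ j, avg (w (.ε j)) (v (.ε j)) (Y.c j) (f ∘ₗ (v (.e j) * s j * v (.e j))) =
      f ∘ₗ v (.e j) := by
    intro j
    rw [← comp_avg_of_comm (hf j).2]
    congr 1
    refine Eq.trans (LinearMap.ext fun x => ?_) (hs j)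
    rw [avg_apply, LinearMap.sum_apply]
    rfl
  simp only [h1, h2]
  ext x
  simp only [LinearMap.sum_apply, LinearMap.comp_apply]
  rw [← map_sum, hv.sum_e]

/-- Commutators with the idempotents and, by `avgLoop_comm_eps`, with the loops lie in the kernel of
`avgLoop`, hence in the preimage of every subspace. A map trace-orthogonal to such a preimage
therefore commutes with `e_k` and `ε_k`. -/
theorem avgLoop_comm_e (hv : Satisfies Ω v) (hw : Satisfies Ω w) (f : A →ₗ[K] B) (k : ι) :
    avgLoop v w (f ∘ₗ v (.e k) - w (.e k) ∘ₗ f) = 0 := by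
  rw [avgLoop_apply]
  refine Finset.sum_eq_zero fun j _ => ?_
  have : w (.e j) ∘ₗ (f ∘ₗ v (.e k) - w (.e k) ∘ₗ f) ∘ₗ v (.e j) = 0 := by
    ext x
    simp only [LinearMap.comp_apply, LinearMap.sub_apply, map_sub, LinearMap.zero_apply]
    by_cases h : j = k
    · subst h; rw [hv.e_e, hw.e_e, sub_self]
    · rw [hv.e_e_ne (Ne.symm h), hw.e_e_ne h]; simp
  rw [this, map_zero]

theorem avgLoop_comm_eps (hv : Satisfies Ω v) (hw : Satisfies Ω w) (f : A →ₗ[K] B) (k : ι) :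
    avgLoop v w (f ∘ₗ v (.ε k) - w (.ε k) ∘ₗ f) = 0 := by
  rw [avgLoop_apply]
  refine Finset.sum_eq_zero fun j _ => ?_
  by_cases h : j = k
  · subst h
    have h1 := avg_left_right (σ' := w (.ε j)) (σ := v (.ε j)) (Y.c j)
      (w (.e j) ∘ₗ f ∘ₗ v (.e j))
    rw [hv.nilp, hw.nilp, LinearMap.comp_zero, LinearMap.zero_comp, add_zero, add_zero] at h1
    have h2 : w (.e j) ∘ₗ (f ∘ₗ v (.ε j) - w (.ε j) ∘ₗ f) ∘ₗ v (.e j) =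
        (w (.e j) ∘ₗ f ∘ₗ v (.e j)) ∘ₗ v (.ε j) - w (.ε j) ∘ₗ w (.e j) ∘ₗ f ∘ₗ v (.e j) := by
      ext x
      simp only [LinearMap.comp_apply, LinearMap.sub_apply, map_sub, hv.eps_e, hv.e_eps,
        hw.eps_e, hw.e_eps]
    rw [h2, map_sub, h1, sub_self]
  · have : w (.e j) ∘ₗ (f ∘ₗ v (.ε k) - w (.ε k) ∘ₗ f) ∘ₗ v (.e j) = 0 := by
      ext x
      simp only [LinearMap.comp_apply, LinearMap.sub_apply, map_sub, LinearMap.zero_apply]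
      rw [hv.eps_of_e h (hv.e_e _ _), ← hw.e_eps k, hw.e_e_ne h]
      simp
    rw [this, map_zero]

/-- Averaging the components of an arbitrary `b` over `q` puts it into `homArr`, and `avg_avg`
identifies its linearized mesh with the full average of the plain quadratic expression. Arbitrary
`b` may thus be used as test elements for the image of `meshLin`. -/
theorem avgLoop_arrow (hv : Satisfies Ω v) (hw : Satisfies Ω w) (b : Arr Y → A →ₗ[K] B) :
    ∃ b' ∈ homArr v w, meshLin Ω v w b' = avgLoop v w (∑ r : Arr Y, Ω.sgn r.1.1 r.1.2 •
      (w (.e r.1.1) ∘ₗ b r ∘ₗ v r.star.gen + w r.gen ∘ₗ b r.star ∘ₗ v (.e r.1.1))) := by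
  have hcv : ∀ r : Arr Y, (v (.ε r.1.2) ^ Y.f r.1.1 r.1.2) ∘ₗ v r.star.gen =
      v r.star.gen ∘ₗ v (.ε r.1.1) ^ Y.f r.1.2 r.1.1 := fun r => hv.comm r.1.2 r.1.1 r.star.2
  have hcw : ∀ r : Arr Y, (w (.ε r.1.1) ^ Y.f r.1.2 r.1.1) ∘ₗ w r.gen =
      w r.gen ∘ₗ w (.ε r.1.2) ^ Y.f r.1.1 r.1.2 := fun r => hw.comm r.1.1 r.1.2 r.2
  refine ⟨fun r => avg (w (.ε r.1.1) ^ Y.f r.1.2 r.1.1) (v (.ε r.1.2) ^ Y.f r.1.1 r.1.2) r.q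
    (w (.e r.1.1) ∘ₗ b r ∘ₗ v (.e r.1.2)), ?_, ?_⟩
  · intro r _
    have nv := (hv.nilpOn r.1.2).pow r.f_fst_pos r.one_le_q r.c_snd
    have nw := (hw.nilpOn r.1.1).pow r.f_snd_pos r.one_le_q r.c_fst
    refine ⟨?_, ?_⟩
    · rw [← LinearMap.comp_assoc, comp_avg_of_comm (α := w (.e r.1.1)) (nw.right.trans nw.left.symm),
        avg_comp_of_comm (α := v (.e r.1.2)) (nv.right.trans nv.left.symm)]
      congr 1
      ext x
      simp [hv.e_e, hw.e_e]
    · have h1 := avg_left_right (σ' := w (.ε r.1.1) ^ Y.f r.1.2 r.1.1)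
        (σ := v (.ε r.1.2) ^ Y.f r.1.1 r.1.2) r.q (w (.e r.1.1) ∘ₗ b r ∘ₗ v (.e r.1.2))
      rw [nv.nil, nw.nil, LinearMap.comp_zero, LinearMap.zero_comp, add_zero, add_zero] at h1
      rw [comp_avg, avg_comp, h1]
  · have key : ∀ r : Arr Y, avgLoop v w
        (w (.e r.1.1) ∘ₗ b r ∘ₗ v r.star.gen + w r.gen ∘ₗ b r.star ∘ₗ v (.e r.1.1)) =
        avg (w (.ε r.1.1)) (v (.ε r.1.1)) (Y.c r.1.1)
          (w (.e r.1.1) ∘ₗ b r ∘ₗ v r.star.gen + w r.gen ∘ₗ b r.star ∘ₗ v (.e r.1.1)) := by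
      intro r
      rw [avgLoop_apply, Finset.sum_eq_single r.1.1]
      · congr 1
        ext x
        simp only [LinearMap.comp_apply, LinearMap.add_apply, map_add, hw.e_e, hw.e_α, hv.e_e]
        rw [show v r.star.gen (v (.e r.1.1) x) = v r.star.gen x from hv.α_e _ _ _ _]
      · intro j _ hj
        have : w (.e j) ∘ₗ (w (.e r.1.1) ∘ₗ b r ∘ₗ v r.star.gen +
            w r.gen ∘ₗ b r.star ∘ₗ v (.e r.1.1)) ∘ₗ v (.e j) = 0 := by
          ext x
          simp only [LinearMap.comp_apply, LinearMap.add_apply, hw.e_e_ne hj,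
            hv.e_e_ne hj.symm, map_zero, add_zero, LinearMap.zero_apply]
        rw [this, map_zero]
      · simp
    rw [map_sum]
    refine Finset.sum_congr rfl fun r _ => ?_
    rw [map_zsmul, key, r.c_fst, ← avg_avg]
    congr 2
    rw [avg_comp_of_comm (hcv r), map_add]
    congr 1
    · congr 1
      ext x
      simp only [LinearMap.comp_apply]
      rw [show r.1.2 = r.star.1.1 from rfl, hv.e_α]
    · have hq : r.star.q = r.q := by
        have h1 := r.c_fst
        have h2 := r.star.c_snd
        have h3 := r.f_snd_pos
        change Y.c r.1.1 = Y.f r.1.2 r.1.1 * r.star.q at h2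
        exact Nat.eq_of_mul_eq_mul_left h3 (h2.symm.trans h1)
      change w r.gen ∘ₗ avg (w (.ε r.1.2) ^ Y.f r.1.1 r.1.2) (v (.ε r.1.1) ^ Y.f r.1.2 r.1.1)
        r.star.q (w (.e r.1.2) ∘ₗ b r.star ∘ₗ v (.e r.1.1)) = _
      rw [hq, comp_avg_of_comm (hcw r)]
      congr 1
      ext x
      simp only [LinearMap.comp_apply]
      rw [hw.α_e]

/-- The cokernel of the linearized mesh is controlled by homomorphisms in the opposite direction:
trace-orthogonality to averaged commutators and to mesh images amounts to commuting with loops and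
arrows. -/
theorem mem_homRep_of_ortho [FiniteDimensional K A] [FiniteDimensional K B]
    (hv : Satisfies Ω v) (hw : Satisfies Ω w) {G : B →ₗ[K] A}
    (hG : G ∈ traceOrtho (((homArr v w).map (meshLin Ω v w)).comap (avgLoop v w))) :
    G ∈ homRep w v := by
  rw [mem_traceOrtho] at hG
  have he : ∀ k, v (.e k) ∘ₗ G = G ∘ₗ w (.e k) := fun k => comp_eq_comp_of_ortho fun f =>
    hG _ (by rw [Submodule.mem_comap, avgLoop_comm_e hv hw]; exact Submodule.zero_mem _)
  have hε : ∀ k, v (.ε k) ∘ₗ G = G ∘ₗ w (.ε k) := fun k => comp_eq_comp_of_ortho fun f =>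
    hG _ (by rw [Submodule.mem_comap, avgLoop_comm_eps hv hw]; exact Submodule.zero_mem _)
  have hα : ∀ s : Arr Y, v s.gen ∘ₗ G = G ∘ₗ w s.gen := by
    intro s
    apply tracePairing_injective
    ext X
    have h1 : ∀ b : Arr Y → A →ₗ[K] B, LinearMap.trace K A (G ∘ₗ (∑ r : Arr Y, Ω.sgn r.1.1 r.1.2 •
      (w (.e r.1.1) ∘ₗ b r ∘ₗ v r.star.gen + w r.gen ∘ₗ b r.star ∘ₗ v (.e r.1.1)))) = 0 := by
      intro b
      refine hG _ ?_
      obtain ⟨b', hb', hb⟩ := avgLoop_arrow hv hw b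
      exact ⟨b', hb', hb⟩
    -- Testing with a deformation of the single arrow opposite to `s` leaves two terms, at `s` and
    -- at `s.star`. Their signs are opposite, so orthogonality becomes `v_s G = G w_s` paired with
    -- the arbitrary `X`.
    have h2 := h1 (Pi.single s.star X)
    have h3 : (∑ r : Arr Y, Ω.sgn r.1.1 r.1.2 •
        (w (.e r.1.1) ∘ₗ (Pi.single s.star X : Arr Y → A →ₗ[K] B) r ∘ₗ v r.star.gen +
          w r.gen ∘ₗ (Pi.single s.star X : Arr Y → A →ₗ[K] B) r.star ∘ₗ v (.e r.1.1))) =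
        Ω.sgn s.1.2 s.1.1 • (w (.e s.1.2) ∘ₗ X ∘ₗ v s.gen) +
          Ω.sgn s.1.1 s.1.2 • (w s.gen ∘ₗ X ∘ₗ v (.e s.1.1)) := by
      simp only [smul_add, Finset.sum_add_distrib]
      congr 1
      · rw [Finset.sum_eq_single s.star]
        · rw [Pi.single_eq_same]; rfl
        · intro r _ hr
          rw [Pi.single_eq_of_ne hr]; simp
        · simp
      · rw [Finset.sum_eq_single s]
        · rw [Pi.single_eq_same]
        · intro r _ hr
          rw [Pi.single_eq_of_ne (fun h => hr (Arr.star_eq_iff.1 h))]; simp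
        · simp
    rw [h3, Ω.sgn_symm (Y.neg_of_fin s.2), LinearMap.comp_add, map_add, LinearMap.comp_smul,
      LinearMap.comp_smul, map_zsmul, map_zsmul, neg_smul, neg_add_eq_sub, ← smul_sub] at h2
    have h4 : LinearMap.trace K A (G ∘ₗ (w s.gen ∘ₗ X ∘ₗ v (.e s.1.1))) =
        LinearMap.trace K A (G ∘ₗ (w (.e s.1.2) ∘ₗ X ∘ₗ v s.gen)) := by
      rw [← sub_eq_zero]
      have := congrArg (fun z => Ω.sgn s.1.1 s.1.2 • z) h2
      simpa only [smul_smul, Ω.sgn_mul_self, one_smul, smul_zero] using this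
    rw [tracePairing_apply, tracePairing_apply]
    have h5 : LinearMap.trace K A (G ∘ₗ (w s.gen ∘ₗ X ∘ₗ v (.e s.1.1))) =
        LinearMap.trace K A ((G ∘ₗ w s.gen) ∘ₗ X) := by
      have := LinearMap.trace_mul_comm K (G ∘ₗ w s.gen ∘ₗ X) (v (.e s.1.1))
      refine Eq.trans (this.trans ?_) rfl
      congr 1
      ext x
      have h := congrArg (fun f => f (w s.gen (X x))) (he s.1.1)
      simp only [LinearMap.comp_apply] at h
      simp only [Module.End.mul_apply, LinearMap.comp_apply]
      rw [h, hw.e_α]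
    have h6 : LinearMap.trace K A (G ∘ₗ (w (.e s.1.2) ∘ₗ X ∘ₗ v s.gen)) =
        LinearMap.trace K A ((v s.gen ∘ₗ G) ∘ₗ X) := by
      have := LinearMap.trace_mul_comm K (G ∘ₗ w (.e s.1.2) ∘ₗ X) (v s.gen)
      refine Eq.trans (this.trans ?_) rfl
      congr 1
      ext x
      have h := congrArg (fun f => f (X x)) (he s.1.2)
      simp only [LinearMap.comp_apply] at h
      simp only [Module.End.mul_apply, LinearMap.comp_apply]
      rw [← h, hv.α_e]
    rw [← h5, ← h6, h4]
  rintro (k | k | ⟨i, j, g⟩)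
  · exact he k
  · exact hε k
  · exact hα ⟨(i, j), g⟩

theorem homRep_eq_inf : homLoop v w ⊓ LinearMap.ker (arrComm v w) = homRep v w := by
  ext f
  constructor
  · rintro ⟨h1, h2⟩ (k | k | ⟨i, j, g⟩)
    · exact (h1 k).1
    · exact (h1 k).2
    · exact sub_eq_zero.1 (congrFun h2 ⟨(i, j), g⟩)
  · intro h
    refine ⟨fun j => ⟨h _, h _⟩, ?_⟩
    funext r
    exact sub_eq_zero.2 (h _)

theorem finrank_map_add_inf_ker {E E' : Type*} [AddCommGroup E] [Module K E] [AddCommGroup E']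
    [Module K E'] [FiniteDimensional K E] (T : E →ₗ[K] E') (S : Submodule K E) :
    Module.finrank K (S.map T) + Module.finrank K (S ⊓ LinearMap.ker T : Submodule K E) =
      Module.finrank K S := by
  have h := LinearMap.finrank_range_add_finrank_ker (T.domRestrict S)
  rw [LinearMap.range_domRestrict] at h
  rw [← h]
  congr 1
  rw [LinearMap.ker_domRestrict, inf_comm]
  exact (Submodule.comapSubtypeEquivOfLe inf_le_right).symm.finrank_eq.trans (by
    rw [Submodule.comap_inf, Submodule.comap_subtype_self, inf_top_eq])

/-- The kernel of the first map of the complex is `homRep v w`, and its image lies in the kernel of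
the second. Let `S` be the image of the second map. As `avgLoop` reaches all of `homLoop`, the
orthogonal of the preimage of `S` has dimension at least `dim homLoop - dim S`, and it consists of
homomorphisms from `w` to `v`. -/
theorem two_mul_finrank_homLoop_le [FiniteDimensional K A] [FiniteDimensional K B]
    (hv : Satisfies Ω v) (hw : Satisfies Ω w)
    (hF : ∀ k, FreeOn (v (.e k)) (v (.ε k)) (Y.c k)) :
    2 * Module.finrank K (homLoop v w) ≤ Module.finrank K (homArr v w) +
      (Module.finrank K (homRep v w) + Module.finrank K (homRep w v)) := by
  set S := (homArr v w).map (meshLin Ω v w) with hS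
  have h1 := finrank_map_add_inf_ker (arrComm v w) (homLoop v w)
  rw [homRep_eq_inf] at h1
  have h2 := finrank_map_add_inf_ker (meshLin Ω v w) (homArr v w)
  rw [← hS] at h2
  have h3 : Module.finrank K ((homLoop v w).map (arrComm v w)) ≤
      Module.finrank K (homArr v w ⊓ LinearMap.ker (meshLin Ω v w) : Submodule K _) := by
    apply Submodule.finrank_mono
    rintro _ ⟨f, hf, rfl⟩
    exact ⟨arrComm_mem hv hw hf, meshLin_arrComm hv hw hf⟩
  have h4 := finrank_traceOrtho (S.comap (avgLoop v w))
  have h5 : Module.finrank K (traceOrtho (S.comap (avgLoop v w))) ≤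
      Module.finrank K (homRep w v) :=
    Submodule.finrank_mono fun G hG => mem_homRep_of_ortho hv hw hG
  have h6 := finrank_map_add_inf_ker (avgLoop v w) (S.comap (avgLoop v w))
  have h7 : Module.finrank K ((S.comap (avgLoop v w)).map (avgLoop v w)) ≤
      Module.finrank K S := Submodule.finrank_mono (Submodule.map_comap_le _ _)
  have h8 : Module.finrank K (S.comap (avgLoop v w) ⊓ LinearMap.ker (avgLoop v w) :
      Submodule K _) ≤ Module.finrank K (LinearMap.ker (avgLoop v w)) :=
    Submodule.finrank_mono inf_le_right
  have h9 := LinearMap.finrank_range_add_finrank_ker (avgLoop v w)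
  have h10 := Submodule.finrank_mono (homLoop_le_range (w := w) hv hF)
  omega

/-- The inequality half of Crawley-Boevey's formula, in which the defect would be an Ext group. Only
`v` is assumed locally free; `w` enters through the dimensions of its vertex spaces, so it may be a
subrepresentation or a reflection whose freeness is not known. -/
theorem euler_le [FiniteDimensional K A] [FiniteDimensional K B]
    (hv : Satisfies Ω v) (hw : Satisfies Ω w)
    (hF : ∀ k, FreeOn (v (.e k)) (v (.ε k)) (Y.c k)) {ν : ι → ℕ}
    (hν : ∀ k, Module.finrank K (LinearMap.range (v (.e k))) = ν k * Y.c k) :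
    ∑ j, ∑ k, Y.C j k * ν k * (Module.finrank K (LinearMap.range (w (.e j))) : ℤ) ≤
      (Module.finrank K (homRep v w) : ℤ) + Module.finrank K (homRep w v) := by
  have h := two_mul_finrank_homLoop_le hv hw hF
  rw [finrank_homLoop hv hw hF hν, finrank_homArr hv hw hF hν] at h
  have h' : (2 * ∑ k, (ν k : ℤ) * Module.finrank K (LinearMap.range (w (.e k)))) ≤
      (∑ j, ∑ k, (Y.g j k : ℤ) * (Y.f j k * ν k) * Module.finrank K (LinearMap.range (w (.e j)))) +
      ((Module.finrank K (homRep v w) : ℤ) + Module.finrank K (homRep w v)) := by exact_mod_cast h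
  rw [Finset.mul_sum, ← sub_le_iff_le_add', ← Finset.sum_sub_distrib] at h'
  refine le_trans (le_of_eq ?_) h'
  refine Finset.sum_congr rfl fun j _ => ?_
  rw [Fintype.sum_eq_add_sum_compl j, Fintype.sum_eq_add_sum_compl j, Y.g_self, Y.diag]
  simp only [Nat.cast_zero, zero_mul, zero_add]
  rw [sub_eq_add_neg, ← Finset.sum_neg_distrib, mul_assoc]
  congr 1
  refine Finset.sum_congr rfl fun k hk => ?_
  have hjk : j ≠ k := by
    rintro rfl; simp at hk
  have h1 := Y.g_mul_f j k hjk
  have h2 : (Y.C j k) = -((Y.g j k : ℤ) * Y.f j k) := by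
    have := Y.nonpos j k hjk
    rw [← Nat.cast_mul, h1]
    omega
  rw [h2]
  ring

end Complex

namespace SymmGCM

/-! ### The Weyl group and the symmetric form -/

section Weyl

variable {ι : Type} [Fintype ι] [DecidableEq ι] (X : SymmGCM ι)

/-- The pairing `∑ c_j x_j δ_j` between weights and elements of the root lattice. -/
def pr : (ι → ℤ) →ₗ[ℤ] (ι → ℤ) →ₗ[ℤ] ℤ :=
  LinearMap.mk₂ ℤ (fun x δ => ∑ j, X.c j * (x j * δ j))
    (fun _ _ _ => by simp only [Pi.add_apply, add_mul, mul_add, Finset.sum_add_distrib])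
    (fun _ _ _ => by
      simp only [Pi.smul_apply, smul_eq_mul, Finset.mul_sum]
      exact Finset.sum_congr rfl fun _ _ => by ring)
    (fun _ _ _ => by simp only [Pi.add_apply, mul_add, Finset.sum_add_distrib])
    (fun _ _ _ => by
      simp only [Pi.smul_apply, smul_eq_mul, Finset.mul_sum]
      exact Finset.sum_congr rfl fun _ _ => by ring)

theorem pr_apply (x δ : ι → ℤ) : X.pr x δ = ∑ j, X.c j * (x j * δ j) := rfl

/-- The embedding of the root lattice into the weight lattice. -/
def cmap : (ι → ℤ) →ₗ[ℤ] (ι → ℤ) := X.C.mulVecLin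

theorem cmap_apply (δ : ι → ℤ) (k : ι) : X.cmap δ k = ∑ j, X.C k j * δ j := rfl

theorem sum_smul_simpleRoot (δ : ι → ℤ) : ∑ j, δ j • X.simpleRoot j = X.cmap δ := by
  funext k
  rw [cmap_apply, Finset.sum_apply]
  exact Finset.sum_congr rfl fun j _ => by simp [simpleRoot, mul_comm]

theorem cmap_single (i : ι) (a : ℤ) : X.cmap (Pi.single i a) = a • X.simpleRoot i := by
  rw [← sum_smul_simpleRoot, Finset.sum_eq_single i]
  · simp
  · intro b _ hb; simp [Pi.single_eq_of_ne hb]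
  · simp

theorem pr_single (x : ι → ℤ) (i : ι) (a : ℤ) : X.pr x (Pi.single i a) = X.c i * (x i * a) := by
  rw [pr_apply, Finset.sum_eq_single i]
  · simp
  · intro b _ hb; simp [Pi.single_eq_of_ne hb]
  · simp

theorem pr_single_left (x : ι → ℤ) (i : ι) (a : ℤ) :
    X.pr (Pi.single i a) x = X.c i * (a * x i) := by
  rw [pr_apply, Finset.sum_eq_single i]
  · simp
  · intro b _ hb; simp [Pi.single_eq_of_ne hb]
  · simp

/-- The bilinear form on the root lattice is symmetric. -/
theorem frm_comm (δ δ' : ι → ℤ) : X.pr (X.cmap δ) δ' = X.pr (X.cmap δ') δ := by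
  simp only [pr_apply, cmap_apply, Finset.sum_mul, Finset.mul_sum]
  rw [Finset.sum_comm]
  refine Finset.sum_congr rfl fun i _ => Finset.sum_congr rfl fun j _ => ?_
  have := X.symm i j
  linear_combination (-(δ i) * δ' j) * this

theorem frm_self_pos (hX : X.IsFiniteType) {δ : ι → ℤ} (h : δ ≠ 0) :
    0 < X.pr (X.cmap δ) δ := by
  have := hX δ h
  simp only [pr_apply, cmap_apply, Finset.sum_mul, Finset.mul_sum]
  refine lt_of_lt_of_eq this ?_
  exact Finset.sum_congr rfl fun i _ => Finset.sum_congr rfl fun j _ => by ring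

theorem eq_zero_of_frm (hX : X.IsFiniteType) {δ : ι → ℤ} (h : X.pr (X.cmap δ) δ ≤ 0) :
    δ = 0 := by
  by_contra hne
  exact absurd (X.frm_self_pos hX hne) (not_lt.2 h)

theorem frm_self_nonneg (hX : X.IsFiniteType) (δ : ι → ℤ) : 0 ≤ X.pr (X.cmap δ) δ := by
  by_cases h : δ = 0
  · simp [h]
  · exact (X.frm_self_pos hX h).le

theorem cmap_injective (hX : X.IsFiniteType) : Function.Injective X.cmap := by
  rw [← LinearMap.ker_eq_bot, LinearMap.ker_eq_bot']
  intro δ h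
  exact X.eq_zero_of_frm hX (by rw [h]; simp)

theorem exists_cmap_eq (hX : X.IsFiniteType) :
    ∃ N : ℤ, 0 < N ∧ ∀ x : ι → ℤ, ∃ y, X.cmap y = N • x := by
  have hdet : X.C.det ≠ 0 := by
    intro h
    obtain ⟨y, hy, hy'⟩ := Matrix.exists_mulVec_eq_zero_iff.2 h
    exact hy (X.cmap_injective hX (hy'.trans (map_zero _).symm))
  -- The adjugate inverts the Cartan matrix up to its determinant; squaring makes the multiplier
  -- positive without a discussion of signs.
  refine ⟨X.C.det * X.C.det, mul_self_pos.2 hdet, fun x => ⟨X.C.det • X.C.adjugate.mulVec x, ?_⟩⟩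
  rw [map_smul, cmap, Matrix.mulVecLin_apply, Matrix.mulVec_mulVec, Matrix.mul_adjugate,
    Matrix.smul_mulVec, Matrix.one_mulVec, smul_smul]

/-- Cauchy–Schwarz without division: positivity of the form at `(y, y) z - (y, z) y`, cancelled by
`(y, y) > 0`. -/
theorem frm_sq_le (hX : X.IsFiniteType) (y z : ι → ℤ) :
    X.pr (X.cmap y) z ^ 2 ≤ X.pr (X.cmap y) y * X.pr (X.cmap z) z := by
  by_cases hy : y = 0
  · simp [hy]
  have h := X.frm_self_nonneg hX (X.pr (X.cmap y) y • z - X.pr (X.cmap y) z • y)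
  simp only [map_sub, map_smul, LinearMap.sub_apply, LinearMap.smul_apply, smul_eq_mul] at h
  rw [X.frm_comm z y] at h
  have hp := X.frm_self_pos hX hy
  refine le_of_mul_le_mul_left ?_ hp
  linarith

/-- Pair `C y` with the negative part of `y`. The positive part contributes at most zero because
off-diagonal entries are nonpositive, so the form at the negative part is nonpositive and that part
vanishes. -/
theorem nonneg_of_cmap_nonneg (hX : X.IsFiniteType) {y : ι → ℤ} (h : ∀ k, 0 ≤ X.cmap y k) (k : ι) :
    0 ≤ y k := by
  set yn : ι → ℤ := fun k => max (-(y k)) 0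
  set yp : ι → ℤ := fun k => max (y k) 0
  have hy : y = yp - yn := by
    funext k
    simp only [yp, yn, Pi.sub_apply]
    omega
  have h1 : 0 ≤ X.pr (X.cmap y) yn := by
    rw [pr_apply]
    exact Finset.sum_nonneg fun j _ => mul_nonneg (by positivity)
      (mul_nonneg (h j) (le_max_right _ _))
  have h2 : X.pr (X.cmap yp) yn ≤ 0 := by
    simp only [pr_apply, cmap_apply, Finset.sum_mul, Finset.mul_sum]
    refine Finset.sum_nonpos fun i _ => Finset.sum_nonpos fun j _ => ?_
    by_cases hij : i = j
    · subst hij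
      have : yp i * yn i = 0 := by
        simp only [yp, yn]
        rcases le_total (y i) 0 with h0 | h0
        · rw [max_eq_right h0, zero_mul]
        · rw [max_eq_right (by omega : -(y i) ≤ 0), mul_zero]
      rw [mul_assoc (X.C i i), this]; simp
    · have := X.nonpos i j hij
      have hp : 0 ≤ yp j := le_max_right _ _
      have hn : 0 ≤ yn i := le_max_right _ _
      have : X.C i j * yp j * yn i ≤ 0 :=
        mul_nonpos_of_nonpos_of_nonneg (mul_nonpos_of_nonpos_of_nonneg this hp) hn
      exact mul_nonpos_of_nonneg_of_nonpos (by positivity) this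
  rw [hy, map_sub, map_sub, LinearMap.sub_apply] at h1
  have h3 := X.eq_zero_of_frm hX (δ := yn) (by linarith)
  have := congrFun h3 k
  simp only [yn, Pi.zero_apply] at this
  omega

/-- The second identity is the invariance `(w x, w y) = (x, y)` expanded by `w x = x + C (d x)`.
Written this way it only uses the pairing of weights with roots and needs no inverse of the Cartan
matrix. -/
theorem exists_diff_of_mem_weylGroup {w : (ι → ℤ) ≃ₗ[ℤ] (ι → ℤ)} (hw : w ∈ X.weylGroup) :
    ∃ d : (ι → ℤ) → (ι → ℤ), (∀ x, w x = x + X.cmap (d x)) ∧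
      ∀ x y, X.pr x (d y) + X.pr y (d x) + X.pr (X.cmap (d x)) (d y) = 0 := by
  induction hw using Subgroup.closure_induction with
  | mem w h =>
    obtain ⟨i, rfl⟩ := h
    refine ⟨fun x => Pi.single i (-(x i)), fun x => ?_, fun x y => ?_⟩
    · rw [cmap_single, neg_smul, ← sub_eq_add_neg]
      rfl
    · rw [pr_single, pr_single, pr_single, cmap_single]
      simp [simpleRoot, X.diag]
      ring
  | one => exact ⟨fun _ => 0, fun x => by simp, fun x y => by simp⟩
  | mul w w' _ _ h h' =>
    obtain ⟨d, h1, h2⟩ := h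
    obtain ⟨d', h1', h2'⟩ := h'
    refine ⟨fun x => d' x + d (w' x), fun x => ?_, fun x y => ?_⟩
    · rw [LinearEquiv.mul_apply, h1, map_add, ← add_assoc, ← h1']
    · have e1 := h2 (w' x) (w' y)
      have e2 := h2' x y
      have e3 : X.pr (w' x) (d (w' y)) =
          X.pr x (d (w' y)) + X.pr (X.cmap (d' x)) (d (w' y)) := by
        rw [h1' x, map_add, LinearMap.add_apply]
      have e4 : X.pr (w' y) (d (w' x)) =
          X.pr y (d (w' x)) + X.pr (X.cmap (d' y)) (d (w' x)) := by
        rw [h1' y, map_add, LinearMap.add_apply]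
      have e5 := X.frm_comm (d' y) (d (w' x))
      simp only [map_add, LinearMap.add_apply]
      linarith
  | inv w _ h =>
    obtain ⟨d, h1, h2⟩ := h
    refine ⟨fun x => - d (w⁻¹ x), fun x => ?_, fun x y => ?_⟩
    · have := h1 (w⁻¹ x)
      rw [map_neg, ← sub_eq_add_neg, eq_sub_iff_add_eq, ← this]
      exact w.apply_symm_apply x
    · have e := h2 (w⁻¹ x) (w⁻¹ y)
      have e1 : x = w⁻¹ x + X.cmap (d (w⁻¹ x)) := by
        rw [← h1]; exact (w.apply_symm_apply x).symm
      have e2 : y = w⁻¹ y + X.cmap (d (w⁻¹ y)) := by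
        rw [← h1]; exact (w.apply_symm_apply y).symm
      have e3 : X.pr x (d (w⁻¹ y)) = X.pr (w⁻¹ x) (d (w⁻¹ y)) +
          X.pr (X.cmap (d (w⁻¹ x))) (d (w⁻¹ y)) := by
        conv_lhs => rw [e1]
        rw [map_add, LinearMap.add_apply]
      have e4 : X.pr y (d (w⁻¹ x)) = X.pr (w⁻¹ y) (d (w⁻¹ x)) +
          X.pr (X.cmap (d (w⁻¹ y))) (d (w⁻¹ x)) := by
        conv_lhs => rw [e2]
        rw [map_add, LinearMap.add_apply]
      have e5 := X.frm_comm (d (w⁻¹ y)) (d (w⁻¹ x))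
      simp only [map_neg, LinearMap.neg_apply]
      linarith

theorem pr_diff (hX : X.IsFiniteType) {w : (ι → ℤ) ≃ₗ[ℤ] (ι → ℤ)} (hw : w ∈ X.weylGroup)
    {x y δ δ' : ι → ℤ} (hx : w x = x + X.cmap δ) (hy : w y = y + X.cmap δ') :
    X.pr x δ' + X.pr y δ + X.pr (X.cmap δ) δ' = 0 := by
  obtain ⟨d, h1, h2⟩ := X.exists_diff_of_mem_weylGroup hw
  have e1 : δ = d x := X.cmap_injective hX (add_left_cancel (hx.symm.trans (h1 x)))
  have e2 : δ' = d y := X.cmap_injective hX (add_left_cancel (hy.symm.trans (h1 y)))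
  rw [e1, e2]
  exact h2 x y

/-- A dominant weight is maximal in its orbit: invariance reads `2 (x, δ) + (δ, δ) = 0`, and both
summands are nonnegative. -/
theorem eq_zero_of_dominant (hX : X.IsFiniteType) {w : (ι → ℤ) ≃ₗ[ℤ] (ι → ℤ)}
    (hw : w ∈ X.weylGroup) {x δ : ι → ℤ} (hx : w x = x + X.cmap δ) (hx0 : ∀ k, 0 ≤ x k)
    (hδ : ∀ k, 0 ≤ δ k) : δ = 0 := by
  have h := X.pr_diff hX hw hx hx
  have h1 : 0 ≤ X.pr x δ := by
    rw [pr_apply]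
    exact Finset.sum_nonneg fun j _ => mul_nonneg (by positivity) (mul_nonneg (hx0 j) (hδ j))
  exact X.eq_zero_of_frm hX (by linarith)

/-- This replaces finiteness of the Weyl group. If `C r = N ρ`, invariance puts `N δ - r` on the
same sphere as `r`; Cauchy–Schwarz bounds its product with `r`, and that bounds the height of `δ`.
It makes the reflection process terminate. -/
theorem exists_bound (hX : X.IsFiniteType) : ∃ b : ℤ, ∀ w ∈ X.weylGroup, ∀ δ : ι → ℤ,
    w (fun _ => -1) = (fun _ => -1) + X.cmap δ → (∀ k, 0 ≤ δ k) → ∑ k, δ k ≤ b := by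
  obtain ⟨N, hN, h⟩ := X.exists_cmap_eq hX
  obtain ⟨r, hr⟩ := h (fun _ => 1)
  refine ⟨2 * X.pr (X.cmap r) r, fun w hw δ hδ h0 => ?_⟩
  have h1 := X.pr_diff hX hw hδ hδ
  have hneg : (fun _ => -1 : ι → ℤ) = -(fun _ => 1) := rfl
  rw [hneg, map_neg, LinearMap.neg_apply] at h1
  set p := X.pr (fun _ => 1) δ with hp
  have h2 : X.pr (X.cmap r) δ = N * p := by rw [hr, map_smul]; rfl
  have h3 := X.frm_comm r δ
  have h4 : X.pr (X.cmap (N • δ - r)) (N • δ - r) = X.pr (X.cmap r) r := by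
    simp only [map_sub, map_smul, LinearMap.sub_apply, LinearMap.smul_apply, smul_eq_mul]
    rw [← h3, h2]
    linear_combination N ^ 2 * h1
  have h5 := X.frm_sq_le hX r (N • δ - r)
  rw [h4] at h5
  have h6 : X.pr (X.cmap r) (N • δ - r) = N * (N * p) - X.pr (X.cmap r) r := by
    rw [map_sub, map_smul, h2, smul_eq_mul]
  have h7 := X.frm_self_nonneg hX r
  have h8 : X.pr (X.cmap r) (N • δ - r) ≤ X.pr (X.cmap r) r := by
    exact abs_le_of_sq_le_sq' (by rwa [sq (X.pr (X.cmap r) r)]) h7 |>.2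
  have h9 : ∑ k, δ k ≤ p := by
    rw [hp, pr_apply]
    refine Finset.sum_le_sum fun k _ => ?_
    have hc : (1 : ℤ) ≤ X.c k := by exact_mod_cast X.c_pos k
    rw [one_mul]
    exact le_mul_of_one_le_left (h0 k) hc
  have h10 : 0 ≤ p := le_trans (Finset.sum_nonneg fun k _ => h0 k) h9
  have h11 : p ≤ N * (N * p) := by
    have := le_mul_of_one_le_left h10 hN
    exact this.trans (le_mul_of_one_le_left (h10.trans this) hN)
  linarith

/-- A weight in the orbit of `-ρ` has the length of `ρ`. If it is moreover `ρ` plus a dominant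
weight, with `y` denoting `N C⁻¹` of that weight, then equality of lengths gives `(y, y) + 2 (r, y)
= 0` with both terms nonnegative, so `y = 0`. -/
theorem eq_one_of_dominant_regular (hX : X.IsFiniteType) {w : (ι → ℤ) ≃ₗ[ℤ] (ι → ℤ)}
    (hw : w ∈ X.weylGroup) (h1 : ∀ k, 1 ≤ w (fun _ => -1) k) : w (fun _ => -1) = fun _ => 1 := by
  obtain ⟨N, hN, h⟩ := X.exists_cmap_eq hX
  obtain ⟨r, hr⟩ := h (fun _ => 1)
  obtain ⟨d, hd, -⟩ := X.exists_diff_of_mem_weylGroup hw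
  obtain ⟨δ, hδ⟩ : ∃ δ, w (fun _ => -1) = (fun _ => -1) + X.cmap δ := ⟨_, hd _⟩
  obtain ⟨y, hy⟩ := h (w (fun _ => -1) - fun _ => 1)
  have hy0 : ∀ k, 0 ≤ y k := X.nonneg_of_cmap_nonneg hX fun k => by
    rw [hy]
    have := h1 k
    simp only [Pi.smul_apply, Pi.sub_apply, smul_eq_mul]
    exact mul_nonneg hN.le (by linarith)
  have hneg : (fun _ => -1 : ι → ℤ) = -(fun _ => 1) := rfl
  have e1 : N • δ = y + (2 : ℤ) • r := by
    apply X.cmap_injective hX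
    rw [map_add, map_smul, map_smul, hy, hr, hδ, hneg]
    funext k
    simp only [Pi.smul_apply, Pi.add_apply, Pi.sub_apply, Pi.neg_apply, smul_eq_mul]
    ring
  have h2 := X.pr_diff hX hw hδ hδ
  rw [hneg, map_neg, LinearMap.neg_apply] at h2
  have h3 : X.pr (X.cmap (N • δ)) (N • δ) = 2 * X.pr (X.cmap r) (N • δ) := by
    rw [hr]
    simp only [map_smul, LinearMap.smul_apply, smul_eq_mul]
    linear_combination N ^ 2 * h2
  rw [e1] at h3
  simp only [map_add, map_smul, LinearMap.add_apply, LinearMap.smul_apply, smul_eq_mul] at h3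
  have h4 := X.frm_comm r y
  have h5 : 0 ≤ X.pr (X.cmap r) y := by
    rw [hr, pr_apply]
    exact Finset.sum_nonneg fun j _ => mul_nonneg (by positivity)
      (mul_nonneg (by simp [hN.le]) (hy0 j))
  have h6 := X.eq_zero_of_frm hX (δ := y) (by linarith)
  rw [h6, map_zero] at hy
  have h7 : w (fun _ => -1) - (fun _ => 1 : ι → ℤ) = 0 := by
    rcases smul_eq_zero.1 hy.symm with h | h
    · exact absurd h hN.ne'
    · exact h
  exact sub_eq_zero.1 h7

/-- Nonzero rows have sum at least one, while the total is the number of columns; hence every row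
sum is one and the matrix is a permutation matrix. -/
theorem exists_eq_single {γ : ι → ι → ℤ} (h0 : ∀ k j, 0 ≤ γ k j) (hne : ∀ k, γ k ≠ 0)
    (hs : ∀ j, ∑ k, γ k j = 1) (i : ι) : ∃ k, γ k = Pi.single i 1 := by
  have h1 : ∀ k, 1 ≤ ∑ j, γ k j := by
    intro k
    obtain ⟨j, hj⟩ := Function.ne_iff.1 (hne k)
    have : 0 < γ k j := lt_of_le_of_ne (h0 k j) (Ne.symm hj)
    exact this.trans_le (Finset.single_le_sum (fun j _ => h0 k j) (Finset.mem_univ j))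
  have h2 : ∑ k, ∑ j, γ k j = ∑ _k : ι, (1 : ℤ) := by
    rw [Finset.sum_comm]
    exact Finset.sum_congr rfl fun j _ => hs j
  have h3 : ∀ k, ∑ j, γ k j = 1 := fun k =>
    ((Finset.sum_eq_sum_iff_of_le fun k _ => h1 k).1 h2.symm k (Finset.mem_univ k)).symm
  have h4 : ∃ k, γ k i ≠ 0 := by
    by_contra h
    push Not at h
    have := hs i
    simp [h] at this
  obtain ⟨k, hk⟩ := h4
  refine ⟨k, ?_⟩
  have h5 : 1 ≤ γ k i := lt_of_le_of_ne (h0 k i) (Ne.symm hk)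
  have h6 := h3 k
  rw [Fintype.sum_eq_add_sum_compl i] at h6
  have h7 : 0 ≤ ∑ j ∈ {i}ᶜ, γ k j := Finset.sum_nonneg fun j _ => h0 k j
  have h8 : ∑ j ∈ {i}ᶜ, γ k j = 0 := by linarith
  funext j
  by_cases hj : j = i
  · subst hj; simp; linarith
  · rw [Pi.single_eq_of_ne hj]
    exact (Finset.sum_eq_zero_iff_of_nonneg fun j _ => h0 k j).1 h8 j (by simpa using hj)

end Weyl

end SymmGCM

/-! ### Filtrations and stability of representations -/

section Filtration

variable {K : Type*} [Field K] {ι : Type} [Fintype ι] [DecidableEq ι] {Y : SymmGCM ι}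
  {Ω : Orientation Y} {M : Type*} [AddCommGroup M] [Module K M]
  {N : Type*} [AddCommGroup N] [Module K N]

/-- `S` is a subrepresentation. -/
def Inv (v : Gen Y → Module.End K M) (S : Submodule K M) : Prop := ∀ a, ∀ x ∈ S, v a x ∈ S

/-- The polynomial multiples of a vector. -/
def cyc (ε : Module.End K M) (u : M) : K[X] →ₗ[K] M :=
  (LinearMap.applyₗ u) ∘ₗ (Polynomial.aeval ε).toLinearMap

theorem cyc_apply (ε : Module.End K M) (u : M) (p : K[X]) :
    cyc ε u p = Polynomial.aeval ε p u := rfl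

/-- A finite filtration of `S` by subrepresentations whose quotients are generalized simple. -/
inductive EFilt (v : Gen Y → Module.End K M) : Submodule K M → Prop
  | bot : EFilt v ⊥
  -- That `ε ^ (c - 1) u` is not in `S` makes the `ε`-string of `u` free of rank one modulo `S`; the
  -- last condition says that this string is all of `T / S`.
  | step (S T : Submodule K M) (i : ι) (u : M) : EFilt v S → Inv v T → S ≤ T → u ∈ T →
      v (.e i) u = u → (v (.ε i) ^ (Y.c i - 1)) u ∉ S →
      T ≤ S ⊔ LinearMap.range (cyc (v (.ε i)) u) → EFilt v T

variable {v : Gen Y → Module.End K M} {v' : Gen Y → Module.End K N}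

theorem EFilt.inv {S : Submodule K M} (h : EFilt v S) : Inv v S := by
  cases h with
  | bot => intro a x hx; rw [Submodule.mem_bot] at hx; simp [hx]
  | step _ _ _ _ _ h => exact h

theorem aeval_comm {φ : M →ₗ[K] N} {ε : Module.End K M} {ε' : Module.End K N}
    (h : ∀ x, φ (ε x) = ε' (φ x)) (p : K[X]) (x : M) :
    φ (Polynomial.aeval ε p x) = Polynomial.aeval ε' p (φ x) := by
  induction p using Polynomial.induction_on' with
  | add p q hp hq => simp [hp, hq]
  | monomial n a =>
    simp only [Polynomial.aeval_monomial, Module.End.mul_apply, Module.algebraMap_end_apply,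
      map_smul]
    congr 1
    exact (pow_comp_of_comm (τ' := ε') (τ := ε) (α := φ) (LinearMap.ext fun x => (h x).symm) n
      x).symm

theorem EFilt.map {φ : M →ₗ[K] N} (hφ : Function.Injective φ)
    (hc : ∀ a x, φ (v a x) = v' a (φ x)) {S : Submodule K M} (h : EFilt v S) :
    EFilt v' (S.map φ) := by
  induction h with
  | bot => rw [Submodule.map_bot]; exact .bot
  | step S T i u _ hT hST hu he hn hle ih =>
    refine .step (S.map φ) (T.map φ) i (φ u) ih ?_ (Submodule.map_mono hST) ⟨u, hu, rfl⟩
      (by rw [← hc, he]) ?_ ?_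
    · rintro a _ ⟨x, hx, rfl⟩
      exact ⟨v a x, hT a x hx, hc a x⟩
    · rintro ⟨x, hx, hxu⟩
      apply hn
      rw [pow_comp_of_comm (τ := v (.ε i)) (LinearMap.ext fun x => (hc _ x).symm)] at hxu
      rwa [← hφ hxu]
    · rintro _ ⟨x, hx, rfl⟩
      obtain ⟨s, hs, _, ⟨p, rfl⟩, rfl⟩ := Submodule.mem_sup.1 (hle hx)
      rw [map_add]
      refine Submodule.add_mem_sup ⟨s, hs, rfl⟩ ⟨p, ?_⟩
      rw [cyc_apply, cyc_apply, aeval_comm fun x => hc _ x]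

theorem aeval_eq_divX (ε : Module.End K M) (p : K[X]) (u : M) :
    Polynomial.aeval ε p u = ε (Polynomial.aeval ε p.divX u) + p.coeff 0 • u := by
  conv_lhs => rw [← Polynomial.X_mul_divX_add p]
  simp only [map_add, map_mul, Polynomial.aeval_X, Polynomial.aeval_C, LinearMap.add_apply,
    Module.End.mul_apply, Module.algebraMap_end_apply]

theorem NilpOn.aeval_e {p ε : Module.End K M} {c : ℕ} (h : NilpOn p ε c) {u : M} (hu : p u = u)
    (f : K[X]) : p (Polynomial.aeval ε f u) = Polynomial.aeval ε f u := by
  rw [aeval_comm (ε' := ε) (fun x => by rw [h.p_eps, h.eps_p]), hu]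

/-- A filtration extends over a quotient that is free and concentrated at one vertex. -/
theorem EFilt.extend [FiniteDimensional K M] (hv : Satisfies Ω v) (j : ι) {S : Submodule K M}
    (hS : EFilt v S) (h1 : ∀ x, x - v (.e j) x ∈ S)
    (h2 : ∀ x, v (.e j) x = x → v (.ε j) x ∈ S →
      ∃ y, v (.e j) y = y ∧ x - (v (.ε j) ^ (Y.c j - 1)) y ∈ S) : EFilt v ⊤ := by
  induction hn : Module.finrank K M - Module.finrank K S using Nat.strong_induction_on
    generalizing S with
  | _ n ih =>
    by_cases htop : S = ⊤
    · rwa [← htop]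
    have hinv := hS.inv
    obtain ⟨x0, hx0⟩ : ∃ x, x ∉ S := by
      by_contra h
      push Not at h
      exact htop (Submodule.eq_top_iff'.2 h)
    have hx1 : v (.e j) x0 ∉ S := fun h => hx0 (by simpa using S.add_mem (h1 x0) h)
    have hpow : ∃ m, (v (.ε j) ^ m) (v (.e j) x0) ∈ S :=
      ⟨Y.c j, by rw [hv.nilp]; exact S.zero_mem⟩
    classical
    set m := Nat.find hpow
    have hm : (v (.ε j) ^ m) (v (.e j) x0) ∈ S := Nat.find_spec hpow
    have hm0 : m ≠ 0 := by
      intro h; rw [h] at hm; exact hx1 hm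
    obtain ⟨m', hm'⟩ : ∃ m', m = m' + 1 := ⟨m - 1, by omega⟩
    have hm2 : (v (.ε j) ^ m') (v (.e j) x0) ∉ S := Nat.find_min hpow (by omega)
    have hej := (hv.nilpOn j)
    -- The last power of `ε_j` applied to `x0` that stays outside `S` is a socle vector of the
    -- quotient; its preimage `y` under `ε_j ^ (c - 1)` generates a free summand of rank one.
    obtain ⟨y, hy, hyS⟩ := h2 _ (hej.apply_pow (hv.e_e j x0) m') (by
      rw [← Module.End.mul_apply, ← pow_succ', ← hm']; exact hm)
    have hyn : (v (.ε j) ^ (Y.c j - 1)) y ∉ S := fun h => hm2 (by simpa using S.add_mem hyS h)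
    set T := S ⊔ LinearMap.range (cyc (v (.ε j)) y) with hT
    have hST : S ≤ T := le_sup_left
    have hyT : y ∈ T := hT ▸ Submodule.mem_sup_right ⟨1, by simp [cyc_apply]⟩
    have hnot : ∀ i, i ≠ j → ∀ z, v (.e i) z = z → z ∈ S := by
      intro i hi z hz
      have := h1 z
      rwa [hv.e_of_e hz, if_neg hi.symm, sub_zero] at this
    have hTinv : Inv v T := by
      intro a x hx
      obtain ⟨s, hs, _, ⟨p, rfl⟩, rfl⟩ := Submodule.mem_sup.1 hx
      rw [map_add]
      refine T.add_mem (hST (hinv a s hs)) ?_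
      have hp : v (.e j) (cyc (v (.ε j)) y p) = cyc (v (.ε j)) y p := hej.aeval_e hy p
      rcases a with i | i | ⟨i, l, g⟩
      · by_cases hi : i = j
        · subst hi
          rw [hp]
          exact Submodule.mem_sup_right ⟨p, rfl⟩
        · rw [hv.e_of_e hp, if_neg hi]; exact T.zero_mem
      · by_cases hi : i = j
        · subst hi
          refine Submodule.mem_sup_right ⟨Polynomial.X * p, ?_⟩
          simp [cyc_apply]
        · rw [hv.eps_of_e (Ne.symm hi) hp]; exact T.zero_mem
      · by_cases hl : l = j
        · subst hl
          exact hST (hnot i (Y.ne_of_fin g) _ (hv.e_α _ _ _ _))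
        · rw [hv.α_of_e (Ne.symm hl) hp]; exact T.zero_mem
    have hTf : EFilt v T := .step S T j y hS hTinv hST hyT hy hyn le_rfl
    have hlt : Module.finrank K S < Module.finrank K T := by
      refine Submodule.finrank_lt_finrank_of_lt (lt_of_le_of_ne hST fun h => hyn ?_)
      rw [h]
      refine Submodule.mem_sup_right ⟨Polynomial.X ^ (Y.c j - 1), ?_⟩
      simp [cyc_apply]
    have hTM := Submodule.finrank_le T
    refine ih (Module.finrank K M - Module.finrank K T) (by omega) hTf
      (fun x => hST (h1 x)) ?_ rfl
    intro x hx hεx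
    obtain ⟨s, hs, _, ⟨p, rfl⟩, hsp⟩ := Submodule.mem_sup.1 hεx
    have hc := Y.c_pos j
    have hpow2 : ∀ z, (v (.ε j) ^ (Y.c j - 1)) (v (.ε j) z) = 0 := by
      intro z
      rw [← Module.End.mul_apply, ← pow_succ, Nat.sub_add_cancel hc, hv.nilp]; rfl
    have hinvpow : ∀ n, ∀ z ∈ S, (v (.ε j) ^ n) z ∈ S := by
      intro n z hz
      induction n with
      | zero => exact hz
      | succ n ih => rw [pow_succ', Module.End.mul_apply]; exact hinv _ _ ih
    rw [cyc_apply, aeval_eq_divX] at hsp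
    -- A nonzero constant term would, after applying `ε_j ^ (c - 1)`, put `ε_j ^ (c - 1) y` into
    -- `S`. So `p` is divisible by the variable, and after subtracting `p.divX` applied to `y` the
    -- vector `x` is a socle vector modulo `S` as well: the smaller quotient inherits the freeness
    -- condition.
    have hk : p.coeff 0 = 0 := by
      by_contra hk
      have h3 := congrArg (v (.ε j) ^ (Y.c j - 1)) hsp
      rw [map_add, map_add, hpow2, hpow2, zero_add, map_smul] at h3
      have h4 : p.coeff 0 • (v (.ε j) ^ (Y.c j - 1)) y ∈ S := by
        rw [eq_neg_of_add_eq_zero_right h3]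
        exact S.neg_mem (hinvpow _ s hs)
      exact hyn ((S.smul_mem_iff hk).1 h4)
    rw [hk, zero_smul, add_zero] at hsp
    set z := Polynomial.aeval (v (.ε j)) p.divX y
    obtain ⟨y', hy', hyS'⟩ := h2 (x - z) (by rw [map_sub, hx, hej.aeval_e hy]) (by
      rw [map_sub, ← hsp, add_sub_cancel_right]; exact hs)
    refine ⟨y', hy', ?_⟩
    have : x - (v (.ε j) ^ (Y.c j - 1)) y' = (x - z - (v (.ε j) ^ (Y.c j - 1)) y') + z := by abel
    rw [this]
    exact T.add_mem (hST hyS') (Submodule.mem_sup_right ⟨p.divX, rfl⟩)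

theorem Satisfies.of_injective (hv : Satisfies Ω v) {φ : N →ₗ[K] M} (hφ : Function.Injective φ)
    (hc : ∀ a x, φ (v' a x) = v a (φ x)) : Satisfies Ω v' where
  idem i j := by
    refine LinearMap.ext fun x => hφ ?_
    rw [Module.End.mul_apply, hc, hc]
    split_ifs with h
    · subst h; rw [hc, hv.e_e]
    · rw [hv.e_e_ne h]; simp
  unit := by
    refine LinearMap.ext fun x => hφ ?_
    simp only [LinearMap.sum_apply, map_sum, hc, Module.End.one_apply, hv.sum_e]
  loop i := by
    refine LinearMap.ext fun x => hφ ?_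
    simp only [Module.End.mul_apply, hc, hv.eps_e, hv.e_eps]
  arrow i j g := by
    refine LinearMap.ext fun x => hφ ?_
    simp only [Module.End.mul_apply, hc, hv.α_e, hv.e_α]
  nilp i := by
    refine LinearMap.ext fun x => hφ ?_
    rw [← pow_comp_of_comm (τ' := v (.ε i)) (LinearMap.ext fun x => (hc _ x).symm), hv.nilp]
    simp
  comm i j g := by
    refine LinearMap.ext fun x => hφ ?_
    rw [Module.End.mul_apply, Module.End.mul_apply, hc,
      ← pow_comp_of_comm (τ' := v (.ε i)) (LinearMap.ext fun x => (hc _ x).symm), hc,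
      ← pow_comp_of_comm (τ' := v (.ε j)) (LinearMap.ext fun x => (hc _ x).symm), hv.comm_apply]
  mesh i := by
    refine LinearMap.ext fun x => hφ ?_
    have h := congrArg (fun f : Module.End K M => f (φ x)) (hv.mesh i)
    rw [mesh_apply]
    simp only [mesh_apply, LinearMap.zero_apply] at h
    rw [LinearMap.zero_apply, map_zero, map_sum, ← h]
    refine Finset.sum_congr rfl fun j _ => ?_
    rw [map_sum]
    refine Finset.sum_congr rfl fun g _ => ?_
    rw [map_sum]
    refine Finset.sum_congr rfl fun f _ => ?_
    have hp : ∀ n x, φ ((v' (.ε i) ^ n) x) = (v (.ε i) ^ n) (φ x) := fun n x =>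
      (pow_comp_of_comm (τ' := v (.ε i)) (LinearMap.ext fun x => (hc _ x).symm) n x).symm
    rw [map_zsmul, hp, hc, hc, hp]

theorem finrank_range_eq {p : Module.End K M} {p' : Module.End K N} (φ : M →ₗ[K] N)
    (ψ : N →ₗ[K] M) (h1 : ∀ x, p' (φ (p x)) = φ (p x)) (h2 : ∀ y, p (ψ (p' y)) = ψ (p' y))
    (h3 : ∀ x, ψ (φ (p x)) = p x) (h4 : ∀ y, φ (ψ (p' y)) = p' y) :
    Module.finrank K (LinearMap.range p) = Module.finrank K (LinearMap.range p') :=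
  LinearEquiv.finrank_eq
    { toFun := fun x => ⟨φ x, by obtain ⟨_, y, rfl⟩ := x; exact ⟨_, h1 y⟩⟩
      map_add' := fun x y => Subtype.ext (map_add φ _ _)
      map_smul' := fun k x => Subtype.ext (map_smul φ k _)
      invFun := fun x => ⟨ψ x, by obtain ⟨_, y, rfl⟩ := x; exact ⟨_, h2 y⟩⟩
      left_inv := by rintro ⟨_, y, rfl⟩; exact Subtype.ext (h3 y)
      right_inv := by rintro ⟨_, y, rfl⟩; exact Subtype.ext (h4 y) }

theorem tl_eq_pi (hv : Satisfies Ω v) (j : ι) :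
    tl v j = Submodule.pi Set.univ fun q : Ar Y j => LinearMap.range (v (.e q.1)) := by
  ext y
  rw [Submodule.mem_pi]
  exact ⟨fun h q _ => ⟨_, h q⟩, fun h q => (hv.nilpOn q.1).mem_range.1 (h q trivial)⟩

theorem finrank_tl [FiniteDimensional K M] (hv : Satisfies Ω v) (j : ι) {ν : ι → ℕ}
    (hν : ∀ k, Module.finrank K (LinearMap.range (v (.e k))) = ν k * Y.c k) :
    (Module.finrank K (tl v j) : ℤ) = Y.c j * (2 * ν j - ∑ k, Y.C j k * ν k) := by
  rw [tl_eq_pi hv, finrank_pi_submodule, Fintype.sum_sigma]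
  have h1 : ∀ k, ((∑ q : Fin (Y.g j k) × Fin (Y.f k j), Module.finrank K (LinearMap.range (v (.e
      (⟨k, q⟩ : Ar Y j).1))) : ℕ) : ℤ) = if k = j then 0 else -(Y.c j * (Y.C j k * ν k)) := by
    intro k
    simp only [hν, Finset.sum_const, Finset.card_univ, Fintype.card_prod, Fintype.card_fin,
      smul_eq_mul]
    split_ifs with h
    · subst h; simp [Y.g_self]
    · by_cases hn : Y.C j k < 0
      · have h2 := Y.g_mul_f j k (Ne.symm h)
        have h3 := Y.c_mul_f j k hn
        have h4 : (Y.C j k) = -((Y.g j k : ℤ) * Y.f j k) := by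
          rw [← Nat.cast_mul, h2]
          omega
        have h3' : (Y.c j : ℤ) * Y.f j k = Y.c k * Y.f k j := by exact_mod_cast h3
        rw [h4]
        push_cast
        linear_combination (-(Y.g j k : ℤ) * ν k) * h3'
      · have : Y.C j k = 0 := le_antisymm (Y.nonpos j k (Ne.symm h)) (not_lt.1 hn)
        simp [SymmGCM.g, this]
  rw [Nat.cast_sum, Finset.sum_congr rfl fun k _ => h1 k, Fintype.sum_eq_add_sum_compl j,
    Fintype.sum_eq_add_sum_compl j (fun k => Y.C j k * (ν k : ℤ)), if_pos rfl, Y.diag]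
  have h2 : ∀ k ∈ ({j}ᶜ : Finset ι), (if k = j then 0 else -((Y.c j : ℤ) * (Y.C j k * ν k))) =
      -((Y.c j : ℤ) * (Y.C j k * ν k)) := fun k hk => if_neg (by simpa using hk)
  rw [Finset.sum_congr rfl h2, Finset.sum_neg_distrib, ← Finset.mul_sum]
  ring

/-- The image of `⊕ₖ ⱼHₖ ⊗ Mₖ` in `M_j`. -/
def imIn (v : Gen Y → Module.End K M) (j : ι) : Submodule K M := (tl v j).map (inMap v j)

theorem finrank_reflR [FiniteDimensional K M] (v : Gen Y → Module.End K M) (j : ι) :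
    Module.finrank K (imIn v j) + Module.finrank K (reflR v j) = Module.finrank K (tl v j) :=
  finrank_map_add_inf_ker (inMap v j) (tl v j)

theorem imIn_le (hv : Satisfies Ω v) (j : ι) : imIn v j ≤ LinearMap.range (v (.e j)) := by
  rintro _ ⟨y, _, rfl⟩
  exact ⟨_, e_inMap hv j y⟩

theorem α_mem_imIn (hv : Satisfies Ω v) (j k : ι) (g) (x : M) : v (.α j k g) x ∈ imIn v j := by
  have hlt : 0 < Y.f k j := by have := Ar.last_lt k g; omega
  refine ⟨Pi.single ⟨k, g, ⟨0, hlt⟩⟩ (v (.e k) x), single_mem_tl (hv.e_e k x), ?_⟩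
  rw [inMap_single]
  simp [hv.α_e]

theorem eps_mem_imIn (hv : Satisfies Ω v) {j : ι} {x : M} (hx : x ∈ imIn v j) :
    v (.ε j) x ∈ imIn v j := by
  obtain ⟨y, hy, rfl⟩ := hx
  exact ⟨_, shift_mem_tl hv hy, inMap_shift hv j y⟩

end Filtration

/-! ### Stable representations of the framed algebra -/

section Stability

variable {K : Type*} [Field K] {ι : Type} [Fintype ι] [DecidableEq ι] {X : SymmGCM ι}
  {Ω : Orientation X} {M : Type*} [AddCommGroup M] [Module K M]
  {N : Type*} [AddCommGroup N] [Module K N]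
  {v : Gen X.framed → Module.End K M} {w : Gen X.framed → Module.End K N}

/-- Every subrepresentation that vanishes at the framing vertices is zero. -/
def Stable (v : Gen X.framed → Module.End K M) : Prop :=
  ∀ S : Submodule K M, Inv v S → (∀ l, ∀ x ∈ S, v (.e (.inr l)) x = 0) → S = ⊥

theorem Stable.of_injective (hs : Stable v) {φ : N →ₗ[K] M} (hφ : Function.Injective φ)
    (hc : ∀ a x, φ (w a x) = v a (φ x)) : Stable w := by
  intro S hS hS0
  have h := hs (S.map φ) (by
    rintro a _ ⟨x, hx, rfl⟩
    exact ⟨w a x, hS a x hx, hc a x⟩) (by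
    rintro l _ ⟨x, hx, rfl⟩
    rw [← hc, hS0 l x hx, map_zero])
  exact Submodule.map_injective_of_injective hφ (h.trans (Submodule.map_bot φ).symm)

/-- The kernel of `outMap` inside `M_j` is killed by all arrows, by `outMap_last`, and is stable
under `ε_j`; so it is a subrepresentation concentrated at an unframed vertex. -/
theorem Stable.outMap_injOn (hs : Stable v) (hv : Satisfies Ω.framed v) (j : ι) {x : M}
    (hx : v (.e (.inl j)) x = x) (h0 : outMap Ω.framed v (.inl j) x = 0) : x = 0 := by
  let S : Submodule K M :=
    LinearMap.ker (outMap Ω.framed v (.inl j)) ⊓ LinearMap.ker (1 - v (.e (.inl j)))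
  have hmem : ∀ y, y ∈ S ↔ outMap Ω.framed v (.inl j) y = 0 ∧ v (.e (.inl j)) y = y := by
    intro y
    rw [Submodule.mem_inf, LinearMap.mem_ker, LinearMap.mem_ker, LinearMap.sub_apply, sub_eq_zero,
      Module.End.one_apply, eq_comm (a := y)]
  have hS : S = ⊥ := by
    refine hs S ?_ ?_
    · rintro (i | i | ⟨i, k, g⟩) y hy
      · rw [hv.e_of_e ((hmem y).1 hy).2]
        split_ifs
        exacts [hy, S.zero_mem]
      · by_cases hi : Sum.inl j = i
        · subst hi
          exact (hmem _).2 ⟨by rw [outMap_eps hv, ((hmem y).1 hy).1, map_zero], hv.e_eps _ _⟩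
        · rw [hv.eps_of_e hi ((hmem y).1 hy).2]; exact S.zero_mem
      · by_cases hk : Sum.inl j = k
        · subst hk
          have h := outMap_last (Ω := Ω.framed) v (.inl j) i
            (Fin.cast (X.framed.g_comm i (.inl j)) g) y
          rw [((hmem y).1 hy).1, Pi.zero_apply, smul_zero] at h
          exact h ▸ S.zero_mem
        · rw [hv.α_of_e hk ((hmem y).1 hy).2]; exact S.zero_mem
    · intro l y hy
      rw [hv.e_of_e ((hmem y).1 hy).2, if_neg (by simp)]
  have := (hmem x).2 ⟨h0, hx⟩
  rwa [hS, Submodule.mem_bot] at this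

theorem Stable.toRefl_injective (hs : Stable v) (hv : Satisfies Ω.framed v) (j : ι) :
    Function.Injective (toRefl hv (.inl j)) := by
  rw [← LinearMap.ker_eq_bot, LinearMap.ker_eq_bot']
  intro x hx
  have h1 : outMap Ω.framed v (.inl j) x = 0 := congrArg (fun w => (w.1 : Ar X.framed (.inl j) → M)) hx
  have h2 : x - v (.e (.inl j)) x = 0 := congrArg (fun w => (w.2 : M)) hx
  exact hs.outMap_injOn hv j (sub_eq_zero.1 h2).symm h1

theorem toRefl_of_e_eq_zero {j : ι} (hv : Satisfies Ω.framed v) {x : M}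
    (hx : v (.e (.inl j)) x = 0) :
    (toRefl hv (.inl j) x).1 = 0 ∧ ((toRefl hv (.inl j) x).2 : M) = x := by
  refine ⟨Subtype.ext ?_, ?_⟩
  · rw [toRefl_fst, ← outMap_e hv, hx, map_zero]; rfl
  · rw [toRefl_snd, hx, sub_zero]

/-- A bad subrepresentation meets the image of `M` trivially, by stability of `M`, and that image
contains everything away from `j`. So it lives at `j`, and an element there is determined by the
arrows applied to its `ε_j`-multiples, which lie in the same subrepresentation and therefore vanish.
-/
theorem Stable.refl (hs : Stable v) (hv : Satisfies Ω.framed v) (j : ι) :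
    Stable (reflVal hv (.inl j)) := by
  intro S hS hS0
  have hT : S.comap (toRefl hv (.inl j)) = ⊥ := by
    refine hs _ ?_ ?_
    · intro a x hx
      rw [Submodule.mem_comap, toRefl_comm]
      exact hS a _ hx
    · intro l x hx
      apply hs.toRefl_injective hv j
      rw [toRefl_comm, map_zero]
      exact hS0 l _ hx
  have h1 : ∀ s ∈ S, s.2 = 0 := by
    intro s hs'
    have h := S.sub_mem hs' (hS (.e (.inl j)) s hs')
    rw [reflVal_e_self] at h
    have h2 : toRefl hv (.inl j) (s.2 : M) = s - (s.1, 0) := by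
      obtain ⟨h3, h4⟩ := toRefl_of_e_eq_zero hv (Refl.e_snd s)
      refine Refl.ext' ?_ ?_
      · rw [h3]; simp
      · rw [h4]; simp
    rw [← h2, ← Submodule.mem_comap, hT, Submodule.mem_bot] at h
    exact Subtype.ext h
  rw [Submodule.eq_bot_iff]
  intro s hs'
  refine Prod.ext (Subtype.ext (funext fun ⟨k, g, f⟩ => ?_)) (h1 s hs')
  have hpow : ∀ n, (reflVal hv (.inl j) (.ε (.inl j)) ^ n) s ∈ S := by
    intro n
    induction n with
    | zero => exact hs'
    | succ n ih => rw [pow_succ', Module.End.mul_apply]; exact hS _ _ ih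
  have h2 := h1 _ (hS (.α k (.inl j) (Fin.cast (X.framed.g_comm _ _) g)) _
    (hpow (X.framed.f k (.inl j) - 1 - f)))
  have h3 := (reflVal_α_out hv (.inl j)
    ((reflVal hv (.inl j) (.ε (.inl j)) ^ (X.framed.f k (.inl j) - 1 - (f : ℕ))) s) k
    (Fin.cast (X.framed.g_comm _ _) g)).2
  rw [h2, reflVal_eps_self_pow, shift_pow_apply _ _ _ _ _ _ (by omega)] at h3
  have hf := f.2
  rw [dif_pos (by dsimp only; omega)] at h3
  have h4 := congrArg (fun x => Ω.framed.sgn (.inl j) k • x) h3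
  rw [smul_smul, Ω.framed.sgn_mul_self, one_smul] at h4
  refine Eq.trans ?_ (h4.symm.trans (smul_zero _))
  have : f = ⟨X.framed.f k (.inl j) - 1 - (X.framed.f k (.inl j) - 1 - f), by omega⟩ :=
    Fin.ext (by dsimp only; omega)
  exact congrArg (fun f => (s.1 : Ar X.framed (.inl j) → M) ⟨k, g, f⟩) this

/-- The image of a homomorphism that vanishes at the framing vertices is a subrepresentation
vanishing there, hence zero; so restriction to the framing vertices is injective on homomorphisms.
-/
theorem finrank_homRep_le [FiniteDimensional K M] [FiniteDimensional K N]
    (hv : Satisfies Ω.framed v) (hw : Satisfies Ω.framed w) (hs : Stable w)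
    (hF : ∀ l, FreeOn (v (.e (.inr l))) (v (.ε (.inr l))) (X.c l)) {ρ : ι → ℕ}
    (hρ : ∀ l, Module.finrank K (LinearMap.range (v (.e (.inr l)))) = ρ l * X.c l) :
    Module.finrank K (homRep v w) ≤
      ∑ l, ρ l * Module.finrank K (LinearMap.range (w (.e (.inr l)))) := by
  let F : homRep v w →ₗ[K] ((l : ι) → NilpOn.homOn (v (.e (.inr l))) (v (.ε (.inr l)))
      (w (.e (.inr l))) (w (.ε (.inr l)))) :=
    { toFun := fun f l => ⟨w (.e (.inr l)) ∘ₗ f.1 ∘ₗ v (.e (.inr l)), by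
        constructor
        · ext x; simp [hv.e_e, hw.e_e]
        · have h1 := fun x => LinearMap.congr_fun (f.2 (.ε (.inr l))) x
          simp only [LinearMap.comp_apply] at h1
          ext x
          simp only [LinearMap.comp_apply, hw.eps_e, hv.e_eps, h1, hv.eps_e]
          rw [← h1, hw.e_eps]⟩
      map_add' := fun f g => by ext l x; simp
      map_smul' := fun k f => by ext l x; simp }
  have hF' : Function.Injective F := by
    rw [← LinearMap.ker_eq_bot, LinearMap.ker_eq_bot']
    rintro ⟨f, hf⟩ h0
    have hc : ∀ a x, w a (f x) = f (v a x) := fun a x => LinearMap.congr_fun (hf a) x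
    have h1 : LinearMap.range f = ⊥ := by
      refine hs _ ?_ ?_
      · rintro a _ ⟨x, rfl⟩
        exact ⟨v a x, (hc a x).symm⟩
      · rintro l _ ⟨x, rfl⟩
        have h2 := congrArg (fun G => (G l : M →ₗ[K] N) x) h0
        change w (.e (.inr l)) (f (v (.e (.inr l)) x)) = 0 at h2
        rwa [← hc, hw.e_e] at h2
    exact Subtype.ext (LinearMap.range_eq_bot.1 h1)
  refine (LinearMap.finrank_le_finrank_of_injective hF').trans ?_
  rw [Module.finrank_pi_fintype]
  refine Finset.sum_le_sum fun l _ => le_of_eq ?_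
  exact NilpOn.finrank_homOn (hv.nilpOn (.inr l)) (hF l) (hw.nilpOn (.inr l)) (hρ l)

variable (Ω) in
/-- Stable representations of the framed algebra with rank `1` at the framing vertex `k` and
rank `0` at the others. -/
structure Good (k : ι) (ν : ι → ℕ) (v : Gen X.framed → Module.End K M) : Prop where
  sat : Satisfies Ω.framed v
  fd : FiniteDimensional K M
  free : ∀ a, FreeOn (v (.e a)) (v (.ε a)) (X.framed.c a)
  rank : ∀ a, Module.finrank K (LinearMap.range (v (.e a))) =
    (Sum.elim ν (Pi.single k 1) a : ℕ) * X.framed.c a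
  -- No arrow leaves the framing vertices nontrivially, so the framed part is a subrepresentation;
  -- it will play the role of `Ñ(μ)`.
  frame : ∀ j l g, v (.α (.inl j) (.inr l) g) = 0
  stable : Stable v
  filt : EFilt v ⊤

/-- The weight `-ϖₖ + ∑ⱼ νⱼ αⱼ`. -/
def wt (X : SymmGCM ι) (k : ι) (ν : ι → ℕ) : ι → ℤ := X.cmap (fun j => (ν j : ℤ)) - Pi.single k 1

theorem sum_framed_C_inl (j k : ι) (ν : ι → ℕ) :
    ∑ b, X.framed.C (.inl j) b * ((Sum.elim ν (Pi.single k 1 : ι → ℕ) b : ℕ) : ℤ) =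
      wt X k ν j := by
  rw [Fintype.sum_sum_type]
  simp [SymmGCM.framed, wt, SymmGCM.cmap_apply, Matrix.one_apply, Pi.single_apply, sub_eq_add_neg,
    Nat.cast_ite]

theorem sum_framed_C_inr (l k : ι) (ν : ι → ℕ) :
    ∑ b, X.framed.C (.inr l) b * ((Sum.elim ν (Pi.single k 1 : ι → ℕ) b : ℕ) : ℤ) =
      -ν l + if l = k then 2 else 0 := by
  rw [Fintype.sum_sum_type]
  simp [SymmGCM.framed, Matrix.one_apply, Matrix.diagonal_apply, Pi.single_apply, Nat.cast_ite]

theorem Good.euler_le {k : ι} {ν ρ : ι → ℕ} (h : Good Ω k ν v) [FiniteDimensional K N]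
    (hw : Satisfies Ω.framed w)
    (hr : ∀ l, Module.finrank K (LinearMap.range (w (.e (.inr l)))) = ρ l * X.c l) :
    ∑ j, wt X k ν j * Module.finrank K (LinearMap.range (w (.e (.inl j)))) +
        2 * (X.c k * ρ k) ≤
      (Module.finrank K (homRep v w) : ℤ) + Module.finrank K (homRep w v) +
        ∑ l, (X.c l : ℤ) * (ρ l * ν l) := by
  have := h.fd
  have h1 := GenPreproj.euler_le h.sat hw h.free h.rank
  simp only [← Finset.sum_mul, Fintype.sum_sum_type (f := fun a => (∑ b, X.framed.C a b *
    ((Sum.elim ν (Pi.single k 1 : ι → ℕ) b : ℕ) : ℤ)) * _), sum_framed_C_inl,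
    sum_framed_C_inr] at h1
  have h2 : ∀ l, (-(ν l : ℤ) + if l = k then 2 else 0) *
      (Module.finrank K (LinearMap.range (w (.e (.inr l)))) : ℤ) =
      (if l = k then 2 * ((X.c k : ℤ) * ρ k) else 0) - (X.c l : ℤ) * (ρ l * ν l) := by
    intro l
    rw [hr]
    split_ifs with hl
    · subst hl; push_cast; ring
    · push_cast; ring
  rw [Finset.sum_congr rfl fun l _ => h2 l, Finset.sum_sub_distrib] at h1
  simp only [Finset.sum_ite_eq', Finset.mem_univ, if_true] at h1
  linarith

theorem Good.finrank_homRep_left {k : ι} {ν ρ : ι → ℕ} (h : Good Ω k ν v) [FiniteDimensional K N]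
    (hw : Satisfies Ω.framed w) (hs : Stable w)
    (hr : ∀ l, Module.finrank K (LinearMap.range (w (.e (.inr l)))) = ρ l * X.c l) :
    Module.finrank K (homRep v w) ≤ X.c k * ρ k := by
  have := h.fd
  refine (finrank_homRep_le h.sat hw hs (fun l => h.free (.inr l))
    (fun l => h.rank (.inr l))).trans (le_of_eq ?_)
  rw [Finset.sum_eq_single k]
  · rw [hr, Sum.elim_inr, Pi.single_eq_same, one_mul, mul_comm]
  · intro l _ hl
    rw [Sum.elim_inr, Pi.single_eq_of_ne hl, zero_mul]
  · simp

theorem Good.finrank_homRep_right {k : ι} {ν ρ : ι → ℕ} (h : Good Ω k ν v)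
    [FiniteDimensional K N] (hw : Satisfies Ω.framed w)
    (hF : ∀ l, FreeOn (w (.e (.inr l))) (w (.ε (.inr l))) (X.c l))
    (hr : ∀ l, Module.finrank K (LinearMap.range (w (.e (.inr l)))) = ρ l * X.c l) :
    Module.finrank K (homRep w v) ≤ X.c k * ρ k := by
  have := h.fd
  refine (finrank_homRep_le hw h.sat h.stable hF hr).trans (le_of_eq ?_)
  have h4 : ∀ l, Module.finrank K (LinearMap.range (v (.e (.inr l)))) =
      (Pi.single k 1 : ι → ℕ) l * X.c l := fun l => h.rank (.inr l)
  rw [Finset.sum_eq_single k]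
  · rw [h4, Pi.single_eq_same, one_mul, mul_comm]
  · intro l _ hl
    rw [h4, Pi.single_eq_of_ne hl, zero_mul, mul_zero]
  · simp

/-- Stability bounds both Hom spaces by `c k * ρ k`, which exactly cancels the term `2 c k ρ k` of
the Euler form at the framing vertex. A linear inequality for the dimensions of `w` at the unframed
vertices remains. -/
theorem Good.sum_le {k : ι} {ν ρ : ι → ℕ} (h : Good Ω k ν v) [FiniteDimensional K N]
    (hw : Satisfies Ω.framed w) (hs : Stable w)
    (hF : ∀ l, FreeOn (w (.e (.inr l))) (w (.ε (.inr l))) (X.c l))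
    (hr : ∀ l, Module.finrank K (LinearMap.range (w (.e (.inr l)))) = ρ l * X.c l) :
    ∑ j, wt X k ν j * Module.finrank K (LinearMap.range (w (.e (.inl j)))) ≤
      ∑ l, (X.c l : ℤ) * (ρ l * ν l) := by
  have h1 := h.euler_le hw hr
  have h2 : (Module.finrank K (homRep v w) : ℤ) ≤ X.c k * ρ k := by
    exact_mod_cast h.finrank_homRep_left hw hs hr
  have h3 : (Module.finrank K (homRep w v) : ℤ) ≤ X.c k * ρ k := by
    exact_mod_cast h.finrank_homRep_right hw hF hr
  linarith

/-- Weyl invariance in disguise: ranks belonging to the same group element `s` attain equality in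
`Good.sum_le`. A stable representation deviating from such ranks at a single vertex thus deviates in
a direction fixed by the sign of the weight there. -/
theorem Good.pr_wt (hX : X.IsFiniteType) {s : (ι → ℤ) ≃ₗ[ℤ] (ι → ℤ)} (hs : s ∈ X.weylGroup)
    {k : ι} {ν ν' ρ : ι → ℕ} (h : s (-Pi.single k 1) = wt X k ν)
    (h' : s (-fun l => (ρ l : ℤ)) = X.cmap (fun j => (ν' j : ℤ)) - fun l => (ρ l : ℤ)) :
    ∑ j, wt X k ν j * (X.c j * ν' j) = ∑ l, (X.c l : ℤ) * (ρ l * ν l) := by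
  have h1 := X.pr_diff hX hs (h.trans (sub_eq_neg_add _ _)) (h'.trans (sub_eq_neg_add _ _))
  rw [← Pi.single_neg, X.pr_single_left] at h1
  have h2 : ∑ j, wt X k ν j * (X.c j * ν' j) = X.pr (wt X k ν) (fun j => (ν' j : ℤ)) := by
    rw [SymmGCM.pr_apply]
    exact Finset.sum_congr rfl fun j _ => by ring
  have h3 : ∑ l, (X.c l : ℤ) * (ρ l * ν l) =
      X.pr (fun l => (ρ l : ℤ)) (fun j => (ν j : ℤ)) := rfl
  rw [h2, h3, wt, map_sub, LinearMap.sub_apply, X.pr_single_left]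
  rw [map_neg, LinearMap.neg_apply] at h1
  linarith

/-- Comparison of a good representation with a stable representation of almost the same
dimension vector. -/
theorem Good.mul_wt_nonpos (hX : X.IsFiniteType) {s : (ι → ℤ) ≃ₗ[ℤ] (ι → ℤ)}
    (hsW : s ∈ X.weylGroup) {k k' : ι} {ν ν' : ι → ℕ} (h1 : s (-Pi.single k 1) = wt X k ν)
    (h1' : s (-Pi.single k' 1) = wt X k' ν') (h : Good Ω k ν v) [FiniteDimensional K N]
    (hw : Satisfies Ω.framed w) (hs : Stable w)
    (hF : ∀ l, FreeOn (w (.e (.inr l))) (w (.ε (.inr l))) (X.c l))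
    (hr : ∀ l, Module.finrank K (LinearMap.range (w (.e (.inr l)))) =
      (Pi.single k' 1 : ι → ℕ) l * X.c l) (j : ι)
    (hj : ∀ i, i ≠ j → Module.finrank K (LinearMap.range (w (.e (.inl i)))) = ν' i * X.c i) :
    wt X k ν j * (Module.finrank K (LinearMap.range (w (.e (.inl j)))) - X.c j * ν' j) ≤ 0 := by
  have h2 := h.sum_le hw hs hF hr
  have hρ : (fun l => ((Pi.single k' 1 : ι → ℕ) l : ℤ)) = Pi.single k' 1 := by
    funext l
    by_cases hl : l = k'
    · subst hl; simp
    · simp [Pi.single_eq_of_ne hl]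
  rw [← Good.pr_wt hX hsW h1 (ρ := Pi.single k' 1) (ν' := ν') (by rw [hρ]; exact h1'), ← sub_nonpos,
    ← Finset.sum_sub_distrib,
    Finset.sum_eq_single j] at h2
  · rw [mul_sub]; exact h2
  · intro i _ hi
    rw [hj i hi]
    push_cast
    ring
  · simp

end Stability

/-! ### Reflecting a family of stable representations -/

section ReflectGood

variable {K : Type*} [Field K] {ι : Type} [Fintype ι] [DecidableEq ι] {X : SymmGCM ι}
  {Ω : Orientation X} {M : Type*} [AddCommGroup M] [Module K M]
  {N : Type*} [AddCommGroup N] [Module K N]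
  {v : Gen X.framed → Module.End K M} {w : Gen X.framed → Module.End K N}

theorem finrank_range_restrict {p : Module.End K M} {T : Submodule K M}
    (h : ∀ x ∈ T, p x ∈ T) :
    Module.finrank K (LinearMap.range (p.restrict h)) = Module.finrank K (T.map p) := by
  have : (LinearMap.range (p.restrict h)).map T.subtype = T.map p := by
    ext x
    constructor
    · rintro ⟨_, ⟨y, rfl⟩, rfl⟩
      exact ⟨y, y.2, rfl⟩
    · rintro ⟨y, hy, rfl⟩
      exact ⟨_, ⟨⟨y, hy⟩, rfl⟩, rfl⟩
  rw [← this]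
  exact ((LinearMap.range (p.restrict h)).equivMapOfInjective T.subtype
    T.injective_subtype).finrank_eq

/-- The largest subrepresentation whose space at `j` is generated by the other vertices. -/
def imSub (v : Gen X.framed → Module.End K M) (j : ι) : Submodule K M :=
  (imIn v (.inl j)).comap (v (.e (.inl j)))

theorem mem_imSub_of_e (hv : Satisfies Ω.framed v) {j : ι} {a : ι ⊕ ι} (ha : a ≠ .inl j) {x : M}
    (hx : v (.e a) x = x) : x ∈ imSub v j := by
  rw [imSub, Submodule.mem_comap, hv.e_of_e hx, if_neg ha.symm]
  exact Submodule.zero_mem _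

theorem imSub_inv (hv : Satisfies Ω.framed v) (j : ι) : Inv v (imSub v j) := by
  rintro (i | i | ⟨i, k, g⟩) x hx
  · by_cases hi : i = .inl j
    · subst hi
      rw [imSub, Submodule.mem_comap, hv.e_e]; exact hx
    · exact mem_imSub_of_e hv hi (hv.e_e _ _)
  · by_cases hi : i = .inl j
    · subst hi
      rw [imSub, Submodule.mem_comap, hv.e_eps, ← hv.eps_e]; exact eps_mem_imIn hv hx
    · exact mem_imSub_of_e hv hi (hv.e_eps _ _)
  · by_cases hi : i = .inl j
    · subst hi
      rw [imSub, Submodule.mem_comap, hv.e_α]; exact α_mem_imIn hv _ _ _ _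
    · exact mem_imSub_of_e hv hi (hv.e_α _ _ _ _)

theorem finrank_reflVal_e_self (hv : Satisfies Ω.framed v) (j : ι) :
    Module.finrank K (LinearMap.range (reflVal hv (.inl j) (.e (.inl j)))) =
      Module.finrank K (reflR v (.inl j)) := by
  rw [finrank_range_eq (p' := (1 : Module.End K (reflR v (.inl j)))) (LinearMap.fst K _ _)
    (LinearMap.inl K _ _)]
  · rw [Module.End.one_eq_id, LinearMap.range_id, finrank_top]
  · intro x; rfl
  · intro y; rw [reflVal_e_self]; rfl
  · intro x; rw [reflVal_e_self]; rfl
  · intro y; rfl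

theorem finrank_reflVal_e_ne (hv : Satisfies Ω.framed v) {j : ι} {a : ι ⊕ ι} (ha : a ≠ .inl j) :
    Module.finrank K (LinearMap.range (reflVal hv (.inl j) (.e a))) =
      Module.finrank K (LinearMap.range (v (.e a))) := by
  refine finrank_range_eq ((reflZ v (.inl j)).subtype ∘ₗ LinearMap.snd K _ _)
    (LinearMap.inr K _ _ ∘ₗ reflPr hv (.inl j)) ?_ ?_ ?_ ?_
  · intro x
    change v (.e a) ((reflVal hv (.inl j) (.e a) x).2 : M) = (reflVal hv (.inl j) (.e a) x).2
    rw [(reflVal_e_ne hv _ x ha).2, hv.e_e]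
  · intro y
    have h := coe_reflPr_of_e hv ha (hv.e_e a y)
    refine Refl.ext' ?_ ?_
    · rw [(reflVal_e_ne hv _ _ ha).1]; rfl
    · rw [(reflVal_e_ne hv _ _ ha).2]
      change v (.e a) (reflPr hv (.inl j) (v (.e a) y) : M) = reflPr hv (.inl j) (v (.e a) y)
      rw [h, hv.e_e]
  · intro x
    refine Refl.ext' ?_ ?_
    · rw [(reflVal_e_ne hv _ _ ha).1]; rfl
    · change (reflPr hv (.inl j) ((reflVal hv (.inl j) (.e a) x).2 : M) : M) =
        (reflVal hv (.inl j) (.e a) x).2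
      rw [(reflVal_e_ne hv _ x ha).2, coe_reflPr_of_e hv ha (hv.e_e a _)]
  · intro y
    exact coe_reflPr_of_e hv ha (hv.e_e a y)

theorem freeOn_reflVal_ne (hv : Satisfies Ω.framed v) {j : ι} {a : ι ⊕ ι} (ha : a ≠ .inl j)
    {c : ℕ} (hF : FreeOn (v (.e a)) (v (.ε a)) c) :
    FreeOn (reflVal hv (.inl j) (.e a)) (reflVal hv (.inl j) (.ε a)) c := by
  intro x hx h0
  have h1 := reflVal_e_ne hv (.inl j) x ha
  have h2 := reflVal_eps_ne hv (.inl j) x ha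
  rw [hx] at h1
  rw [h0] at h2
  obtain ⟨y, hy, hyx⟩ := hF _ h1.2.symm h2.2.symm
  have h3 : (reflPr hv (.inl j) y : M) = y := coe_reflPr_of_e hv ha hy
  refine ⟨(0, reflPr hv (.inl j) y), Refl.ext' ?_ ?_, Refl.ext' ?_ ?_⟩
  · rw [(reflVal_e_ne hv _ _ ha).1]
  · rw [(reflVal_e_ne hv _ _ ha).2]
    change v (.e a) (reflPr hv (.inl j) y : M) = reflPr hv (.inl j) y
    rw [h3, hy]
  · rw [reflVal_eps_ne_pow_fst hv _ _ ha _ rfl, h1.1]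
  · rw [reflVal_eps_ne_pow hv _ _ ha]
    change (v (.ε a) ^ (c - 1)) (reflPr hv (.inl j) y : M) = x.2
    rw [h3, hyx]

/-- The kernel of a surjection between free modules is free. The preimage `z` from `shift_free` maps
to `ε_j x` for some `x`; surjectivity lifts `x` to `t`, and `z - shift t` lies in the kernel with
the same image under the top power. -/
theorem freeOn_reflR (hv : Satisfies Ω.framed v)
    (hF : ∀ a, FreeOn (v (.e a)) (v (.ε a)) (X.framed.c a)) {j : ι}
    (hs : imIn v (.inl j) = LinearMap.range (v (.e (.inl j)))) {y : Ar X.framed (.inl j) → M}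
    (hy : y ∈ reflR v (.inl j)) (h0 : shift v (.inl j) y = 0) :
    ∃ z ∈ reflR v (.inl j), (shift v (.inl j) ^ (X.framed.c (.inl j) - 1)) z = y := by
  obtain ⟨z, hz, hzy⟩ := shift_free hv hF _ hy.1 h0
  have hc := X.framed.c_pos (.inl j)
  have hin : ∀ n z, inMap v (.inl j) ((shift v (.inl j) ^ n) z) =
      (v (.ε (.inl j)) ^ n) (inMap v (.inl j) z) := fun n z =>
    (pow_comp_of_comm (LinearMap.ext fun y => (inMap_shift hv _ y).symm) n z).symm
  have hin0 : (v (.ε (.inl j)) ^ (X.framed.c (.inl j) - 1)) (inMap v (.inl j) z) = 0 := by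
    rw [← hin, hzy]; exact hy.2
  obtain ⟨x, hx, hxz⟩ := (hv.nilpOn (.inl j)).eps_injOn_of_pow (hF (.inl j)) _
    (Nat.sub_le _ 1) _ (e_inMap hv _ z) hin0
  rw [Nat.sub_sub_self hc, pow_one] at hxz
  have hxi : x ∈ imIn v (.inl j) := by rw [hs]; exact ⟨x, hx⟩
  obtain ⟨t, ht, rfl⟩ := hxi
  refine ⟨z - shift v (.inl j) t, ⟨Submodule.sub_mem _ hz (shift_mem_tl hv ht), ?_⟩, ?_⟩
  · change inMap v (.inl j) (z - shift v (.inl j) t) = 0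
    rw [map_sub, inMap_shift hv, hxz, sub_self]
  · rw [map_sub, ← Module.End.mul_apply, ← pow_succ, Nat.sub_add_cancel hc, shift_pow_c hv, hzy,
      LinearMap.zero_apply, sub_zero]

theorem freeOn_reflVal_self (hv : Satisfies Ω.framed v)
    (hF : ∀ a, FreeOn (v (.e a)) (v (.ε a)) (X.framed.c a)) {j : ι}
    (hs : imIn v (.inl j) = LinearMap.range (v (.e (.inl j)))) :
    FreeOn (reflVal hv (.inl j) (.e (.inl j))) (reflVal hv (.inl j) (.ε (.inl j)))
      (X.framed.c (.inl j)) := by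
  intro x hx h0
  rw [reflVal_e_self] at hx
  rw [reflVal_eps_self] at h0
  have h1 : x.2 = 0 := (congrArg Prod.snd hx).symm
  obtain ⟨z, hz, hzx⟩ := freeOn_reflR hv hF hs x.1.2
    (congrArg (fun w => (w.1 : Ar X.framed (.inl j) → M)) h0)
  refine ⟨(⟨z, hz⟩, 0), by rw [reflVal_e_self], Refl.ext' ?_ ?_⟩
  · rw [reflVal_eps_self_pow, hzx]
  · rw [reflVal_eps_self_pow_snd _ _ _ _ rfl, h1]

/-- By stability `M` embeds in its reflection, which carries the filtration over. The quotient sits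
at `j` and is free, being the cokernel of an injection of free modules over a self-injective
algebra, so `EFilt.extend` finishes. -/
theorem eFilt_reflVal [FiniteDimensional K M] (hv : Satisfies Ω.framed v) (hst : Stable v)
    (hF : ∀ a, FreeOn (v (.e a)) (v (.ε a)) (X.framed.c a)) {j : ι}
    (hs : imIn v (.inl j) = LinearMap.range (v (.e (.inl j)))) (hf : EFilt v ⊤) :
    EFilt (reflVal hv (.inl j)) ⊤ := by
  have hmap := hf.map (hst.toRefl_injective hv j) (toRefl_comm hv (.inl j))
  refine hmap.extend (reflVal_satisfies hv _) (.inl j) ?_ ?_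
  · intro x
    refine ⟨x.2, trivial, ?_⟩
    obtain ⟨h3, h4⟩ := toRefl_of_e_eq_zero hv (Refl.e_snd x)
    rw [reflVal_e_self]
    refine Refl.ext' ?_ ?_
    · rw [h3]; simp
    · rw [h4]; simp
  · rintro x hx ⟨m, -, hm⟩
    rw [reflVal_e_self] at hx
    rw [reflVal_eps_self] at hm
    have hx2 : x.2 = 0 := (congrArg Prod.snd hx).symm
    have hm1 : outMap Ω.framed v (.inl j) m = shift v (.inl j) x.1 :=
      congrArg (fun w => (w.1 : Ar X.framed (.inl j) → M)) hm
    have hm2 : m - v (.e (.inl j)) m = 0 := congrArg (fun w => (w.2 : M)) hm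
    have hme : v (.e (.inl j)) m = m := (sub_eq_zero.1 hm2).symm
    have hc := X.framed.c_pos (.inl j)
    have hout : ∀ n x, outMap Ω.framed v (.inl j) ((v (.ε (.inl j)) ^ n) x) =
      (shift v (.inl j) ^ n) (outMap Ω.framed v (.inl j) x) := fun n z =>
        (pow_comp_of_comm (LinearMap.ext fun y => (outMap_eps hv _ y).symm) n z).symm
    have hm0 : (v (.ε (.inl j)) ^ (X.framed.c (.inl j) - 1)) m = 0 := by
      refine hst.outMap_injOn hv j ((hv.nilpOn _).apply_pow hme _) ?_
      rw [hout, hm1, ← Module.End.mul_apply, ← pow_succ, Nat.sub_add_cancel hc, shift_pow_c hv,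
        LinearMap.zero_apply]
    obtain ⟨m', hm', hmm⟩ := (hv.nilpOn (.inl j)).eps_injOn_of_pow (hF (.inl j)) _
      (Nat.sub_le _ 1) _ hme hm0
    rw [Nat.sub_sub_self hc, pow_one] at hmm
    obtain ⟨z, hz, hzx⟩ := freeOn_reflR hv hF hs (y := x.1 - outMap Ω.framed v (.inl j) m')
      (Submodule.sub_mem _ x.1.2 (outMap_mem_reflR hv _ _)) (by
        rw [map_sub, ← outMap_eps hv, hmm, hm1, sub_self])
    refine ⟨(⟨z, hz⟩, 0), by rw [reflVal_e_self], ⟨m', trivial, ?_⟩⟩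
    refine Refl.ext' ?_ ?_
    · rw [toRefl_fst, Prod.fst_sub, Submodule.coe_sub, reflVal_eps_self_pow, hzx, sub_sub_cancel]
    · rw [toRefl_snd, hm', sub_self, Prod.snd_sub, hx2, reflVal_eps_self_pow_snd _ _ _ _ rfl,
        sub_zero, Submodule.coe_zero]

theorem Good.finrank_add {k : ι} {ν : ι → ℕ} (h : Good Ω k ν v) (j : ι) :
    (Module.finrank K (imIn v (.inl j)) : ℤ) + Module.finrank K (reflR v (.inl j)) =
      X.c j * (2 * ν j - wt X k ν j) := by
  have := h.fd
  have h1 := finrank_tl h.sat (.inl j) h.rank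
  rw [sum_framed_C_inl] at h1
  have h2 := finrank_reflR v (.inl j)
  rw [← Nat.cast_add, h2, h1]
  rfl

theorem Good.finrank_reflR {k : ι} {ν : ι → ℕ} (h : Good Ω k ν v) {j : ι}
    (hs : imIn v (.inl j) = LinearMap.range (v (.e (.inl j)))) :
    (Module.finrank K (reflR v (.inl j)) : ℤ) = X.c j * (ν j - wt X k ν j) := by
  have h1 := h.finrank_add j
  rw [hs, h.rank] at h1
  have h2 : ((Sum.elim ν (Pi.single k 1 : ι → ℕ) (.inl j) * X.framed.c (.inl j) : ℕ) : ℤ) =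
    X.c j * ν j := by rw [mul_comm]; push_cast; rfl
  rw [h2] at h1
  linarith

theorem Good.wt_le {k : ι} {ν : ι → ℕ} (h : Good Ω k ν v) {j : ι}
    (hs : imIn v (.inl j) = LinearMap.range (v (.e (.inl j)))) : wt X k ν j ≤ ν j := by
  have h1 := h.finrank_reflR hs
  have h2 : (0 : ℤ) < X.c j := by exact_mod_cast X.c_pos j
  have h3 : 0 ≤ (X.c j : ℤ) * (ν j - wt X k ν j) := h1 ▸ Nat.cast_nonneg _
  have := nonneg_of_mul_nonneg_right h3 h2
  linarith

theorem wt_update (k j : ι) (ν : ι → ℕ) (h : wt X k ν j ≤ ν j) :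
    wt X k (Function.update ν j (ν j - wt X k ν j).toNat) = X.reflection j (wt X k ν) := by
  have h1 : (fun i => ((Function.update ν j (ν j - wt X k ν j).toNat i : ℕ) : ℤ)) =
      (fun i => (ν i : ℤ)) - Pi.single j (wt X k ν j) := by
    funext i
    by_cases hi : i = j
    · subst hi
      rw [Function.update_self, Int.toNat_of_nonneg (by linarith)]
      simp
    · simp [Function.update_of_ne hi, Pi.single_eq_of_ne hi]
  change X.cmap _ - _ = (X.cmap _ - _) - wt X k ν j • X.simpleRoot j
  rw [h1, map_sub, X.cmap_single, sub_right_comm]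

theorem Good.refl {k : ι} {ν : ι → ℕ} (h : Good Ω k ν v) {j : ι}
    (hs : imIn v (.inl j) = LinearMap.range (v (.e (.inl j)))) :
    Good Ω k (Function.update ν j (ν j - wt X k ν j).toNat) (reflVal h.sat (.inl j)) := by
  have := h.fd
  refine ⟨reflVal_satisfies _ _, inferInstance, ?_, ?_, ?_, h.stable.refl _ _,
    eFilt_reflVal h.sat h.stable h.free hs h.filt⟩
  · intro a
    by_cases ha : a = .inl j
    · subst ha; exact freeOn_reflVal_self h.sat h.free hs
    · exact freeOn_reflVal_ne h.sat ha (h.free a)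
  · intro a
    by_cases ha : a = .inl j
    · subst ha
      rw [finrank_reflVal_e_self]
      have h1 := h.finrank_reflR hs
      have h2 := h.wt_le hs
      zify
      rw [h1, Sum.elim_inl, Function.update_self, Int.toNat_of_nonneg (by linarith), mul_comm]
      rfl
    · rw [finrank_reflVal_e_ne _ ha, h.rank]
      congr 1
      rcases a with a | a
      · rw [Sum.elim_inl, Sum.elim_inl, Function.update_of_ne (fun e => ha (by rw [e]))]
      · rfl
  · intro i l g
    refine LinearMap.ext fun x => ?_
    by_cases hi : i = j
    · subst hi
      have h1 := reflVal_α_in h.sat (.inl i) x (.inr l) g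
      refine Refl.ext' ?_ ?_
      · rw [h1.1, h.frame, LinearMap.zero_apply, map_zero]; rfl
      · rw [h1.2]; rfl
    · have h1 := reflVal_α_ne h.sat (.inl j) x (a := .inl i) (b := .inr l) (by simpa using hi)
        (by simp) g
      refine Refl.ext' ?_ ?_
      · rw [h1.1]; rfl
      · rw [h1.2, h.frame]; rfl

/-- The comparison is made with the reflection of `w` at `j`: it is stable and differs from `w` only
at `j`, where its freeness is not required. -/
theorem Good.mul_finrank_reflR_le (hX : X.IsFiniteType) {s : (ι → ℤ) ≃ₗ[ℤ] (ι → ℤ)}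
    (hsW : s ∈ X.weylGroup) {k k' : ι} {ν ν' : ι → ℕ} (h1 : s (-Pi.single k 1) = wt X k ν)
    (h1' : s (-Pi.single k' 1) = wt X k' ν') (h : Good Ω k ν v) (h' : Good Ω k' ν' w) (j : ι) :
    wt X k ν j * (Module.finrank K (reflR w (.inl j)) - X.c j * ν' j) ≤ 0 := by
  have := h'.fd
  rw [← finrank_reflVal_e_self h'.sat]
  refine h.mul_wt_nonpos hX hsW h1 h1' (reflVal_satisfies h'.sat (.inl j)) (h'.stable.refl _ _)
    (fun l => freeOn_reflVal_ne _ (by simp) (h'.free (.inr l)))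
    (fun l => ?_) j fun i hi => ?_
  · rw [finrank_reflVal_e_ne _ (by simp), h'.rank]; rfl
  · rw [finrank_reflVal_e_ne _ (by simpa using hi), h'.rank]; rfl

/-- Here the comparison is made with the subrepresentation `imSub w j`, which agrees with `w` away
from `j` and has the image of the incoming map at `j`. -/
theorem Good.mul_finrank_imIn_le (hX : X.IsFiniteType) {s : (ι → ℤ) ≃ₗ[ℤ] (ι → ℤ)}
    (hsW : s ∈ X.weylGroup) {k k' : ι} {ν ν' : ι → ℕ} (h1 : s (-Pi.single k 1) = wt X k ν)
    (h1' : s (-Pi.single k' 1) = wt X k' ν') (h : Good Ω k ν v) (h' : Good Ω k' ν' w) (j : ι) :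
    wt X k ν j * (Module.finrank K (imIn w (.inl j)) - X.c j * ν' j) ≤ 0 := by
  have := h'.fd
  have hinv := imSub_inv h'.sat j
  let w' : Gen X.framed → Module.End K (imSub w j) := fun a => (w a).restrict (hinv a)
  have hc : ∀ a x, (imSub w j).subtype (w' a x) = w a ((imSub w j).subtype x) := fun _ _ => rfl
  have hinj := (imSub w j).injective_subtype
  have hne : ∀ a, a ≠ .inl j → Module.finrank K (LinearMap.range (w' (.e a))) =
      Module.finrank K (LinearMap.range (w (.e a))) := by
    intro a ha
    rw [finrank_range_restrict]
    have : (imSub w j).map (w (.e a)) = LinearMap.range (w (.e a)) := by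
      refine le_antisymm LinearMap.map_le_range ?_
      rintro _ ⟨x, rfl⟩
      exact ⟨w (.e a) x, mem_imSub_of_e h'.sat ha (h'.sat.e_e _ _), h'.sat.e_e _ _⟩
    rw [this]
  have hj : Module.finrank K (LinearMap.range (w' (.e (.inl j)))) =
      Module.finrank K (imIn w (.inl j)) := by
    rw [finrank_range_restrict]
    have : (imSub w j).map (w (.e (.inl j))) = imIn w (.inl j) := by
      refine le_antisymm ?_ ?_
      · rintro _ ⟨x, hx, rfl⟩
        exact hx
      · intro x hx
        have hex : w (.e (.inl j)) x = x :=
          (h'.sat.nilpOn _).mem_range.1 (imIn_le h'.sat _ hx)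
        refine ⟨x, ?_, hex⟩
        change w (.e (.inl j)) x ∈ imIn w (.inl j)
        rwa [hex]
    rw [this]
  rw [← hj]
  refine h.mul_wt_nonpos hX hsW h1 h1' (w := w') (h'.sat.of_injective hinj hc)
    (h'.stable.of_injective hinj hc) (fun l => ?_)
    (fun l => ?_) j fun i hi => ?_
  · intro x hx h0
    obtain ⟨y, hy, hyx⟩ := h'.free (.inr l) x (congrArg (imSub w j).subtype hx)
      (congrArg (imSub w j).subtype h0)
    have hyT : y ∈ imSub w j := mem_imSub_of_e h'.sat (by simp) hy
    refine ⟨⟨y, hyT⟩, Subtype.ext hy, Subtype.ext ?_⟩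
    rw [← hyx]
    exact (pow_comp_of_comm (τ' := w (.ε (.inr l))) (τ := w' (.ε (.inr l)))
      (α := (imSub w j).subtype) (LinearMap.ext fun x => (hc _ x).symm) _ (⟨y, hyT⟩ : imSub w j)).symm
  · rw [hne _ (by simp), h'.rank]; rfl
  · rw [hne _ (by simpa using hi), h'.rank]; rfl

theorem Good.finrank_range_inl {k' : ι} {ν' : ι → ℕ} (h' : Good Ω k' ν' w) (j : ι) :
    Module.finrank K (LinearMap.range (w (.e (.inl j)))) = X.c j * ν' j := by
  rw [h'.rank, mul_comm]; rfl

/-- A single member with negative weight at `j` turns the comparison into a lower bound for the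
image, and so makes the incoming map onto for every member belonging to the same `s`. -/
theorem Good.imIn_eq_of_wt_neg (hX : X.IsFiniteType) {s : (ι → ℤ) ≃ₗ[ℤ] (ι → ℤ)}
    (hsW : s ∈ X.weylGroup) {k k' : ι} {ν ν' : ι → ℕ} (h1 : s (-Pi.single k 1) = wt X k ν)
    (h1' : s (-Pi.single k' 1) = wt X k' ν') (h : Good Ω k ν v) (h' : Good Ω k' ν' w) {j : ι}
    (hj : wt X k ν j < 0) : imIn w (.inl j) = LinearMap.range (w (.e (.inl j))) := by
  have := h'.fd
  have h2 := nonneg_of_mul_nonpos_right (h.mul_finrank_imIn_le hX hsW h1 h1' h' j) hj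
  refine Submodule.eq_of_le_of_finrank_le (imIn_le h'.sat _) ?_
  rw [h'.finrank_range_inl]
  zify
  linarith

/-- A single member with positive weight at `j` bounds the kernel of `inMap` from above by `dim
M_j`, while stability embeds `M_j` into it; the two therefore agree for every member belonging to
`s`. -/
theorem Good.exact_of_wt_pos (hX : X.IsFiniteType) {s : (ι → ℤ) ≃ₗ[ℤ] (ι → ℤ)}
    (hsW : s ∈ X.weylGroup) {k k' : ι} {ν ν' : ι → ℕ} (h1 : s (-Pi.single k 1) = wt X k ν)
    (h1' : s (-Pi.single k' 1) = wt X k' ν') (h : Good Ω k ν v) (h' : Good Ω k' ν' w) {j : ι}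
    (hj : 0 < wt X k ν j) :
    (LinearMap.range (w (.e (.inl j)))).map (outMap Ω.framed w (.inl j)) = reflR w (.inl j) := by
  have := h'.fd
  have h2 := nonpos_of_mul_nonpos_right (h.mul_finrank_reflR_le hX hsW h1 h1' h' j) hj
  refine Submodule.eq_of_le_of_finrank_le ?_ ?_
  · rintro _ ⟨x, -, rfl⟩
    exact outMap_mem_reflR h'.sat _ _
  · have h3 := finrank_map_add_inf_ker (outMap Ω.framed w (.inl j))
      (LinearMap.range (w (.e (.inl j))))
    have h4 : LinearMap.range (w (.e (.inl j))) ⊓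
        LinearMap.ker (outMap Ω.framed w (.inl j)) = ⊥ := by
      rw [Submodule.eq_bot_iff]
      rintro x ⟨hx, hx0⟩
      exact h'.stable.outMap_injOn h'.sat j ((h'.sat.nilpOn _).mem_range.1 hx) hx0
    rw [h4, finrank_bot, add_zero] at h3
    rw [h3, h'.finrank_range_inl]
    zify
    linarith

end ReflectGood

/-! ### The stable representations attached to the lowest weights -/

section Iteration

variable {K : Type u} [Field K] {ι : Type} [Fintype ι] [DecidableEq ι] {X : SymmGCM ι}
  {Ω : Orientation X}

/-- The generalized simple representation at the framing vertex `k`. -/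
def initVal (K : Type u) [Field K] (X : SymmGCM ι) (k : ι) :
    Gen X.framed → Module.End K (AdjoinRoot (Polynomial.X ^ X.c k : K[X]))
  | .e a => if a = .inr k then 1 else 0
  | .ε a => if a = .inr k then LinearMap.mulLeft K (AdjoinRoot.root _) else 0
  | .α _ _ _ => 0

theorem good_initVal (Ω : Orientation X) (k : ι) : Good Ω k 0 (initVal K X k) := by
  have hc := X.c_pos k
  have hmonic : (Polynomial.X ^ X.c k : K[X]).Monic := Polynomial.monic_X_pow _
  have hsat : Satisfies Ω.framed (initVal K X k) := by
    refine ⟨?_, ?_, ?_, ?_, ?_, ?_, ?_⟩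
    · intro a b
      by_cases ha : a = .inr k <;> by_cases hb : b = .inr k <;> by_cases hab : a = b <;>
        simp_all [initVal]
    · simp [initVal]
    · intro a
      by_cases ha : a = .inr k <;> simp [initVal, ha]
    · intro a b g; simp [initVal]
    · intro a
      by_cases ha : a = .inr k
      · subst ha
        simp only [initVal, if_true]
        rw [LinearMap.pow_mulLeft]
        have : (AdjoinRoot.root (Polynomial.X ^ X.c k : K[X])) ^ X.framed.c (.inr k) = 0 := by
          rw [← AdjoinRoot.mk_X, ← map_pow]
          exact AdjoinRoot.mk_self
        rw [this, LinearMap.mulLeft_zero_eq_zero]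
      · simp only [initVal, if_neg ha]
        exact zero_pow (by have := X.framed.c_pos a; omega)
    · intro a b g; simp [initVal]
    · intro a; simp [mesh, initVal]
  have hfd : FiniteDimensional K (AdjoinRoot (Polynomial.X ^ X.c k : K[X])) :=
    (AdjoinRoot.powerBasis' hmonic).finite
  refine ⟨hsat, hfd, ?_, ?_, fun _ _ _ => rfl, ?_, ?_⟩
  · intro a x hx h0
    by_cases ha : a = .inr k
    · subst ha
      obtain ⟨p, rfl⟩ := AdjoinRoot.mk_surjective x
      simp only [initVal, if_true, LinearMap.mulLeft_apply] at h0
      rw [← AdjoinRoot.mk_X, ← map_mul, AdjoinRoot.mk_eq_zero] at h0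
      obtain ⟨q, hq⟩ := h0
      have : p = Polynomial.X ^ (X.c k - 1) * q := by
        apply mul_left_cancel₀ (Polynomial.X_ne_zero (R := K))
        rw [hq, ← mul_assoc, ← pow_succ', Nat.sub_add_cancel hc]
      refine ⟨AdjoinRoot.mk _ q, by simp [initVal], ?_⟩
      simp only [initVal, if_true]
      rw [LinearMap.pow_mulLeft, LinearMap.mulLeft_apply, this, map_mul, map_pow, AdjoinRoot.mk_X]
      rfl
    · have : x = 0 := by rw [← hx]; simp [initVal, ha]
      exact ⟨0, by simp, by simp [this]⟩
  · intro a
    by_cases ha : a = .inr k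
    · subst ha
      have h1 : initVal K X k (.e (.inr k)) = 1 := if_pos rfl
      rw [h1, Module.End.one_eq_id, LinearMap.range_id, finrank_top,
        (AdjoinRoot.powerBasis' hmonic).finrank, AdjoinRoot.powerBasis'_dim,
        Polynomial.natDegree_X_pow, Sum.elim_inr, Pi.single_eq_same, one_mul]
      rfl
    · have h1 : initVal K X k (.e a) = 0 := if_neg ha
      have h2 : (Sum.elim 0 (Pi.single k 1) a : ℕ) = 0 := by
        rcases a with a | a
        · rfl
        · exact Pi.single_eq_of_ne (fun e => ha (by rw [e])) _
      rw [h1, h2, LinearMap.range_zero, finrank_bot, zero_mul]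
  · intro S _ h0
    rw [Submodule.eq_bot_iff]
    intro x hx
    simpa [initVal] using h0 k x hx
  · refine .step ⊥ ⊤ (.inr k) 1 .bot (fun _ _ _ => trivial) bot_le trivial (by simp [initVal])
      ?_ ?_
    · rw [Submodule.mem_bot]
      simp only [initVal, if_true]
      rw [LinearMap.pow_mulLeft, LinearMap.mulLeft_apply, mul_one, ← AdjoinRoot.mk_X, ← map_pow,
        AdjoinRoot.mk_eq_zero]
      change ¬ (Polynomial.X ^ X.c k : K[X]) ∣ Polynomial.X ^ (X.c k - 1)
      rw [pow_dvd_pow_iff Polynomial.X_ne_zero Polynomial.not_isUnit_X]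
      omega
    · rintro x -
      obtain ⟨p, rfl⟩ := AdjoinRoot.mk_surjective x
      refine Submodule.mem_sup_right ⟨p, ?_⟩
      rw [cyc_apply]
      simp only [initVal, if_true]
      change Polynomial.aeval (Algebra.lmul K _ (AdjoinRoot.root _)) p 1 = _
      rw [Polynomial.aeval_algHom_apply, AdjoinRoot.aeval_eq]
      simp

theorem neg_one_eq_sum : (fun _ => -1 : ι → ℤ) = ∑ k, -Pi.single k 1 := by
  funext j
  simp [Finset.sum_apply, Pi.single_apply]

/-- Starting with the generalized simples at the framing vertices and `s = 1`, the whole family is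
reflected at a vertex `j` where some weight is negative. The total of all ranks then grows strictly,
and it is the height for the orbit of `-ρ`, bounded by `exists_bound`; the induction is on the
distance to that bound. -/
theorem exists_family (hX : X.IsFiniteType) (Ω : Orientation X) :
    ∃ s ∈ X.weylGroup, ∃ ν : ι → ι → ℕ, (∀ k, s (-Pi.single k 1) = wt X k (ν k)) ∧
      (∀ k, ∃ (M : Type u) (_ : AddCommGroup M) (_ : Module K M)
        (v : Gen X.framed → Module.End K M), Good Ω k (ν k) v) ∧
      ∀ k j, 0 ≤ wt X k (ν k) j := by
  obtain ⟨b, hb⟩ := X.exists_bound hX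
  have hsum : ∀ (s : (ι → ℤ) ≃ₗ[ℤ] (ι → ℤ)) (ν : ι → ι → ℕ),
      (∀ k, s (-Pi.single k 1) = wt X k (ν k)) →
      s (fun _ => -1) = (fun _ => -1) + X.cmap (∑ k, fun j => (ν k j : ℤ)) := by
    intro s ν h
    rw [neg_one_eq_sum, map_sum, map_sum, ← Finset.sum_add_distrib]
    refine Finset.sum_congr rfl fun k _ => ?_
    rw [h, wt, sub_eq_neg_add]
  suffices H : ∀ (n : ℕ) (s : (ι → ℤ) ≃ₗ[ℤ] (ι → ℤ)), s ∈ X.weylGroup → ∀ ν : ι → ι → ℕ,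
      (∀ k, s (-Pi.single k 1) = wt X k (ν k)) →
      (∀ k, ∃ (M : Type u) (_ : AddCommGroup M) (_ : Module K M)
        (v : Gen X.framed → Module.End K M), Good Ω k (ν k) v) →
      (b - ∑ j, ∑ k, (ν k j : ℤ)).toNat = n → _ by
    refine H _ 1 (one_mem _) (fun _ => 0) (fun k => ?_) (fun k => ?_) rfl
    · rw [wt]
      have : X.cmap (fun _ => ((0 : ι → ℕ) k : ℤ)) = 0 := by
        rw [show (fun _ : ι => ((0 : ι → ℕ) k : ℤ)) = 0 by funext; simp, map_zero]
      exact (zero_sub _).symm.trans (congrArg (· - _) this.symm)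
    · exact ⟨_, _, _, _, good_initVal Ω k⟩
  intro n
  induction n using Nat.strong_induction_on with
  | _ n ih =>
    intro s hs ν hν hG hn
    by_cases hpos : ∀ k j, 0 ≤ wt X k (ν k) j
    · exact ⟨s, hs, ν, hν, hG, hpos⟩
    push Not at hpos
    obtain ⟨k0, j, hj⟩ := hpos
    obtain ⟨M0, _, _, v0, h0⟩ := hG k0
    set ν' : ι → ι → ℕ := fun k => Function.update (ν k) j (ν k j - wt X k (ν k) j).toNat with hν'
    have hkey : ∀ k, wt X k (ν k) j ≤ ν k j ∧ wt X k (ν k) j ≤ 0 ∧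
        ∃ (M : Type u) (_ : AddCommGroup M) (_ : Module K M)
        (v : Gen X.framed → Module.End K M), Good Ω k (ν' k) v := by
      intro k
      obtain ⟨M, _, _, v, h⟩ := hG k
      have hsurj := h0.imIn_eq_of_wt_neg hX hs (hν k0) (hν k) h hj
      refine ⟨h.wt_le hsurj, ?_, _, _, _, _, h.refl hsurj⟩
      -- Signs at `j` cannot be mixed: the member `k0` has `dim R` greater than `dim M_j`, so the
      -- comparison with any other member forces its weight at `j` to be nonpositive. Hence no rank
      -- decreases in this step.
      have h1 := h.mul_finrank_reflR_le hX hs (hν k) (hν k0) h0 j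
      rw [h0.finrank_reflR (h0.imIn_eq_of_wt_neg hX hs (hν k0) (hν k0) h0 hj)] at h1
      have hc : (0 : ℤ) < X.c j := by exact_mod_cast X.c_pos j
      refine nonpos_of_mul_nonpos_left h1 ?_
      have := mul_pos hc (neg_pos.2 hj)
      linarith
    have hs' : X.reflection j * s ∈ X.weylGroup :=
      mul_mem (Subgroup.subset_closure ⟨j, rfl⟩) hs
    have hwt : ∀ k, (X.reflection j * s) (-Pi.single k 1) = wt X k (ν' k) := by
      intro k
      rw [hν', wt_update _ _ _ (hkey k).1, ← hν k]
      rfl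
    have hcast : ∀ k i, ((ν' k i : ℕ) : ℤ) = ν k i + if i = j then -wt X k (ν k) j else 0 := by
      intro k i
      by_cases hi : i = j
      · subst hi
        have := (hkey k).1
        simp only [hν', Function.update_self, if_true]
        rw [Int.toNat_of_nonneg (by linarith)]
        ring
      · simp [hν', hi]
    have hlt : ∑ i, ∑ k, (ν k i : ℤ) < ∑ i, ∑ k, (ν' k i : ℤ) := by
      have h1 : ∑ i, ∑ k, (ν' k i : ℤ) =
          ∑ i, ∑ k, (ν k i : ℤ) + ∑ k, -wt X k (ν k) j := by
        simp only [hcast, Finset.sum_add_distrib]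
        congr 1
        rw [Finset.sum_comm]
        simp
      have h2 : 0 < ∑ k, -wt X k (ν k) j :=
        Finset.sum_pos' (fun k _ => neg_nonneg.2 (hkey k).2.1) ⟨k0, Finset.mem_univ _, neg_pos.2 hj⟩
      linarith
    have hle : ∑ i, ∑ k, (ν' k i : ℤ) ≤ b := by
      have := hb _ hs' _ (hsum _ _ hwt) (fun i => by
        rw [Finset.sum_apply]
        exact Finset.sum_nonneg fun _ _ => Nat.cast_nonneg _)
      simpa only [Finset.sum_apply] using this
    exact ih _ (by omega) _ hs' ν' hwt (fun k => (hkey k).2.2) rfl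

/-- The family of stable representations at the dominant end: it consists of exact
representations, and every fundamental weight occurs. -/
theorem exists_dominant_family (hX : X.IsFiniteType) (Ω : Orientation X) :
    ∃ s ∈ X.weylGroup, ∃ ν : ι → ι → ℕ, (∀ k, s (-Pi.single k 1) = wt X k (ν k)) ∧
      (∀ k, ∃ (M : Type u) (_ : AddCommGroup M) (_ : Module K M)
        (v : Gen X.framed → Module.End K M), Good Ω k (ν k) v ∧
          ∀ j, (LinearMap.range (v (.e (.inl j)))).map (outMap Ω.framed v (.inl j)) =
            reflR v (.inl j)) ∧
      ∀ i, ∃ k, wt X k (ν k) = Pi.single i 1 := by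
  obtain ⟨s, hs, ν, hν, hG, hpos⟩ := exists_family (K := K) hX Ω
  have hex : ∀ j, ∃ k, 0 < wt X k (ν k) j := by
    intro j
    by_contra h
    push Not at h
    -- If no member had positive weight at `j`, the `j`-th coordinate of `s` would vanish on a
    -- basis, contradicting surjectivity of `s`.
    have h0 : ∀ x, s x j = 0 := by
      intro x
      have hx : x = ∑ k, (-x k) • (-Pi.single k 1 : ι → ℤ) := by
        funext i
        simp [Finset.sum_apply, Pi.single_apply]
      rw [hx, map_sum, Finset.sum_apply]
      refine Finset.sum_eq_zero fun k _ => ?_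
      rw [map_smul, hν, Pi.smul_apply, le_antisymm (h k) (hpos k j), smul_zero]
    obtain ⟨x, hx⟩ := s.surjective (Pi.single j 1)
    have := h0 x
    rw [hx] at this
    simp at this
  refine ⟨s, hs, ν, hν, fun k => ?_, ?_⟩
  · obtain ⟨M, i1, i2, v, h⟩ := hG k
    refine ⟨M, i1, i2, v, h, fun j => ?_⟩
    obtain ⟨k', hk'⟩ := hex j
    obtain ⟨M', _, _, v', h'⟩ := hG k'
    exact h'.exact_of_wt_pos hX hs (hν k') (hν k) h hk'
  · have hsum : s (fun _ => -1) = ∑ k, wt X k (ν k) := by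
      rw [neg_one_eq_sum, map_sum]
      exact Finset.sum_congr rfl fun k _ => hν k
    refine SymmGCM.exists_eq_single hpos (fun k h => ?_) fun j => ?_
    · rw [← hν k, LinearEquiv.map_eq_zero_iff] at h
      have := congrFun h k
      simp at this
    -- The sum of all weights is `s (-ρ)` and is positive in every coordinate, hence equals `ρ`.
    -- This gives the column sums needed for the weights to form a permutation of the fundamental
    -- weights.
    · have h1 := X.eq_one_of_dominant_regular hX hs (fun j => by
        obtain ⟨k, hk⟩ := hex j
        rw [hsum, Finset.sum_apply]
        exact (Int.add_one_le_iff.2 hk).trans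
          (Finset.single_le_sum (f := fun k => wt X k (ν k) j) (fun k _ => hpos k j)
            (Finset.mem_univ k)))
      rw [← Finset.sum_apply, ← hsum, h1]

end Iteration

/-! ### Uniqueness of stable representations with dominant weight -/

section Uniqueness

variable {K : Type*} [Field K] {ι : Type} [Fintype ι] [DecidableEq ι] {X : SymmGCM ι}
  {Ω : Orientation X} {M : Type*} [AddCommGroup M] [Module K M]
  {N : Type*} [AddCommGroup N] [Module K N]
  {v : Gen X.framed → Module.End K M} {w : Gen X.framed → Module.End K N}

theorem coe_rangeRestrict (p : Module.End K M) (x : M) : (p.rangeRestrict x : M) = p x := rfl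

/-- Free modules of the same rank over `K[ε]/(ε ^ c)` are isomorphic. -/
theorem exists_mem_homOn_injOn [FiniteDimensional K M] [FiniteDimensional K N]
    {p ε : Module.End K M} {p' ε' : Module.End K N} {c : ℕ}
    (h : NilpOn p ε c) (hF : FreeOn p ε c) (h' : NilpOn p' ε' c) (hF' : FreeOn p' ε' c)
    (hr : Module.finrank K (LinearMap.range p) = Module.finrank K (LinearMap.range p')) :
    ∃ f ∈ NilpOn.homOn p ε p' ε', ∀ x, p x = x → f x = 0 → x = 0 := by
  obtain ⟨r, u, hu, b, hb⟩ := h.exists_chainBasis hF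
  obtain ⟨r', u', hu', b', hb'⟩ := h'.exists_chainBasis hF'
  have hc := h.pos
  have hrr : r = r' := by
    rw [Module.finrank_eq_card_basis b, Module.finrank_eq_card_basis b'] at hr
    simpa [Nat.one_le_iff_ne_zero.1 hc] using hr
  subst hrr
  let e : LinearMap.range p ≃ₗ[K] LinearMap.range p' := b.equiv b' (Equiv.refl _)
  have he : ∀ q, (e (b q) : N) = (ε' ^ (q.2 : ℕ)) (u' q.1) := by
    intro q
    rw [Module.Basis.equiv_apply, Equiv.refl_apply, hb']
  have hp' : ∀ y : LinearMap.range p', p' y = y := fun y => h'.mem_range.1 y.2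
  have hcomm : ∀ y : LinearMap.range p, ε' (e y) = e (p.rangeRestrict (ε y)) := by
    intro y
    have h1 : ε'.comp ((LinearMap.range p').subtype.comp e.toLinearMap) =
        (LinearMap.range p').subtype.comp (e.toLinearMap.comp (p.rangeRestrict.comp
          (ε.comp (LinearMap.range p).subtype))) := by
      refine b.ext fun q => ?_
      change ε' (e (b q)) = e (p.rangeRestrict (ε (b q)))
      rw [he, ← Module.End.mul_apply, ← pow_succ']
      by_cases hq : (q.2 : ℕ) + 1 < c
      · have : p.rangeRestrict (ε (b q)) = b (q.1, ⟨q.2 + 1, hq⟩) := by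
          refine Subtype.ext ?_
          rw [hb, coe_rangeRestrict, h.p_eps, hb, ← Module.End.mul_apply, ← pow_succ']
        rw [this, he]
      · have hq' : (q.2 : ℕ) + 1 = c := by have := q.2.2; omega
        have : p.rangeRestrict (ε (b q)) = 0 := by
          refine Subtype.ext ?_
          rw [coe_rangeRestrict, h.p_eps, hb, ← Module.End.mul_apply, ← pow_succ', hq',
            h.nil]
          rfl
        rw [this, map_zero, hq', h'.nil]
        rfl
    exact LinearMap.congr_fun h1 y
  refine ⟨(LinearMap.range p').subtype ∘ₗ e.toLinearMap ∘ₗ p.rangeRestrict, ⟨?_, ?_⟩, ?_⟩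
  · ext x
    change p' (e (p.rangeRestrict (p x))) = e (p.rangeRestrict x)
    rw [hp']
    congr 2
    exact Subtype.ext (h.apply_self x)
  · ext x
    change ε' (e (p.rangeRestrict x)) = e (p.rangeRestrict (ε x))
    rw [hcomm, coe_rangeRestrict, h.eps_p]
  · intro x hx h0
    have h1 : e (p.rangeRestrict x) = 0 := Subtype.ext h0
    rw [LinearEquiv.map_eq_zero_iff] at h1
    rw [← hx]
    exact congrArg Subtype.val h1

theorem range_e_eq_sum [FiniteDimensional K M] (hv : Satisfies Ω.framed v) :
    Module.finrank K M = ∑ a, Module.finrank K (LinearMap.range (v (.e a))) := by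
  rw [← Module.finrank_pi_fintype]
  exact LinearEquiv.finrank_eq
    { toFun := fun x a => (v (.e a)).rangeRestrict x
      map_add' := fun x y => by ext a; simp
      map_smul' := fun k x => by ext a; simp
      invFun := fun y => ∑ a, (y a : M)
      left_inv := fun x => by simpa using hv.sum_e x
      right_inv := fun y => by
        have hy : ∀ a, v (.e a) (y a : M) = y a := fun a => (hv.nilpOn a).mem_range.1 (y a).2
        ext a
        change v (.e a) (∑ b, (y b : M)) = y a
        rw [map_sum, Finset.sum_eq_single a, hy]
        · intro b _ hb
          rw [hv.e_of_e (hy b), if_neg hb.symm]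
        · simp }

/-- A stable representation with the same rank vector as a good one is isomorphic to it. -/
theorem Good.exists_iso {k : ι} {ν : ι → ℕ} (h : Good Ω k ν v) [FiniteDimensional K N]
    (hw : Satisfies Ω.framed w) (hs : Stable w)
    (hF : ∀ l, FreeOn (w (.e (.inr l))) (w (.ε (.inr l))) (X.c l))
    (hr : ∀ a, Module.finrank K (LinearMap.range (w (.e a))) =
      (Sum.elim ν (Pi.single k 1) a : ℕ) * X.framed.c a)
    (hwt : ∑ j, wt X k ν j * (X.c j * ν j) = X.c k * ν k) :
    ∃ f : N ≃ₗ[K] M, ∀ a x, f (w a x) = v a (f x) := by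
  have := h.fd
  have hr' : ∀ l, Module.finrank K (LinearMap.range (w (.e (.inr l)))) =
      (Pi.single k 1 : ι → ℕ) l * X.c l := fun l => hr (.inr l)
  have h1 := h.euler_le hw hr'
  have h2 : (Module.finrank K (homRep v w) : ℤ) ≤ X.c k := by
    have := h.finrank_homRep_left hw hs hr'
    rw [Pi.single_eq_same, mul_one] at this
    exact_mod_cast this
  have h3 : ∑ j, wt X k ν j * Module.finrank K (LinearMap.range (w (.e (.inl j)))) =
      X.c k * ν k := by
    rw [← hwt]
    refine Finset.sum_congr rfl fun j _ => ?_
    rw [hr, mul_comm (X.c j : ℤ)]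
    push_cast
    rfl
  have h4 : ∑ l, (X.c l : ℤ) * ((Pi.single k 1 : ι → ℕ) l * ν l) = X.c k * ν k := by
    rw [Finset.sum_eq_single k]
    · simp
    · intro l _ hl; simp [Pi.single_eq_of_ne hl]
    · simp
  rw [h3, h4, Pi.single_eq_same] at h1
  -- The Euler inequality makes the two Hom dimensions add up to at least `2 c k`, and one of them
  -- is at most `c k`.
  have h5 : X.c k ≤ Module.finrank K (homRep w v) := by
    zify
    push_cast at h1
    linarith
  obtain ⟨g, hg, hg0⟩ := exists_mem_homOn_injOn (hw.nilpOn (.inr k)) (hF k)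
    (h.sat.nilpOn (.inr k)) (h.free (.inr k)) (by rw [hr, h.rank])
  let F : homRep w v →ₗ[K] NilpOn.homOn (w (.e (.inr k))) (w (.ε (.inr k)))
      (v (.e (.inr k))) (v (.ε (.inr k))) :=
    { toFun := fun f => ⟨v (.e (.inr k)) ∘ₗ f.1 ∘ₗ w (.e (.inr k)), by
        constructor
        · ext x; simp [hw.e_e, h.sat.e_e]
        · have h1 := fun x => LinearMap.congr_fun (f.2 (.ε (.inr k))) x
          simp only [LinearMap.comp_apply] at h1
          ext x
          simp only [LinearMap.comp_apply, h.sat.eps_e, hw.e_eps, h1, hw.eps_e]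
          rw [← h1, h.sat.e_eps]⟩
      map_add' := fun f g => by ext x; simp
      map_smul' := fun k f => by ext x; simp }
  have hzero : ∀ l, l ≠ k → ∀ x, v (.e (.inr l)) x = 0 := by
    intro l hl x
    have : LinearMap.range (v (.e (.inr l))) = ⊥ := by
      rw [← Submodule.finrank_eq_zero, h.rank, Sum.elim_inr, Pi.single_eq_of_ne hl, zero_mul]
    rw [LinearMap.range_eq_bot.1 this, LinearMap.zero_apply]
  have hzero' : ∀ l, l ≠ k → ∀ x, w (.e (.inr l)) x = 0 := by
    intro l hl x
    have : LinearMap.range (w (.e (.inr l))) = ⊥ := by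
      rw [← Submodule.finrank_eq_zero, hr, Sum.elim_inr, Pi.single_eq_of_ne hl, zero_mul]
    rw [LinearMap.range_eq_bot.1 this, LinearMap.zero_apply]
  have hFi : Function.Injective F := by
    rw [← LinearMap.ker_eq_bot, LinearMap.ker_eq_bot']
    rintro ⟨f, hf⟩ h0
    have hc : ∀ a x, v a (f x) = f (w a x) := fun a x => LinearMap.congr_fun (hf a) x
    have h1 : LinearMap.range f = ⊥ := by
      refine h.stable _ ?_ ?_
      · rintro a _ ⟨x, rfl⟩
        exact ⟨w a x, (hc a x).symm⟩
      · rintro l _ ⟨x, rfl⟩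
        by_cases hl : l = k
        · subst hl
          have h2 := LinearMap.congr_fun (congrArg Subtype.val h0) x
          change v (.e (.inr l)) (f (w (.e (.inr l)) x)) = 0 at h2
          rwa [← hc, h.sat.e_e] at h2
        · exact hzero l hl _
    exact Subtype.ext (LinearMap.range_eq_bot.1 h1)
  have hdim : Module.finrank K (NilpOn.homOn (w (.e (.inr k))) (w (.ε (.inr k)))
      (v (.e (.inr k))) (v (.ε (.inr k)))) = X.c k := by
    rw [NilpOn.finrank_homOn (r := 1) (hw.nilpOn (.inr k)) (hF k) (h.sat.nilpOn (.inr k)), h.rank]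
    · simp; rfl
    · rw [hr]; simp
  -- Dimensions now force restriction to the framing vertex `k` to be bijective, so the isomorphism
  -- `g` there extends to a homomorphism; stability of `w` makes that extension injective.
  have hsurj : Function.Surjective F := by
    rw [← LinearMap.range_eq_top]
    refine Submodule.eq_top_of_finrank_eq (le_antisymm (Submodule.finrank_le _) ?_)
    rw [LinearMap.finrank_range_of_inj hFi, hdim]
    exact h5
  obtain ⟨⟨f, hf⟩, hfg⟩ := hsurj ⟨g, hg⟩
  have hc : ∀ a x, v a (f x) = f (w a x) := fun a x => LinearMap.congr_fun (hf a) x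
  have hfg' : ∀ x, v (.e (.inr k)) (f (w (.e (.inr k)) x)) = g x := fun x =>
    LinearMap.congr_fun (congrArg Subtype.val hfg) x
  have hker : LinearMap.ker f = ⊥ := by
    refine hs _ ?_ ?_
    · intro a x hx
      rw [LinearMap.mem_ker] at hx ⊢
      rw [← hc, hx, map_zero]
    · intro l x hx
      by_cases hl : l = k
      · subst hl
        refine hg0 _ (hw.e_e _ _) ?_
        rw [← hfg', hw.e_e, ← hc, (LinearMap.mem_ker.1 hx), map_zero, map_zero]
      · exact hzero' l hl _
  have hfr : Module.finrank K N = Module.finrank K M := by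
    rw [range_e_eq_sum hw, range_e_eq_sum h.sat]
    exact Finset.sum_congr rfl fun a _ => by rw [hr, h.rank]
  refine ⟨LinearMap.linearEquivOfInjective f (LinearMap.ker_eq_bot.1 hker) hfr, fun a x => ?_⟩
  rw [LinearMap.linearEquivOfInjective_apply, LinearMap.linearEquivOfInjective_apply, hc]

/-- In the presence of a dominant family of good representations, the rank vector of a stable
representation whose weight is fundamental belongs to the family. -/
theorem exists_rank_eq (hX : X.IsFiniteType) {s : (ι → ℤ) ≃ₗ[ℤ] (ι → ℤ)} (hs : s ∈ X.weylGroup)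
    {ν : ι → ι → ℕ} (hν : ∀ k, s (-Pi.single k 1) = wt X k (ν k))
    (hσ : ∀ i, ∃ k, wt X k (ν k) = Pi.single i 1)
    (hG : ∀ k, ∃ (M : Type u) (_ : AddCommGroup M) (_ : Module K M)
        (v : Gen X.framed → Module.End K M), Good Ω k (ν k) v)
    {s' : (ι → ℤ) ≃ₗ[ℤ] (ι → ℤ)} (hs' : s' ∈ X.weylGroup) {r : ι ⊕ ι → ℕ} {i : ι}
    (hi : X.cmap (fun j => (r (.inl j) : ℤ)) - (fun l => (r (.inr l) : ℤ)) = Pi.single i 1)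
    (hi' : s' (-fun l => (r (.inr l) : ℤ)) = Pi.single i 1) [FiniteDimensional K N]
    (hw : Satisfies Ω.framed w) (hst : Stable w)
    (hF : ∀ l, FreeOn (w (.e (.inr l))) (w (.ε (.inr l))) (X.c l))
    (hr : ∀ a, Module.finrank K (LinearMap.range (w (.e a))) = r a * X.framed.c a) :
    ∃ k, wt X k (ν k) = Pi.single i 1 ∧ r = Sum.elim (ν k) (Pi.single k 1) := by
  -- These are the ranks that `s` attaches to the antidominant weight with framing ranks `r (.inr
  -- k)`, obtained additively from the family.
  let νm : ι → ℕ := fun j => ∑ k, r (.inr k) * ν k j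
  have hm : (fun l => (r (.inr l) : ℤ)) = ∑ k, (r (.inr k) : ℤ) • (Pi.single k 1 : ι → ℤ) := by
    funext l
    simp [Finset.sum_apply, Pi.single_apply]
  have hνm : (fun j => (νm j : ℤ)) = ∑ k, (r (.inr k) : ℤ) • fun j => (ν k j : ℤ) := by
    funext j
    simp [νm, Finset.sum_apply]
  have hsm : s (-fun l => (r (.inr l) : ℤ)) =
      X.cmap (fun j => (νm j : ℤ)) - fun l => (r (.inr l) : ℤ) := by
    rw [hνm, hm, ← Finset.sum_neg_distrib, map_sum, map_sum, ← Finset.sum_sub_distrib]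
    refine Finset.sum_congr rfl fun k _ => ?_
    rw [← smul_neg, map_smul, hν, wt, map_smul, smul_sub]
  have hle : ∀ j, r (.inl j) ≤ νm j := by
    intro j
    obtain ⟨k, hk⟩ := hσ j
    obtain ⟨M, _, _, v, h⟩ := hG k
    -- For the member of weight `ϖ_j` both sums collapse to their `j`-th term, so `Good.sum_le`
    -- compares the single rank at `j` with `νm j`.
    have h1 := h.sum_le hw hst hF (ρ := fun l => r (.inr l)) fun l => hr (.inr l)
    rw [← Good.pr_wt hX hs (hν k) hsm, hk, Finset.sum_eq_single j, Finset.sum_eq_single j,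
      Pi.single_eq_same, one_mul, one_mul, hr] at h1
    · have hc : (0 : ℤ) < X.c j := by exact_mod_cast X.c_pos j
      have h2 : ((r (.inl j) * X.framed.c (.inl j) : ℕ) : ℤ) = X.c j * r (.inl j) := by
        rw [mul_comm]; push_cast; rfl
      rw [h2] at h1
      exact_mod_cast le_of_mul_le_mul_left h1 hc
    · intro b _ hb; simp [Pi.single_eq_of_ne hb]
    · simp
    · intro b _ hb; simp [Pi.single_eq_of_ne hb]
    · simp
  -- The element `s s'⁻¹` moves the dominant weight `ϖ_i` up by this nonnegative difference, so
  -- `eq_zero_of_dominant` applies.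
  have hδ : (fun j => (νm j : ℤ) - r (.inl j)) = 0 := by
    refine X.eq_zero_of_dominant hX (mul_mem hs (inv_mem hs')) (x := Pi.single i 1) ?_ ?_ ?_
    · have h1 : s'⁻¹ (Pi.single i 1) = -fun l => (r (.inr l) : ℤ) := by
        rw [← hi']; exact s'.symm_apply_apply _
      change s (s'⁻¹ (Pi.single i 1)) = _
      have h2 : (fun j => (νm j : ℤ) - r (.inl j)) =
        (fun j => (νm j : ℤ)) - fun j => (r (.inl j) : ℤ) := rfl
      rw [h1, hsm, h2, map_sub, ← hi]
      abel
    · intro k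
      by_cases hk : k = i
      · subst hk; simp
      · simp [Pi.single_eq_of_ne hk]
    · intro k
      have := hle k
      omega
  have hνr : ∀ j, r (.inl j) = νm j := by
    intro j
    have := congrFun hδ j
    simp only [Pi.zero_apply] at this
    omega
  obtain ⟨k, hk⟩ := hσ i
  have hmk : (fun l => (r (.inr l) : ℤ)) = Pi.single k 1 := by
    apply neg_injective
    apply s.injective
    rw [hν, hk, hsm, ← hi]
    congr 2
    funext j
    rw [hνr]
  have hrk : ∀ l, r (.inr l) = (Pi.single k 1 : ι → ℕ) l := by
    intro l
    have := congrFun hmk l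
    by_cases hl : l = k
    · subst hl; simpa using this
    · simpa [Pi.single_eq_of_ne hl] using this
  refine ⟨k, hk, funext ?_⟩
  rintro (j | l)
  · rw [hνr, Sum.elim_inl]
    simp only [νm, hrk]
    rw [Finset.sum_eq_single k]
    · simp
    · intro b _ hb; simp [Pi.single_eq_of_ne hb]
    · simp
  · exact hrk l

end Uniqueness

/-! ### Approximate homomorphisms into filtered representations -/

section Approx

variable {K : Type*} [Field K] {ι : Type} [Fintype ι] [DecidableEq ι]

section Cyclic

variable {M : Type*} [AddCommGroup M] [Module K M]

theorem X_pow_dvd_of_cyc_eq_zero {ε : Module.End K M} {c : ℕ} (hnil : ε ^ c = 0) {u : M}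
    (hu : (ε ^ (c - 1)) u ≠ 0) {f : K[X]} (hf : cyc ε u f = 0) : Polynomial.X ^ c ∣ f := by
  rw [Polynomial.X_pow_dvd_iff]
  intro d
  induction d using Nat.strong_induction_on with
  | _ d ih =>
    intro hd
    obtain ⟨g, rfl⟩ : Polynomial.X ^ d ∣ f :=
      Polynomial.X_pow_dvd_iff.2 fun m hm => ih m hm (hm.trans hd)
    have h1 : cyc ε u (Polynomial.X ^ (c - 1 - d) * (Polynomial.X ^ d * g)) = 0 := by
      have hf' : Polynomial.aeval ε (Polynomial.X ^ d * g) u = 0 := hf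
      rw [cyc_apply, map_mul, Module.End.mul_apply, hf', map_zero]
    rw [← mul_assoc, ← pow_add, show c - 1 - d + d = c - 1 by omega, cyc_apply, map_mul,
      Module.End.mul_apply, map_pow, Polynomial.aeval_X, aeval_eq_divX, map_add,
      ← Module.End.mul_apply, ← pow_succ, show c - 1 + 1 = c by omega, hnil, map_smul,
      LinearMap.zero_apply, zero_add] at h1
    rw [Polynomial.coeff_X_pow_mul', if_pos le_rfl, Nat.sub_self]
    exact (smul_eq_zero.1 h1).resolve_right hu

theorem cyc_eq_of_dvd {ε : Module.End K M} {c : ℕ} (hnil : ε ^ c = 0) (u : M) {f g : K[X]}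
    (h : Polynomial.X ^ c ∣ f - Polynomial.X * g) : cyc ε u f = ε (cyc ε u g) := by
  obtain ⟨r, hr⟩ := h
  rw [sub_eq_iff_eq_add] at hr
  rw [hr, map_add, cyc_apply, cyc_apply, map_mul, map_mul, map_pow, Polynomial.aeval_X, hnil,
    zero_mul, LinearMap.zero_apply, zero_add]
  rfl

/-- Coordinates on a free module of rank one over `K[ε]/(ε ^ c)`. -/
theorem exists_coordinate [FiniteDimensional K M] {p ε : Module.End K M} {c : ℕ}
    (h : NilpOn p ε c) (hF : FreeOn p ε c)
    (hr : Module.finrank K (LinearMap.range p) = c) :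
    ∃ u, p u = u ∧ ∃ θ : M →ₗ[K] K[X], (∀ x, p x = cyc ε u (θ x)) ∧
      (∀ x, Polynomial.X ^ c ∣ θ (ε x) - Polynomial.X * θ x) ∧ (∀ x, θ (p x) = θ x) ∧
      θ u = 1 := by
  obtain ⟨r, u, hu, b, hb⟩ := h.exists_chainBasis hF
  have hc := h.pos
  have hr1 : r = 1 := by
    rw [Module.finrank_eq_card_basis b] at hr
    simp only [Fintype.card_prod, Fintype.card_fin] at hr
    exact Nat.eq_of_mul_eq_mul_right hc (by rw [hr, one_mul])
  subst hr1
  let θ0 : LinearMap.range p →ₗ[K] K[X] :=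
    b.constr K fun q => Polynomial.X ^ (q.2 : ℕ)
  have h1 : (LinearMap.range p).subtype = cyc ε (u 0) ∘ₗ θ0 := by
    refine b.ext fun q => ?_
    simp only [LinearMap.comp_apply, θ0, Module.Basis.constr_basis, Submodule.subtype_apply, hb]
    rw [cyc_apply, map_pow, Polynomial.aeval_X, Subsingleton.elim q.1 0]
  have h2 : ∀ x, p x = cyc ε (u 0) ((θ0 ∘ₗ p.rangeRestrict) x) := fun x =>
    LinearMap.congr_fun h1 (p.rangeRestrict x)
  have hu0 : (ε ^ (c - 1)) (u 0) ≠ 0 := by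
    have := hb (0, ⟨c - 1, by omega⟩)
    intro h0
    rw [← this] at h0
    exact b.ne_zero _ (Subtype.ext h0)
  refine ⟨u 0, hu 0, θ0 ∘ₗ p.rangeRestrict, h2, fun x => ?_, fun x => ?_, ?_⟩
  · refine X_pow_dvd_of_cyc_eq_zero h.nil hu0 ?_
    rw [map_sub, ← h2, cyc_apply, map_mul, Polynomial.aeval_X, Module.End.mul_apply, ← cyc_apply,
      ← h2, h.p_eps, h.eps_p, sub_self]
  · rw [LinearMap.comp_apply, LinearMap.comp_apply]
    congr 1
    exact Subtype.ext (h.apply_self x)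
  · have : p.rangeRestrict (u 0) = b (0, ⟨0, hc⟩) := by
      refine Subtype.ext ?_
      rw [hb]
      exact hu 0
    rw [LinearMap.comp_apply, this, Module.Basis.constr_basis, pow_zero]

end Cyclic

variable {X : SymmGCM ι} {Ω : Orientation X} {M : Type*} [AddCommGroup M] [Module K M]
  {Q : Type*} [AddCommGroup Q] [Module K Q]
  {v : Gen X.framed → Module.End K M} {u : Gen X.framed → Module.End K Q}

/-- The part of `M` at the vertex `i` that is not generated from other vertices is free of rank
one. -/
theorem Good.exists_coker_generator {k : ι} {ν : ι → ℕ} (h : Good Ω k ν v) {i : ι}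
    (hex : (LinearMap.range (v (.e (.inl i)))).map (outMap Ω.framed v (.inl i)) =
      reflR v (.inl i)) (hd : Module.finrank K (LinearMap.range (v (.e (.inl i)))) =
        Module.finrank K (imIn v (.inl i)) + X.c i) :
    ∃ v0, v (.e (.inl i)) v0 = v0 ∧ ∃ θ : M →ₗ[K] K[X], (∀ x ∈ imIn v (.inl i), θ x = 0) ∧
      (∀ x, v (.e (.inl i)) x - cyc (v (.ε (.inl i))) v0 (θ x) ∈ imIn v (.inl i)) ∧
      (∀ x, Polynomial.X ^ X.c i ∣ θ (v (.ε (.inl i)) x) - Polynomial.X * θ x) ∧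
      (∀ x, θ (v (.e (.inl i)) x) = θ x) ∧ θ v0 = 1 := by
  have := h.fd
  have hv := h.sat
  have hc := X.framed.c_pos (.inl i)
  have hn := hv.nilpOn (.inl i)
  set I := imIn v (.inl i) with hI
  have hIe : ∀ x ∈ I, v (.e (.inl i)) x = x := fun x hx => hn.mem_range.1 (imIn_le hv _ hx)
  have hpI : I ≤ I.comap (v (.e (.inl i))) := fun x hx => by
    rw [Submodule.mem_comap, hIe x hx]; exact hx
  have heI : I ≤ I.comap (v (.ε (.inl i))) := fun x hx => eps_mem_imIn hv hx
  let p' : Module.End K (M ⧸ I) := I.mapQ I (v (.e (.inl i))) hpI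
  let ε' : Module.End K (M ⧸ I) := I.mapQ I (v (.ε (.inl i))) heI
  have hp' : ∀ x, I.mkQ (v (.e (.inl i)) x) = p' (I.mkQ x) := fun x => rfl
  have hε' : ∀ x, I.mkQ (v (.ε (.inl i)) x) = ε' (I.mkQ x) := fun x => rfl
  have hεpow : ∀ n x, (ε' ^ n) (I.mkQ x) = I.mkQ ((v (.ε (.inl i)) ^ n) x) := fun n x =>
    pow_comp_of_comm (LinearMap.ext fun x => (hε' x).symm) n x
  have hout : ∀ n x, outMap Ω.framed v (.inl i) ((v (.ε (.inl i)) ^ n) x) =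
      (shift v (.inl i) ^ n) (outMap Ω.framed v (.inl i) x) := fun n z =>
        (pow_comp_of_comm (LinearMap.ext fun y => (outMap_eps hv _ y).symm) n z).symm
  have hin : ∀ n z, inMap v (.inl i) ((shift v (.inl i) ^ n) z) =
      (v (.ε (.inl i)) ^ n) (inMap v (.inl i) z) := fun n z =>
    (pow_comp_of_comm (LinearMap.ext fun y => (inMap_shift hv _ y).symm) n z).symm
  -- The image `I` is itself free. If `inMap y` is killed by `ε_i`, then exactness gives `shift y =
  -- outMap m`; stability and freeness of `M_i` give `m = ε_i m'`. Now `y - outMap m'` is killed by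
  -- the shift and has the same image as `y`, so `shift_free` applies.
  have hIF : ∀ x ∈ I, v (.ε (.inl i)) x = 0 →
      ∃ y ∈ I, (v (.ε (.inl i)) ^ (X.framed.c (.inl i) - 1)) y = x := by
    rintro _ ⟨y, hy, rfl⟩ h0
    have hsy : shift v (.inl i) y ∈ reflR v (.inl i) :=
      ⟨shift_mem_tl hv hy, by
        change inMap v (.inl i) (shift v (.inl i) y) = 0
        rw [inMap_shift hv, h0]⟩
    rw [← hex] at hsy
    obtain ⟨m, hm, hms⟩ := hsy
    have hme := hn.mem_range.1 hm
    have hm0 : (v (.ε (.inl i)) ^ (X.framed.c (.inl i) - 1)) m = 0 := by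
      refine h.stable.outMap_injOn hv i (hn.apply_pow hme _) ?_
      rw [hout, hms, ← Module.End.mul_apply, ← pow_succ, Nat.sub_add_cancel hc, shift_pow_c hv,
        LinearMap.zero_apply]
    obtain ⟨m', hm', hmm⟩ := hn.eps_injOn_of_pow (h.free (.inl i)) _ (Nat.sub_le _ 1) _ hme hm0
    rw [Nat.sub_sub_self hc, pow_one] at hmm
    obtain ⟨z, hz, hzy⟩ := shift_free hv h.free (.inl i)
      (y := y - outMap Ω.framed v (.inl i) m')
      (Submodule.sub_mem _ hy (outMap_mem_tl hv _ _)) (by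
        rw [map_sub, ← outMap_eps hv, hmm, hms, sub_self])
    refine ⟨inMap v (.inl i) z, ⟨z, hz, rfl⟩, ?_⟩
    rw [← hin, hzy, map_sub, inMap_outMap hv, sub_zero]
  have hN : NilpOn p' ε' (X.framed.c (.inl i)) := by
    refine ⟨?_, ?_, ?_, ?_, hc⟩
    · refine LinearMap.ext fun x => ?_
      obtain ⟨x, rfl⟩ := I.mkQ_surjective x
      rw [Module.End.mul_apply, ← hp', ← hp', hv.e_e]
    · refine LinearMap.ext fun x => ?_
      obtain ⟨x, rfl⟩ := I.mkQ_surjective x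
      rw [Module.End.mul_apply, ← hε', ← hp', hv.e_eps]
    · refine LinearMap.ext fun x => ?_
      obtain ⟨x, rfl⟩ := I.mkQ_surjective x
      rw [Module.End.mul_apply, ← hp', ← hε', ← hε', hv.eps_e]
    · refine LinearMap.ext fun x => ?_
      obtain ⟨x, rfl⟩ := I.mkQ_surjective x
      rw [hεpow, hv.nilp, LinearMap.zero_apply, map_zero, LinearMap.zero_apply]
  have hFr : FreeOn p' ε' (X.framed.c (.inl i)) := by
    intro x hx h0
    obtain ⟨x, rfl⟩ := I.mkQ_surjective x
    have hxI : v (.ε (.inl i)) x ∈ I := by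
      rw [← hε'] at h0
      exact (Submodule.Quotient.mk_eq_zero I).1 h0
    -- Self-injectivity in elementary form: `ε_i x` lies in the free module `I` and is killed by
    -- `ε_i ^ (c - 1)`, so it is `ε_i g` with `g` in `I`. After subtracting `g`, freeness of `M_i`
    -- supplies the preimage.
    obtain ⟨g, hg, hgx⟩ : ∃ g ∈ I, v (.ε (.inl i)) g = v (.ε (.inl i)) x := by
      have hNI : NilpOn (1 : Module.End K I) ((v (.ε (.inl i))).restrict heI)
          (X.framed.c (.inl i)) := by
        refine ⟨one_mul 1, one_mul _, mul_one _, ?_, hc⟩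
        refine LinearMap.ext fun y => Subtype.ext ?_
        have := pow_comp_of_comm (τ' := v (.ε (.inl i))) (τ := (v (.ε (.inl i))).restrict heI)
          (α := I.subtype) (LinearMap.ext fun x => rfl) (X.framed.c (.inl i)) y
        refine this.symm.trans ?_
        rw [hv.nilp]; rfl
      have hFI : FreeOn (1 : Module.End K I) ((v (.ε (.inl i))).restrict heI)
          (X.framed.c (.inl i)) := by
        intro y _ hy0
        obtain ⟨z, hz, hzy⟩ := hIF y y.2 (congrArg Subtype.val hy0)
        refine ⟨⟨z, hz⟩, rfl, Subtype.ext ?_⟩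
        rw [← hzy]
        exact (pow_comp_of_comm (τ' := v (.ε (.inl i))) (τ := (v (.ε (.inl i))).restrict heI)
          (α := I.subtype) (LinearMap.ext fun x => rfl) _ ⟨z, hz⟩).symm
      obtain ⟨g, -, hg⟩ := hNI.eps_injOn_of_pow hFI _ (Nat.sub_le _ 1)
        (⟨v (.ε (.inl i)) x, hxI⟩ : I) rfl (by
          refine Subtype.ext ?_
          refine (pow_comp_of_comm (τ' := v (.ε (.inl i))) (τ := (v (.ε (.inl i))).restrict heI)
            (α := I.subtype) (LinearMap.ext fun x => rfl) _ ⟨v (.ε (.inl i)) x, hxI⟩).symm.trans ?_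
          change (v (.ε (.inl i)) ^ _) (v (.ε (.inl i)) x) = 0
          rw [← Module.End.mul_apply, ← pow_succ, Nat.sub_add_cancel hc, hv.nilp]
          rfl)
      rw [Nat.sub_sub_self hc, pow_one] at hg
      exact ⟨g, g.2, congrArg Subtype.val hg⟩
    obtain ⟨y, hy, hyx⟩ := h.free (.inl i) (v (.e (.inl i)) x - g)
      (by rw [map_sub, hv.e_e, hIe g hg]) (by rw [map_sub, hv.eps_e, hgx, sub_self])
    refine ⟨I.mkQ y, by rw [← hp', hy], ?_⟩
    rw [hεpow, hyx, map_sub, hp', hx, (Submodule.Quotient.mk_eq_zero I).2 hg |> fun h => (h :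
      I.mkQ g = 0), sub_zero]
  have hrk : Module.finrank K (LinearMap.range p') = X.framed.c (.inl i) := by
    have h1 : LinearMap.range p' = (LinearMap.range (v (.e (.inl i)))).map I.mkQ := by
      ext x
      constructor
      · rintro ⟨y, rfl⟩
        obtain ⟨y, rfl⟩ := I.mkQ_surjective y
        exact ⟨_, ⟨y, rfl⟩, rfl⟩
      · rintro ⟨_, ⟨y, rfl⟩, rfl⟩
        exact ⟨I.mkQ y, rfl⟩
    have h2 := finrank_map_add_inf_ker I.mkQ (LinearMap.range (v (.e (.inl i))))
    rw [Submodule.ker_mkQ, inf_eq_right.2 (imIn_le hv _), hd, ← h1] at h2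
    change _ = X.c i
    exact Nat.add_left_cancel ((add_comm _ _).trans h2)
  obtain ⟨u, hu, θ, h1, h2, h3, h4⟩ := exists_coordinate hN hFr hrk
  obtain ⟨y, rfl⟩ := I.mkQ_surjective u
  have hu' : I.mkQ (v (.e (.inl i)) y) = I.mkQ y := by rw [hp', hu]
  refine ⟨v (.e (.inl i)) y, hv.e_e _ _, θ ∘ₗ I.mkQ, fun x hx => ?_, fun x => ?_, fun x => ?_,
    fun x => ?_, ?_⟩
  · rw [LinearMap.comp_apply, show I.mkQ x = 0 from (Submodule.Quotient.mk_eq_zero I).2 hx,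
      map_zero]
  · refine (Submodule.Quotient.mk_eq_zero I).1 ?_
    change I.mkQ _ = 0
    rw [map_sub, cyc_apply,
      aeval_comm (ε' := ε') hε', hu', hp', h1, cyc_apply, LinearMap.comp_apply, sub_self]
  · exact h2 (I.mkQ x)
  · exact h3 (I.mkQ x)
  · rw [LinearMap.comp_apply, hu', h4]

/-- A sequence of subrepresentations which the arrows move by one step. -/
structure ArrowFilt (u : Gen X.framed → Module.End K Q) (J : ℕ → Submodule K Q) : Prop where
  inv : ∀ t, Inv u (J t)
  arrow : ∀ t a b g, ∀ x ∈ J t, u (.α a b g) x ∈ J (t + 1)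

/-- `s` is a homomorphism modulo `J`. -/
def HomMod (v : Gen X.framed → Module.End K M) (u : Gen X.framed → Module.End K Q)
    (J : Submodule K Q) (s : M →ₗ[K] Q) : Prop := ∀ a x, s (v a x) - u a (s x) ∈ J

namespace HomMod

variable {J : Submodule K Q} {s : M →ₗ[K] Q}

theorem aeval (hs : HomMod v u J s) (hJ : Inv u J) (b : ι ⊕ ι) (p : K[X]) (x : M) :
    s (Polynomial.aeval (v (.ε b)) p x) - Polynomial.aeval (u (.ε b)) p (s x) ∈ J := by
  induction p using Polynomial.induction_on generalizing x with
  | C a => simp [Module.algebraMap_end_apply]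
  | add p q hp hq =>
    have := J.add_mem (hp x) (hq x)
    simp only [map_add, LinearMap.add_apply]
    rwa [add_sub_add_comm]
  | monomial n a ih =>
    have h1 := J.add_mem (hs (.ε b) (Polynomial.aeval (v (.ε b)) (Polynomial.C a * Polynomial.X ^ n) x))
      (hJ (.ε b) _ (ih x))
    rw [map_sub, sub_add_sub_cancel] at h1
    rw [pow_succ', mul_left_comm]
    simpa only [map_mul, Polynomial.aeval_X, Module.End.mul_apply] using h1

theorem pow (hs : HomMod v u J s) (hJ : Inv u J) (b : ι ⊕ ι) (n : ℕ) (x : M) :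
    s ((v (.ε b) ^ n) x) - (u (.ε b) ^ n) (s x) ∈ J := by
  simpa using hs.aeval hJ b (Polynomial.X ^ n) x

theorem out (hs : HomMod v u J s) (hJ : Inv u J) (b : ι ⊕ ι) (x : M) (q : Ar X.framed b) :
    s (outMap Ω.framed v b x q) - outMap Ω.framed u b (s x) q ∈ J := by
  rw [outMap_apply, outMap_apply, map_zsmul, ← smul_sub]
  refine J.smul_of_tower_mem _ ?_
  have h1 := J.add_mem (hs (.α q.1 b (Fin.cast (X.framed.g_comm b q.1) q.2.1))
    ((v (.ε b) ^ (X.framed.f q.1 b - 1 - q.2.2)) x)) (hJ (.α q.1 b (Fin.cast (X.framed.g_comm b q.1) q.2.1)) _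
    (hs.pow hJ b (X.framed.f q.1 b - 1 - q.2.2) x))
  rwa [map_sub, sub_add_sub_cancel] at h1

theorem shift (hs : HomMod v u J s) (hJ : Inv u J) (b : ι ⊕ ι) (y : Ar X.framed b → M)
    (q : Ar X.framed b) :
    s (GenPreproj.shift v b y q) - GenPreproj.shift u b (s.compLeft _ y) q ∈ J := by
  obtain ⟨k, g, f⟩ := q
  rw [shift_apply, shift_apply]
  split_ifs with hf
  · exact hs.pow hJ _ _ _
  · simp

theorem inMap (hs : HomMod v u J s) (hJ : Inv u J) (b : ι ⊕ ι) (y : Ar X.framed b → M) :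
    s (GenPreproj.inMap v b y) - GenPreproj.inMap u b (s.compLeft _ y) ∈ J := by
  rw [inMap_apply, inMap_apply]
  simp only [map_sum, ← Finset.sum_sub_distrib]
  refine J.sum_mem fun k _ => J.sum_mem fun g _ => J.sum_mem fun f _ => ?_
  have hp : ∀ (n : ℕ), ∀ x ∈ J, (u (.ε b) ^ n) x ∈ J := by
    intro n x hx
    induction n with
    | zero => exact hx
    | succ n ih => rw [pow_succ', Module.End.mul_apply]; exact hJ _ _ ih
  have h1 := J.add_mem (hs.pow hJ b f (v (.α b k g) (y ⟨k, g, f⟩))) (hp f _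
    (hs (.α b k g) (y ⟨k, g, f⟩)))
  rwa [map_sub, sub_add_sub_cancel] at h1

end HomMod

theorem ArrowFilt.inMap_mem {J : ℕ → Submodule K Q} (hJ : ArrowFilt u J) (b : ι ⊕ ι) {t : ℕ}
    {y : Ar X.framed b → Q} (hy : ∀ q, y q ∈ J t) : inMap u b y ∈ J (t + 1) := by
  have hp : ∀ (n : ℕ), ∀ x ∈ J (t + 1), (u (.ε b) ^ n) x ∈ J (t + 1) := by
    intro n x hx
    induction n with
    | zero => exact hx
    | succ n ih => rw [pow_succ', Module.End.mul_apply]; exact hJ.inv _ _ _ ih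
  rw [inMap_apply]
  exact Submodule.sum_mem _ fun k _ => Submodule.sum_mem _ fun g _ => Submodule.sum_mem _
    fun f _ => hp _ _ (hJ.arrow t _ _ _ _ (hy _))

end Approx

/-! ### Lifting the generator by successive improvement of approximate homomorphisms. -/

section Lifting

variable {K : Type*} [Field K] {ι : Type} [Fintype ι] [DecidableEq ι]
  {X : SymmGCM ι} {Ω : Orientation X} {M : Type*} [AddCommGroup M] [Module K M]
  {Q : Type*} [AddCommGroup Q] [Module K Q]
  {v : Gen X.framed → Module.End K M} {u : Gen X.framed → Module.End K Q}

/-- Data exhibiting `M`, up to its framed part, as generated by the vector `v0` at the vertex `i`,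
with all relations coming from exactness at the unframed vertices. -/
structure Presentation (Ω : Orientation X) (v : Gen X.framed → Module.End K M) (i : ι) (v0 : M)
    (θ : M →ₗ[K] K[X]) (κ : ∀ j : ι, M →ₗ[K] (Ar X.framed (.inl j) → M)) : Prop where
  sat : Satisfies Ω.framed v
  exact : ∀ j, ∀ y ∈ reflR v (.inl j), ∃ m, outMap Ω.framed v (.inl j) m = y
  e_v0 : v (.e (.inl i)) v0 = v0
  θ_im : ∀ x ∈ imIn v (.inl i), θ x = 0
  θ_eps : ∀ x, Polynomial.X ^ X.c i ∣ θ (v (.ε (.inl i)) x) - Polynomial.X * θ x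
  θ_e : ∀ x, θ (v (.e (.inl i)) x) = θ x
  θ_v0 : θ v0 = 1
  κ_tl : ∀ j x, κ j x ∈ tl v (.inl j)
  κ_e : ∀ j x, κ j (v (.e (.inl j)) x) = κ j x
  in_κ : ∀ j x, inMap v (.inl j) (κ j x) =
    v (.e (.inl j)) x - if j = i then cyc (v (.ε (.inl i))) v0 (θ x) else 0

namespace Presentation

variable {i : ι} {v0 : M} {θ : M →ₗ[K] K[X]} {κ : ∀ j : ι, M →ₗ[K] (Ar X.framed (.inl j) → M)}

theorem θ_of_e (P : Presentation Ω v i v0 θ κ) {b : ι ⊕ ι} (hb : b ≠ .inl i) {x : M}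
    (hx : v (.e b) x = x) : θ x = 0 := by
  rw [← P.θ_e, P.sat.e_of_e hx, if_neg hb.symm, map_zero]

theorem κ_of_e (P : Presentation Ω v i v0 θ κ) {b : ι ⊕ ι} {j : ι} (hb : b ≠ .inl j) {x : M}
    (hx : v (.e b) x = x) : κ j x = 0 := by
  rw [← P.κ_e, P.sat.e_of_e hx, if_neg hb.symm, map_zero]

variable (u v0 θ κ) in
/-- The part at `j` of the improved approximation. -/
def part (s : M →ₗ[K] Q) (j : ι) : M →ₗ[K] Q :=
  inMap u (.inl j) ∘ₗ s.compLeft _ ∘ₗ κ j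

variable (u i θ) in
/-- The contribution of the generator to the improved approximation. -/
def base (z0 : Q) : M →ₗ[K] Q := cyc (u (.ε (.inl i))) z0 ∘ₗ θ

variable (u i θ κ) in
/-- The improved approximation. -/
def improve (z0 : Q) (s : M →ₗ[K] Q) : M →ₗ[K] Q :=
  ∑ j, part u κ s j + base u i θ z0

theorem improve_apply (z0 : Q) (s : M →ₗ[K] Q) (x : M) :
    improve u i θ κ z0 s x = ∑ j, part u κ s j x + base u i θ z0 x := by
  simp [improve]

variable {J : ℕ → Submodule K Q} {t : ℕ} {s : M →ₗ[K] Q} {z0 : Q}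

/-- The reason why improvement works. By exactness a relation `y` is `outMap m`; modulo `J t` its
image is `outMap (s m)`, which `inMap` kills by the mesh relation, while `inMap` moves the error in
`J t` one arrow further. -/
theorem inMap_compLeft_mem (P : Presentation Ω v i v0 θ κ) (hu : Satisfies Ω.framed u)
    (hJ : ArrowFilt u J) (hs : HomMod v u (J t) s) {j : ι} {y : Ar X.framed (.inl j) → M}
    (hy : y ∈ reflR v (.inl j)) : inMap u (.inl j) (s.compLeft _ y) ∈ J (t + 1) := by
  obtain ⟨m, rfl⟩ := P.exact j y hy
  have h1 := hJ.inMap_mem (.inl j) (y := s.compLeft _ (outMap Ω.framed v (.inl j) m) -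
    outMap Ω.framed u (.inl j) (s m)) fun q => hs.out (hJ.inv t) _ m q
  rwa [map_sub, inMap_outMap hu, sub_zero] at h1

theorem e_part (hu : Satisfies Ω.framed u) (j : ι) (x : M) :
    u (.e (.inl j)) (part u κ s j x) = part u κ s j x := e_inMap hu _ _

theorem e_base (hu : Satisfies Ω.framed u) (hz : u (.e (.inl i)) z0 = z0) (x : M) :
    u (.e (.inl i)) (base u i θ z0 x) = base u i θ z0 x :=
  (hu.nilpOn (.inl i)).aeval_e hz _

theorem part_of_e (P : Presentation Ω v i v0 θ κ) {b : ι ⊕ ι} {j : ι} (hb : b ≠ .inl j) {x : M}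
    (hx : v (.e b) x = x) : part u κ s j x = 0 := by
  rw [part, LinearMap.comp_apply, LinearMap.comp_apply, P.κ_of_e hb hx, map_zero, map_zero]

theorem base_of_e (P : Presentation Ω v i v0 θ κ) {b : ι ⊕ ι} (hb : b ≠ .inl i) {x : M}
    (hx : v (.e b) x = x) : base u i θ z0 x = 0 := by
  rw [base, LinearMap.comp_apply, P.θ_of_e hb hx, map_zero]

theorem improve_of_inr (P : Presentation Ω v i v0 θ κ) {l : ι} {x : M}
    (hx : v (.e (.inr l)) x = x) : improve u i θ κ z0 s x = 0 := by
  rw [improve_apply, P.base_of_e (by simp) hx, add_zero]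
  exact Finset.sum_eq_zero fun j _ => P.part_of_e (by simp) hx

theorem improve_of_inl (P : Presentation Ω v i v0 θ κ) {j : ι} {x : M}
    (hx : v (.e (.inl j)) x = x) :
    improve u i θ κ z0 s x = part u κ s j x + base u i θ z0 x := by
  rw [improve_apply, Finset.sum_eq_single j]
  · intro l _ hl
    exact P.part_of_e (by simpa using hl.symm) hx
  · simp

theorem improve_e (P : Presentation Ω v i v0 θ κ) (hu : Satisfies Ω.framed u)
    (hu0 : ∀ l, u (.e (.inr l)) = 0) (hz : u (.e (.inl i)) z0 = z0) (b : ι ⊕ ι) (x : M) :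
    improve u i θ κ z0 s (v (.e b) x) = u (.e b) (improve u i θ κ z0 s x) := by
  rcases b with j | l
  · rw [P.improve_of_inl (P.sat.e_e _ _), improve_apply, map_add, map_sum,
      Finset.sum_eq_single j]
    · rw [e_part hu]
      congr 1
      · simp only [part, LinearMap.comp_apply, P.κ_e]
      · rw [hu.e_of_e (e_base hu hz x)]
        split_ifs with h
        · rw [Sum.inl.inj h, base, LinearMap.comp_apply, LinearMap.comp_apply, P.θ_e]
        · exact P.base_of_e h (P.sat.e_e _ _)
    · intro k _ hk
      rw [hu.e_of_e (e_part hu k x), if_neg (by simpa using hk.symm)]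
    · simp
  · rw [P.improve_of_inr (P.sat.e_e _ _), hu0, LinearMap.zero_apply]

/-- The linear map `κ j` is not assumed to commute with `ε_j`, but its defect is a relation, which
`inMap_compLeft_mem` absorbs. -/
theorem part_eps (P : Presentation Ω v i v0 θ κ) (hu : Satisfies Ω.framed u)
    (hJ : ArrowFilt u J) (hs : HomMod v u (J t) s) (j : ι) (x : M) :
    part u κ s j (v (.ε (.inl j)) x) - u (.ε (.inl j)) (part u κ s j x) ∈ J (t + 1) := by
  have h1 : κ j (v (.ε (.inl j)) x) - shift v (.inl j) (κ j x) ∈ reflR v (.inl j) := by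
    refine ⟨Submodule.sub_mem _ (P.κ_tl j _) (shift_mem_tl P.sat (P.κ_tl j _)), ?_⟩
    change inMap v (.inl j) _ = 0
    rw [map_sub, inMap_shift P.sat, P.in_κ, P.in_κ, map_sub, P.sat.e_eps, P.sat.eps_e,
      sub_sub_sub_cancel_left]
    split_ifs with hj
    · subst hj
      have h2 : cyc (v (.ε (.inl j))) v0 (θ (v (.ε (.inl j)) x)) =
          v (.ε (.inl j)) (cyc (v (.ε (.inl j))) v0 (θ x)) :=
        cyc_eq_of_dvd (c := X.c j) (P.sat.nilp (.inl j)) v0 (P.θ_eps x)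
      rw [h2, sub_self]
    · rw [map_zero, sub_zero]
  have h2 := (J (t + 1)).add_mem (P.inMap_compLeft_mem hu hJ hs h1)
    (hJ.inMap_mem (.inl j) (y := s.compLeft _ (shift v (.inl j) (κ j x)) -
      shift u (.inl j) (s.compLeft _ (κ j x))) fun q => hs.shift (hJ.inv t) _ _ q)
  rwa [map_sub, map_sub, map_sub, sub_add_sub_cancel, inMap_shift hu] at h2

theorem base_eps (P : Presentation Ω v i v0 θ κ) (hu : Satisfies Ω.framed u) (x : M) :
    base u i θ z0 (v (.ε (.inl i)) x) = u (.ε (.inl i)) (base u i θ z0 x) :=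
  cyc_eq_of_dvd (hu.nilp _) z0 (P.θ_eps x)

theorem improve_eps (P : Presentation Ω v i v0 θ κ) (hu : Satisfies Ω.framed u)
    (hu0 : ∀ l, u (.e (.inr l)) = 0) (hz : u (.e (.inl i)) z0 = z0)
    (hJ : ArrowFilt u J) (hs : HomMod v u (J t) s) (b : ι ⊕ ι) (x : M) :
    improve u i θ κ z0 s (v (.ε b) x) - u (.ε b) (improve u i θ κ z0 s x) ∈ J (t + 1) := by
  rcases b with j | l
  · rw [P.improve_of_inl (P.sat.e_eps _ _), ← hu.eps_e (.inl j) (improve u i θ κ z0 s x),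
      ← P.improve_e hu hu0 hz, P.improve_of_inl (P.sat.e_e _ _), map_add, add_sub_add_comm]
    refine Submodule.add_mem _ ?_ ?_
    · have := P.part_eps hu hJ hs j (v (.e (.inl j)) x)
      rwa [P.sat.eps_e] at this
    · by_cases hj : j = i
      · subst hj
        have := P.base_eps (z0 := z0) hu (v (.e (.inl j)) x)
        rw [P.sat.eps_e] at this
        rw [this, sub_self]
        exact Submodule.zero_mem _
      · rw [P.base_of_e (by simpa using hj) (P.sat.e_eps _ _),
          P.base_of_e (by simpa using hj) (P.sat.e_e _ _), map_zero, sub_self]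
        exact Submodule.zero_mem _
  · rw [P.improve_of_inr (P.sat.e_eps _ _), ← hu.eps_e, hu0, LinearMap.zero_apply, map_zero,
      sub_self]
    exact Submodule.zero_mem _

/-- Each vector at `j` is recovered from its coordinates by `in_κ`, and `s` respects this expression
modulo `J t`; so the improvement changes `s` only within `J t`. -/
theorem improve_sub (P : Presentation Ω v i v0 θ κ)
    (hu0 : ∀ l, u (.e (.inr l)) = 0)
    (hJ : ArrowFilt u J) (hs : HomMod v u (J t) s) (hs0 : s v0 - z0 ∈ J t) (x : M) :
    s x - improve u i θ κ z0 s x ∈ J t := by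
  conv => enter [2]; rw [← P.sat.sum_e x]
  rw [map_sum, map_sum, ← Finset.sum_sub_distrib]
  refine Submodule.sum_mem _ fun b _ => ?_
  rcases b with j | l
  · rw [P.improve_of_inl (P.sat.e_e _ _)]
    have h1 := P.in_κ j (v (.e (.inl j)) x)
    rw [P.sat.e_e, eq_sub_iff_add_eq] at h1
    have h2 := hs.inMap (hJ.inv t) (.inl j) (κ j (v (.e (.inl j)) x))
    rw [← h1, map_add, h1, add_sub_add_comm]
    refine Submodule.add_mem _ h2 ?_
    split_ifs with hj
    · subst hj
      have hcyc : ∀ (p : K[X]) (y : Q), y ∈ J t → cyc (u (.ε (.inl j))) y p ∈ J t := by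
        intro p y hy
        rw [cyc_apply]
        induction p using Polynomial.induction_on generalizing y with
        | C a => simpa [Module.algebraMap_end_apply] using (J t).smul_mem a hy
        | add p q hp hq => simpa using (J t).add_mem (hp y hy) (hq y hy)
        | monomial n a ih =>
          rw [pow_succ', mul_left_comm]
          simpa only [map_mul, Polynomial.aeval_X, Module.End.mul_apply] using hJ.inv t _ _ (ih y hy)
      have h3 := (J t).add_mem (hs.aeval (hJ.inv t) (.inl j) (θ (v (.e (.inl j)) x)) v0)
        (hcyc (θ (v (.e (.inl j)) x)) _ hs0)
      rw [cyc_apply, map_sub, sub_add_sub_cancel] at h3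
      exact h3
    · rw [P.base_of_e (by simpa using hj) (P.sat.e_e _ _), map_zero, sub_self]
      exact Submodule.zero_mem _
  · rw [P.improve_of_inr (P.sat.e_e _ _), sub_zero]
    have := hs (.e (.inr l)) x
    rwa [hu0, LinearMap.zero_apply, sub_zero] at this

/-- The coordinates of `α x` and the family with single entry `x` at the arrow `α` have the same
image, so they differ by a relation. Replacing `s x` by its improvement afterwards costs an element
of `α (J t)`, which lies in `J (t + 1)`. -/
theorem improve_arrow (P : Presentation Ω v i v0 θ κ) (hu : Satisfies Ω.framed u)
    (hu0 : ∀ l, u (.e (.inr l)) = 0)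
    (hJ : ArrowFilt u J) (hs : HomMod v u (J t) s) (hs0 : s v0 - z0 ∈ J t) (b c : ι ⊕ ι) (g)
    (x : M) :
    improve u i θ κ z0 s (v (.α b c g) x) - u (.α b c g) (improve u i θ κ z0 s x) ∈ J (t + 1) := by
  rcases b with j | l
  · have hθ : base u i θ z0 (v (.α (.inl j) c g) x) = 0 := by
      by_cases hj : j = i
      · subst hj
        rw [base, LinearMap.comp_apply, P.θ_im _ (α_mem_imIn P.sat _ _ _ _), map_zero]
      · exact P.base_of_e (by simpa using hj) (P.sat.e_α _ _ _ _)
    have hθ' : (if j = i then cyc (v (.ε (.inl i))) v0 (θ (v (.α (.inl j) c g) x)) else 0) = 0 := by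
      split_ifs with hj
      · subst hj
        rw [P.θ_im _ (α_mem_imIn P.sat _ _ _ _), map_zero]
      · rfl
    rw [P.improve_of_inl (P.sat.e_α _ _ _ _), hθ, add_zero]
    have hlt : 0 < X.framed.f c (.inl j) := by have := Ar.last_lt c g; omega
    let q : Ar X.framed (.inl j) := ⟨c, g, ⟨0, hlt⟩⟩
    have h1 : κ j (v (.α (.inl j) c g) x) - Pi.single q (v (.e c) x) ∈ reflR v (.inl j) := by
      refine ⟨Submodule.sub_mem _ (P.κ_tl j _) (single_mem_tl (P.sat.e_e _ _)), ?_⟩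
      change inMap v (.inl j) _ = 0
      rw [map_sub, P.in_κ, inMap_single, hθ', sub_zero, P.sat.e_α]
      change _ - v (.α (.inl j) c g) (v (.e c) x) = 0
      rw [P.sat.α_e, sub_self]
    have h2 := P.inMap_compLeft_mem hu hJ hs h1
    have h3 : s.compLeft (Ar X.framed (.inl j)) (Pi.single q (v (.e c) x)) =
        Pi.single q (s (v (.e c) x)) := by
      funext q'
      by_cases hq : q' = q
      · subst hq; simp
      · simp [Pi.single_eq_of_ne hq]
    rw [map_sub, map_sub, h3, inMap_single] at h2
    change part u κ s j _ - u (.α (.inl j) c g) (s (v (.e c) x)) ∈ J (t + 1) at h2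
    have h4 := hJ.arrow t (.inl j) c g _ (hs (.e c) x)
    rw [map_sub, hu.α_e] at h4
    have h5 := hJ.arrow t (.inl j) c g _ (P.improve_sub hu0 hJ hs hs0 x)
    rw [map_sub] at h5
    have h6 := Submodule.add_mem _ (Submodule.add_mem _ h2 h4) h5
    rwa [sub_add_sub_cancel, sub_add_sub_cancel] at h6
  · rw [P.improve_of_inr (P.sat.e_α _ _ _ _), ← hu.e_α, hu0, LinearMap.zero_apply, sub_zero]
    exact Submodule.zero_mem _

theorem improve_v0 (P : Presentation Ω v i v0 θ κ) (hu : Satisfies Ω.framed u)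
    (hJ : ArrowFilt u J) (hs : HomMod v u (J t) s) :
    improve u i θ κ z0 s v0 - z0 ∈ J (t + 1) := by
  have h1 : base u i θ z0 v0 = z0 := by
    rw [base, LinearMap.comp_apply, P.θ_v0, cyc_apply, map_one, Module.End.one_apply]
  rw [P.improve_of_inl P.e_v0, h1, add_sub_cancel_right]
  refine P.inMap_compLeft_mem hu hJ hs ⟨P.κ_tl i _, ?_⟩
  change inMap v (.inl i) _ = 0
  rw [P.in_κ, if_pos rfl, P.θ_v0, P.e_v0, cyc_apply, map_one, Module.End.one_apply, sub_self]

/-- There are homomorphisms modulo every step of the filtration that send `v0` to `z0`. -/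
theorem exists_homMod (P : Presentation Ω v i v0 θ κ) (hu : Satisfies Ω.framed u)
    (hu0 : ∀ l, u (.e (.inr l)) = 0) (hz : u (.e (.inl i)) z0 = z0)
    (hJ : ArrowFilt u J) (hJ0 : J 0 = ⊤) (t : ℕ) :
    ∃ s : M →ₗ[K] Q, HomMod v u (J t) s ∧ s v0 - z0 ∈ J t := by
  induction t with
  | zero => exact ⟨0, fun a x => hJ0 ▸ trivial, hJ0 ▸ trivial⟩
  | succ t ih =>
    obtain ⟨s, hs, hs0⟩ := ih
    refine ⟨improve u i θ κ z0 s, ?_, P.improve_v0 hu hJ hs⟩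
    rintro (b | b | ⟨b, c, g⟩) x
    · rw [P.improve_e hu hu0 hz, sub_self]
      exact Submodule.zero_mem _
    · exact P.improve_eps hu hu0 hz hJ hs b x
    · exact P.improve_arrow hu hu0 hJ hs hs0 b c g x

end Presentation

/-- The good representation of weight `ϖᵢ` has a presentation. -/
theorem Good.exists_presentation {k : ι} {ν : ι → ℕ} (h : Good Ω k ν v) {i : ι}
    (hwt : wt X k ν = Pi.single i 1)
    (hex : ∀ j, (LinearMap.range (v (.e (.inl j)))).map (outMap Ω.framed v (.inl j)) =
      reflR v (.inl j)) : ∃ v0 θ κ, Presentation Ω v i v0 θ κ := by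
  have := h.fd
  have hv := h.sat
  -- By exactness and stability `dim R = dim M_j`, so `Good.finrank_add` gives the cokernel of the
  -- incoming map dimension `c j` times the weight at `j`: only the vertex `i` needs a new
  -- generator.
  have hrank : ∀ j, Module.finrank K (LinearMap.range (v (.e (.inl j)))) =
      Module.finrank K (imIn v (.inl j)) + if j = i then X.c j else 0 := by
    intro j
    have h3 := finrank_map_add_inf_ker (outMap Ω.framed v (.inl j))
      (LinearMap.range (v (.e (.inl j))))
    have h4 : LinearMap.range (v (.e (.inl j))) ⊓
        LinearMap.ker (outMap Ω.framed v (.inl j)) = ⊥ := by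
      rw [Submodule.eq_bot_iff]
      rintro x ⟨hx, hx0⟩
      exact h.stable.outMap_injOn hv j ((hv.nilpOn _).mem_range.1 hx) hx0
    rw [h4, finrank_bot, add_zero, hex] at h3
    have h5 := h.finrank_add j
    rw [h3, h.finrank_range_inl, hwt, Nat.cast_mul] at h5
    rw [h.finrank_range_inl]
    zify
    by_cases hj : j = i
    · subst hj
      rw [Pi.single_eq_same] at h5
      rw [if_pos rfl]
      linarith
    · rw [Pi.single_eq_of_ne hj] at h5
      rw [if_neg hj]
      linarith
  obtain ⟨v0, h0, θ, h1, h2, h3, h4, h5⟩ := h.exists_coker_generator (hex i)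
    (by rw [hrank, if_pos rfl])
  have hκ : ∀ j, ∃ κ : M →ₗ[K] (Ar X.framed (.inl j) → M), (∀ x, κ x ∈ tl v (.inl j)) ∧
      ∀ x, inMap v (.inl j) (κ x) =
        v (.e (.inl j)) x - if j = i then cyc (v (.ε (.inl i))) v0 (θ x) else 0 := by
    intro j
    let T : tl v (.inl j) →ₗ[K] imIn v (.inl j) :=
      (inMap v (.inl j)).restrict fun y hy => ⟨y, hy, rfl⟩
    have hT : LinearMap.range T = ⊤ := by
      rw [LinearMap.range_eq_top]
      rintro ⟨_, y, hy, rfl⟩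
      exact ⟨⟨y, hy⟩, rfl⟩
    -- A mere `K`-linear section of the incoming map is enough for the coordinates `κ j`.
    obtain ⟨σ, hσ⟩ := T.exists_rightInverse_of_surjective hT
    let G : M →ₗ[K] M := v (.e (.inl j)) -
      if j = i then cyc (v (.ε (.inl i))) v0 ∘ₗ θ else 0
    have hG : ∀ x, G x = v (.e (.inl j)) x -
        if j = i then cyc (v (.ε (.inl i))) v0 (θ x) else 0 := by
      intro x
      simp only [G, LinearMap.sub_apply]
      split_ifs <;> rfl
    have hGm : ∀ x, G x ∈ imIn v (.inl j) := by
      intro x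
      rw [hG]
      split_ifs with hj
      · subst hj; exact h2 x
      · have : imIn v (.inl j) = LinearMap.range (v (.e (.inl j))) := by
          refine Submodule.eq_of_le_of_finrank_eq (imIn_le hv _) ?_
          rw [hrank, if_neg hj, add_zero]
        rw [sub_zero, this]
        exact ⟨x, rfl⟩
    refine ⟨(tl v (.inl j)).subtype ∘ₗ σ ∘ₗ G.codRestrict _ hGm, fun x => (σ _).2, fun x => ?_⟩
    rw [← hG]
    exact congrArg Subtype.val (LinearMap.congr_fun hσ (G.codRestrict _ hGm x))
  choose κ hκ1 hκ2 using hκ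
  refine ⟨v0, θ, fun j => κ j ∘ₗ v (.e (.inl j)), hv, fun j y hy => ?_, h0, h1, h3, h4, h5,
    fun j x => hκ1 _ _, fun j x => ?_, fun j x => ?_⟩
  · rw [← hex] at hy
    obtain ⟨m, -, hm⟩ := hy
    exact ⟨m, hm⟩
  · rw [LinearMap.comp_apply, LinearMap.comp_apply, hv.e_e]
  · rw [LinearMap.comp_apply, hκ2, hv.e_e]
    split_ifs with hj
    · subst hj; rw [h4]
    · rfl

end Lifting

/-! ### The grading of `Π` by the number of arrows. -/

section Grading

variable {K : Type*} [Field K] {ι : Type} [Fintype ι] [DecidableEq ι] {X : SymmGCM ι}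
  {Ω : Orientation X}

theorem mk_surjective (Ω : Orientation X) : Function.Surjective (mk K Ω) :=
  RingQuot.mkAlgHom_surjective K (Rel K Ω)

theorem Preproj.algHom_ext {A : Type*} [Ring A] [Algebra K A] {φ ψ : Preproj K Ω →ₐ[K] A}
    (h : ∀ x, φ (gen K Ω x) = ψ (gen K Ω x)) : φ = ψ := by
  have h1 : φ.comp (mk K Ω) = ψ.comp (mk K Ω) := FreeAlgebra.hom_ext (funext h)
  refine AlgHom.ext fun a => ?_
  obtain ⟨a, rfl⟩ := mk_surjective Ω a
  exact DFunLike.congr_fun h1 a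

/-- Induction over the generators of `Π`. -/
theorem Preproj.induction {P : Preproj K Ω → Prop} (hK : ∀ k, P (algebraMap K _ k))
    (hg : ∀ x, P (gen K Ω x)) (ha : ∀ a b, P a → P b → P (a + b))
    (hm : ∀ a b, P a → P b → P (a * b)) (a : Preproj K Ω) : P a := by
  obtain ⟨a, rfl⟩ := mk_surjective Ω a
  induction a using FreeAlgebra.induction with
  | grade0 k => rw [AlgHom.commutes]; exact hK k
  | grade1 x => exact hg x
  | mul a b h1 h2 => rw [map_mul]; exact hm _ _ h1 h2
  | add a b h1 h2 => rw [map_add]; exact ha _ _ h1 h2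

theorem Satisfies.map {A B : Type*} [Ring A] [Ring B] {v : Gen X → A} (hv : Satisfies Ω v)
    (φ : A →+* B) : Satisfies Ω fun x => φ (v x) where
  idem i j := by rw [← map_mul, hv.idem]; split_ifs <;> simp
  unit := by rw [← map_sum, hv.unit, map_one]
  loop i := by rw [← map_mul, ← map_mul, hv.loop]
  arrow i j g := by rw [← map_mul, ← map_mul, hv.arrow]
  nilp i := by rw [← map_pow, hv.nilp, map_zero]
  comm i j g := by rw [← map_pow, ← map_pow, ← map_mul, ← map_mul, hv.comm]
  mesh i := by rw [← map_mesh, hv.mesh, map_zero]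

/-- The generators of `Π`, with a formal variable recording the number of arrows. -/
def gradeVal (K : Type*) [Field K] (Ω : Orientation X) : Gen X → (Preproj K Ω)[X]
  | .e i => Polynomial.C (gen K Ω (.e i))
  | .ε i => Polynomial.C (gen K Ω (.ε i))
  | .α i j g => Polynomial.C (gen K Ω (.α i j g)) * Polynomial.X

/-- All relations are homogeneous in the arrows: `comm` has one arrow on each side and every term of
a mesh has two. -/
theorem gradeVal_satisfies : Satisfies Ω (gradeVal K Ω) := by
  have hg := (gen_satisfies K Ω).map (Polynomial.C : Preproj K Ω →+* (Preproj K Ω)[X])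
  have hX : ∀ p : (Preproj K Ω)[X], Polynomial.X * p = p * Polynomial.X := fun _ => Polynomial.X_mul
  refine ⟨hg.idem, hg.unit, hg.loop, fun i j g => ?_, hg.nilp, fun i j g => ?_, fun i => ?_⟩
  · have := hg.arrow i j g
    change Polynomial.C _ * (Polynomial.C _ * Polynomial.X) * Polynomial.C _ = Polynomial.C _ * _
    rw [← this, ← mul_assoc, mul_assoc _ Polynomial.X, hX, ← mul_assoc]
    simp only [this]
  · have := hg.comm i j g
    change Polynomial.C _ ^ _ * (Polynomial.C _ * Polynomial.X) =
      Polynomial.C _ * Polynomial.X * Polynomial.C _ ^ _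
    rw [← mul_assoc, this, mul_assoc, mul_assoc, hX]
  · have := hg.mesh i
    rw [mesh] at this ⊢
    rw [← zero_mul (Polynomial.X * Polynomial.X : (Preproj K Ω)[X]), ← this]
    simp only [Finset.sum_mul, smul_mul_assoc]
    refine Finset.sum_congr rfl fun j _ => Finset.sum_congr rfl fun g _ =>
      Finset.sum_congr rfl fun f _ => congrArg _ ?_
    change Polynomial.C _ ^ _ * (Polynomial.C _ * Polynomial.X) * (Polynomial.C _ * Polynomial.X) *
      Polynomial.C _ ^ _ = _
    simp only [mul_assoc]
    congr 2
    rw [hX (_ * _), hX (Polynomial.C _ ^ _)]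
    simp only [mul_assoc]

/-- The homomorphism that records the number of arrows. -/
def grade (K : Type*) [Field K] (Ω : Orientation X) : Preproj K Ω →ₐ[K] (Preproj K Ω)[X] :=
  lift K Ω (gradeVal K Ω) gradeVal_satisfies

theorem grade_gen (x : Gen X) : grade K Ω (gen K Ω x) = gradeVal K Ω x := lift_gen _ _ _ _ _

/-- Setting the formal variable equal to one is a left inverse. -/
theorem grade_injective : Function.Injective (grade K Ω) := by
  let E : (Preproj K Ω)[X] →ₐ[K] Preproj K Ω :=
    { Polynomial.eval₂RingHom' (RingHom.id _) 1 fun a => Commute.one_right a with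
      commutes' := fun k => Polynomial.eval₂_C _ _ }
  have hC : ∀ a, E (Polynomial.C a) = a := fun a => Polynomial.eval₂_C _ _
  have hX : E Polynomial.X = 1 := Polynomial.eval₂_X _ _
  have h : E.comp (grade K Ω) = AlgHom.id K _ := by
    refine Preproj.algHom_ext fun x => ?_
    rw [AlgHom.comp_apply, grade_gen]
    rcases x with i | i | ⟨i, j, g⟩ <;>
      simp [gradeVal, hC, hX]
  intro a b hab
  have := DFunLike.congr_fun h
  simp only [AlgHom.comp_apply, AlgHom.id_apply] at this
  rw [← this a, ← this b, hab]

/-- The elements of `Π` that involve at least `t` arrows. -/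
def arrowIdeal (K : Type*) [Field K] (Ω : Orientation X) (t : ℕ) : Submodule K (Preproj K Ω) where
  carrier := {a | ∀ m < t, (grade K Ω a).coeff m = 0}
  add_mem' ha hb m hm := by rw [map_add, Polynomial.coeff_add, ha m hm, hb m hm, add_zero]
  zero_mem' m _ := by simp
  smul_mem' k a ha m hm := by rw [map_smul, Polynomial.coeff_smul, ha m hm, smul_zero]

theorem mul_mem_arrowIdeal {t : ℕ} (a : Preproj K Ω) {b : Preproj K Ω}
    (hb : b ∈ arrowIdeal K Ω t) : a * b ∈ arrowIdeal K Ω t := by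
  intro m hm
  rw [map_mul, Polynomial.coeff_mul]
  refine Finset.sum_eq_zero fun p hp => ?_
  rw [hb p.2 (by have := Finset.HasAntidiagonal.mem_antidiagonal.1 hp; omega), mul_zero]

/-- The filtration by arrows is separated. This allows congruences modulo arbitrarily long paths to
stand in for finite-dimensionality of `Π`, which is not used. -/
theorem eq_zero_of_mem_arrowIdeal {a : Preproj K Ω} (h : ∀ t, a ∈ arrowIdeal K Ω t) : a = 0 := by
  apply grade_injective
  rw [map_zero]
  exact Polynomial.ext fun m => h (m + 1) m (Nat.lt_succ_self m)

/-- `Π` as a representation of the framed algebra. -/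
def regVal (K : Type*) [Field K] (Ω : Orientation X) (a : Gen X.framed) :
    Module.End K (Preproj K Ω) := LinearMap.mulLeft K (framedVal K Ω a)

theorem regVal_satisfies : Satisfies Ω.framed (regVal K Ω) :=
  (framedVal_satisfies K Ω).map (Algebra.lmul K (Preproj K Ω)).toRingHom

theorem arrowFilt : ArrowFilt (regVal K Ω) (arrowIdeal K Ω) where
  inv t a x hx := mul_mem_arrowIdeal _ hx
  arrow t a b g x hx := by
    rcases a with i | i <;> rcases b with j | j
    · intro m hm
      change (grade K Ω (gen K Ω (.α i j g) * x)).coeff m = 0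
      have h1 : gradeVal K Ω (.α i j g) = Polynomial.C (gen K Ω (.α i j g)) * Polynomial.X := rfl
      rw [map_mul, grade_gen, h1, mul_assoc, Polynomial.coeff_C_mul, Polynomial.X_mul]
      cases m with
      | zero => rw [Polynomial.coeff_mul_X_zero, mul_zero]
      | succ m => rw [Polynomial.coeff_mul_X, hx m (by omega), mul_zero]
    all_goals
      have : regVal K Ω (.α _ _ g) x = 0 := zero_mul x
      rw [this]
      exact Submodule.zero_mem _

end Grading

/-! ### Nilpotency of the radical of a filtered representation, and Nakayama's lemma. -/

section Nakayama

variable {K : Type*} [Field K] {ι : Type} [Fintype ι] [DecidableEq ι] {Y : SymmGCM ι}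
  {Ω : Orientation Y} {M : Type*} [AddCommGroup M] [Module K M] {v : Gen Y → Module.End K M}

/-- The sum of the images of a subspace under the loops and arrows. -/
def rad (v : Gen Y → Module.End K M) (T : Submodule K M) : Submodule K M :=
  (⨆ i, T.map (v (.ε i))) ⊔ ⨆ q : Σ i j, Fin (Y.g i j), T.map (v (.α q.1 q.2.1 q.2.2))

theorem eps_mem_rad {T : Submodule K M} (i : ι) {x : M} (hx : x ∈ T) : v (.ε i) x ∈ rad v T :=
  Submodule.mem_sup_left (Submodule.mem_iSup_of_mem i ⟨x, hx, rfl⟩)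

theorem arrow_mem_rad {T : Submodule K M} (i j : ι) (g) {x : M} (hx : x ∈ T) :
    v (.α i j g) x ∈ rad v T :=
  Submodule.mem_sup_right (Submodule.mem_iSup_of_mem ⟨i, j, g⟩ ⟨x, hx, rfl⟩)

theorem rad_le {T S : Submodule K M} (h1 : ∀ i, ∀ x ∈ T, v (.ε i) x ∈ S)
    (h2 : ∀ i j g, ∀ x ∈ T, v (.α i j g) x ∈ S) : rad v T ≤ S := by
  refine sup_le (iSup_le fun i => ?_) (iSup_le fun q => ?_)
  · rintro _ ⟨x, hx, rfl⟩; exact h1 i x hx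
  · rintro _ ⟨x, hx, rfl⟩; exact h2 _ _ _ x hx

theorem rad_mono {T S : Submodule K M} (h : T ≤ S) : rad v T ≤ rad v S :=
  rad_le (fun i _ hx => eps_mem_rad i (h hx)) fun i j g _ hx => arrow_mem_rad i j g (h hx)

theorem rad_sup_le (T S : Submodule K M) : rad v (T ⊔ S) ≤ rad v T ⊔ rad v S := by
  refine rad_le (fun i x hx => ?_) (fun i j g x hx => ?_)
  · obtain ⟨a, ha, b, hb, rfl⟩ := Submodule.mem_sup.1 hx
    rw [map_add]
    exact Submodule.add_mem_sup (eps_mem_rad i ha) (eps_mem_rad i hb)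
  · obtain ⟨a, ha, b, hb, rfl⟩ := Submodule.mem_sup.1 hx
    rw [map_add]
    exact Submodule.add_mem_sup (arrow_mem_rad i j g ha) (arrow_mem_rad i j g hb)

theorem Inv.rad_le {S : Submodule K M} (h : Inv v S) : rad v S ≤ S :=
  GenPreproj.rad_le (fun _ x hx => h _ x hx) fun _ _ _ x hx => h _ x hx

theorem rad_iterate_mono (n : ℕ) {T S : Submodule K M} (h : T ≤ S) :
    (rad v)^[n] T ≤ (rad v)^[n] S := by
  induction n generalizing T S with
  | zero => exact h
  | succ n ih => exact ih (rad_mono h)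

/-- Modulo `S` the next step `T` is one `ε_i`-string at the vertex `i`. Arrows change the vertex and
so send it into `S`, and each application of the radical raises the power of `ε_i`; thus `c i`
applications push `T` into `S`. -/
theorem EFilt.rad_iterate_eq_bot (hv : Satisfies Ω v) {T : Submodule K M} (h : EFilt v T) :
    ∃ n, (rad v)^[n] T = ⊥ := by
  induction h with
  | bot => exact ⟨0, rfl⟩
  | step S T i u hS hT hST hu he hn hle ih =>
    obtain ⟨n, hn⟩ := ih
    let D : ℕ → Submodule K M := fun m =>
      LinearMap.range (cyc (v (.ε i)) u ∘ₗ LinearMap.mulLeft K (Polynomial.X ^ m : K[X]))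
    have hce : ∀ p, v (.e i) (cyc (v (.ε i)) u p) = cyc (v (.ε i)) u p :=
      fun p => (hv.nilpOn i).aeval_e he p
    have hcT : ∀ p, cyc (v (.ε i)) u p ∈ T := by
      intro p
      rw [cyc_apply]
      induction p using Polynomial.induction_on with
      | C a => simpa [Module.algebraMap_end_apply] using T.smul_mem a hu
      | add p q hp hq => simpa using T.add_mem hp hq
      | monomial n a ih =>
        rw [pow_succ', mul_left_comm]
        simpa only [map_mul, Polynomial.aeval_X, Module.End.mul_apply] using hT _ _ ih
    have hstep : ∀ m, rad v (S ⊔ D m) ≤ S ⊔ D (m + 1) := by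
      intro m
      refine (rad_sup_le S (D m)).trans (sup_le (hS.inv.rad_le.trans le_sup_left) ?_)
      refine GenPreproj.rad_le ?_ ?_
      · rintro j _ ⟨p, rfl⟩
        by_cases hj : i = j
        · subst hj
          refine Submodule.mem_sup_right ⟨p, ?_⟩
          simp only [LinearMap.comp_apply, LinearMap.mulLeft_apply, cyc_apply]
          rw [pow_succ', mul_assoc, map_mul (Polynomial.aeval _) Polynomial.X, Polynomial.aeval_X,
            Module.End.mul_apply]
        · rw [LinearMap.comp_apply, hv.eps_of_e hj (hce _)]
          exact Submodule.zero_mem _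
      · rintro a b g _ ⟨p, rfl⟩
        by_cases hb : i = b
        · subst hb
          rw [LinearMap.comp_apply]
          obtain ⟨s, hs, _, ⟨p', rfl⟩, hsp⟩ := Submodule.mem_sup.1
            (hle (hT (.α a i g) _ (hcT (LinearMap.mulLeft K (Polynomial.X ^ m : K[X]) p))))
          have h1 := congrArg (v (.e a)) hsp
          rw [map_add, hv.e_α, hv.e_of_e (hce p'), if_neg (Y.ne_of_fin g), add_zero] at h1
          exact Submodule.mem_sup_left (h1 ▸ hS.inv _ _ hs)
        · rw [LinearMap.comp_apply, hv.α_of_e hb (hce _)]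
          exact Submodule.zero_mem _
    have hiter : ∀ m, (rad v)^[m] T ≤ S ⊔ D m := by
      intro m
      induction m with
      | zero =>
        refine hle.trans (sup_le_sup_left ?_ _)
        rintro _ ⟨p, rfl⟩
        exact ⟨p, by simp⟩
      | succ m ihm =>
        rw [Function.iterate_succ_apply']
        exact (rad_mono ihm).trans (hstep m)
    have hD : D (Y.c i) = ⊥ := by
      rw [eq_bot_iff]
      rintro _ ⟨p, rfl⟩
      rw [LinearMap.comp_apply, LinearMap.mulLeft_apply, cyc_apply, map_mul, map_pow,
        Polynomial.aeval_X, hv.nilp, zero_mul]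
      exact Submodule.zero_mem _
    refine ⟨n + Y.c i, ?_⟩
    rw [Function.iterate_add_apply, eq_bot_iff, ← hn]
    refine rad_iterate_mono n ((hiter _).trans ?_)
    rw [hD, sup_bot_eq]

/-- Nakayama's lemma for filtered representations. -/
theorem EFilt.eq_top_of_sup_rad (hv : Satisfies Ω v) (h : EFilt v ⊤) {S : Submodule K M}
    (hS : Inv v S) (hr : S ⊔ rad v ⊤ = ⊤) : S = ⊤ := by
  obtain ⟨n, hn⟩ := h.rad_iterate_eq_bot hv
  have key : ∀ m, S ⊔ (rad v)^[m] ⊤ = ⊤ := by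
    intro m
    induction m with
    | zero => exact sup_top_eq S
    | succ m ih =>
      rw [Function.iterate_succ_apply', eq_top_iff]
      have h1 : rad v ⊤ ≤ S ⊔ rad v ((rad v)^[m] ⊤) := by
        conv_lhs => rw [← ih]
        exact (rad_sup_le _ _).trans (sup_le_sup_right hS.rad_le _)
      exact hr.symm.le.trans (sup_le le_sup_left h1)
  have := key n
  rwa [hn, sup_bot_eq] at this

end Nakayama

/-! ### Projectivity of the quotient by the framed part, and its map onto `S_i`. -/

section Cover

variable {K : Type*} [Field K] {ι : Type} [Fintype ι] [DecidableEq ι] {X : SymmGCM ι}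
  {Ω : Orientation X} {M : Type*} [AddCommGroup M] [Module K M]
  {v : Gen X.framed → Module.End K M} {N : Type*} [AddCommGroup N] [Module (Preproj K Ω) N]

variable (Ω) in
/-- The underlying vector space of `S_i`. -/
def toSimple (i : ι) : K ≃+ Simple K Ω i := AddEquiv.refl K

theorem gen_smul_toSimple (i : ι) (x : Gen X) (z : K) :
    gen K Ω x • toSimple Ω i z = toSimple Ω i (simpleVal K i x * z) := by
  change (lift K Ω (simpleVal K i) (simpleVal_satisfies K Ω i) (gen K Ω x) * z : K) = _
  rw [lift_gen]
  rfl

theorem algebraMap_smul_toSimple (i : ι) (k z : K) :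
    algebraMap K (Preproj K Ω) k • toSimple Ω i z = toSimple Ω i (k * z) := by
  change (lift K Ω (simpleVal K i) (simpleVal_satisfies K Ω i) (algebraMap K _ k) * z : K) = _
  rw [AlgHom.commutes]
  rfl

/-- The subrepresentation of `M` concentrated at the framing vertices. -/
def framedPart (v : Gen X.framed → Module.End K M) : Submodule K M :=
  ⨅ j, LinearMap.ker (v (.e (.inl j)))

theorem mem_framedPart {x : M} : x ∈ framedPart v ↔ ∀ j, v (.e (.inl j)) x = 0 := by
  simp [framedPart]

namespace Presentation

variable {i : ι} {v0 : M} {θ : M →ₗ[K] K[X]} {κ : ∀ j : ι, M →ₗ[K] (Ar X.framed (.inl j) → M)}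

/-- By `in_κ` a vector at an unframed vertex is a sum of values of arrows and, at `i`, of a
polynomial in `ε_i` applied to `v0`; modulo the radical only the constant term of that polynomial
survives. -/
theorem top_le (P : Presentation Ω v i v0 θ κ) :
    ⊤ ≤ framedPart v ⊔ (rad v ⊤ ⊔ K ∙ v0) := by
  rintro x -
  rw [← P.sat.sum_e x]
  refine Submodule.sum_mem _ fun b _ => ?_
  rcases b with j | l
  · refine Submodule.mem_sup_right ?_
    have h1 := P.in_κ j x
    rw [eq_sub_iff_add_eq] at h1
    rw [← h1]
    refine Submodule.add_mem _ (Submodule.mem_sup_left ?_) ?_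
    · rw [inMap_apply]
      refine Submodule.sum_mem _ fun k _ => Submodule.sum_mem _ fun g _ =>
        Submodule.sum_mem _ fun f _ => ?_
      obtain ⟨f, hf⟩ := f
      cases f with
      | zero => exact arrow_mem_rad _ _ _ trivial
      | succ f =>
        rw [pow_succ', Module.End.mul_apply]
        exact eps_mem_rad _ trivial
    · split_ifs
      · rw [cyc_apply, aeval_eq_divX]
        exact Submodule.add_mem_sup (eps_mem_rad _ trivial)
          (Submodule.smul_mem _ _ (Submodule.mem_span_singleton_self v0))
      · exact Submodule.zero_mem _
  · refine Submodule.mem_sup_left (mem_framedPart.2 fun j => ?_)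
    rw [P.sat.e_e_ne (by simp)]

variable {q : M →+ N}

/-- The algebra `Π` acts on `N` but not on `M`, so the action of `a` is lifted to `M` generator by
generator; `s` turns such a lift into left multiplication by `a` modulo long paths. -/
theorem exists_lift (hq : ∀ a x, q (v a x) = framedVal K Ω a • q x)
    (hqK : ∀ (k : K) x, q (k • x) = algebraMap K (Preproj K Ω) k • q x)
    {t : ℕ} {s : M →ₗ[K] Preproj K Ω} (hs : HomMod v (regVal K Ω) (arrowIdeal K Ω t) s)
    (a : Preproj K Ω) (x : M) : ∃ y, q y = a • q x ∧ s y - a * s x ∈ arrowIdeal K Ω t := by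
  induction a using Preproj.induction generalizing x with
  | hK k =>
    refine ⟨k • x, hqK k x, ?_⟩
    rw [map_smul, Algebra.smul_def, sub_self]
    exact Submodule.zero_mem _
  | hg a =>
    obtain ⟨b, hb⟩ : ∃ b : Gen X.framed, framedVal K Ω b = gen K Ω a := by
      rcases a with j | j | ⟨j, k, g⟩
      · exact ⟨.e (.inl j), rfl⟩
      · exact ⟨.ε (.inl j), rfl⟩
      · exact ⟨.α (.inl j) (.inl k) g, rfl⟩
    refine ⟨v b x, by rw [hq, hb], ?_⟩
    have := hs b x
    rwa [regVal, LinearMap.mulLeft_apply, hb] at this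
  | ha a b h1 h2 =>
    obtain ⟨y, hy, hy'⟩ := h1 x
    obtain ⟨z, hz, hz'⟩ := h2 x
    refine ⟨y + z, by rw [map_add, hy, hz, add_smul], ?_⟩
    rw [map_add, add_mul, add_sub_add_comm]
    exact Submodule.add_mem _ hy' hz'
  | hm a b h1 h2 =>
    obtain ⟨z, hz, hz'⟩ := h2 x
    obtain ⟨y, hy, hy'⟩ := h1 z
    refine ⟨y, by rw [hy, hz, mul_smul], ?_⟩
    have := Submodule.add_mem _ hy' (mul_mem_arrowIdeal a hz')
    rwa [mul_sub, sub_add_sub_cancel, ← mul_assoc] at this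

/-- If `a` kills the image of `v0`, a lift of `a • q v0` to `M` lies in the framed part. An
approximate homomorphism with `v0 ↦ e_i` sends that part into long paths, because framing
idempotents act as zero on `Π`. So `a e_i` lies in every step of a separated filtration. -/
theorem mul_e_eq_zero (P : Presentation Ω v i v0 θ κ)
    (hq : ∀ a x, q (v a x) = framedVal K Ω a • q x)
    (hqK : ∀ (k : K) x, q (k • x) = algebraMap K (Preproj K Ω) k • q x)
    (hker : ∀ x, q x = 0 → x ∈ framedPart v) {a : Preproj K Ω} (ha : a • q v0 = 0) :
    a * gen K Ω (.e i) = 0 := by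
  refine eq_zero_of_mem_arrowIdeal fun t => ?_
  have hz : regVal K Ω (.e (.inl i)) (gen K Ω (.e i)) = gen K Ω (.e i) := by
    have := (gen_satisfies K Ω).idem i i
    rwa [if_pos rfl] at this
  obtain ⟨s, hs, hs0⟩ := P.exists_homMod (regVal_satisfies (Ω := Ω))
    (fun l => LinearMap.ext fun x => zero_mul x) hz arrowFilt
    (eq_top_iff.2 fun a _ m hm => absurd hm (Nat.not_lt_zero m)) t
  obtain ⟨y, hy, hy'⟩ := exists_lift hq hqK hs a v0
  rw [ha] at hy
  have h1 : s y ∈ arrowIdeal K Ω t := by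
    rw [← P.sat.sum_e y, map_sum]
    refine Submodule.sum_mem _ fun b _ => ?_
    rcases b with j | l
    · rw [mem_framedPart.1 (hker y hy), map_zero]
      exact Submodule.zero_mem _
    · have := hs (.e (.inr l)) y
      rwa [show regVal K Ω (.e (.inr l)) (s y) = 0 from zero_mul _, sub_zero] at this
  have h2 := Submodule.sub_mem _ h1 (Submodule.add_mem _ hy' (mul_mem_arrowIdeal a hs0))
  rwa [mul_sub, sub_add_sub_cancel, sub_sub_cancel] at h2

/-- The quotient of a presented filtered representation by its framed part is a projective
cover of a simple module. -/
theorem exists_projectiveCover (P : Presentation Ω v i v0 θ κ) (hf : EFilt v ⊤)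
    (hq : ∀ a x, q (v a x) = framedVal K Ω a • q x)
    (hqK : ∀ (k : K) x, q (k • x) = algebraMap K (Preproj K Ω) k • q x)
    (hqs : Function.Surjective q) (hker : ∀ x, q x = 0 ↔ x ∈ framedPart v) :
    ∃ p : N →ₗ[Preproj K Ω] Simple K Ω i, IsProjectiveCover p := by
  have hnak : ∀ A : Submodule (Preproj K Ω) N,
      (∀ x, ∃ y, q y ∈ A ∧ x - y ∈ rad v ⊤) → A = ⊤ := by
    intro A hA
    let S : Submodule K M :=
      { carrier := {x | q x ∈ A}
        add_mem' := fun {x y} hx hy => by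
          change q (x + y) ∈ A
          rw [map_add]; exact A.add_mem hx hy
        zero_mem' := by change q 0 ∈ A; rw [map_zero]; exact A.zero_mem
        smul_mem' := fun k x hx => by
          change q (k • x) ∈ A
          rw [hqK]; exact A.smul_mem _ hx }
    have hS : S = ⊤ := by
      refine hf.eq_top_of_sup_rad P.sat (fun a x hx => ?_) (eq_top_iff.2 fun x _ => ?_)
      · change q (v a x) ∈ A
        rw [hq]; exact A.smul_mem _ hx
      · obtain ⟨y, hy, hxy⟩ := hA x
        rw [← add_sub_cancel y x]
        exact Submodule.add_mem_sup hy hxy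
    rw [eq_top_iff]
    rintro n -
    obtain ⟨x, rfl⟩ := hqs n
    have : x ∈ S := hS ▸ trivial
    exact this
  have hgen : ∀ x : M, ∃ (l r : M) (k : K), x = l + (r + k • v0) ∧ q l = 0 ∧ r ∈ rad v ⊤ := by
    intro x
    obtain ⟨l, hl, y, hy, rfl⟩ := Submodule.mem_sup.1 (P.top_le (show x ∈ ⊤ from trivial))
    obtain ⟨r, hr, z, hz, rfl⟩ := Submodule.mem_sup.1 hy
    obtain ⟨k, rfl⟩ := Submodule.mem_span_singleton.1 hz
    exact ⟨l, r, k, rfl, (hker l).2 hl, hr⟩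
  set f : Preproj K Ω →ₗ[Preproj K Ω] N := LinearMap.toSpanSingleton _ N (q v0) with hfdef
  have hfs : Function.Surjective f := by
    rw [← LinearMap.range_eq_top]
    refine hnak _ fun x => ?_
    obtain ⟨l, r, k, rfl, hl, hr⟩ := hgen x
    refine ⟨l + k • v0, ⟨algebraMap K _ k, ?_⟩, ?_⟩
    · rw [map_add, hl, zero_add, hqK]; rfl
    · rwa [show l + (r + k • v0) - (l + k • v0) = r by abel]
  set g : Preproj K Ω →ₗ[Preproj K Ω] Preproj K Ω :=
    LinearMap.toSpanSingleton _ _ (gen K Ω (.e i)) with hgdef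
  have hle : LinearMap.ker f ≤ LinearMap.ker g := fun a ha =>
    P.mul_e_eq_zero hq hqK (fun x hx => (hker x).1 hx) ha
  -- The map `a • q v0 ↦ a e_i` is well defined by `mul_e_eq_zero` and is a section of `f`, since
  -- `e_i` fixes `q v0`. So `N` is a direct summand of `Π`.
  let σ : N →ₗ[Preproj K Ω] Preproj K Ω :=
    (LinearMap.ker f).liftQ g hle ∘ₗ (f.quotKerEquivOfSurjective hfs).symm.toLinearMap
  have hσ : ∀ a, σ (f a) = a * gen K Ω (.e i) := by
    intro a
    have : (f.quotKerEquivOfSurjective hfs).symm (f a) = (LinearMap.ker f).mkQ a := by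
      rw [LinearEquiv.symm_apply_eq]; rfl
    change (LinearMap.ker f).liftQ g hle ((f.quotKerEquivOfSurjective hfs).symm (f a)) = _
    rw [this]
    rfl
  have he0 : gen K Ω (.e i) • q v0 = q v0 := by
    have := hq (.e (.inl i)) v0
    rw [P.e_v0] at this
    exact this.symm
  have hfσ : f ∘ₗ σ = LinearMap.id := by
    refine LinearMap.ext fun n => ?_
    obtain ⟨a, rfl⟩ := hfs n
    rw [LinearMap.comp_apply, hσ]
    change (a * gen K Ω (.e i)) • q v0 = a • q v0
    rw [mul_smul, he0]
  let p : N →ₗ[Preproj K Ω] Simple K Ω i :=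
    LinearMap.toSpanSingleton _ _ (toSimple Ω i 1) ∘ₗ σ
  have hp0 : p (q v0) = toSimple Ω i 1 := by
    have : q v0 = f 1 := (one_smul _ _).symm
    change σ (q v0) • toSimple Ω i (1 : K) = _
    rw [this, hσ, one_mul, gen_smul_toSimple]
    simp [simpleVal]
  have hpk : ∀ k : K, p (q (k • v0)) = toSimple Ω i k := by
    intro k
    rw [hqK, map_smul, hp0, algebraMap_smul_toSimple, mul_one]
  have hprad : ∀ r ∈ rad v ⊤, p (q r) = 0 := by
    let R : Submodule K M :=
      { carrier := {x | p (q x) = 0}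
        add_mem' := fun {x y} hx hy => by
          change p (q (x + y)) = 0
          rw [map_add, map_add, hx, hy, add_zero]
        zero_mem' := by change p (q 0) = 0; rw [map_zero, map_zero]
        smul_mem' := fun k x hx => by
          change p (q (k • x)) = 0
          rw [hqK, map_smul, hx, smul_zero] }
    have hgs : ∀ a : Gen X, simpleVal K i a = 0 → ∀ z : Simple K Ω i, gen K Ω a • z = 0 := by
      intro a ha z
      obtain ⟨z, rfl⟩ := (toSimple Ω i).surjective z
      rw [gen_smul_toSimple, ha, zero_mul, map_zero]
    have hR : rad v ⊤ ≤ R := by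
      refine rad_le (fun b x _ => ?_) (fun b c g x _ => ?_)
      · change p (q _) = 0
        rw [hq, map_smul]
        rcases b with b | b
        · exact hgs _ rfl _
        · exact zero_smul _ _
      · change p (q _) = 0
        rw [hq, map_smul]
        rcases b with b | b <;> rcases c with c | c
        · exact hgs _ rfl _
        all_goals exact zero_smul _ _
    exact fun r hr => hR hr
  -- The radical maps into the kernel of `p`, and modulo it `N` is spanned by `q v0`, which `p`
  -- sends to a nonzero vector. A submodule filling `N` together with the kernel therefore already
  -- fills `N` modulo the radical, and Nakayama's lemma applies.
  refine ⟨p, .of_split σ f hfσ, fun z => ?_, fun A hA => hnak A fun x => ?_⟩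
  · obtain ⟨z, rfl⟩ := (toSimple Ω i).surjective z
    exact ⟨q (z • v0), hpk z⟩
  obtain ⟨a, ha, n, hn, han⟩ := Submodule.mem_sup.1
    (show q x ∈ A ⊔ LinearMap.ker p from hA ▸ trivial)
  obtain ⟨y, rfl⟩ := hqs n
  obtain ⟨l, r, k, rfl, hl, hr⟩ := hgen y
  rw [LinearMap.mem_ker, map_add, hl, zero_add, map_add, map_add, hprad r hr, zero_add, hpk,
    EmbeddingLike.map_eq_zero_iff] at hn
  subst hn
  refine ⟨x - r, ?_, by rwa [sub_sub_cancel]⟩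
  rw [map_sub, ← han, map_add, hl, zero_smul, add_zero, zero_add, add_sub_cancel_right]
  exact ha

end Presentation

end Cover

/-! ### Modules and representations -/

section LoopAlgebra

variable {K : Type*} [Field K] {ι : Type} [Fintype ι] [DecidableEq ι] {Y : SymmGCM ι}

/-- The generator of `H_i`. -/
def loopGen (K : Type*) [Field K] (Y : SymmGCM ι) (i : ι) : H K Y i :=
  Ideal.Quotient.mk _ Polynomial.X

theorem H.mk_eq_zero {i : ι} {p : K[X]} :
    (Ideal.Quotient.mk (Ideal.span {(Polynomial.X : K[X]) ^ Y.c i}) p = 0) ↔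
      Polynomial.X ^ Y.c i ∣ p := by
  rw [Ideal.Quotient.eq_zero_iff_mem, Ideal.mem_span_singleton]

theorem H.nontrivial (Y : SymmGCM ι) (i : ι) : Nontrivial (H K Y i) := by
  refine ⟨⟨1, 0, fun h => ?_⟩⟩
  have h1 : (Polynomial.X : K[X]) ^ Y.c i ∣ 1 := H.mk_eq_zero.1 h
  have h2 := isUnit_of_dvd_one h1
  rw [isUnit_pow_iff (Nat.one_le_iff_ne_zero.1 (Y.c_pos i))] at h2
  exact Polynomial.not_isUnit_X h2

theorem H.exists_pow_mul {i : ι} {h : H K Y i} (h0 : loopGen K Y i * h = 0) :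
    ∃ h', loopGen K Y i ^ (Y.c i - 1) * h' = h := by
  obtain ⟨p, rfl⟩ := Ideal.Quotient.mk_surjective h
  rw [loopGen, ← map_mul, H.mk_eq_zero] at h0
  obtain ⟨q, hq⟩ := h0
  have : p = Polynomial.X ^ (Y.c i - 1) * q := by
    apply mul_left_cancel₀ (Polynomial.X_ne_zero (R := K))
    rw [hq, ← mul_assoc, ← pow_succ', Nat.sub_add_cancel (Y.c_pos i)]
  exact ⟨Ideal.Quotient.mk _ q, by rw [this, map_mul, map_pow]; rfl⟩

theorem H.finrank (i : ι) : Module.finrank K (H K Y i) = Y.c i := by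
  have h := (AdjoinRoot.powerBasis' (Polynomial.monic_X_pow (R := K) (Y.c i))).finrank
  rw [AdjoinRoot.powerBasis'_dim, Polynomial.natDegree_X_pow] at h
  exact h

theorem H.finite (i : ι) : Module.Finite K (H K Y i) :=
  (AdjoinRoot.powerBasis' (Polynomial.monic_X_pow (R := K) (Y.c i))).finite

end LoopAlgebra

/-! ### Local freeness over `H_i` compared with the elementwise condition `FreeOn`. -/

section ModVal

variable {K : Type*} [Field K] {ι : Type} [Fintype ι] [DecidableEq ι] {Y : SymmGCM ι}
  {Ω : Orientation Y} {M : Type*} [AddCommGroup M] [Module K M] [Module (Preproj K Ω) M]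
  [IsScalarTower K (Preproj K Ω) M]

variable (K Ω M) in
/-- The representation underlying a `Π`-module. -/
def modVal (a : Gen Y) : Module.End K M := Algebra.lsmul K K M (gen K Ω a)

theorem modVal_apply (a : Gen Y) (x : M) : modVal K Ω M a x = gen K Ω a • x := rfl

theorem modVal_satisfies : Satisfies Ω (modVal K Ω M) :=
  (gen_satisfies K Ω).map (Algebra.lsmul K K M).toRingHom

/-- A subrepresentation is a submodule. -/
def Inv.toSubmodule {S : Submodule K M} (h : Inv (modVal K Ω M) S) :
    Submodule (Preproj K Ω) M where
  carrier := S
  add_mem' := S.add_mem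
  zero_mem' := S.zero_mem
  smul_mem' a := by
    induction a using Preproj.induction with
    | hK k =>
      intro x hx
      rw [algebraMap_smul]
      exact S.smul_mem k hx
    | hg a =>
      intro x hx
      exact h a x hx
    | ha a b h1 h2 =>
      intro x hx
      rw [add_smul]
      exact S.add_mem (h1 hx) (h2 hx)
    | hm a b h1 h2 =>
      intro x hx
      rw [mul_smul]
      exact h1 (h2 hx)

theorem Inv.mem_toSubmodule {S : Submodule K M} (h : Inv (modVal K Ω M) S) {x : M} :
    x ∈ h.toSubmodule ↔ x ∈ S := Iff.rfl

theorem inv_restrictScalars (L : Submodule (Preproj K Ω) M) :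
    Inv (modVal K Ω M) (L.restrictScalars K) := fun _ _ hx => L.smul_mem _ hx

variable (M) in
/-- The identity map, from a module to its restriction to `H_i`. -/
def toLoop (Ω : Orientation Y) (i : ι) : M ≃+ LoopRestrict Ω i M := AddEquiv.refl M

theorem mk_smul_toLoop (i : ι) (p : K[X]) (x : M) :
    (Ideal.Quotient.mk _ p : H K Y i) • toLoop M Ω i x =
      toLoop M Ω i (Polynomial.aeval (modVal K Ω M (.ε i)) p x) := by
  change Polynomial.aeval (gen K Ω (.ε i)) p • x = _
  rw [show modVal K Ω M (.ε i) = Algebra.lsmul K K M (gen K Ω (.ε i)) from rfl,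
    Polynomial.aeval_algHom_apply]
  rfl

theorem toLoop_mem_vertexModule {i : ι} {x : M} :
    toLoop M Ω i x ∈ vertexModule K Ω i M ↔ modVal K Ω M (.e i) x = x := by
  constructor
  · rintro ⟨y, hy⟩
    have hy' : modVal K Ω M (.e i) y = x := hy
    rw [← hy']
    exact modVal_satisfies.e_e i y
  · intro h
    exact ⟨x, h⟩

variable (K M) in
/-- The space `e_i M`, as the range of `e_i` and as a vertex module. -/
def rangeEquivVertex (Ω : Orientation Y) [Module (Preproj K Ω) M] [IsScalarTower K (Preproj K Ω) M]
    (i : ι) : LinearMap.range (modVal K Ω M (.e i)) ≃+ vertexModule K Ω i M where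
  toFun x := ⟨toLoop M Ω i x,
    toLoop_mem_vertexModule.2 ((modVal_satisfies.nilpOn i).mem_range.1 x.2)⟩
  invFun x := ⟨(toLoop M Ω i).symm x, _, toLoop_mem_vertexModule.1 x.2⟩
  left_inv _ := rfl
  right_inv _ := rfl
  map_add' _ _ := rfl

theorem mk_smul_rangeEquivVertex {i : ι} {p : K[X]}
    {x y : LinearMap.range (modVal K Ω M (.e i))}
    (h : Polynomial.aeval (modVal K Ω M (.ε i)) p (x : M) = y) :
    (Ideal.Quotient.mk _ p : H K Y i) • rangeEquivVertex K M Ω i x =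
      rangeEquivVertex K M Ω i y := by
  refine Subtype.ext ((mk_smul_toLoop i p (x : M)).trans ?_)
  rw [h]
  rfl

theorem C_smul_rangeEquivVertex {i : ι} (k : K) (x : LinearMap.range (modVal K Ω M (.e i))) :
    (Ideal.Quotient.mk _ (Polynomial.C k) : H K Y i) • rangeEquivVertex K M Ω i x =
      rangeEquivVertex K M Ω i (k • x) :=
  mk_smul_rangeEquivVertex (by rw [Polynomial.aeval_C]; rfl)

/-- A basis of `e_i M` over `H_i` as an isomorphism of vector spaces. -/
theorem HasRankVec.exists_equiv {r : ι → ℕ} (h : HasRankVec K Ω M r) (i : ι) :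
    ∃ E : LinearMap.range (modVal K Ω M (.e i)) ≃ₗ[K] (Fin (r i) → H K Y i),
      ∀ x y : LinearMap.range (modVal K Ω M (.e i)), modVal K Ω M (.ε i) x = (y : M) →
        E y = loopGen K Y i • E x := by
  obtain ⟨h1, h2, h3⟩ := h i
  have := H.nontrivial (K := K) Y i
  let b := (Module.finBasisOfFinrankEq (H K Y i) (vertexModule K Ω i M) h3).equivFun
  let E : LinearMap.range (modVal K Ω M (.e i)) ≃ₗ[K] (Fin (r i) → H K Y i) :=
    { (rangeEquivVertex K M Ω i).trans b.toAddEquiv with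
      map_smul' := fun k x => by
        change b (rangeEquivVertex K M Ω i (k • x)) = k • b (rangeEquivVertex K M Ω i x)
        rw [← C_smul_rangeEquivVertex, map_smul]
        funext t
        rw [Pi.smul_apply, Pi.smul_apply, smul_eq_mul]
        exact (Algebra.smul_def k _).symm }
  refine ⟨E, fun x y hxy => ?_⟩
  change b (rangeEquivVertex K M Ω i y) = loopGen K Y i • b (rangeEquivVertex K M Ω i x)
  rw [← map_smul, loopGen, mk_smul_rangeEquivVertex (y := y)]
  rw [Polynomial.aeval_X, hxy]

theorem HasRankVec.finrank {r : ι → ℕ} (h : HasRankVec K Ω M r) (i : ι) :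
    Module.finrank K (LinearMap.range (modVal K Ω M (.e i))) = r i * Y.c i := by
  obtain ⟨E, -⟩ := h.exists_equiv i
  have := H.finite (K := K) (Y := Y) i
  rw [E.finrank_eq, Module.finrank_pi_fintype]
  simp [H.finrank]

theorem HasRankVec.finiteDimensional {r : ι → ℕ} (h : HasRankVec K Ω M r) :
    FiniteDimensional K M := by
  have : ∀ i, Module.Finite K (LinearMap.range (modVal K Ω M (.e i))) := by
    intro i
    obtain ⟨E, -⟩ := h.exists_equiv i
    have := H.finite (K := K) (Y := Y) i
    exact Module.Finite.equiv E.symm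
  let F : (∀ i, LinearMap.range (modVal K Ω M (.e i))) →ₗ[K] M :=
    ∑ i, (LinearMap.range (modVal K Ω M (.e i))).subtype ∘ₗ LinearMap.proj i
  refine Module.Finite.of_surjective F fun x => ⟨fun i => ⟨_, x, rfl⟩, ?_⟩
  simp only [F, LinearMap.sum_apply]
  exact modVal_satisfies.sum_e x

theorem HasRankVec.freeOn {r : ι → ℕ} (h : HasRankVec K Ω M r) (i : ι) :
    FreeOn (modVal K Ω M (.e i)) (modVal K Ω M (.ε i)) (Y.c i) := by
  obtain ⟨E, hE⟩ := h.exists_equiv i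
  have hn := (modVal_satisfies (K := K) (Ω := Ω) (M := M)).nilpOn i
  intro x hx h0
  let x' : LinearMap.range (modVal K Ω M (.e i)) := ⟨x, x, hx⟩
  have h1 : loopGen K Y i • E x' = 0 := by rw [← hE x' 0 h0, map_zero]
  choose y hy using fun t => H.exists_pow_mul (congrFun h1 t)
  have hpow : ∀ n (z : LinearMap.range (modVal K Ω M (.e i))),
      ∃ z' : LinearMap.range (modVal K Ω M (.e i)),
        (z' : M) = (modVal K Ω M (.ε i) ^ n) z ∧ E z' = loopGen K Y i ^ n • E z := by
    intro n z
    induction n with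
    | zero => exact ⟨z, rfl, by rw [pow_zero, one_smul]⟩
    | succ n ih =>
      obtain ⟨z', h2, h3⟩ := ih
      refine ⟨⟨modVal K Ω M (.ε i) z', _, hn.p_eps z'⟩, ?_, ?_⟩
      · rw [pow_succ', Module.End.mul_apply, ← h2]
      · rw [hE z' ⟨_, _, hn.p_eps z'⟩ rfl, h3, pow_succ']
        funext t
        exact (mul_assoc _ _ _).symm
  obtain ⟨z, hz1, hz2⟩ := hpow (Y.c i - 1) (E.symm y)
  have hzx : z = x' := by
    apply E.injective
    rw [hz2, E.apply_symm_apply]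
    exact funext hy
  exact ⟨E.symm y, hn.mem_range.1 (E.symm y).2, hz1.symm.trans (congrArg Subtype.val hzx)⟩

theorem hasRankVec_of_freeOn [FiniteDimensional K M] {r : ι → ℕ}
    (hF : ∀ i, FreeOn (modVal K Ω M (.e i)) (modVal K Ω M (.ε i)) (Y.c i))
    (hr : ∀ i, Module.finrank K (LinearMap.range (modVal K Ω M (.e i))) = r i * Y.c i) :
    HasRankVec K Ω M r := by
  intro i
  have hn := (modVal_satisfies (K := K) (Ω := Ω) (M := M)).nilpOn i
  have := H.nontrivial (K := K) Y i
  have := H.finite (K := K) (Y := Y) i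
  obtain ⟨r', u, hu, b, hb⟩ := hn.exists_chainBasis (hF i)
  have hrr : r' = r i := by
    have h1 := hr i
    rw [Module.finrank_eq_card_basis b, Fintype.card_prod, Fintype.card_fin, Fintype.card_fin] at h1
    exact Nat.eq_of_mul_eq_mul_right (Y.c_pos i) h1
  let u' : Fin r' → vertexModule K Ω i M := fun t =>
    ⟨toLoop M Ω i (u t), toLoop_mem_vertexModule.2 (hu t)⟩
  let Ψ : (Fin r' → H K Y i) →ₗ[H K Y i] vertexModule K Ω i M :=
    Fintype.linearCombination (H K Y i) u'
  let val : vertexModule K Ω i M →+ M :=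
    ((toLoop M Ω i).symm : LoopRestrict Ω i M →+ M).comp
      (vertexModule K Ω i M).subtype.toAddMonoidHom
  have hval : Function.Injective val := Subtype.val_injective
  have hmem : ∀ x, val x ∈ LinearMap.range (modVal K Ω M (.e i)) := fun x =>
    ⟨_, toLoop_mem_vertexModule.1 x.2⟩
  have hsm : ∀ (p : K[X]) x, val ((Ideal.Quotient.mk _ p : H K Y i) • x) =
      Polynomial.aeval (modVal K Ω M (.ε i)) p (val x) := fun p x => mk_smul_toLoop i p (val x)
  let Ψ' : (Fin r' → H K Y i) →ₗ[K] M :=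
    { toFun := fun y => val (Ψ y)
      map_add' := fun x y => by rw [map_add, map_add]
      map_smul' := fun k y => by
        have h1 : k • y = (Ideal.Quotient.mk _ (Polynomial.C k) : H K Y i) • y := by
          funext t
          exact Algebra.smul_def (A := H K Y i) k (y t)
        rw [h1, map_smul, hsm, Polynomial.aeval_C]
        rfl }
  have hrange : LinearMap.range Ψ' = LinearMap.range (modVal K Ω M (.e i)) := by
    refine le_antisymm ?_ ?_
    · rintro _ ⟨y, rfl⟩
      exact hmem _
    · intro x hx
      have h1 : (⟨x, hx⟩ : LinearMap.range (modVal K Ω M (.e i))) ∈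
          Submodule.span K (Set.range b) := by rw [b.span_eq]; trivial
      have h2 := Submodule.mem_map_of_mem (f := (LinearMap.range (modVal K Ω M (.e i))).subtype) h1
      rw [Submodule.map_span] at h2
      refine Submodule.span_le.2 ?_ h2
      rintro _ ⟨_, ⟨q, rfl⟩, rfl⟩
      refine ⟨Pi.single q.1 (Ideal.Quotient.mk _ (Polynomial.X ^ (q.2 : ℕ))), ?_⟩
      change val (Ψ _) = _
      have h3 : Ψ (Pi.single q.1 (Ideal.Quotient.mk _ (Polynomial.X ^ (q.2 : ℕ)))) =
          (Ideal.Quotient.mk _ (Polynomial.X ^ (q.2 : ℕ)) : H K Y i) • u' q.1 :=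
        Fintype.linearCombination_apply_single _ _ _ _
      rw [h3, hsm, Submodule.subtype_apply, hb, map_pow, Polynomial.aeval_X]
      rfl
  -- The chain basis gives surjectivity onto `e_i M`; equality of `K`-dimensions then gives
  -- injectivity.
  have hinj : Function.Injective Ψ' := by
    rw [← LinearMap.ker_eq_bot, ← Submodule.finrank_eq_zero (R := K)]
    have h1 := LinearMap.finrank_range_add_finrank_ker Ψ'
    rw [hrange, hr, Module.finrank_pi_fintype, ← hrr] at h1
    simp only [H.finrank, Finset.sum_const, Finset.card_univ, Fintype.card_fin, smul_eq_mul] at h1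
    omega
  have hbij : Function.Bijective Ψ := by
    refine ⟨fun x y hxy => hinj (congrArg val hxy), fun x => ?_⟩
    have hx : val x ∈ LinearMap.range Ψ' := by
      rw [hrange]; exact hmem x
    obtain ⟨y, hy⟩ := hx
    exact ⟨y, hval hy⟩
  let e := LinearEquiv.ofBijective Ψ hbij
  refine ⟨Module.Free.of_equiv e, Module.Finite.equiv e, ?_⟩
  rw [← e.finrank_eq, Module.finrank_fintype_fun_eq_card, Fintype.card_fin, hrr]

end ModVal

/-! ### `𝔼`-filtrations of modules and of representations. -/

section Filtered

variable {K : Type*} [Field K] {ι : Type} [Fintype ι] [DecidableEq ι] {Y : SymmGCM ι}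
  {Ω : Orientation Y} {M : Type*} [AddCommGroup M] [Module K M] [Module (Preproj K Ω) M]
  [IsScalarTower K (Preproj K Ω) M]

/-- It suffices that `T / S` is concentrated at `i`, not that it is free: arrows vanish on it, and
`ε_i ^ c i = 0`. -/
theorem rad_iterate_step {i : ι} {S T : Submodule K M} (hS : Inv (modVal K Ω M) S)
    (hT : Inv (modVal K Ω M) T)
    (h : ∀ j, j ≠ i → ∀ x ∈ T, modVal K Ω M (.e j) x ∈ S) :
    (rad (modVal K Ω M))^[Y.c i] T ≤ S := by
  have hv := modVal_satisfies (K := K) (Ω := Ω) (M := M)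
  have hpow : ∀ m, ∀ x ∈ T, (modVal K Ω M (.ε i) ^ m) x ∈ T := by
    intro m x hx
    induction m with
    | zero => exact hx
    | succ m ih => rw [pow_succ', Module.End.mul_apply]; exact hT _ _ ih
  have hiter : ∀ m, (rad (modVal K Ω M))^[m] T ≤ S ⊔ T.map (modVal K Ω M (.ε i) ^ m) := by
    intro m
    induction m with
    | zero => exact le_sup_of_le_right fun x hx => ⟨x, hx, rfl⟩
    | succ m ih =>
      rw [Function.iterate_succ_apply']
      refine (rad_mono ih).trans ((rad_sup_le _ _).trans (sup_le (hS.rad_le.trans le_sup_left) ?_))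
      refine GenPreproj.rad_le ?_ ?_
      · rintro j _ ⟨x, hx, rfl⟩
        by_cases hj : j = i
        · subst hj
          exact Submodule.mem_sup_right ⟨x, hx, by rw [pow_succ', Module.End.mul_apply]⟩
        · rw [← hv.eps_e]
          exact Submodule.mem_sup_left (hS _ _ (h j hj _ (hpow m x hx)))
      · rintro a b g _ ⟨x, hx, rfl⟩
        refine Submodule.mem_sup_left ?_
        by_cases hb : b = i
        · subst hb
          rw [← hv.e_α]
          exact h a (Y.ne_of_fin g) _ (hT _ _ (hpow m x hx))
        · rw [← hv.α_e]
          exact hS _ _ (h b hb _ (hpow m x hx))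
  refine (hiter _).trans ?_
  rw [hv.nilp, Submodule.map_zero, sup_bot_eq]

theorem IsGenSimple.e_smul_mem {i : ι} {A B : Submodule (Preproj K Ω) M}
    (h : IsGenSimple K Ω i (B ⧸ A.submoduleOf B)) {j : ι} (hj : j ≠ i) {x : M} (hx : x ∈ B) :
    gen K Ω (.e j) • x ∈ A := by
  have := h.2 j hj
  let x' : B ⧸ A.submoduleOf B := Submodule.Quotient.mk ⟨x, hx⟩
  have h1 : (⟨toLoop _ Ω j (gen K Ω (.e j) • x'), x', rfl⟩ :
      vertexModule K Ω j (B ⧸ A.submoduleOf B)) = 0 := Subsingleton.elim _ _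
  have h2 : (Submodule.Quotient.mk (gen K Ω (.e j) • (⟨x, hx⟩ : B)) : B ⧸ A.submoduleOf B) = 0 :=
    congrArg Subtype.val h1
  exact (Submodule.Quotient.mk_eq_zero (A.submoduleOf B)).1 h2

theorem IsEFiltered.rad_iterate_eq_bot (h : IsEFiltered K Ω M) :
    ∃ n, (rad (modVal K Ω M))^[n] ⊤ = ⊥ := by
  obtain ⟨m, F, h0, hm, hF⟩ := h
  have key : ∀ k ≤ m, ∃ n, (rad (modVal K Ω M))^[n] ((F k).restrictScalars K) = ⊥ := by
    intro k
    induction k with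
    | zero => exact fun _ => ⟨0, by rw [h0]; rfl⟩
    | succ k ih =>
      intro hk
      obtain ⟨n, hn⟩ := ih (by omega)
      obtain ⟨-, i, hi⟩ := hF k (by omega)
      refine ⟨n + Y.c i, ?_⟩
      rw [Function.iterate_add_apply, eq_bot_iff, ← hn]
      exact rad_iterate_mono n (rad_iterate_step (inv_restrictScalars _) (inv_restrictScalars _)
        fun j hj x hx => hi.e_smul_mem hj hx)
  have := key m le_rfl
  rwa [hm, Submodule.restrictScalars_top] at this

theorem isGenSimple_of_cyclic {i : ι} {w : M} (hw : modVal K Ω M (.e i) w = w)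
    (hn : (modVal K Ω M (.ε i) ^ (Y.c i - 1)) w ≠ 0)
    (hs : Function.Surjective (cyc (modVal K Ω M (.ε i)) w)) : IsGenSimple K Ω i M := by
  have hv := modVal_satisfies (K := K) (Ω := Ω) (M := M)
  let w' : vertexModule K Ω i M := ⟨toLoop M Ω i w, toLoop_mem_vertexModule.2 hw⟩
  have hsm : ∀ p : K[X], (((Ideal.Quotient.mk _ p : H K Y i) • w' : vertexModule K Ω i M) :
      LoopRestrict Ω i M) = toLoop M Ω i (cyc (modVal K Ω M (.ε i)) w p) :=
    fun p => mk_smul_toLoop i p w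
  refine ⟨⟨(LinearEquiv.ofBijective (LinearMap.toSpanSingleton (H K Y i) _ w') ⟨?_, ?_⟩).symm⟩,
    fun j hj => ⟨fun x y => ?_⟩⟩
  · rw [← LinearMap.ker_eq_bot, LinearMap.ker_eq_bot']
    intro h h0
    obtain ⟨p, rfl⟩ := Ideal.Quotient.mk_surjective h
    have h1 := congrArg Subtype.val h0
    rw [LinearMap.toSpanSingleton_apply, hsm] at h1
    rw [H.mk_eq_zero]
    exact X_pow_dvd_of_cyc_eq_zero (hv.nilp i) hn h1
  · rintro ⟨x, hx⟩
    obtain ⟨x, rfl⟩ := (toLoop M Ω i).surjective x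
    obtain ⟨p, rfl⟩ := hs x
    exact ⟨Ideal.Quotient.mk _ p, Subtype.ext (hsm p)⟩
  · have h0 : ∀ x : vertexModule K Ω j M, x = 0 := by
      rintro ⟨_, x, rfl⟩
      obtain ⟨p, rfl⟩ := hs x
      refine Subtype.ext ?_
      have h1 := hv.e_of_e (i := j) ((hv.nilpOn i).aeval_e hw p)
      rwa [if_neg hj] at h1
    rw [h0 x, h0 y]

theorem isGenSimple_quotient {i : ι} {A B : Submodule (Preproj K Ω) M} {u : M} (hu : u ∈ B)
    (he : modVal K Ω M (.e i) u = u) (hn : (modVal K Ω M (.ε i) ^ (Y.c i - 1)) u ∉ A)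
    (hle : B.restrictScalars K ≤
      A.restrictScalars K ⊔ LinearMap.range (cyc (modVal K Ω M (.ε i)) u)) :
    IsGenSimple K Ω i (B ⧸ A.submoduleOf B) := by
  let π : B →ₗ[K] B ⧸ A.submoduleOf B := (A.submoduleOf B).mkQ.restrictScalars K
  let σ : B →ₗ[K] M := B.subtype.restrictScalars K
  let u' : B := ⟨u, hu⟩
  have h1 : ∀ p, cyc (modVal K Ω _ (.ε i)) (π u') p = π (cyc (modVal K Ω B (.ε i)) u' p) :=
    fun p => (aeval_comm (φ := π) (fun _ => rfl) p u').symm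
  have h2 : ∀ p, cyc (modVal K Ω M (.ε i)) u p = σ (cyc (modVal K Ω B (.ε i)) u' p) :=
    fun p => (aeval_comm (φ := σ) (fun _ => rfl) p u').symm
  refine isGenSimple_of_cyclic (w := π u') ?_ ?_ ?_
  · exact congrArg π (Subtype.ext he : modVal K Ω B (.e i) u' = u')
  · intro h0
    apply hn
    have h3 := h1 (Polynomial.X ^ (Y.c i - 1))
    have h4 := h2 (Polynomial.X ^ (Y.c i - 1))
    rw [cyc_apply, map_pow, Polynomial.aeval_X] at h3 h4
    rw [h0] at h3
    rw [h4]
    exact (Submodule.Quotient.mk_eq_zero (A.submoduleOf B)).1 h3.symm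
  · intro x
    obtain ⟨⟨x, hx⟩, rfl⟩ := (A.submoduleOf B).mkQ_surjective x
    obtain ⟨a, ha, _, ⟨p, rfl⟩, hap⟩ := Submodule.mem_sup.1 (hle hx)
    refine ⟨p, ?_⟩
    rw [h1]
    refine (Submodule.Quotient.eq _).2 (?_ : _ - x ∈ A)
    have h3 : cyc (modVal K Ω M (.ε i)) u p - x = -a := by rw [← hap]; abel
    rw [h2] at h3
    rw [show ((cyc (modVal K Ω B (.ε i)) u' p : B) : M) - x = -a from h3]
    exact A.neg_mem ha

theorem EFilt.isEFiltered (h : EFilt (modVal K Ω M) ⊤) : IsEFiltered K Ω M := by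
  let P (A B : Submodule (Preproj K Ω) M) : Prop :=
    A ≤ B ∧ ∃ i, IsGenSimple K Ω i (B ⧸ A.submoduleOf B)
  have key : ∀ S : Submodule K M, EFilt (modVal K Ω M) S →
      ∃ (m : ℕ) (F : ℕ → Submodule (Preproj K Ω) M), F 0 = ⊥ ∧ (F m).restrictScalars K = S ∧
        ∀ k < m, P (F k) (F (k + 1)) := by
    intro S hS
    induction hS with
    | bot => exact ⟨0, fun _ => ⊥, rfl, rfl, fun k hk => absurd hk (Nat.not_lt_zero k)⟩
    | step S T i u _ hT hST hu he hn hle ih =>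
      obtain ⟨m, F, h0, hm, hF⟩ := ih
      subst hm
      have hlt : ∀ k ≤ m, (fun k => if k ≤ m then F k else hT.toSubmodule) k = F k :=
        fun k hk => if_pos hk
      have hgt : (fun k => if k ≤ m then F k else hT.toSubmodule) (m + 1) = hT.toSubmodule :=
        if_neg (by omega)
      refine ⟨m + 1, fun k => if k ≤ m then F k else hT.toSubmodule, ?_, ?_, fun k hk => ?_⟩
      · rw [hlt 0 (Nat.zero_le m), h0]
      · rw [hgt]; rfl
      · rw [hlt k (by omega)]
        rcases Nat.lt_or_ge k m with hk' | hk'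
        · rw [hlt (k + 1) (by omega)]
          exact hF k hk'
        · obtain rfl : k = m := by omega
          rw [hgt]
          exact ⟨hST, i, isGenSimple_quotient hu he hn hle⟩
  obtain ⟨m, F, h0, hm, hF⟩ := key ⊤ h
  exact ⟨m, F, h0, (Submodule.restrictScalars_eq_top_iff K _ _).1 hm, hF⟩

theorem nonempty_equiv_simple {i : ι} {Q : Type*} [AddCommGroup Q] [Module (Preproj K Ω) Q]
    [IsSimpleModule (Preproj K Ω) Q] {w : Q} (hw : w ≠ 0)
    (h : ∀ a, gen K Ω a • w = algebraMap K (Preproj K Ω) (simpleVal K i a) • w) :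
    Nonempty (Q ≃ₗ[Preproj K Ω] Simple K Ω i) := by
  let f : Simple K Ω i →+ Q :=
    (LinearMap.toSpanSingleton (Preproj K Ω) Q w).toAddMonoidHom.comp
      ((algebraMap K (Preproj K Ω)).toAddMonoidHom.comp (toSimple Ω i).symm.toAddMonoidHom)
  have hf : ∀ z, f (toSimple Ω i z) = algebraMap K (Preproj K Ω) z • w := fun z => rfl
  have hsm : ∀ (a : Preproj K Ω) z, f (a • z) = a • f z := by
    intro a
    induction a using Preproj.induction with
    | hK k =>
      intro z
      obtain ⟨z, rfl⟩ := (toSimple Ω i).surjective z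
      rw [algebraMap_smul_toSimple, hf, hf, map_mul, mul_smul]
    | hg a =>
      intro z
      obtain ⟨z, rfl⟩ := (toSimple Ω i).surjective z
      rw [gen_smul_toSimple, hf, hf, smul_smul, ← Algebra.commutes, mul_smul, h, smul_smul,
        ← map_mul, mul_comm]
    | ha a b h1 h2 => intro z; rw [add_smul, map_add, h1, h2, add_smul]
    | hm a b h1 h2 => intro z; rw [mul_smul, h1, h2, mul_smul]
  let g : Simple K Ω i →ₗ[Preproj K Ω] Q := { f with map_smul' := hsm }
  refine ⟨(LinearEquiv.ofBijective g ⟨?_, ?_⟩).symm⟩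
  · rw [← LinearMap.ker_eq_bot, LinearMap.ker_eq_bot']
    intro z hz
    obtain ⟨z, rfl⟩ := (toSimple Ω i).surjective z
    by_contra hne
    have hz0 : z ≠ 0 := fun h0 => hne (by rw [h0, map_zero])
    apply hw
    have h1 : algebraMap K (Preproj K Ω) z⁻¹ • g (toSimple Ω i z) = w := by
      rw [show g (toSimple Ω i z) = algebraMap K (Preproj K Ω) z • w from hf z, smul_smul,
        ← map_mul, inv_mul_cancel₀ hz0, map_one, one_smul]
    rw [← h1, hz, smul_zero]
  · rw [← LinearMap.range_eq_top]
    refine (IsSimpleOrder.eq_bot_or_eq_top _).resolve_left fun h0 => hw ?_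
    have h1 : g (toSimple Ω i 1) ∈ LinearMap.range g := ⟨_, rfl⟩
    rw [h0, Submodule.mem_bot] at h1
    rw [← h1, show g (toSimple Ω i 1) = algebraMap K (Preproj K Ω) 1 • w from hf 1, map_one,
      one_smul]

end Filtered

/-! ### Stability through `subAt` and through subrepresentations away from the framing. -/

section FramedModule

variable {K : Type*} [Field K] {ι : Type} [Fintype ι] [DecidableEq ι] {X : SymmGCM ι}
  {Ω : Orientation X} {M : Type*} [AddCommGroup M] [Module K M]
  [Module (Preproj K Ω.framed) M] [IsScalarTower K (Preproj K Ω.framed) M]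

/-- Radical powers of a nonzero subrepresentation eventually vanish because `M` is filtered. The
last nonzero one contains a vector killed by all loops and arrows, and a component of it at some
unframed `j` spans a copy of `S_j`, which belongs to `subAt`. -/
theorem stable_of_subAt_eq_bot (hE : IsEFiltered K Ω.framed M)
    (hsub : ∀ i : ι, subAt K Ω.framed (.inl i) M = ⊥) : Stable (modVal K Ω.framed M) := by
  have hv := modVal_satisfies (K := K) (Ω := Ω.framed) (M := M)
  intro S hS hS0
  by_contra hne
  obtain ⟨n, hn⟩ := hE.rad_iterate_eq_bot
  have hex : ∃ n, (rad (modVal K Ω.framed M))^[n] S = ⊥ :=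
    ⟨n, eq_bot_iff.2 (hn ▸ rad_iterate_mono n le_top)⟩
  classical
  obtain ⟨m, hm⟩ : ∃ m, Nat.find hex = m + 1 := by
    refine ⟨Nat.find hex - 1, (Nat.sub_add_cancel (Nat.one_le_iff_ne_zero.2 fun h0 => hne ?_)).symm⟩
    have := Nat.find_spec hex
    rwa [h0] at this
  have h1 := Nat.find_spec hex
  have h2 := Nat.find_min hex (m := m) (by omega)
  rw [hm, Function.iterate_succ_apply'] at h1
  obtain ⟨x, hx, hx0⟩ := (Submodule.ne_bot_iff _).1 h2
  have hle : ∀ m, (rad (modVal K Ω.framed M))^[m] S ≤ S := by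
    intro m
    induction m with
    | zero => exact le_rfl
    | succ m ih => rw [Function.iterate_succ_apply']; exact (rad_mono ih).trans hS.rad_le
  have hε : ∀ b, modVal K Ω.framed M (.ε b) x = 0 := fun b =>
    (Submodule.mem_bot K).1 (h1 ▸ eps_mem_rad b hx)
  have hα : ∀ a b g, modVal K Ω.framed M (.α a b g) x = 0 := fun a b g =>
    (Submodule.mem_bot K).1 (h1 ▸ arrow_mem_rad a b g hx)
  obtain ⟨a, ha⟩ : ∃ a, modVal K Ω.framed M (.e a) x ≠ 0 := by
    by_contra! h
    exact hx0 (by rw [← hv.sum_e x, Finset.sum_eq_zero fun a _ => h a])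
  rcases a with j | l
  swap
  · exact ha (hS0 l x (hle m hx))
  set y := modVal K Ω.framed M (.e (.inl j)) x with hy
  have hval : ∀ a, modVal K Ω.framed M a y = simpleVal K (.inl j) a • y := by
    rintro (b | b | ⟨b, c, g⟩)
    · rw [hv.e_of_e (hv.e_e _ x)]
      by_cases h : b = .inl j <;> simp [simpleVal, h, hy]
    · refine Eq.trans ?_ (zero_smul K y).symm
      by_cases h : b = .inl j
      · rw [h, hy, hv.eps_e, hε]
      · exact hv.eps_of_e (Ne.symm h) (hv.e_e _ x)
    · refine Eq.trans ?_ (zero_smul K y).symm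
      by_cases h : c = .inl j
      · subst h
        rw [hy, hv.α_e, hα]
      · exact hv.α_of_e (Ne.symm h) (hv.e_e _ x)
  have hinv : Inv (modVal K Ω.framed M) (K ∙ y) := by
    intro a z hz
    obtain ⟨k, rfl⟩ := Submodule.mem_span_singleton.1 hz
    rw [map_smul, hval]
    exact Submodule.smul_mem _ _ (Submodule.smul_mem _ _ (Submodule.mem_span_singleton_self y))
  have hall : AllFactorsSimple K Ω.framed (.inl j) hinv.toSubmodule := by
    intro A B hAB hBL hsimp
    obtain ⟨b, hb, hbA⟩ : ∃ b ∈ B, b ∉ A := by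
      by_contra! h
      have h3 : A.submoduleOf B = ⊤ := eq_top_iff.2 fun z _ => h z z.2
      exact (isSimpleModule_iff_isCoatom.1 hsimp).1 h3
    obtain ⟨k, rfl⟩ := Submodule.mem_span_singleton.1 (hinv.mem_toSubmodule.1 (hBL hb))
    have hk : k ≠ 0 := fun h0 => hbA (by rw [h0, zero_smul]; exact A.zero_mem)
    have hyB : y ∈ B := by
      have := (B.restrictScalars K).smul_mem k⁻¹ hb
      rwa [smul_smul, inv_mul_cancel₀ hk, one_smul] at this
    have hyA : y ∉ A := fun h => hbA ((A.restrictScalars K).smul_mem k h)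
    refine nonempty_equiv_simple (w := Submodule.Quotient.mk ⟨y, hyB⟩) (fun h0 => hyA ?_)
      fun a => ?_
    · exact (Submodule.Quotient.mk_eq_zero (A.submoduleOf B)).1 h0
    · refine congrArg (Submodule.Quotient.mk (p := A.submoduleOf B)) (Subtype.ext ?_ :
        gen K Ω.framed a • (⟨y, hyB⟩ : B) =
          algebraMap K (Preproj K Ω.framed) (simpleVal K (.inl j) a) • (⟨y, hyB⟩ : B))
      refine (hval a).trans ?_
      exact (algebraMap_smul _ _ y).symm
  have hbot := (le_sSup hall).trans (hsub j).le
  exact ha ((Submodule.mem_bot _).1 (hbot (hinv.mem_toSubmodule.2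
    (Submodule.mem_span_singleton_self y))))

/-- If `L` had a nonzero vector `y` at a framing vertex, the cyclic module it generates would have a
simple quotient in which `y` survives. As a factor of `L` this quotient is `S_i`, where framing
idempotents act by zero. So `L` vanishes at the framing and stability applies. -/
theorem Stable.subAt_eq_bot (hs : Stable (modVal K Ω.framed M)) (i : ι) :
    subAt K Ω.framed (.inl i) M = ⊥ := by
  have hv := modVal_satisfies (K := K) (Ω := Ω.framed) (M := M)
  refine sSup_eq_bot.2 fun L hL => ?_
  have h0 := hs (L.restrictScalars K) (inv_restrictScalars L) ?_
  · exact (Submodule.restrictScalars_eq_bot_iff K _ _).1 h0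
  intro l x hx
  by_contra hne
  set y := modVal K Ω.framed M (.e (.inr l)) x with hy
  have hyL : y ∈ L := L.smul_mem _ hx
  let B : Submodule (Preproj K Ω.framed) M := (Preproj K Ω.framed) ∙ y
  have hyB : y ∈ B := Submodule.mem_span_singleton_self y
  have hfin : Module.Finite (Preproj K Ω.framed) B := inferInstance
  have hbt : (⊥ : Submodule (Preproj K Ω.framed) B) ≠ ⊤ := by
    intro h
    have h1 : (⟨y, hyB⟩ : B) ∈ (⊥ : Submodule (Preproj K Ω.framed) B) := h ▸ trivial
    exact hne (congrArg Subtype.val ((Submodule.mem_bot _).1 h1))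
  obtain ⟨A', hA', -⟩ := (eq_top_or_exists_le_coatom
    (⊥ : Submodule (Preproj K Ω.framed) B)).resolve_left hbt
  have hA : (A'.map B.subtype).submoduleOf B = A' :=
    Submodule.comap_map_eq_of_injective B.subtype_injective A'
  obtain ⟨E⟩ := hL (A'.map B.subtype) B (Submodule.map_subtype_le B A')
    ((Submodule.span_singleton_le_iff_mem _ _).2 hyL) (isSimpleModule_iff_isCoatom.2 (hA.symm ▸ hA'))
  let q : B ⧸ (A'.map B.subtype).submoduleOf B := Submodule.Quotient.mk ⟨y, hyB⟩
  have hq : gen K Ω.framed (.e (.inr l)) • q = q :=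
    congrArg (Submodule.Quotient.mk (p := (A'.map B.subtype).submoduleOf B)) (Subtype.ext
      (hv.e_e _ x) : gen K Ω.framed (.e (.inr l)) • (⟨y, hyB⟩ : B) = ⟨y, hyB⟩)
  obtain ⟨z, hz⟩ := (toSimple Ω.framed (.inl i)).surjective (E q)
  have h1 : E q = 0 := by
    rw [← hq, map_smul, ← hz, gen_smul_toSimple]
    simp [simpleVal]
  have h2 : (⟨y, hyB⟩ : B) ∈ A' := by
    rw [← hA]
    exact (Submodule.Quotient.mk_eq_zero _).1 (E.map_eq_zero_iff.1 h1)
  apply hA'.1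
  rw [eq_top_iff]
  rintro ⟨z, hz⟩ -
  obtain ⟨a, rfl⟩ := Submodule.mem_span_singleton.1 hz
  exact A'.smul_mem a h2

end FramedModule

/-! ### The modules `N(ϖ_i)` -/

section RepModule

variable {K : Type*} [Field K] {ι : Type} [Fintype ι] [DecidableEq ι] {Y : SymmGCM ι}
  {Ω : Orientation Y} {M : Type*} [AddCommGroup M] [Module K M] {v : Gen Y → Module.End K M}

/-- The `Π`-module given by a representation. -/
abbrev repModule (hv : Satisfies Ω v) : Module (Preproj K Ω) M :=
  Module.compHom M (lift K Ω v hv).toRingHom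

theorem repModule_isScalarTower (hv : Satisfies Ω v) :
    letI := repModule hv
    IsScalarTower K (Preproj K Ω) M := by
  let := repModule hv
  refine ⟨fun k a x => ?_⟩
  change lift K Ω v hv (k • a) x = k • lift K Ω v hv a x
  rw [map_smul]
  rfl

theorem repModule_modVal (hv : Satisfies Ω v) :
    letI := repModule hv
    haveI := repModule_isScalarTower hv
    modVal K Ω M = v := by
  let := repModule hv
  have := repModule_isScalarTower hv
  funext a
  refine LinearMap.ext fun x => ?_
  change lift K Ω v hv (gen K Ω a) x = v a x
  rw [lift_gen]

end RepModule

theorem finrank_range_of_injective {K : Type*} [Field K] {L M : Type*} [AddCommGroup L]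
    [Module K L] [AddCommGroup M] [Module K M] {σ : L →ₗ[K] M} (hσ : Function.Injective σ)
    {p : Module.End K L} {p' : Module.End K M} (hc : ∀ x, σ (p x) = p' (σ x))
    (h : ∀ y, ∃ x, σ (p x) = p' y) :
    Module.finrank K (LinearMap.range p) = Module.finrank K (LinearMap.range p') := by
  have h1 : (LinearMap.range p).map σ = LinearMap.range p' := by
    refine le_antisymm ?_ ?_
    · rintro _ ⟨_, ⟨x, rfl⟩, rfl⟩
      exact ⟨σ x, (hc x).symm⟩
    · rintro _ ⟨y, rfl⟩
      obtain ⟨x, hx⟩ := h y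
      exact ⟨p x, ⟨x, rfl⟩, hx⟩
  rw [← h1]
  exact (Submodule.equivMapOfInjective σ hσ _).finrank_eq

/-! ### Framed representations that vanish at the framing vertices, and framed parts. -/

section Deframe

variable {K : Type*} [Field K] {ι : Type} [Fintype ι] [DecidableEq ι] {X : SymmGCM ι}
  {Ω : Orientation X}

/-- The generators of `Π` among those of the framed algebra. -/
def unframedGen : Gen X → Gen X.framed
  | .e i => .e (.inl i)
  | .ε i => .ε (.inl i)
  | .α i j g => .α (.inl i) (.inl j) g

theorem Satisfies.eq_zero_of_framed {A : Type*} [Ring A] {w : Gen X.framed → A}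
    (hw : Satisfies Ω.framed w) (h0 : ∀ l, w (.e (.inr l)) = 0) :
    (∀ l, w (.ε (.inr l)) = 0) ∧ (∀ a l g, w (.α a (.inr l) g) = 0) ∧
      ∀ a l g, w (.α (.inr l) a g) = 0 := by
  refine ⟨fun l => ?_, fun a l g => ?_, fun a l g => ?_⟩
  · rw [← hw.loop, h0, mul_zero]
  · rw [← hw.arrow, h0, mul_zero]
  · rw [← hw.arrow, h0, zero_mul, zero_mul]

theorem Satisfies.of_framed {A : Type*} [Ring A] {w : Gen X.framed → A}
    (hw : Satisfies Ω.framed w) (h0 : ∀ l, w (.e (.inr l)) = 0) :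
    Satisfies Ω fun a => w (unframedGen a) where
  idem i j := by
    have := hw.idem (.inl i) (.inl j)
    simp only [Sum.inl.injEq] at this
    exact this
  unit := by
    have := hw.unit
    rw [Fintype.sum_sum_type, Finset.sum_eq_zero (s := Finset.univ) fun l _ => h0 l,
      add_zero] at this
    exact this
  loop i := hw.loop (.inl i)
  arrow i j g := hw.arrow (.inl i) (.inl j) g
  nilp i := hw.nilp (.inl i)
  comm i j g := hw.comm (.inl i) (.inl j) g
  mesh i := by
    have := hw.mesh (.inl i)
    rw [GenPreproj.mesh, Fintype.sum_sum_type] at this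
    have h1 := (hw.eq_zero_of_framed h0).2.1
    simp only [h1, mul_zero, zero_mul, smul_zero, Finset.sum_const_zero, add_zero] at this
    exact this

theorem Satisfies.lift_framedVal {A : Type*} [Ring A] [Algebra K A] {w : Gen X.framed → A}
    (hw : Satisfies Ω.framed w) (h0 : ∀ l, w (.e (.inr l)) = 0) (a : Gen X.framed) :
    lift K Ω _ (hw.of_framed h0) (framedVal K Ω a) = w a := by
  obtain ⟨h1, h2, h3⟩ := hw.eq_zero_of_framed h0
  rcases a with (i | l) | (i | l) | ⟨i | l, j | l', g⟩
  · exact lift_gen _ _ _ _ _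
  · exact (map_zero _).trans (h0 l).symm
  · exact lift_gen _ _ _ _ _
  · exact (map_zero _).trans (h1 l).symm
  · exact lift_gen _ _ _ _ (Gen.α i j g)
  · exact (map_zero _).trans (h2 _ _ _).symm
  · exact (map_zero _).trans (h3 _ _ _).symm
  · exact (map_zero _).trans (h3 _ _ _).symm

variable {M : Type*} [AddCommGroup M] [Module K M]
  [Module (Preproj K Ω.framed) M] [IsScalarTower K (Preproj K Ω.framed) M]

theorem Good.isStableOfWeight {k : ι} {ν : ι → ℕ} (h : Good Ω k ν (modVal K Ω.framed M)) :
    IsStableOfWeight K Ω (wt X k ν) (-Pi.single k 1) M := by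
  have := h.fd
  refine ⟨h.filt.isEFiltered, h.stable.subAt_eq_bot, Sum.elim ν (Pi.single k 1),
    hasRankVec_of_freeOn h.free h.rank, ?_, fun i => ?_⟩
  · simp only [Sum.elim_inl]
    rw [X.sum_smul_simpleRoot, wt, sub_neg_eq_add, sub_add_cancel]
  · simp only [Sum.elim_inr, Pi.neg_apply, neg_neg]
    by_cases hi : i = k
    · subst hi; simp
    · simp [Pi.single_eq_of_ne hi]

theorem Good.inv_framedPart {N : Type*} [AddCommGroup N] [Module K N]
    {v : Gen X.framed → Module.End K N} {k : ι} {ν : ι → ℕ}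
    (h : Good Ω k ν v) : Inv v (framedPart v) := by
  intro a x hx
  rw [mem_framedPart] at hx ⊢
  intro j
  rcases a with b | b | ⟨b, c, g⟩
  · by_cases hb : .inl j = b
    · rw [← hb, h.sat.e_e, hx]
    · rw [h.sat.e_e_ne hb]
  · rcases b with i | l
    · rw [← h.sat.eps_e, hx, map_zero, map_zero]
    · rw [← h.sat.e_eps, h.sat.e_e_ne (by simp)]
  · rcases b with i | l
    · rcases c with c | c
      · rw [← h.sat.α_e, hx, map_zero, map_zero]
      · rw [h.frame, LinearMap.zero_apply, map_zero]
    · rw [← h.sat.e_α, h.sat.e_e_ne (by simp)]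

/-- This supplies the submodule `Ñ(μ)`. It lives at the one framing vertex `k` and is free of rank
one there, so its filtration has a single step. -/
theorem Good.framedPart {k : ι} {ν : ι → ℕ} (h : Good Ω k ν (modVal K Ω.framed M)) :
    Good Ω k 0 (modVal K Ω.framed h.inv_framedPart.toSubmodule) := by
  set L := h.inv_framedPart.toSubmodule with hL
  have := h.fd
  have hv := h.sat
  let σ : L →ₗ[K] M := L.subtype.restrictScalars K
  have hσ : Function.Injective σ := L.subtype_injective
  have hc : ∀ a x, σ (modVal K Ω.framed L a x) = modVal K Ω.framed M a (σ x) := fun _ _ => rfl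
  have hfd : FiniteDimensional K L := FiniteDimensional.of_injective σ hσ
  have hw := modVal_satisfies (K := K) (Ω := Ω.framed) (M := L)
  have hmem : ∀ x : L, ∀ j, modVal K Ω.framed M (.e (.inl j)) (σ x) = 0 := fun x =>
    mem_framedPart.1 (h.inv_framedPart.mem_toSubmodule.1 x.2)
  have hin : ∀ l (y : M), modVal K Ω.framed M (.e (.inr l)) y = y → y ∈ L := by
    intro l y hy
    refine h.inv_framedPart.mem_toSubmodule.2 (mem_framedPart.2 fun j => ?_)
    rw [hv.e_of_e hy, if_neg (by simp)]
  have h0 : ∀ j (x : L), modVal K Ω.framed L (.e (.inl j)) x = 0 := fun j x =>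
    hσ (by rw [hc, hmem, map_zero])
  have hfree : ∀ a, FreeOn (modVal K Ω.framed L (.e a)) (modVal K Ω.framed L (.ε a))
      (X.framed.c a) := by
    rintro (j | l) x hx hx0
    · exact ⟨0, map_zero _, by rw [map_zero, ← hx, h0]⟩
    · obtain ⟨y, hy, hyx⟩ := h.free (.inr l) (σ x) (by rw [← hc, hx]) (by rw [← hc, hx0, map_zero])
      refine ⟨⟨y, hin l y hy⟩, hσ hy, hσ ?_⟩
      rw [← hyx]
      exact (pow_comp_of_comm (τ' := modVal K Ω.framed M (.ε (.inr l)))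
        (τ := modVal K Ω.framed L (.ε (.inr l))) (α := σ)
        (LinearMap.ext fun x => (hc _ x).symm) _ (⟨y, hin l y hy⟩ : L)).symm
  have hrank : ∀ l, Module.finrank K (LinearMap.range (modVal K Ω.framed L (.e (.inr l)))) =
      (Pi.single k 1 : ι → ℕ) l * X.c l := by
    intro l
    rw [finrank_range_of_injective hσ (hc (.e (.inr l))) fun y => ⟨⟨_, hin l _ (hv.e_e _ y)⟩, hv.e_e _ y⟩,
      h.rank]
    rfl
  have hne : ∀ l, l ≠ k → ∀ x : L, modVal K Ω.framed L (.e (.inr l)) x = 0 := by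
    intro l hl x
    have h1 := hrank l
    rw [Pi.single_eq_of_ne hl, zero_mul, Submodule.finrank_eq_zero, LinearMap.range_eq_bot] at h1
    rw [h1, LinearMap.zero_apply]
  have hsum : ∀ x : L, modVal K Ω.framed L (.e (.inr k)) x = x := by
    intro x
    conv_rhs => rw [← hw.sum_e x]
    rw [Finset.sum_eq_single (.inr k)]
    · rintro (j | l) - hb
      · exact h0 j x
      · exact hne l (by simpa using hb) x
    · simp
  refine ⟨hw, hfd, hfree, ?_, fun j l g => ?_, h.stable.of_injective hσ hc, ?_⟩
  · rintro (j | l)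
    · rw [LinearMap.range_eq_bot.2 (LinearMap.ext (h0 j))]
      simp
    · exact hrank l
  · refine LinearMap.ext fun x => hσ ?_
    rw [hc, h.frame]
    simp
  · refine EFilt.extend hw (.inr k) .bot (fun x => ?_) fun x hx hx0 => ?_
    · rw [hsum, sub_self]
      exact Submodule.zero_mem _
    · obtain ⟨y, hy, hyx⟩ := hfree (.inr k) x hx ((Submodule.mem_bot K).1 hx0)
      exact ⟨y, hy, (Submodule.mem_bot K).2 (sub_eq_zero.2 hyx.symm)⟩

end Deframe

/-! ### Existence of `N(ϖ_i)`, and its identification as a projective cover. -/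

section Main

variable {K : Type*} [Field K] {ι : Type} [Fintype ι] [DecidableEq ι] {X : SymmGCM ι}
  {Ω : Orientation X}

theorem wt_zero (k : ι) : wt X k 0 = -Pi.single k 1 := by
  have : (fun j => (((0 : ι → ℕ) j : ℕ) : ℤ)) = 0 := by funext j; simp
  rw [wt, this, map_zero, zero_sub]

theorem Good.exists_isN {M : Type v} [AddCommGroup M] [Module K M]
    {v : Gen X.framed → Module.End K M} {k : ι} {ν : ι → ℕ} (h : Good Ω k ν v)
    (hw : ∃ w ∈ X.weylGroup, w (-Pi.single k 1) = wt X k ν) :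
    ∃ (N : Type v) (_ : AddCommGroup N) (_ : Module (Preproj K Ω) N), IsN K Ω (wt X k ν) N := by
  let := repModule h.sat
  have := repModule_isScalarTower h.sat
  have hv : modVal K Ω.framed M = v := repModule_modVal h.sat
  rw [← hv] at h
  let L := h.inv_framedPart.toSubmodule
  have hq := modVal_satisfies (K := K) (Ω := Ω.framed) (M := M ⧸ L)
  have h0 : ∀ l, modVal K Ω.framed (M ⧸ L) (.e (.inr l)) = 0 := by
    refine fun l => LinearMap.ext fun x => ?_
    obtain ⟨x, rfl⟩ := L.mkQ_surjective x
    refine (Submodule.Quotient.mk_eq_zero L).2 (h.inv_framedPart.mem_toSubmodule.2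
      (mem_framedPart.2 fun j => ?_))
    exact h.sat.e_e_ne (by simp) x
  have hL : IsStableOfWeight K Ω (wt X k 0) (-Pi.single k 1) L := h.framedPart.isStableOfWeight
  rw [wt_zero] at hL
  refine ⟨M ⧸ L, inferInstance, repModule (hq.of_framed h0), -Pi.single k 1, fun i => ?_, hw,
    M, inferInstance, inferInstance, L, h.isStableOfWeight, hL, AddEquiv.refl _, fun a x => ?_⟩
  · by_cases hi : i = k
    · subst hi; simp
    · simp [Pi.single_eq_of_ne hi]
  · have h1 : Algebra.lsmul K K (M ⧸ L) =
        (lift K Ω _ (hq.of_framed h0)).comp (framedProj K Ω) := by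
      refine Preproj.algHom_ext fun b => ?_
      rw [AlgHom.comp_apply, framedProj, lift_gen, hq.lift_framedVal h0]
      rfl
    exact DFunLike.congr_fun (DFunLike.congr_fun h1 a) x

/-- There is no choice for `Ñ(μ)`. In finite type the simple roots are independent, so its unframed
ranks vanish; its framing ranks are those of `M`, so by dimension it contains everything at the
framing vertices. -/
theorem mem_iff_mem_framedPart (hX : X.IsFiniteType) {M : Type*} [AddCommGroup M] [Module K M]
    [Module (Preproj K Ω.framed) M] [IsScalarTower K (Preproj K Ω.framed) M]
    [FiniteDimensional K M] {L : Submodule (Preproj K Ω.framed) M} {r : ι ⊕ ι → ℕ}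
    (hr : HasRankVec K Ω.framed L r) (h0 : ∑ j, (r (.inl j) : ℤ) • X.simpleRoot j = 0)
    (hdim : ∀ l, Module.finrank K (LinearMap.range (modVal K Ω.framed M (.e (.inr l)))) =
      r (.inr l) * X.framed.c (.inr l)) (x : M) :
    x ∈ L ↔ x ∈ framedPart (modVal K Ω.framed M) := by
  have hM := modVal_satisfies (K := K) (Ω := Ω.framed) (M := M)
  let σ : L →ₗ[K] M := L.subtype.restrictScalars K
  have hσ : Function.Injective σ := L.subtype_injective
  have := hr.finiteDimensional
  rw [mem_framedPart]
  constructor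
  · intro hx j
    rw [X.sum_smul_simpleRoot] at h0
    have h1 := congrFun (X.cmap_injective hX (h0.trans (map_zero _).symm)) j
    have h2 := hr.finrank (.inl j)
    rw [Int.natCast_eq_zero.1 h1, zero_mul, Submodule.finrank_eq_zero, LinearMap.range_eq_bot] at h2
    exact congrArg σ (LinearMap.congr_fun h2 ⟨x, hx⟩)
  · intro hx
    rw [← hM.sum_e x]
    refine Submodule.sum_mem _ fun a _ => ?_
    rcases a with j | l
    · rw [hx]
      exact L.zero_mem
    · have h1 : (LinearMap.range (modVal K Ω.framed L (.e (.inr l)))).map σ =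
          LinearMap.range (modVal K Ω.framed M (.e (.inr l))) := by
        refine Submodule.eq_of_le_of_finrank_eq ?_ ?_
        · rintro _ ⟨_, ⟨y, rfl⟩, rfl⟩
          exact ⟨σ y, rfl⟩
        · rw [hdim, ← hr.finrank]
          exact (Submodule.equivMapOfInjective σ hσ _).finrank_eq.symm
      have h2 : modVal K Ω.framed M (.e (.inr l)) x ∈
          LinearMap.range (modVal K Ω.framed M (.e (.inr l))) := ⟨x, rfl⟩
      rw [← h1] at h2
      obtain ⟨y, -, hy⟩ := h2
      exact hy ▸ y.2

/-- Nothing is assumed about the given `Ñ(γ)` beyond stability and weight, so it is first identified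
with the member of the dominant family of weight `ϖ_i`; exactness and the presentation are then
available for it. -/
theorem IsN.exists_projectiveCover {K : Type u} [Field K] {Ω : Orientation X}
    (hX : X.IsFiniteType) {i : ι} {N : Type v}
    [AddCommGroup N] [Module (Preproj K Ω) N] (h : IsN K Ω (Pi.single i 1) N) :
    ∃ p : N →ₗ[Preproj K Ω] Simple K Ω i, IsProjectiveCover p := by
  obtain ⟨μ, hμ, ⟨s', hs', hs'μ⟩, M, _, _, L, ⟨hE, hsub, r, hr, hwt, hrμ⟩,
    ⟨-, -, r', hr', hwt', hrμ'⟩, φ, hφ⟩ := h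
  let : Module K M := Module.compHom M (algebraMap K (Preproj K Ω.framed))
  have : IsScalarTower K (Preproj K Ω.framed) M := ⟨fun k a x => by
    rw [Algebra.smul_def, mul_smul]; rfl⟩
  have hM := modVal_satisfies (K := K) (Ω := Ω.framed) (M := M)
  have hst := stable_of_subAt_eq_bot hE hsub
  have hfd := hr.finiteDimensional
  have hμr : (fun l => (r (.inr l) : ℤ)) = -μ := funext hrμ
  obtain ⟨s, hs, ν, hν, hG, hσ⟩ := exists_dominant_family.{u} (K := K) hX Ω
  obtain ⟨k, hk, rfl⟩ := exists_rank_eq hX hs hν hσ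
    (fun k => by obtain ⟨M, _, _, v, hv, -⟩ := hG k; exact ⟨M, _, _, v, hv⟩) hs' (i := i)
    (by rw [hμr, ← X.sum_smul_simpleRoot, hwt]; abel)
    (by rw [hμr, neg_neg]; exact hs'μ) hM hst (fun l => hr.freeOn (.inr l)) hr.finrank
  obtain ⟨M', _, _, v, hv, hex⟩ := hG k
  have hρ : (fun l => ((Pi.single k 1 : ι → ℕ) l : ℤ)) = Pi.single k 1 := by
    funext l
    by_cases hl : l = k
    · subst hl; simp
    · simp [Pi.single_eq_of_ne hl]
  obtain ⟨f, hf⟩ := hv.exists_iso hM hst (fun l => hr.freeOn (.inr l)) hr.finrank (by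
    rw [Good.pr_wt hX hs (hν k) (ρ := Pi.single k 1) (by rw [hρ]; exact hν k)]
    rw [Finset.sum_eq_single k]
    · simp
    · intro l _ hl; simp [Pi.single_eq_of_ne hl]
    · simp)
  obtain ⟨v0, θ, κ, P⟩ := hv.exists_presentation hk hex
  -- The given submodule is the framed part, so the quotient map to `N` has exactly the kernel
  -- required by `Presentation.exists_projectiveCover`.
  have hL := mem_iff_mem_framedPart hX hr' (hwt'.trans (sub_self μ)) fun l => by
    have := (hrμ' l).trans (hrμ l).symm
    rw [hr.finrank, Int.natCast_inj.1 this]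
  let q : M' →+ N := (φ : (M ⧸ L) →+ N).comp
    (L.mkQ.toAddMonoidHom.comp (f.symm : M' →ₗ[K] M).toAddMonoidHom)
  have hq : ∀ x, q (f x) = φ (Submodule.Quotient.mk x) := fun x => by
    change φ (Submodule.Quotient.mk (f.symm (f x))) = _
    rw [f.symm_apply_apply]
  refine P.exists_projectiveCover (q := q) hv.filt (fun a x => ?_) (fun c x => ?_) (fun y => ?_)
    fun x => ?_
  · obtain ⟨x, rfl⟩ := f.surjective x
    rw [← hf, hq, hq, modVal_apply, Submodule.Quotient.mk_smul, hφ, framedProj, lift_gen]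
  · obtain ⟨x, rfl⟩ := f.surjective x
    rw [← map_smul, hq, hq, ← algebraMap_smul (Preproj K Ω.framed) c x, Submodule.Quotient.mk_smul,
      hφ, AlgHom.commutes]
  · obtain ⟨y, rfl⟩ := φ.surjective y
    obtain ⟨x, rfl⟩ := L.mkQ_surjective y
    exact ⟨f x, hq x⟩
  · obtain ⟨x, rfl⟩ := f.surjective x
    rw [hq, EmbeddingLike.map_eq_zero_iff, Submodule.Quotient.mk_eq_zero, hL, mem_framedPart,
      mem_framedPart]
    simp only [← hf, EmbeddingLike.map_eq_zero_iff]

theorem exists_isN {K : Type u} [Field K] (hX : X.IsFiniteType) (Ω : Orientation X) (i : ι) :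
    ∃ (N : Type u) (_ : AddCommGroup N) (_ : Module (Preproj K Ω) N),
      IsN K Ω (Pi.single i 1) N := by
  obtain ⟨s, hs, ν, hν, hG, hσ⟩ := exists_dominant_family.{u} (K := K) hX Ω
  obtain ⟨k, hk⟩ := hσ i
  obtain ⟨M, _, _, v, hv, -⟩ := hG k
  rw [← hk]
  exact hv.exists_isN ⟨s, hs, hν k⟩

end Main

end GenPreproj

end

theorem mainTheorem7 {K : Type u} [Field K] {n : ℕ} (X : GenPreproj.SymmGCM (Fin n))
    (hX : X.IsFiniteType) (Ω : GenPreproj.Orientation X) (i : Fin n) :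
    (∃ (N : Type u) (_ : AddCommGroup N) (_ : Module (GenPreproj.Preproj K Ω) N),
      GenPreproj.IsN K Ω (Pi.single i 1) N) ∧
    ∀ (N : Type u) [AddCommGroup N] [Module (GenPreproj.Preproj K Ω) N],
      GenPreproj.IsN K Ω (Pi.single i 1) N →
        ∃ p : N →ₗ[GenPreproj.Preproj K Ω] GenPreproj.Simple K Ω i,
          GenPreproj.IsProjectiveCover p :=
  ⟨GenPreproj.exists_isN hX Ω i, fun _ _ _ h => h.exists_projectiveCover hX⟩
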